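/- **Setting.** Let $\gamma\in[-2,1]$, let $(x,v)\in\mathbf T^3\times\mathbf R^3$ with $\mathbf T^3=\mathbf R^3/\mathbf Z^3$, and put $\langle v\rangle=(1+|v|^2)^{1/2}$, $M(v)=(2\pi)^{-3/2}e^{-|v|^2/2}$ and $$a_{ij}(v)=|v|^{\gamma+2}\Big(\delta_{ij}-\frac{v_iv_j}{|v|^2}\Big).$$ With summation over repeated indices, the Landau operator and its bilinear form around $M$ are $$Q(g,f)(v)=\partial_{v_i}\int_{\mathbf R^3}a_{ij}(v-v_*)\big[g(v_*)\partial_{v_j}f(v)-f(v)\partial_{v_j}g(v_*)\big]\,dv_*,\qquad \Gamma(f_1,f_2)=\frac1{\sqrt M}\,Q(\sqrt M f_1,\sqrt M f_2).$$ The matrix $\mathbf A(v)=(a_{ij}*M)(v)$ has, for $v\ne0$, an eigenvalue $\ell_1(v)>0$ with eigenvector $v$ and a double eigenvalue $\ell_2(v)>0$ on $v^\perp$. Let $$\mathbf B(v)=\sqrt{\ell_1(v)}\,\frac{v}{|v|}\otimes\frac v{|v|}+\sqrt{\ell_2(v)}\Big(\mathrm{Id}-\frac v{|v|}\otimes\frac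 v{|v|}\Big),\qquad \widetilde\nabla_v=\mathbf B(v)\nabla_v,\qquad \widetilde\nabla_x=\mathbf B(v)\nabla_x .$$ With $P_vw=\big(w\cdot\frac v{|v|}\big)\frac v{|v|}$, define $$\|f\|_{H^1_{v,*}}^2=\|\langle v\rangle^{\frac\gamma2+1}f\|_{L^2_v}^2+\|\langle v\rangle^{\frac\gamma2}P_v\nabla_vf\|_{L^2_v}^2+\|\langle v\rangle^{\frac\gamma2+1}(\mathrm{Id}-P_v)\nabla_vf\|_{L^2_v}^2,$$ $$\|f\|_{H^2_{v,*}}^2=\|\langle v\rangle^{\gamma+2}f\|_{L^2_v}^2+\|\widetilde\nabla_v(\langle v\rangle^{\frac\gamma2+1}f)\|_{L^2_v}^2+\|\langle v\rangle^{\frac\gamma2+1}\widetilde\nabla_vf\|_{L^2_v}^2+\|\widetilde\nabla_v\widetilde\nabla_vf\|_{L^2_v}^2,$$ and let $\mathscr X$, $\mathscr Y_1$, $\mathscr Y_2$ be given by $$\sum_{k=0}^3\big\|\langle v\rangle^{(3-k)(\frac\gamma2+1)}\nabla_x^kf\big\|_{L^2_x(H)}^2\qquad\text{with } H=L^2_v,\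 H^1_{v,*},\ H^2_{v,*}\ \text{respectively}$$ as the square of the norm. The scalar product of $\mathscr X$ is $$\langle f,g\rangle_{\mathscr X}=\sum_{k=0}^3\big\langle\langle v\rangle^{(3-k)(\frac\gamma2+1)}\nabla_x^kf,\langle v\rangle^{(3-k)(\frac\gamma2+1)}\nabla_x^kg\big\rangle_{L^2_{x,v}}.$$ For vector fields, norms squared and scalar products are summed over components. For $N\in\mathbf N$, let $\mathcal S_N$ be the set of real functions $g\in C^N(\mathbf T^3\times\mathbf R^3)$ such that $\langle v\rangle^N\partial^\alpha_{x,v}g$ is bounded for every $|\alpha|\le N$. **Proposition.** There is $N\in\mathbf N$ such that for every $\gamma\in[-2,1]$ there is a constant $C$, depending only on $\gamma$, such that for all $g_1,g_2\in\mathcal S_N$ and every vector field $G_3\in(\mathcal S_N)^3$ the integrals defining the scalar products below converge absolutely and $$\big|\big\langle\widetilde\nabla_x\Gamma(g_1,g_2),G_3\big\rangle_{\mathscr X}\big|\le C\Big(\|g_1\|_{\mathscr X}\|\widetilde\nabla_xg_2\|_{\mathscr Y_1}+\|\widetilde\nabla_xg_1\|_{\mathscr X}\|g_2\|_{\mathscr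 Y_1}+\|g_1\|_{\mathscr X}\|g_2\|_{\mathscr Y_2}\Big)\|G_3\|_{\mathscr Y_1},$$ $$\big|\big\langle\widetilde\nabla_v\Gamma(g_1,g_2),G_3\big\rangle_{\mathscr X}\big|\le C\Big(\|g_1\|_{\mathscr X}\|g_2\|_{\mathscr Y_2}+\|g_1\|_{\mathscr Y_1}\|g_2\|_{\mathscr X}\Big)\|G_3\|_{\mathscr Y_1},$$ $$\|\Gamma(g_1,g_2)\|_{\mathscr X}\le C\Big(\|g_1\|_{\mathscr X}\|g_2\|_{\mathscr Y_2}+\|g_1\|_{\mathscr Y_1}\|g_2\|_{\mathscr X}\Big).$$ -/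

import Mathlib

open MeasureTheory
open scoped ENNReal NNReal

namespace Landau

noncomputable section

/-- The space `ℝ³` with its Euclidean norm (used for positions and for velocities). -/
abbrev E3 : Type := EuclideanSpace ℝ (Fin 3)

/-- The unit cube, a fundamental domain of the torus `𝕋³ = ℝ³ / ℤ³`.  Functions on `𝕋³` are
functions on `ℝ³` which are `1`-periodic in each coordinate. -/
def cube : Set E3 := {x | ∀ i, x i ∈ Set.Ico (0 : ℝ) 1}

/-- The Japanese bracket `⟨v⟩ = (1 + |v|²)^{1/2}`. -/
def jap (v : E3) : ℝ := Real.sqrt (1 + ‖v‖ ^ 2)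

/-- The partial derivative in the direction of the `i`-th coordinate. -/
def pd (i : Fin 3) (f : E3 → ℝ) (v : E3) : ℝ := fderiv ℝ f v (EuclideanSpace.single i 1)

/-- The gradient, as a Euclidean vector. -/
def grad (f : E3 → ℝ) (v : E3) : E3 := WithLp.toLp 2 (fun i => pd i f v)

/-- The partial derivative `∂_{x_i}` of a function of `(x, v)`. -/
def dx (i : Fin 3) (g : E3 → E3 → ℝ) (x v : E3) : ℝ := pd i (fun y => g y v) x

/-- The iterated partial derivative `∂_{x_{i₁}} ⋯ ∂_{x_{i_k}}`. -/
def dxIter : List (Fin 3) → (E3 → E3 → ℝ) → E3 → E3 → ℝ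
  | [], g => g
  | i :: l, g => dx i (dxIter l g)

/-- The component `ι = (i₁, …, i_k)` of the tensor `∇_x^k g`. -/
def gradX {k : ℕ} (ι : Fin k → Fin 3) (g : E3 → E3 → ℝ) : E3 → E3 → ℝ :=
  dxIter (List.ofFn ι) g

/-! ### The Landau collision operator -/

/-- The normalized Maxwellian `M(v) = (2π)^{-3/2} e^{-|v|²/2}`. -/
def maxwellian (v : E3) : ℝ := (2 * Real.pi) ^ (-(3 / 2) : ℝ) * Real.exp (-‖v‖ ^ 2 / 2)

/-- `√M`. -/
def sqrtM (v : E3) : ℝ := Real.sqrt (maxwellian v)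

/-- The collision kernel `a_{ij}(v) = |v|^{γ+2} (δ_{ij} - v_i v_j / |v|²)`. -/
def aKer (γ : ℝ) (i j : Fin 3) (v : E3) : ℝ :=
  ‖v‖ ^ (γ + 2) * ((if i = j then 1 else 0) - v i * v j / ‖v‖ ^ 2)

/-- The Landau operator
`Q(g,f)(v) = ∂_{v_i} ∫ a_{ij}(v - v_*) [g(v_*) ∂_{v_j} f(v) - f(v) ∂_{v_j} g(v_*)] dv_*`,
summed over `i` and `j`. -/
def landauQ (γ : ℝ) (g f : E3 → ℝ) (v : E3) : ℝ :=
  ∑ i, pd i (fun u => ∫ w, ∑ j, aKer γ i j (u - w) * (g w * pd j f u - f u * pd j g w)) v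

/-- The bilinear operator `Γ(f₁,f₂) = M^{-1/2} Q(√M f₁, √M f₂)`, acting in velocity only. -/
def Gam (γ : ℝ) (f₁ f₂ : E3 → E3 → ℝ) (x v : E3) : ℝ :=
  (sqrtM v)⁻¹ * landauQ γ (fun w => sqrtM w * f₁ x w) (fun w => sqrtM w * f₂ x w) v

/-! ### The matrix `𝐁(v)` and the anisotropic gradients -/

/-- `A_{ij} = a_{ij} * M`. -/
def matA (γ : ℝ) (i j : Fin 3) (v : E3) : ℝ := ∫ w, aKer γ i j (v - w) * maxwellian w

/-- The trace of `𝐀(v)`. -/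
def trA (γ : ℝ) (v : E3) : ℝ := ∑ i, matA γ i i v

/-- The eigenvalue `ℓ₁(v)` of `𝐀(v)` for the eigenvector `v ≠ 0`, computed as
`⟨𝐀(v) v, v⟩ / |v|²`.  At `v = 0` the matrix `𝐀(0)` is a multiple of the identity and `ℓ₁(0)` is
its only eigenvalue. -/
def ell1 (γ : ℝ) (v : E3) : ℝ :=
  open Classical in
  if v = 0 then trA γ v / 3 else (∑ i, ∑ j, matA γ i j v * v i * v j) / ‖v‖ ^ 2

/-- The eigenvalue `ℓ₂(v)` of `𝐀(v)` on the plane `v^⊥`, where it is double, so that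
`tr 𝐀 = ℓ₁ + 2 ℓ₂`. -/
def ell2 (γ : ℝ) (v : E3) : ℝ := (trA γ v - ell1 γ v) / 2

/-- `𝐁(v) = √ℓ₁(v) v/|v| ⊗ v/|v| + √ℓ₂(v) (Id - v/|v| ⊗ v/|v|)`. -/
def matB (γ : ℝ) (i j : Fin 3) (v : E3) : ℝ :=
  Real.sqrt (ell1 γ v) * (v i / ‖v‖ * (v j / ‖v‖)) +
    Real.sqrt (ell2 γ v) * ((if i = j then 1 else 0) - v i / ‖v‖ * (v j / ‖v‖))

/-- The `k`-th component of `∇̃_v f = 𝐁(v) ∇_v f`, for a function of the velocity. -/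
def tgV (γ : ℝ) (k : Fin 3) (f : E3 → ℝ) (v : E3) : ℝ := ∑ l, matB γ k l v * pd l f v

/-- The vector field `∇̃_v g = 𝐁(v) ∇_v g`, for a function of `(x, v)`. -/
def tildeV (γ : ℝ) (g : E3 → E3 → ℝ) : Fin 3 → E3 → E3 → ℝ := fun k x v => tgV γ k (g x) v

/-- The vector field `∇̃_x g = 𝐁(v) ∇_x g`. -/
def tildeX (γ : ℝ) (g : E3 → E3 → ℝ) : Fin 3 → E3 → E3 → ℝ :=
  fun k x v => ∑ l, matB γ k l v * dx l g x v

/-! ### Norms.  They take values in `[0, ∞]`. -/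

/-- `‖f‖²_{L²_v}`. -/
def L2sq (f : E3 → ℝ) : ℝ≥0∞ := ∫⁻ v, ‖f v‖ₑ ^ 2

/-- `P_v w = (w · v/|v|) v/|v|`, the projection of `w` on `v`. -/
def projV (v w : E3) : E3 := inner ℝ w (‖v‖⁻¹ • v) • (‖v‖⁻¹ • v)

/-- `‖f‖²_{H¹_{v,*}}`. -/
def H1sq (γ : ℝ) (f : E3 → ℝ) : ℝ≥0∞ :=
  L2sq (fun v => jap v ^ (γ / 2 + 1) * f v) +
    (∫⁻ v, ‖jap v ^ (γ / 2) • projV v (grad f v)‖ₑ ^ 2) +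
    ∫⁻ v, ‖jap v ^ (γ / 2 + 1) • (grad f v - projV v (grad f v))‖ₑ ^ 2

/-- `‖f‖²_{H²_{v,*}}`. -/
def H2sq (γ : ℝ) (f : E3 → ℝ) : ℝ≥0∞ :=
  L2sq (fun v => jap v ^ (γ + 2) * f v) +
    (∑ k, L2sq (tgV γ k (fun v => jap v ^ (γ / 2 + 1) * f v))) +
    (∑ k, L2sq (fun v => jap v ^ (γ / 2 + 1) * tgV γ k f v)) +
    ∑ k, ∑ l, L2sq (tgV γ k (tgV γ l f))

/-- The weight `⟨v⟩^{(3-k)(γ/2+1)}` attached to the derivatives of order `k` in `x`. -/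
def wt (γ : ℝ) (k : ℕ) (v : E3) : ℝ := jap v ^ ((3 - (k : ℝ)) * (γ / 2 + 1))

/-- `∑_{k=0}^{3} ‖⟨v⟩^{(3-k)(γ/2+1)} ∇_x^k g‖²_{L²_x(H)}`, where `Hsq` is the square of the norm of
a space `H` of functions of the velocity. -/
def twistedSq (γ : ℝ) (Hsq : (E3 → ℝ) → ℝ≥0∞) (g : E3 → E3 → ℝ) : ℝ≥0∞ :=
  ∑ k ∈ Finset.range 4, ∑ ι : Fin k → Fin 3,
    ∫⁻ x in cube, Hsq (fun v => wt γ k v * gradX ι g x v)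

/-- `‖g‖_𝒳`. -/
def normX (γ : ℝ) (g : E3 → E3 → ℝ) : ℝ≥0∞ := twistedSq γ L2sq g ^ (1 / 2 : ℝ)

/-- `‖g‖_{𝒴₁}`. -/
def normY1 (γ : ℝ) (g : E3 → E3 → ℝ) : ℝ≥0∞ := twistedSq γ (H1sq γ) g ^ (1 / 2 : ℝ)

/-- `‖g‖_{𝒴₂}`. -/
def normY2 (γ : ℝ) (g : E3 → E3 → ℝ) : ℝ≥0∞ := twistedSq γ (H2sq γ) g ^ (1 / 2 : ℝ)

/-- `‖G‖_𝒳` for a vector field `G = (G₁, G₂, G₃)`. -/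
def vnormX (γ : ℝ) (G : Fin 3 → E3 → E3 → ℝ) : ℝ≥0∞ :=
  (∑ j, twistedSq γ L2sq (G j)) ^ (1 / 2 : ℝ)

/-- `‖G‖_{𝒴₁}` for a vector field `G = (G₁, G₂, G₃)`. -/
def vnormY1 (γ : ℝ) (G : Fin 3 → E3 → E3 → ℝ) : ℝ≥0∞ :=
  (∑ j, twistedSq γ (H1sq γ) (G j)) ^ (1 / 2 : ℝ)

/-! ### The scalar product of `𝒳` -/

/-- The Lebesgue measure on `𝕋³ × ℝ³`. -/
def muXV : Measure (E3 × E3) := (volume.restrict cube).prod volume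

/-- The function of `(x, v)` whose integral is the contribution of the derivative `ι` of order `k`
to `⟨F, G⟩_𝒳`. -/
def pairIntegrand (γ : ℝ) {k : ℕ} (ι : Fin k → Fin 3) (F G : E3 → E3 → ℝ) (p : E3 × E3) : ℝ :=
  (wt γ k p.2 * gradX ι F p.1 p.2) * (wt γ k p.2 * gradX ι G p.1 p.2)

/-- `⟨F, G⟩_𝒳` for vector fields: the sum over the components of the scalar product associated
with `‖·‖_𝒳`. -/
def innerX (γ : ℝ) (F G : Fin 3 → E3 → E3 → ℝ) : ℝ :=
  ∑ j, ∑ k ∈ Finset.range 4, ∑ ι : Fin k → Fin 3, ∫ p, pairIntegrand γ ι (F j) (G j) p ∂muXV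

/-- All the integrals in `⟨F, G⟩_𝒳` converge absolutely. -/
def InnerXConverges (γ : ℝ) (F G : Fin 3 → E3 → E3 → ℝ) : Prop :=
  ∀ j, ∀ k ∈ Finset.range 4, ∀ ι : Fin k → Fin 3,
    Integrable (pairIntegrand γ ι (F j) (G j)) muXV

/-! ### Regularity -/

/-- `g` is a function on `𝕋³ × ℝ³` of class `C^N` whose derivatives of order at most `N` are all
`O(⟨v⟩^{-N})`. -/
structure SmoothEnough (N : ℕ) (g : E3 → E3 → ℝ) : Prop where
  periodic : ∀ (x v : E3) (i : Fin 3), g (x + EuclideanSpace.single i 1) v = g x v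
  contDiff : ContDiff ℝ N (fun p : E3 × E3 => g p.1 p.2)
  decay : ∀ n ≤ N, ∃ K : ℝ, ∀ p : E3 × E3,
    jap p.2 ^ N * ‖iteratedFDeriv ℝ n (fun q : E3 × E3 => g q.1 q.2) p‖ ≤ K

end

end Landau

/-! Write f, g for the two arguments of Γ and z = v − w. Two structural facts carry the proof.

First, a(z)z = 0. The derivatives of √M therefore cancel inside the collision integral, and Γ(f,g) =
∑_i (∂_i − v_i/2) J_i with J_i = ∑_j [(a_ij * √M f) ∂_j g − (a_ij * √M ∂_j f) g]
(`inner_integral_eq`, `Gam_eq`). Since Γ acts in v only, derivatives in x follow the Leibniz rule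
(`dxIter_Gam`).

Second, the anisotropy of a(v − w) is that of 𝐁(v)², up to powers of ⟨w⟩ which the Gaussian absorbs:
|a(v − w)p·q| ≤ C⟨w⟩⁶ |𝐁(v)p| |𝐁(v)q| (`aForm_le_bn`). This rests on ℓ₁ ~ ⟨v⟩^γ and ℓ₂ ~ ⟨v⟩^{γ+2}
(`ell_bounds`). The divergence b = −2|z|^γ z of a is no more singular than 1/|z|, because γ ≥ −2,
and 1/|z| is locally square integrable in dimension 3. Hence all convolutions are controlled by one
functional, `majorant`, which is bounded uniformly in v by an L² norm with a spare weight ⟨w⟩^{-1}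
(`majorant_sq_le`).

Two pointwise bounds follow. In weak form, J·p is at most majorant(f) D1(g) |𝐁p|
(`abs_sum_flux_le`): the derivative of f in J has been moved to the kernel. In strong form, |Γ| is
at most majorant(f) D2(g) + ∑_j majorant(∂_j f) |g| (`abs_Gam_le`): only the singular part of b,
which is bounded at infinity, leaves a derivative on f, and it carries no weight on g. This is the
origin of the term ‖g₁‖_{𝒴₁}‖g₂‖_𝒳. As the coefficients of ∇̃ depend on v, one also needs that 𝐁 is
differentiable, including at the origin, and that (∂𝐁)𝐁⁻¹ is bounded (`hasFDerivAt_matB_zero`,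
`abs_matE_le`).

In x the tool is H²(𝕋³) ⊂ L^∞, applied at fixed v and then integrated in v. When k ≤ 3 derivatives
are distributed, either at most one falls on f, and f is bounded in x, or at most k − 2 fall on g,
and g is bounded in x. The weight goes entirely to g: the weight of order 3 is 1, so f may be
measured without any. This gives the bound on ‖Γ‖_𝒳. The pairing with ∇̃_v reduces to it, after an
integration by parts that puts the derivative on the test field.

For the pairing with ∇̃_x the weak form is used. If ∂_m falls on g, the sum ∑_m 𝐁_{jm} ∂_m g is
reassembled into ∇̃_x g (`abs_weak_sum_le`). If it falls on f, the stray factor 𝐁_{jm} costs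
⟨v⟩^{γ/2+1}. When f receives 0 or 2 further derivatives this factor turns D1(g) into D2(g); when it
receives 1 or 3, g has lost a derivative, its weight can be raised by exactly ⟨v⟩^{γ/2+1}, and ∂_m f
is recovered from ∇̃_x f through 𝐁⁻¹. These two cases give the last two terms of the first estimate.
-/

namespace Landau
noncomputable section

/-! ### The Japanese bracket -/

lemma one_le_jap (v : E3) : 1 ≤ jap v := by
  unfold jap; exact Real.one_le_sqrt.2 (by nlinarith [sq_nonneg ‖v‖])

lemma jap_pos (v : E3) : 0 < jap v := lt_of_lt_of_le one_pos (one_le_jap v)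

lemma jap_sq (v : E3) : jap v ^ 2 = 1 + ‖v‖ ^ 2 := Real.sq_sqrt (by positivity)

lemma norm_le_jap (v : E3) : ‖v‖ ≤ jap v := Real.le_sqrt_of_sq_le (by linarith)

lemma jap_le (v : E3) : jap v ≤ 1 + ‖v‖ := by
  refine Real.sqrt_le_iff.2 ⟨by positivity, by nlinarith [norm_nonneg v]⟩

lemma one_add_norm_le (v : E3) : 1 + ‖v‖ ≤ 2 * jap v := by
  linarith [one_le_jap v, norm_le_jap v]

lemma jap_neg (v : E3) : jap (-v) = jap v := by simp [jap]

lemma jap_add_le (v w : E3) : jap (v + w) ≤ 2 * jap v * jap w := by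
  have h2 : ‖v + w‖ ^ 2 ≤ (‖v‖ + ‖w‖) ^ 2 := by gcongr; exact norm_add_le v w
  refine abs_le_of_sq_le_sq' ?_ (by positivity [jap_pos v, jap_pos w]) |>.2
  have e : (2 * jap v * jap w) ^ 2 = 4 * (1 + ‖v‖ ^ 2) * (1 + ‖w‖ ^ 2) := by
    rw [← jap_sq, ← jap_sq]; ring
  rw [e, jap_sq]
  nlinarith [sq_nonneg (‖v‖ - ‖w‖), mul_nonneg (sq_nonneg ‖v‖) (sq_nonneg ‖w‖)]

lemma jap_sub_le (v w : E3) : jap (v - w) ≤ 2 * jap v * jap w := by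
  simpa [sub_eq_add_neg, jap_neg] using jap_add_le v (-w)

lemma jap_rpow_pos (v : E3) (s : ℝ) : 0 < jap v ^ s := Real.rpow_pos_of_pos (jap_pos v) s

lemma jap_rpow_mono (v : E3) {s t : ℝ} (h : s ≤ t) : jap v ^ s ≤ jap v ^ t :=
  Real.rpow_le_rpow_of_exponent_le (one_le_jap v) h

lemma jap_rpow_add (v : E3) (s t : ℝ) : jap v ^ (s + t) = jap v ^ s * jap v ^ t :=
  Real.rpow_add (jap_pos v) s t

lemma one_le_jap_rpow (v : E3) {s : ℝ} (h : 0 ≤ s) : 1 ≤ jap v ^ s :=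
  Real.one_le_rpow (one_le_jap v) h

/-- Peetre's inequality. -/
lemma jap_peetre (s : ℝ) (v w : E3) :
    jap (v + w) ^ s ≤ 2 ^ |s| * jap v ^ s * jap w ^ |s| := by
  rcases le_total 0 s with hs | hs
  · rw [abs_of_nonneg hs, ← Real.mul_rpow (by norm_num) (jap_pos v).le,
      ← Real.mul_rpow (by positivity [jap_pos v]) (jap_pos w).le]
    exact Real.rpow_le_rpow (jap_pos _).le (jap_add_le v w) hs
  -- For a negative exponent this is the inequality for −s with v and v + w exchanged, since v = (v
  -- + w) − w.
  · have h : jap v ≤ 2 * jap (v + w) * jap w := by simpa using jap_sub_le (v + w) w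
    have h' : jap v ^ (-s) ≤ 2 ^ (-s) * jap (v + w) ^ (-s) * jap w ^ (-s) := by
      rw [← Real.mul_rpow (by norm_num) (jap_pos _).le,
        ← Real.mul_rpow (by positivity [jap_pos (v + w)]) (jap_pos w).le]
      exact Real.rpow_le_rpow (jap_pos _).le h (by linarith)
    rw [abs_of_nonpos hs]
    have e1 : jap v ^ s * jap v ^ (-s) = 1 := by rw [← jap_rpow_add]; simp
    have e2 : jap (v + w) ^ s * jap (v + w) ^ (-s) = 1 := by rw [← jap_rpow_add]; simp
    have p1 := jap_rpow_pos v s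
    have p2 := jap_rpow_pos (v + w) s
    calc jap (v + w) ^ s = jap (v + w) ^ s * (jap v ^ s * jap v ^ (-s)) := by rw [e1, mul_one]
      _ ≤ jap (v + w) ^ s * (jap v ^ s * (2 ^ (-s) * jap (v + w) ^ (-s) * jap w ^ (-s))) := by
          gcongr
      _ = (jap (v + w) ^ s * jap (v + w) ^ (-s)) * (2 ^ (-s) * jap v ^ s * jap w ^ (-s)) := by
          ring
      _ = _ := by rw [e2, one_mul]

lemma continuous_jap : Continuous jap := by unfold jap; fun_prop

lemma continuous_jap_rpow (s : ℝ) : Continuous fun v => jap v ^ s :=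
  continuous_jap.rpow_const fun v => Or.inl (jap_pos v).ne'

lemma contDiff_jap : ContDiff ℝ ⊤ jap := by
  unfold jap
  exact (contDiff_const.add (contDiff_norm_sq ℝ)).sqrt fun v => by positivity

lemma contDiff_jap_rpow (s : ℝ) : ContDiff ℝ ⊤ fun v => jap v ^ s :=
  contDiff_jap.rpow_const_of_ne fun v => (jap_pos v).ne'

lemma integrable_jap_rpow {s : ℝ} (hs : s < -3) : Integrable fun v => jap v ^ s := by
  have h := (integrable_one_add_norm (E := E3) (μ := volume) (r := -s)
    (by simp; linarith)).const_mul (2 ^ (-s))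
  refine h.mono' (continuous_jap_rpow s).aestronglyMeasurable (.of_forall fun v => ?_)
  rw [Real.norm_of_nonneg (jap_rpow_pos v s).le, neg_neg]
  have h1 : (1 + ‖v‖) / 2 ≤ jap v := by linarith [one_add_norm_le v]
  calc jap v ^ s ≤ ((1 + ‖v‖) / 2) ^ s :=
        Real.rpow_le_rpow_of_nonpos (by positivity) h1 (by linarith)
    _ = _ := by
        rw [Real.div_rpow (by positivity) (by norm_num), Real.rpow_neg (by norm_num)]
        field_simp

/-! ### Partial derivatives -/

/-- The `i`-th vector of the canonical basis. -/
abbrev e3 (i : Fin 3) : E3 := EuclideanSpace.single i 1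

lemma pd_mul (i : Fin 3) {f g : E3 → ℝ} {v : E3} (hf : DifferentiableAt ℝ f v)
    (hg : DifferentiableAt ℝ g v) :
    pd i (fun u => f u * g u) v = pd i f v * g v + f v * pd i g v := by
  simp [pd, fderiv_fun_mul hf hg]; ring

lemma pd_add (i : Fin 3) {f g : E3 → ℝ} {v : E3} (hf : DifferentiableAt ℝ f v)
    (hg : DifferentiableAt ℝ g v) :
    pd i (fun u => f u + g u) v = pd i f v + pd i g v := by
  simp [pd, fderiv_fun_add hf hg]

lemma pd_sub (i : Fin 3) {f g : E3 → ℝ} {v : E3} (hf : DifferentiableAt ℝ f v)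
    (hg : DifferentiableAt ℝ g v) :
    pd i (fun u => f u - g u) v = pd i f v - pd i g v := by
  simp [pd, fderiv_fun_sub hf hg]

lemma pd_sum (i : Fin 3) {ι : Type*} (s : Finset ι) {f : ι → E3 → ℝ} {v : E3}
    (hf : ∀ a ∈ s, DifferentiableAt ℝ (f a) v) :
    pd i (fun u => ∑ a ∈ s, f a u) v = ∑ a ∈ s, pd i (f a) v := by
  simp [pd, fderiv_fun_sum hf]

lemma pd_const_mul (i : Fin 3) (c : ℝ) (f : E3 → ℝ) (v : E3) :
    pd i (fun u => c * f u) v = c * pd i f v := by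
  unfold pd
  rw [show (fun u => c * f u) = c • f from rfl, fderiv_const_smul_field]; rfl

lemma hasFDerivAt_coord (i : Fin 3) (v : E3) :
    HasFDerivAt (fun u : E3 => u i) (EuclideanSpace.proj i : E3 →L[ℝ] ℝ) v :=
  (EuclideanSpace.proj i : E3 →L[ℝ] ℝ).hasFDerivAt

lemma pd_coord (i j : Fin 3) (v : E3) : pd i (fun u => u j) v = if i = j then 1 else 0 := by
  rw [pd, (hasFDerivAt_coord j v).fderiv]
  simp [eq_comm]

lemma norm_sq_eq_sum (v : E3) : ‖v‖ ^ 2 = ∑ i, v i ^ 2 := by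
  rw [EuclideanSpace.norm_sq_eq]; simp

lemma abs_coord_le (v : E3) (i : Fin 3) : |v i| ≤ ‖v‖ := by
  simpa using PiLp.norm_apply_le v i

lemma differentiable_norm_sq : Differentiable ℝ fun u : E3 => ‖u‖ ^ 2 :=
  (contDiff_norm_sq ℝ (n := 1)).differentiable (by simp)

lemma pd_norm_sq (i : Fin 3) (v : E3) : pd i (fun u => ‖u‖ ^ 2) v = 2 * v i := by
  rw [pd, (hasStrictFDerivAt_norm_sq v).hasFDerivAt.fderiv]
  simp [EuclideanSpace.inner_single_right]

lemma pd_comp (i : Fin 3) {φ : ℝ → ℝ} {φ' : ℝ} {f : E3 → ℝ} {v : E3}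
    (hφ : HasDerivAt φ φ' (f v)) (hf : DifferentiableAt ℝ f v) :
    pd i (fun u => φ (f u)) v = φ' * pd i f v := by
  have h := (hφ.comp_hasFDerivAt v hf.hasFDerivAt).fderiv
  change fderiv ℝ (φ ∘ f) v _ = _
  rw [h]; rfl

lemma differentiable_jap_rpow (s : ℝ) : Differentiable ℝ fun v => jap v ^ s :=
  (contDiff_jap_rpow s).differentiable (by simp)

lemma jap_rpow_eq (s : ℝ) (v : E3) : jap v ^ s = (1 + ‖v‖ ^ 2) ^ (s / 2) := by
  rw [jap, Real.sqrt_eq_rpow, ← Real.rpow_mul (by positivity)]; ring_nf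

lemma pd_jap_rpow (i : Fin 3) (s : ℝ) (v : E3) :
    pd i (fun u => jap u ^ s) v = s * jap v ^ (s - 2) * v i := by
  simp_rw [jap_rpow_eq]
  have hd : DifferentiableAt ℝ (fun u : E3 => 1 + ‖u‖ ^ 2) v :=
    (differentiableAt_const _).add (differentiable_norm_sq v)
  rw [pd_comp i (φ := fun t => t ^ (s / 2))
    (Real.hasDerivAt_rpow_const (Or.inl (by positivity))) hd,
    pd_add i (differentiableAt_const _) (differentiable_norm_sq v), pd_norm_sq]
  have : pd i (fun _ : E3 => (1 : ℝ)) v = 0 := by simp [pd]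
  rw [this, show (s - 2) / 2 = s / 2 - 1 by ring]; ring

lemma pd_congr (i : Fin 3) {f g : E3 → ℝ} {v : E3} (h : f =ᶠ[nhds v] g) :
    pd i f v = pd i g v := by rw [pd, pd, h.fderiv_eq]

/-! ### The Gaussian -/

/-- The normalization constant of `√M`. -/
def gaussConst : ℝ := Real.sqrt ((2 * Real.pi) ^ (-(3 / 2) : ℝ))

lemma gaussConst_pos : 0 < gaussConst := Real.sqrt_pos.2 (by positivity)

lemma sqrtM_eq (v : E3) : sqrtM v = gaussConst * Real.exp (-‖v‖ ^ 2 / 4) := by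
  rw [sqrtM, maxwellian, Real.sqrt_mul (by positivity), gaussConst, ← Real.exp_half]
  ring_nf

lemma sqrtM_pos (v : E3) : 0 < sqrtM v := by
  rw [sqrtM_eq]; exact mul_pos gaussConst_pos (Real.exp_pos _)

lemma maxwellian_eq (v : E3) : maxwellian v = sqrtM v * sqrtM v := by
  rw [sqrtM, Real.mul_self_sqrt]; unfold maxwellian; positivity

lemma contDiff_sqrtM : ContDiff ℝ ⊤ sqrtM := by
  rw [show sqrtM = fun v => gaussConst * Real.exp (-‖v‖ ^ 2 / 4) from funext sqrtM_eq]
  have : ContDiff ℝ ⊤ fun v : E3 => ‖v‖ ^ 2 := contDiff_norm_sq ℝ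
  fun_prop

lemma continuous_sqrtM : Continuous sqrtM := contDiff_sqrtM.continuous

lemma differentiable_sqrtM : Differentiable ℝ sqrtM := contDiff_sqrtM.differentiable (by simp)

lemma pd_sqrtM (i : Fin 3) (v : E3) : pd i sqrtM v = -(v i / 2) * sqrtM v := by
  have hd : DifferentiableAt ℝ (fun u : E3 => ‖u‖ ^ 2) v := differentiable_norm_sq v
  rw [show sqrtM = fun v => gaussConst * Real.exp ((-1 / 4) * ‖v‖ ^ 2) from
    funext fun v => by rw [sqrtM_eq]; ring_nf]
  rw [pd_const_mul, pd_comp i (Real.hasDerivAt_exp _) (hd.const_mul _), pd_const_mul, pd_norm_sq]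
  ring

/-- The Gaussian decays faster than any power. -/
lemma sqrtM_le (s : ℝ) : ∃ C : ℝ, 0 < C ∧ ∀ v, sqrtM v ≤ C * jap v ^ s := by
  obtain ⟨n, hn⟩ := exists_nat_ge (-s)
  refine ⟨gaussConst * (Real.exp (1 / 4) * ((n.factorial : ℝ) * 4 ^ n)),
    mul_pos gaussConst_pos (by positivity), fun v => ?_⟩
  -- A single term of the exponential series, of order n ≥ −s, beats ⟨v⟩^{-s}. The factor e^{1/4} in
  -- the constant is e^{⟨v⟩²/4} e^{-|v|²/4}.
  have h1 : (jap v ^ 2 / 4) ^ n / n.factorial ≤ Real.exp (jap v ^ 2 / 4) :=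
    Real.pow_div_factorial_le_exp _ (by positivity) n
  have h2 : Real.exp (-‖v‖ ^ 2 / 4) * Real.exp (jap v ^ 2 / 4) = Real.exp (1 / 4) := by
    rw [← Real.exp_add, jap_sq]; ring_nf
  have h3 : jap v ^ (-s) ≤ jap v ^ (2 * n) := by
    rw [← Real.rpow_natCast]
    exact jap_rpow_mono v (by push_cast; linarith [n.cast_nonneg (α := ℝ)])
  have e1 : jap v ^ s * jap v ^ (-s) = 1 := by rw [← jap_rpow_add]; simp
  have p1 := jap_rpow_pos v s
  have hf : (0 : ℝ) < n.factorial := by positivity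
  have h4 : jap v ^ (2 * n) ≤ (n.factorial * 4 ^ n) * Real.exp (jap v ^ 2 / 4) := by
    rw [div_pow, ← pow_mul, div_div, div_le_iff₀ (by positivity)] at h1
    linarith
  rw [sqrtM_eq]
  calc gaussConst * Real.exp (-‖v‖ ^ 2 / 4)
      = gaussConst * Real.exp (-‖v‖ ^ 2 / 4) * (jap v ^ s * jap v ^ (-s)) := by rw [e1, mul_one]
    _ ≤ gaussConst * Real.exp (-‖v‖ ^ 2 / 4) * (jap v ^ s *
        ((n.factorial * 4 ^ n) * Real.exp (jap v ^ 2 / 4))) := by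
        have := gaussConst_pos
        gcongr; linarith
    _ = gaussConst * (Real.exp (-‖v‖ ^ 2 / 4) * Real.exp (jap v ^ 2 / 4)) *
        (n.factorial * 4 ^ n) * jap v ^ s := by ring
    _ = _ := by rw [h2]; ring

/-! ### Functions of `(x, v)` with derivatives of controlled growth -/

section Growth

variable {F G : Type} [NormedAddCommGroup F] [NormedSpace ℝ F] [NormedAddCommGroup G]
  [NormedSpace ℝ G]

/-- `h` is of class `C^n` with derivatives of order at most `n` which are `O(⟨v⟩^s)`. -/
def Gr (n : ℕ) (s : ℝ) (h : E3 × E3 → F) : Prop :=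
  ContDiff ℝ n h ∧ ∀ k ≤ n, ∃ K : ℝ, ∀ p, ‖iteratedFDeriv ℝ k h p‖ ≤ K * jap p.2 ^ s

lemma Gr.mono {m n : ℕ} {s t : ℝ} {h : E3 × E3 → F} (H : Gr n s h) (hm : m ≤ n) (hs : s ≤ t) :
    Gr m t h := by
  refine ⟨H.1.of_le (by exact_mod_cast hm), fun k hk => ?_⟩
  obtain ⟨K, hK⟩ := H.2 k (hk.trans hm)
  refine ⟨|K|, fun p => (hK p).trans ?_⟩
  have := jap_rpow_mono p.2 hs
  have := jap_rpow_pos p.2 s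
  gcongr
  exact le_abs_self K

lemma Gr.bound {n : ℕ} {s : ℝ} {h : E3 × E3 → F} (H : Gr n s h) :
    ∃ K : ℝ, 0 < K ∧ ∀ p, ‖h p‖ ≤ K * jap p.2 ^ s := by
  obtain ⟨K, hK⟩ := H.2 0 (Nat.zero_le _)
  refine ⟨|K| + 1, by positivity, fun p => ?_⟩
  have h1 := hK p
  rw [norm_iteratedFDeriv_zero] at h1
  refine h1.trans ?_
  have := jap_rpow_pos p.2 s
  gcongr
  linarith [le_abs_self K]

lemma Gr.fderiv {n : ℕ} {s : ℝ} {h : E3 × E3 → F} (H : Gr (n + 1) s h) :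
    Gr n s (_root_.fderiv ℝ h) := by
  refine ⟨(contDiff_succ_iff_fderiv.1 (by exact_mod_cast H.1)).2.2, fun k hk => ?_⟩
  obtain ⟨K, hK⟩ := H.2 (k + 1) (by omega)
  exact ⟨K, fun p => by rw [norm_iteratedFDeriv_fderiv]; exact hK p⟩

lemma Gr.differentiable {n : ℕ} {s : ℝ} {h : E3 × E3 → F} (H : Gr (n + 1) s h) :
    Differentiable ℝ h := H.1.differentiable (by simp)

/-- The induction step for regularity: closure properties are proved by passing to the differential,
which takes values in a space of linear maps. This is why the target F is arbitrary. -/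
lemma Gr.succ {n : ℕ} {s : ℝ} {h : E3 × E3 → F} (hd : Differentiable ℝ h)
    (hb : ∃ K : ℝ, ∀ p, ‖h p‖ ≤ K * jap p.2 ^ s) (H : Gr n s (_root_.fderiv ℝ h)) :
    Gr (n + 1) s h := by
  refine ⟨?_, fun k hk => ?_⟩
  · have : ContDiff ℝ ((n : WithTop ℕ∞) + 1) h := contDiff_succ_iff_fderiv.2 ⟨hd, by simp, H.1⟩
    exact_mod_cast this
  · rcases k with _ | k
    · simpa using hb
    · obtain ⟨K, hK⟩ := H.2 k (by omega)
      exact ⟨K, fun p => by rw [← norm_iteratedFDeriv_fderiv]; exact hK p⟩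

lemma Gr.zero {s : ℝ} {h : E3 × E3 → F} (hc : Continuous h)
    (hb : ∃ K : ℝ, ∀ p, ‖h p‖ ≤ K * jap p.2 ^ s) : Gr 0 s h := by
  refine ⟨by simpa using (contDiff_zero (𝕜 := ℝ)).2 hc, fun k hk => ?_⟩
  obtain rfl : k = 0 := by omega
  simpa using hb

lemma Gr.clm {n : ℕ} {s : ℝ} {h : E3 × E3 → F} (H : Gr n s h) (L : F →L[ℝ] G) :
    Gr n s (fun p => L (h p)) := by
  refine ⟨L.contDiff.comp H.1, fun k hk => ?_⟩
  obtain ⟨K, hK⟩ := H.2 k hk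
  refine ⟨‖L‖ * K, fun p => ?_⟩
  refine (L.norm_iteratedFDeriv_comp_left H.1.contDiffAt (by exact_mod_cast hk)).trans ?_
  rw [mul_assoc]
  gcongr
  exact hK p

lemma Gr.add {n : ℕ} {s : ℝ} {h g : E3 × E3 → F} (H : Gr n s h) (H' : Gr n s g) :
    Gr n s (fun p => h p + g p) := by
  refine ⟨H.1.add H'.1, fun k hk => ?_⟩
  obtain ⟨K, hK⟩ := H.2 k hk
  obtain ⟨K', hK'⟩ := H'.2 k hk
  refine ⟨K + K', fun p => ?_⟩
  have hk' : (k : WithTop ℕ∞) ≤ n := by exact_mod_cast hk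
  rw [show (fun p => h p + g p) = h + g from rfl,
    iteratedFDeriv_add (H.1.of_le hk') (H'.1.of_le hk'), Pi.add_apply]
  refine (norm_add_le _ _).trans ?_
  linarith [hK p, hK' p]

lemma Gr.smul {n : ℕ} {s t : ℝ} {f : E3 × E3 → ℝ} {g : E3 × E3 → F} (H : Gr n s f)
    (H' : Gr n t g) : Gr n (s + t) (fun p => f p • g p) := by
  refine ⟨H.1.smul H'.1, fun k hk => ?_⟩
  have h1 : ∀ i : ℕ, ∃ K : ℝ, i ≤ n → ∀ p, ‖iteratedFDeriv ℝ i f p‖ ≤ K * jap p.2 ^ s := fun i => by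
    by_cases hi : i ≤ n
    · obtain ⟨K, hK⟩ := H.2 i hi
      exact ⟨K, fun _ => hK⟩
    · exact ⟨0, fun h => absurd h hi⟩
  have h2 : ∀ i : ℕ, ∃ K : ℝ, i ≤ n → ∀ p, ‖iteratedFDeriv ℝ i g p‖ ≤ K * jap p.2 ^ t := fun i => by
    by_cases hi : i ≤ n
    · obtain ⟨K, hK⟩ := H'.2 i hi
      exact ⟨K, fun _ => hK⟩
    · exact ⟨0, fun h => absurd h hi⟩
  choose K1 hK1 using h1
  choose K2 hK2 using h2
  refine ⟨∑ i ∈ Finset.range (k + 1), (k.choose i : ℝ) * K1 i * K2 (k - i), fun p => ?_⟩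
  refine (norm_iteratedFDeriv_smul_le H.1 H'.1 p (by exact_mod_cast hk)).trans ?_
  rw [Finset.sum_mul]
  refine Finset.sum_le_sum fun i hi => ?_
  have hi' : i ≤ k := by simpa [Nat.lt_succ_iff] using hi
  have a1 := hK1 i (hi'.trans hk) p
  have a2 := hK2 (k - i) ((Nat.sub_le _ _).trans hk) p
  calc _ ≤ (k.choose i : ℝ) * (K1 i * jap p.2 ^ s) * (K2 (k - i) * jap p.2 ^ t) := by
        have := (norm_nonneg _).trans a1
        gcongr
    _ = _ := by rw [jap_rpow_add]; ring

lemma Gr.mul {n : ℕ} {s t : ℝ} {f g : E3 × E3 → ℝ} (H : Gr n s f)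
    (H' : Gr n t g) : Gr n (s + t) (fun p => f p * g p) := H.smul H'

lemma Gr.const (n : ℕ) (c : F) : Gr n 0 (fun _ => c) := by
  refine ⟨contDiff_const, fun k hk => ⟨‖c‖, fun p => ?_⟩⟩
  rcases k with _ | k
  · simp
  · simp [iteratedFDeriv_const_of_ne]

lemma Gr.clm_snd (n : ℕ) (L : E3 →L[ℝ] F) : Gr n 1 (fun p => L p.2) := by
  have hb : ∃ K : ℝ, ∀ p : E3 × E3, ‖L p.2‖ ≤ K * jap p.2 ^ (1 : ℝ) := by
    refine ⟨‖L‖, fun p => (L.le_opNorm _).trans ?_⟩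
    rw [Real.rpow_one]
    gcongr
    exact norm_le_jap _
  rcases n with _ | n
  · exact Gr.zero (by fun_prop) hb
  · refine Gr.succ (by fun_prop) hb ?_
    have e : _root_.fderiv ℝ (fun p : E3 × E3 => L p.2) =
        fun _ => L.comp (ContinuousLinearMap.snd ℝ E3 E3) := by
      funext p
      exact (L.comp (ContinuousLinearMap.snd ℝ E3 E3)).hasFDerivAt.fderiv
    rw [e]
    exact (Gr.const n _).mono le_rfl (by norm_num)

lemma Gr.sum {n : ℕ} {s : ℝ} {ι : Type*} (S : Finset ι) {h : ι → E3 × E3 → F}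
    (H : ∀ a ∈ S, Gr n s (h a)) : Gr n s (fun p => ∑ a ∈ S, h a p) := by
  classical
  induction S using Finset.induction_on with
  | empty =>
    refine ⟨by simpa using contDiff_const, fun k _ => ⟨0, fun p => ?_⟩⟩
    have : iteratedFDeriv ℝ k (fun _ : E3 × E3 => (0 : F)) = 0 := iteratedFDeriv_fun_zero
    simp [this]
  | insert a S ha ih =>
    simp_rw [Finset.sum_insert ha]
    exact (H a (Finset.mem_insert_self _ _)).add
      (ih fun b hb => H b (Finset.mem_insert_of_mem hb))

end Growth

/-- The differential of √M is √M times a map linear in v, which costs one power of ⟨v⟩. The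
induction therefore runs over all s at once and calls the previous order at s − 1. -/
lemma gr_sqrtM (n : ℕ) (s : ℝ) : Gr n s (fun p => sqrtM p.2) := by
  have hb : ∃ K : ℝ, ∀ p : E3 × E3, ‖sqrtM p.2‖ ≤ K * jap p.2 ^ s := by
    obtain ⟨C, _, hC⟩ := sqrtM_le s
    exact ⟨C, fun p => by rw [Real.norm_of_nonneg (sqrtM_pos _).le]; exact hC _⟩
  induction n generalizing s with
  | zero => exact Gr.zero (continuous_sqrtM.comp continuous_snd) hb
  | succ n ih =>
    refine Gr.succ (differentiable_sqrtM.comp differentiable_snd) hb ?_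
    let L : E3 →L[ℝ] (E3 × E3 →L[ℝ] ℝ) :=
      (ContinuousLinearMap.precomp ℝ (ContinuousLinearMap.snd ℝ E3 E3)).comp
        ((-(1 / 2) : ℝ) • (innerSL ℝ (E := E3)))
    have e : _root_.fderiv ℝ (fun p : E3 × E3 => sqrtM p.2) = fun p => sqrtM p.2 • L p.2 := by
      funext p
      have h : HasFDerivAt sqrtM (sqrtM p.2 • ((-(1 / 2) : ℝ) • innerSL ℝ p.2)) p.2 := by
        rw [show sqrtM = fun v => gaussConst * Real.exp ((-1 / 4) * ‖v‖ ^ 2) from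
          funext fun v => by rw [sqrtM_eq]; ring_nf]
        have h1 := (((hasStrictFDerivAt_norm_sq p.2).hasFDerivAt.const_mul (-1 / 4)).exp).const_mul
          gaussConst
        refine h1.congr_fderiv ?_
        ext w
        simp
        ring
      exact (h.comp p hasFDerivAt_snd).fderiv
    rw [e]
    refine ((ih (s - 1) ?_).smul (Gr.clm_snd n L)).mono le_rfl (by linarith)
    obtain ⟨C, _, hC⟩ := sqrtM_le (s - 1)
    exact ⟨C, fun p => by rw [Real.norm_of_nonneg (sqrtM_pos _).le]; exact hC _⟩

/-! ### Integrability of singular weights -/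

/-- In polar coordinates the Jacobian r² cancels the singularity r^{-2}. Square integrability of
1/|z| near the origin is what allows L² bounds on the functions convolved with b. -/
lemma integrable_sing_sq {s : ℝ} (hs : s < -3) :
    Integrable fun z : E3 => (1 + ‖z‖⁻¹) ^ 2 * jap z ^ s := by
  have h1 : Integrable fun z : E3 => (‖z‖⁻¹) ^ 2 * (1 + ‖z‖ ^ 2) ^ (s / 2) := by
    refine (integrable_fun_norm_addHaar (E := E3) volume
      (f := fun r : ℝ => (r⁻¹) ^ 2 * (1 + r ^ 2) ^ (s / 2))).2 ?_
    have h2 := (integrable_rpow_neg_one_add_norm_sq (E := ℝ) (μ := volume) (r := -s)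
      (by simp; linarith)).integrableOn (s := Set.Ioi 0)
    refine h2.congr_fun (fun r hr => ?_) measurableSet_Ioi
    have hr' : (0 : ℝ) < r := hr
    simp
    field_simp
  refine (((integrable_jap_rpow hs).const_mul 2).add (h1.const_mul 2)).mono' ?_
    (.of_forall fun z => ?_)
  · exact ((measurable_const.add measurable_norm.inv).pow_const 2).mul
      (continuous_jap_rpow s).measurable |>.aestronglyMeasurable
  · have := jap_rpow_pos z s
    rw [Real.norm_of_nonneg (by positivity)]
    simp only [Pi.add_apply]
    rw [← jap_rpow_eq]
    nlinarith [sq_nonneg (1 - ‖z‖⁻¹)]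

lemma integrable_sing {s : ℝ} (hs : s < -3) :
    Integrable fun z : E3 => (1 + ‖z‖⁻¹) * jap z ^ s := by
  refine (integrable_sing_sq hs).mono' ?_ (.of_forall fun z => ?_)
  · exact ((measurable_const.add measurable_norm.inv)).mul
      (continuous_jap_rpow s).measurable |>.aestronglyMeasurable
  · have := jap_rpow_pos z s
    have h0 : 0 ≤ ‖z‖⁻¹ := by positivity
    rw [Real.norm_of_nonneg (by positivity)]
    gcongr
    nlinarith

/-! ### Convolutions with singular kernels -/

/-- A kernel bounded by `(1 + 1/|z|)⟨z⟩⁴`. -/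
def Ker (K : E3 → ℝ) : Prop :=
  Measurable K ∧ ∃ C : ℝ, 0 ≤ C ∧ ∀ z, |K z| ≤ C * ((1 + ‖z‖⁻¹) * jap z ^ (4 : ℝ))

section Conv

variable {F : Type} [NormedAddCommGroup F] [NormedSpace ℝ F]

/-- The convolution in `v` of a kernel and of a function of `(x, v)`. -/
def conv (K : E3 → ℝ) (h : E3 × E3 → F) (p : E3 × E3) : F := ∫ z, K z • h (p.1, p.2 - z)

/-- Peetre's inequality moves the decay ⟨v − z⟩^{-12} onto z at the price ⟨v⟩^{12}; with the growth
⟨z⟩⁴ of the kernel this leaves an integrable ⟨z⟩^{-8}. -/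
lemma conv_bound {K : E3 → ℝ} (hK : Ker K) {h : E3 × E3 → F} {A : ℝ}
    (hh : ∀ p, ‖h p‖ ≤ A * jap p.2 ^ (-12 : ℝ)) :
    ∃ C : ℝ, 0 ≤ C ∧ ∀ (p : E3 × E3) z, ‖K z • h (p.1, p.2 - z)‖ ≤
      C * jap p.2 ^ (12 : ℝ) * ((1 + ‖z‖⁻¹) * jap z ^ (-8 : ℝ)) := by
  obtain ⟨C, hC0, hC⟩ := hK.2
  have hA : 0 ≤ A := by
    have := (norm_nonneg _).trans (hh 0)
    exact nonneg_of_mul_nonneg_left this (jap_rpow_pos _ _)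
  refine ⟨C * (A * 2 ^ (12 : ℝ)), by positivity, fun p z => ?_⟩
  have h1 := jap_peetre (-12) (-z) p.2
  rw [show |(-12 : ℝ)| = 12 by norm_num, jap_neg, neg_add_eq_sub] at h1
  rw [norm_smul]
  have p1 := jap_rpow_pos z 4
  have e : jap z ^ (-8 : ℝ) = jap z ^ (4 : ℝ) * jap z ^ (-12 : ℝ) := by
    rw [← jap_rpow_add]; norm_num
  calc ‖K z‖ * ‖h (p.1, p.2 - z)‖
      ≤ (C * ((1 + ‖z‖⁻¹) * jap z ^ (4 : ℝ))) *
        (A * (2 ^ (12 : ℝ) * jap z ^ (-12 : ℝ) * jap p.2 ^ (12 : ℝ))) := by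
        refine mul_le_mul (hC z) ((hh _).trans ?_) (norm_nonneg _) (by positivity)
        gcongr
    _ = _ := by rw [e]; ring

lemma conv_meas {K : E3 → ℝ} (hK : Ker K) {h : E3 × E3 → F} (hc : Continuous h) (p : E3 × E3) :
    AEStronglyMeasurable (fun z => K z • h (p.1, p.2 - z)) volume := by
  refine hK.1.aestronglyMeasurable.smul (Continuous.aestronglyMeasurable ?_)
  fun_prop

lemma conv_integrable {K : E3 → ℝ} (hK : Ker K) {h : E3 × E3 → F} (H : Gr 0 (-12) h)
    (p : E3 × E3) : Integrable (fun z => K z • h (p.1, p.2 - z)) volume := by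
  obtain ⟨A, _, hA⟩ := H.bound
  obtain ⟨C, _, hC⟩ := conv_bound hK hA
  exact ((integrable_sing (by norm_num)).const_mul _).mono' (conv_meas hK H.1.continuous p)
    (.of_forall fun z => hC p z)

lemma conv_norm_le {K : E3 → ℝ} (hK : Ker K) {h : E3 × E3 → F} (H : Gr 0 (-12) h) :
    ∃ C : ℝ, ∀ p, ‖conv K h p‖ ≤ C * jap p.2 ^ (12 : ℝ) := by
  obtain ⟨A, _, hA⟩ := H.bound
  obtain ⟨C, _, hC⟩ := conv_bound hK hA
  refine ⟨C * ∫ z : E3, (1 + ‖z‖⁻¹) * jap z ^ (-8 : ℝ), fun p => ?_⟩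
  refine (norm_integral_le_of_norm_le ((integrable_sing (by norm_num)).const_mul _)
    (.of_forall fun z => hC p z)).trans (le_of_eq ?_)
  rw [integral_const_mul]; ring

lemma jap_ball_bound (p : E3 × E3) : ∀ᶠ q in nhds p, jap q.2 ^ (12 : ℝ) ≤ jap p.2 ^ (12 : ℝ) + 1 :=
  ((((continuous_jap_rpow 12).comp continuous_snd).continuousAt (x := p)).eventually_lt_const
    (by simp [Function.comp])).mono fun _ h => le_of_lt h

lemma conv_continuous {K : E3 → ℝ} (hK : Ker K) {h : E3 × E3 → F} (H : Gr 0 (-12) h) :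
    Continuous (conv K h) := by
  obtain ⟨A, _, hA⟩ := H.bound
  obtain ⟨C, hC0, hC⟩ := conv_bound hK hA
  refine continuous_iff_continuousAt.2 fun p => ?_
  refine continuousAt_of_dominated (bound := fun z =>
    C * (jap p.2 ^ (12 : ℝ) + 1) * ((1 + ‖z‖⁻¹) * jap z ^ (-8 : ℝ)))
    (.of_forall fun q => conv_meas hK H.1.continuous q) ?_
    ((integrable_sing (by norm_num)).const_mul _) (.of_forall fun z => ?_)
  · filter_upwards [jap_ball_bound p] with q hq
    refine .of_forall fun z => (hC q z).trans ?_
    have := jap_rpow_pos z (-8)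
    gcongr
  · have := H.1.continuous
    fun_prop

/-- The kernel is merely measurable with a singular bound, so the derivative is put on h. Domination
holds on the neighbourhood where ⟨v⟩^{12} exceeds its value at p by at most 1. -/
lemma conv_hasFDerivAt {K : E3 → ℝ} (hK : Ker K) {h : E3 × E3 → F} (H : Gr 1 (-12) h)
    (p : E3 × E3) : HasFDerivAt (conv K h) (conv K (fderiv ℝ h) p) p := by
  obtain ⟨A, _, hA⟩ := (H.fderiv (n := 0)).bound
  obtain ⟨C, hC0, hC⟩ := conv_bound hK hA
  refine hasFDerivAt_integral_of_dominated_of_fderiv_le (jap_ball_bound p)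
    (bound := fun z => C * (jap p.2 ^ (12 : ℝ) + 1) * ((1 + ‖z‖⁻¹) * jap z ^ (-8 : ℝ)))
    (F' := fun q z => K z • fderiv ℝ h (q.1, q.2 - z))
    (.of_forall fun q => conv_meas hK H.1.continuous q)
    (conv_integrable hK (H.mono (by norm_num) le_rfl) p)
    (conv_meas hK (H.fderiv (n := 0)).1.continuous p) ?_
    ((integrable_sing (by norm_num)).const_mul _) ?_
  · refine .of_forall fun z q hq => (hC q z).trans ?_
    have := jap_rpow_pos z (-8)
    have hq' : jap q.2 ^ (12 : ℝ) ≤ jap p.2 ^ (12 : ℝ) + 1 := hq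
    gcongr
  · refine .of_forall fun z q _ => ?_
    have hd : HasFDerivAt h (fderiv ℝ h (q.1, q.2 - z)) (q.1, q.2 - z) :=
      (H.differentiable (n := 0) _).hasFDerivAt
    have h2 : HasFDerivAt (fun q : E3 × E3 => (q.1, q.2 - z)) (ContinuousLinearMap.id ℝ _) q := by
      have := (hasFDerivAt_id (𝕜 := ℝ) q).sub_const ((0, z) : E3 × E3)
      refine this.congr_of_eventuallyEq (.of_forall fun r => ?_)
      ext <;> simp
    have h3 := (hd.comp q h2).const_smul (K z)
    rwa [ContinuousLinearMap.comp_id] at h3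

lemma fderiv_conv {K : E3 → ℝ} (hK : Ker K) {h : E3 × E3 → F} (H : Gr 1 (-12) h) :
    fderiv ℝ (conv K h) = conv K (fderiv ℝ h) :=
  funext fun p => (conv_hasFDerivAt hK H p).fderiv

end Conv

/-- The target space is quantified inside the induction on n because the step replaces h by its
differential. -/
lemma Gr.conv {K : E3 → ℝ} (hK : Ker K) (n : ℕ) :
    ∀ {F : Type} [NormedAddCommGroup F] [NormedSpace ℝ F] {h : E3 × E3 → F},
      Gr n (-12) h → Gr n 12 (Landau.conv K h) := by
  induction n with
  | zero => intro F _ _ h H; exact Gr.zero (conv_continuous hK H) (conv_norm_le hK H)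
  | succ n ih =>
    intro F _ _ h H
    have H1 : Gr 1 (-12) h := H.mono (by omega) le_rfl
    refine Gr.succ (fun p => (conv_hasFDerivAt hK H1 p).differentiableAt)
      (conv_norm_le hK (H.mono (by omega) le_rfl)) ?_
    rw [fderiv_conv hK H1]
    exact ih H.fderiv

/-! ### Partial derivatives of functions of `(x, v)` -/

/-- The partial derivative `∂_{v_l}` of a function of `(x, v)`. -/
def pv (l : Fin 3) (g : E3 → E3 → ℝ) (x v : E3) : ℝ := pd l (g x) v

/-- The function of the pair `(x, v)`. -/
def unc (g : E3 → E3 → ℝ) (p : E3 × E3) : ℝ := g p.1 p.2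

/-- `Gr` for functions of two variables. -/
def Sm (n : ℕ) (s : ℝ) (g : E3 → E3 → ℝ) : Prop := Gr n s (unc g)

section Sm

variable {n : ℕ} {s t : ℝ} {f g : E3 → E3 → ℝ}

lemma Sm.mono {m : ℕ} (H : Sm n s g) (hm : m ≤ n) (hs : s ≤ t) : Sm m t g := Gr.mono H hm hs

lemma Sm.le {m : ℕ} (H : Sm n s g) (hm : m ≤ n) : Sm m s g := Gr.mono H hm le_rfl

lemma Sm.contDiff_x (H : Sm n s g) (v : E3) : ContDiff ℝ n (fun x => g x v) :=
  H.1.comp (contDiff_id.prodMk contDiff_const)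

lemma Sm.contDiff_v (H : Sm n s g) (x : E3) : ContDiff ℝ n (g x) :=
  H.1.comp (contDiff_const.prodMk contDiff_id)

lemma Sm.diff_x (H : Sm (n + 1) s g) (v : E3) : Differentiable ℝ (fun x => g x v) :=
  (H.contDiff_x v).differentiable (by simp)

lemma Sm.diff_v (H : Sm (n + 1) s g) (x : E3) : Differentiable ℝ (g x) :=
  (H.contDiff_v x).differentiable (by simp)

lemma Sm.continuous (H : Sm n s g) : Continuous (unc g) := H.1.continuous

lemma unc_dx (H : Differentiable ℝ (unc g)) (i : Fin 3) :
    unc (dx i g) = fun p => fderiv ℝ (unc g) p (e3 i, 0) := by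
  funext p
  have h := (H p).hasFDerivAt.comp (f := fun y => (y, p.2)) p.1
    ((hasFDerivAt_id p.1).prodMk (hasFDerivAt_const p.2 p.1))
  change fderiv ℝ (unc g ∘ fun y => (y, p.2)) p.1 _ = _
  rw [h.fderiv]; simp

lemma unc_pv (H : Differentiable ℝ (unc g)) (i : Fin 3) :
    unc (pv i g) = fun p => fderiv ℝ (unc g) p (0, e3 i) := by
  funext p
  have h := (H p).hasFDerivAt.comp (f := fun y => (p.1, y)) p.2
    ((hasFDerivAt_const p.1 p.2).prodMk (hasFDerivAt_id p.2))
  change fderiv ℝ (unc g ∘ fun y => (p.1, y)) p.2 _ = _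
  rw [h.fderiv]; simp

lemma Sm.dx (H : Sm (n + 1) s g) (i : Fin 3) : Sm n s (dx i g) := by
  unfold Sm
  rw [unc_dx (Gr.differentiable H)]
  exact (Gr.fderiv H).clm (ContinuousLinearMap.apply ℝ ℝ ((e3 i, 0) : E3 × E3))

lemma Sm.pv (H : Sm (n + 1) s g) (i : Fin 3) : Sm n s (pv i g) := by
  unfold Sm
  rw [unc_pv (Gr.differentiable H)]
  exact (Gr.fderiv H).clm (ContinuousLinearMap.apply ℝ ℝ ((0, e3 i) : E3 × E3))

lemma Sm.dx_pv (H : Sm (n + 2) s g) (i l : Fin 3) :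
    Landau.dx i (Landau.pv l g) = Landau.pv l (Landau.dx i g) := by
  have H1 : Differentiable ℝ (unc g) := Gr.differentiable (n := n + 1) H
  have H2 : Differentiable ℝ (fderiv ℝ (unc g)) := Gr.differentiable (n := n) (Gr.fderiv H)
  have a1 := unc_dx (Gr.differentiable (n := n) (Sm.pv (n := n + 1) H l)) i
  have a2 := unc_pv (Gr.differentiable (n := n) (Sm.dx (n := n + 1) H i)) l
  suffices h : unc (Landau.dx i (Landau.pv l g)) = unc (Landau.pv l (Landau.dx i g)) from
    funext fun x => funext fun v => congrFun h (x, v)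
  rw [a1, a2, unc_dx H1, unc_pv H1]
  funext p
  have key : ∀ a b : E3 × E3, fderiv ℝ (fun p => fderiv ℝ (unc g) p a) p b =
      fderiv ℝ (fderiv ℝ (unc g)) p b a := fun a b => by
    have h := (ContinuousLinearMap.apply ℝ ℝ a).hasFDerivAt.comp p (H2 p).hasFDerivAt
    change fderiv ℝ ((ContinuousLinearMap.apply ℝ ℝ a) ∘ fderiv ℝ (unc g)) p b = _
    rw [h.fderiv]; rfl
  rw [key, key]
  have hs : ContDiffAt ℝ 2 (unc g) p := (H.1.of_le (by norm_cast; omega)).contDiffAt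
  exact hs.isSymmSndFDerivAt (by simp) _ _

lemma Sm.add (H : Sm n s f) (H' : Sm n s g) : Sm n s (fun x v => f x v + g x v) :=
  Gr.add H H'

lemma Sm.mul (H : Sm n s f) (H' : Sm n t g) : Sm n (s + t) (fun x v => f x v * g x v) :=
  Gr.mul H H'

lemma Sm.sum {ι : Type*} (S : Finset ι) {h : ι → E3 → E3 → ℝ}
    (H : ∀ a ∈ S, Sm n s (h a)) : Sm n s (fun x v => ∑ a ∈ S, h a x v) := Gr.sum S H

lemma Sm.const (n : ℕ) (c : ℝ) : Sm n 0 (fun _ _ => c) := Gr.const n c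

lemma Sm.coord (n : ℕ) (i : Fin 3) : Sm n 1 (fun _ v => v i) :=
  Gr.clm_snd n (EuclideanSpace.proj i : E3 →L[ℝ] ℝ)

lemma Sm.const_mul (H : Sm n s f) (c : ℝ) : Sm n s (fun x v => c * f x v) := by
  simpa using (Sm.const n c).mul H

lemma Sm.neg (H : Sm n s f) : Sm n s (fun x v => - f x v) := by
  simpa using H.const_mul (-1)

lemma Sm.sub (H : Sm n s f) (H' : Sm n s g) : Sm n s (fun x v => f x v - g x v) := by
  simpa [sub_eq_add_neg] using H.add H'.neg

lemma Sm.sqrtM_mul (H : Sm n s f) (r : ℝ) : Sm n r (fun x v => sqrtM v * f x v) := by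
  have := (gr_sqrtM n (r - s)).mul H
  rw [sub_add_cancel] at this
  exact this

lemma SmoothEnough.sm {N : ℕ} (H : SmoothEnough N g) : Sm N (-N) g := by
  refine ⟨H.contDiff, fun k hk => ?_⟩
  obtain ⟨K, hK⟩ := H.decay k hk
  refine ⟨K, fun p => ?_⟩
  have := jap_rpow_pos p.2 (-(N : ℝ))
  have h := hK p
  have e : jap p.2 ^ (-(N : ℝ)) * jap p.2 ^ N = 1 := by
    rw [← Real.rpow_natCast, ← jap_rpow_add]; simp
  calc _ = (jap p.2 ^ (-(N : ℝ)) * jap p.2 ^ N) * ‖iteratedFDeriv ℝ k (unc g) p‖ := by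
        rw [e, one_mul]
    _ ≤ jap p.2 ^ (-(N : ℝ)) * K := by rw [mul_assoc]; gcongr; exact h
    _ = _ := mul_comm _ _

end Sm

/-! ### The kernels -/

lemma jap_rpow_nonneg (v : E3) (s : ℝ) : 0 ≤ jap v ^ s := (jap_rpow_pos v s).le

/-- The divergence `b_i = ∂_j a_{ij}`. -/
def bKer (γ : ℝ) (i : Fin 3) (z : E3) : ℝ := -2 * ‖z‖ ^ γ * z i

/-- The regularization `(|z|² + ε)^{γ/2} (|z|² δ_{ij} - z_i z_j)` of `a_{ij}`. -/
def aReg (γ ε : ℝ) (i j : Fin 3) (z : E3) : ℝ :=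
  (‖z‖ ^ 2 + ε) ^ (γ / 2) * (‖z‖ ^ 2 * (if i = j then 1 else 0) - z i * z j)

/-- The regularization of `b_i`. -/
def bReg (γ ε : ℝ) (i : Fin 3) (z : E3) : ℝ := -2 * (‖z‖ ^ 2 + ε) ^ (γ / 2) * z i

/-- The divergence of `bReg γ 1`. -/
def cReg (γ : ℝ) (z : E3) : ℝ :=
  -2 * (γ * ‖z‖ ^ 2 * (1 + ‖z‖ ^ 2) ^ (γ / 2 - 1) + 3 * (1 + ‖z‖ ^ 2) ^ (γ / 2))

lemma norm_rpow_le_jap (z : E3) {s : ℝ} (hs : 0 ≤ s) : ‖z‖ ^ s ≤ jap z ^ s :=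
  Real.rpow_le_rpow (norm_nonneg _) (norm_le_jap z) hs

lemma measurable_coord (i : Fin 3) : Measurable fun z : E3 => z i :=
  (EuclideanSpace.proj i : E3 →L[ℝ] ℝ).measurable

@[fun_prop]
lemma differentiable_coord (i : Fin 3) : Differentiable ℝ fun z : E3 => z i :=
  (EuclideanSpace.proj i : E3 →L[ℝ] ℝ).differentiable

lemma measurable_aKer (γ : ℝ) (i j : Fin 3) : Measurable (aKer γ i j) := by
  have h1 := measurable_coord i
  have h2 := measurable_coord j
  unfold aKer
  fun_prop

lemma measurable_bKer (γ : ℝ) (i : Fin 3) : Measurable (bKer γ i) := by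
  have h1 := measurable_coord i
  unfold bKer
  fun_prop

lemma abs_aKer_le {γ : ℝ} (i j : Fin 3) (z : E3) : |aKer γ i j z| ≤ 2 * ‖z‖ ^ (γ + 2) := by
  unfold aKer
  have h0 : 0 ≤ ‖z‖ ^ (γ + 2) := Real.rpow_nonneg (norm_nonneg _) _
  rw [abs_mul, abs_of_nonneg h0, mul_comm]
  gcongr
  have h1 : |z i * z j / ‖z‖ ^ 2| ≤ 1 := by
    rw [abs_div, abs_mul, abs_of_nonneg (sq_nonneg ‖z‖)]
    refine div_le_one_of_le₀ ?_ (sq_nonneg _)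
    rw [sq]
    exact mul_le_mul (abs_coord_le z i) (abs_coord_le z j) (abs_nonneg _) (norm_nonneg _)
  refine (abs_sub _ _).trans ?_
  have h2 : |(if i = j then (1 : ℝ) else 0)| ≤ 1 := by split_ifs <;> simp
  linarith

lemma ker_aKer {γ : ℝ} (h1 : -2 ≤ γ) (h2 : γ ≤ 1) (i j : Fin 3) : Ker (aKer γ i j) := by
  refine ⟨measurable_aKer γ i j, 2, by norm_num, fun z => (abs_aKer_le i j z).trans ?_⟩
  have a1 := (norm_rpow_le_jap z (s := γ + 2) (by linarith)).trans
    (jap_rpow_mono z (t := 4) (by linarith))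
  have a2 : 0 ≤ ‖z‖⁻¹ := by positivity
  have a3 := jap_rpow_nonneg z 4
  nlinarith [mul_nonneg a2 a3]

/-- Uniformity in ε is what dominated convergence needs as ε → 0. For γ ≤ 0, dropping ε only
increases the first factor, and then γ + 2 ≥ 0 keeps |z|^{γ+2} bounded near the origin. -/
lemma reg_bound {γ ε : ℝ} (h1 : -2 ≤ γ) (h2 : γ ≤ 1) (hε : 0 < ε) (hε1 : ε ≤ 1) (z : E3) :
    (‖z‖ ^ 2 + ε) ^ (γ / 2) * ‖z‖ ^ 2 ≤ jap z ^ (4 : ℝ) := by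
  rcases eq_or_ne z 0 with rfl | hz
  · simpa using jap_rpow_nonneg 0 4
  have hz' : 0 < ‖z‖ := norm_pos_iff.2 hz
  rcases le_total 0 γ with h | h
  · have a1 : (‖z‖ ^ 2 + ε) ^ (γ / 2) ≤ jap z ^ (2 : ℝ) := by
      refine (Real.rpow_le_rpow (by positivity) (show _ ≤ 1 + ‖z‖ ^ 2 by linarith)
        (by linarith)).trans ?_
      rw [← jap_rpow_eq]
      exact jap_rpow_mono z (by linarith)
    have a2 : ‖z‖ ^ 2 ≤ jap z ^ (2 : ℝ) := by
      rw [Real.rpow_two, jap_sq]; linarith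
    calc _ ≤ jap z ^ (2 : ℝ) * jap z ^ (2 : ℝ) :=
          mul_le_mul a1 a2 (by positivity) (jap_rpow_nonneg _ _)
      _ = _ := by rw [← jap_rpow_add]; norm_num
  · have a1 : (‖z‖ ^ 2 + ε) ^ (γ / 2) ≤ (‖z‖ ^ 2) ^ (γ / 2) :=
      Real.rpow_le_rpow_of_nonpos (by positivity) (by linarith) (by linarith)
    have a2 : (‖z‖ ^ 2) ^ (γ / 2) * ‖z‖ ^ 2 = ‖z‖ ^ (γ + 2) := by
      rw [← Real.rpow_natCast ‖z‖ 2, ← Real.rpow_mul (norm_nonneg _), ← Real.rpow_add hz']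
      congr 1
      push_cast; ring
    calc _ ≤ (‖z‖ ^ 2) ^ (γ / 2) * ‖z‖ ^ 2 := by gcongr
      _ = _ := a2
      _ ≤ jap z ^ (γ + 2) := norm_rpow_le_jap z (by linarith)
      _ ≤ _ := jap_rpow_mono z (by linarith)

lemma reg_bound' {γ ε : ℝ} (h1 : -2 ≤ γ) (h2 : γ ≤ 1) (hε : 0 < ε) (hε1 : ε ≤ 1) (z : E3) :
    (‖z‖ ^ 2 + ε) ^ (γ / 2) * ‖z‖ ≤ (1 + ‖z‖⁻¹) * jap z ^ (4 : ℝ) := by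
  rcases eq_or_ne z 0 with rfl | hz
  · simpa using jap_rpow_nonneg 0 4
  have hz' : 0 < ‖z‖ := norm_pos_iff.2 hz
  have h := reg_bound h1 h2 hε hε1 z
  have a3 := jap_rpow_nonneg z 4
  calc _ = ‖z‖⁻¹ * ((‖z‖ ^ 2 + ε) ^ (γ / 2) * ‖z‖ ^ 2) := by field_simp
    _ ≤ ‖z‖⁻¹ * jap z ^ (4 : ℝ) := by gcongr
    _ ≤ _ := by nlinarith

lemma abs_delta_sub_le (i j : Fin 3) (z : E3) :
    |‖z‖ ^ 2 * (if i = j then 1 else 0) - z i * z j| ≤ 2 * ‖z‖ ^ 2 := by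
  have a1 := mul_le_mul (abs_coord_le z i) (abs_coord_le z j) (abs_nonneg _) (norm_nonneg _)
  rw [← abs_mul] at a1
  have a2 : |‖z‖ ^ 2 * (if i = j then (1 : ℝ) else 0)| ≤ ‖z‖ ^ 2 := by
    split_ifs <;> simp
  refine (abs_sub _ _).trans ?_
  nlinarith

lemma abs_aReg_le {γ ε : ℝ} (h1 : -2 ≤ γ) (h2 : γ ≤ 1) (hε : 0 < ε) (hε1 : ε ≤ 1) (i j : Fin 3)
    (z : E3) : |aReg γ ε i j z| ≤ 2 * ((1 + ‖z‖⁻¹) * jap z ^ (4 : ℝ)) := by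
  unfold aReg
  have h0 : 0 ≤ (‖z‖ ^ 2 + ε) ^ (γ / 2) := by positivity
  rw [abs_mul, abs_of_nonneg h0]
  have := reg_bound h1 h2 hε hε1 z
  have a3 := jap_rpow_nonneg z 4
  have a2 : 0 ≤ ‖z‖⁻¹ := by positivity
  calc _ ≤ (‖z‖ ^ 2 + ε) ^ (γ / 2) * (2 * ‖z‖ ^ 2) := by gcongr; exact abs_delta_sub_le i j z
    _ ≤ 2 * jap z ^ (4 : ℝ) := by linarith
    _ ≤ _ := by nlinarith [mul_nonneg a2 a3]

lemma abs_bReg_le {γ ε : ℝ} (h1 : -2 ≤ γ) (h2 : γ ≤ 1) (hε : 0 < ε) (hε1 : ε ≤ 1) (i : Fin 3)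
    (z : E3) : |bReg γ ε i z| ≤ 2 * ((1 + ‖z‖⁻¹) * jap z ^ (4 : ℝ)) := by
  unfold bReg
  have h0 : 0 ≤ (‖z‖ ^ 2 + ε) ^ (γ / 2) := by positivity
  rw [abs_mul, abs_mul, abs_of_nonneg h0, abs_neg, abs_two]
  have := reg_bound' h1 h2 hε hε1 z
  calc _ ≤ 2 * (‖z‖ ^ 2 + ε) ^ (γ / 2) * ‖z‖ := by gcongr; exact abs_coord_le z i
    _ ≤ _ := by linarith

lemma tendsto_reg {z : E3} (hz : z ≠ 0) (γ : ℝ) {e : ℕ → ℝ}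
    (he : Filter.Tendsto e Filter.atTop (nhds 0)) :
    Filter.Tendsto (fun n => (‖z‖ ^ 2 + e n) ^ (γ / 2)) Filter.atTop (nhds (‖z‖ ^ γ)) := by
  have hz' : 0 < ‖z‖ := norm_pos_iff.2 hz
  have h1 : Filter.Tendsto (fun n => ‖z‖ ^ 2 + e n) Filter.atTop (nhds (‖z‖ ^ 2)) := by
    simpa using he.const_add (‖z‖ ^ 2)
  have h2 := h1.rpow_const (p := γ / 2) (Or.inl (by positivity))
  have e2 : (‖z‖ ^ 2) ^ (γ / 2) = ‖z‖ ^ γ := by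
    rw [← Real.rpow_natCast ‖z‖ 2, ← Real.rpow_mul (norm_nonneg _)]
    congr 1; push_cast; ring
  rwa [e2] at h2

lemma aKer_eq {z : E3} (hz : z ≠ 0) (γ : ℝ) (i j : Fin 3) :
    aKer γ i j z = ‖z‖ ^ γ * (‖z‖ ^ 2 * (if i = j then 1 else 0) - z i * z j) := by
  have hz' : 0 < ‖z‖ := norm_pos_iff.2 hz
  rw [aKer, Real.rpow_add hz', Real.rpow_two]
  field_simp

lemma hasFDerivAt_reg (γ : ℝ) {ε : ℝ} (hε : 0 < ε) (z : E3) :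
    DifferentiableAt ℝ (fun u : E3 => (‖u‖ ^ 2 + ε) ^ (γ / 2)) z := by
  have h : DifferentiableAt ℝ (fun u : E3 => ‖u‖ ^ 2 + ε) z :=
    (differentiable_norm_sq z).add (differentiableAt_const ε)
  have h0 : ‖z‖ ^ 2 + ε ≠ 0 := by positivity
  exact h.rpow_const (Or.inl h0)

lemma pd_reg (γ : ℝ) {ε : ℝ} (hε : 0 < ε) (k : Fin 3) (z : E3) :
    pd k (fun u : E3 => (‖u‖ ^ 2 + ε) ^ (γ / 2)) z =
      γ * (‖z‖ ^ 2 + ε) ^ (γ / 2 - 1) * z k := by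
  have hd : DifferentiableAt ℝ (fun u : E3 => ‖u‖ ^ 2 + ε) z :=
    (differentiable_norm_sq z).add (differentiableAt_const ε)
  rw [pd_comp k (φ := fun t => t ^ (γ / 2))
    (Real.hasDerivAt_rpow_const (Or.inl (by positivity))) hd,
    pd_add k (differentiable_norm_sq z) (differentiableAt_const ε), pd_norm_sq]
  have : pd k (fun _ : E3 => ε) z = 0 := by simp [pd]
  rw [this]; ring

lemma differentiable_aReg (γ : ℝ) {ε : ℝ} (hε : 0 < ε) (i j : Fin 3) :
    Differentiable ℝ (aReg γ ε i j) := fun z => by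
  have := hasFDerivAt_reg γ hε z
  have := differentiable_norm_sq z
  unfold aReg
  fun_prop

lemma differentiable_bReg (γ : ℝ) {ε : ℝ} (hε : 0 < ε) (i : Fin 3) :
    Differentiable ℝ (bReg γ ε i) := fun z => by
  have := hasFDerivAt_reg γ hε z
  unfold bReg
  fun_prop

lemma pd_aReg (γ : ℝ) {ε : ℝ} (hε : 0 < ε) (i j k : Fin 3) (z : E3) :
    pd k (aReg γ ε i j) z = γ * (‖z‖ ^ 2 + ε) ^ (γ / 2 - 1) * z k *
        (‖z‖ ^ 2 * (if i = j then 1 else 0) - z i * z j) +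
      (‖z‖ ^ 2 + ε) ^ (γ / 2) * (2 * z k * (if i = j then 1 else 0) -
        ((if k = i then 1 else 0) * z j + z i * (if k = j then 1 else 0))) := by
  have h1 := hasFDerivAt_reg γ hε z
  have h2 := differentiable_norm_sq z
  unfold aReg
  rw [pd_mul k h1 (by fun_prop), pd_reg γ hε, pd_sub k (by fun_prop) (by fun_prop),
    pd_mul k (by fun_prop) (by fun_prop), pd_mul k (by fun_prop) (by fun_prop), pd_norm_sq,
    pd_coord, pd_coord]
  have : pd k (fun _ : E3 => if i = j then (1 : ℝ) else 0) z = 0 := by simp [pd]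
  rw [this]; ring

/-- The matrix |z|² Id − z ⊗ z annihilates z, so the derivative of the radial factor disappears;
what remains is 2z_i − z_i − 3z_i = −2z_i times that factor. -/
lemma sum_pd_aReg (γ : ℝ) {ε : ℝ} (hε : 0 < ε) (i : Fin 3) (z : E3) :
    ∑ j, pd j (aReg γ ε i j) z = bReg γ ε i z := by
  simp_rw [pd_aReg γ hε]
  unfold bReg
  rw [Finset.sum_add_distrib]
  simp_rw [norm_sq_eq_sum]
  fin_cases i <;> simp [Fin.sum_univ_three] <;> ring

lemma pd_bReg (γ : ℝ) {ε : ℝ} (hε : 0 < ε) (i k : Fin 3) (z : E3) :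
    pd k (bReg γ ε i) z = -2 * (γ * (‖z‖ ^ 2 + ε) ^ (γ / 2 - 1) * z k * z i +
      (‖z‖ ^ 2 + ε) ^ (γ / 2) * (if k = i then 1 else 0)) := by
  have h1 := hasFDerivAt_reg γ hε z
  unfold bReg
  simp_rw [mul_assoc]
  rw [pd_const_mul, pd_mul k h1 (by fun_prop), pd_reg γ hε, pd_coord]
  ring

lemma sum_pd_bReg (γ : ℝ) (z : E3) : ∑ j, pd j (bReg γ 1 j) z = cReg γ z := by
  simp_rw [pd_bReg γ one_pos]
  unfold cReg
  simp only [Fin.sum_univ_three, if_true]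
  rw [add_comm (1 : ℝ), norm_sq_eq_sum, Fin.sum_univ_three]
  ring

lemma reg_sub_one {γ ε : ℝ} (hε : 0 < ε) (z : E3) :
    (‖z‖ ^ 2 + ε) ^ (γ / 2 - 1) * ‖z‖ ^ 2 ≤ (‖z‖ ^ 2 + ε) ^ (γ / 2) := by
  have h : 0 < ‖z‖ ^ 2 + ε := by positivity
  calc _ ≤ (‖z‖ ^ 2 + ε) ^ (γ / 2 - 1) * (‖z‖ ^ 2 + ε) := by gcongr; linarith
    _ = _ := by rw [← Real.rpow_add_one h.ne']; ring_nf

lemma ker_aReg {γ ε : ℝ} (h1 : -2 ≤ γ) (h2 : γ ≤ 1) (hε : 0 < ε) (hε1 : ε ≤ 1) (i j : Fin 3) :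
    Ker (aReg γ ε i j) :=
  ⟨(differentiable_aReg γ hε i j).continuous.measurable, 2, by norm_num,
    abs_aReg_le h1 h2 hε hε1 i j⟩

lemma ker_bReg {γ ε : ℝ} (h1 : -2 ≤ γ) (h2 : γ ≤ 1) (hε : 0 < ε) (hε1 : ε ≤ 1) (i : Fin 3) :
    Ker (bReg γ ε i) :=
  ⟨(differentiable_bReg γ hε i).continuous.measurable, 2, by norm_num,
    abs_bReg_le h1 h2 hε hε1 i⟩

lemma measurable_pd (k : Fin 3) (f : E3 → ℝ) : Measurable (pd k f) :=
  measurable_fderiv_apply_const ℝ f _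

lemma ker_pd_aReg {γ ε : ℝ} (h1 : -2 ≤ γ) (h2 : γ ≤ 1) (hε : 0 < ε) (hε1 : ε ≤ 1)
    (i j k : Fin 3) : Ker (pd k (aReg γ ε i j)) := by
  refine ⟨measurable_pd _ _, 8, by norm_num, fun z => ?_⟩
  rw [pd_aReg γ hε]
  have hγ : |γ| ≤ 2 := abs_le.2 ⟨h1, by linarith⟩
  have b1 := reg_bound' h1 h2 hε hε1 z
  have b2 := reg_sub_one (γ := γ) hε z
  have h : 0 < ‖z‖ ^ 2 + ε := by positivity
  have p1 : 0 ≤ (‖z‖ ^ 2 + ε) ^ (γ / 2 - 1) := by positivity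
  have p2 : 0 ≤ (‖z‖ ^ 2 + ε) ^ (γ / 2) := by positivity
  have c1 := abs_coord_le z i
  have c2 := abs_coord_le z j
  have c3 := abs_coord_le z k
  have d1 : |2 * z k * (if i = j then 1 else 0) -
        ((if k = i then 1 else 0) * z j + z i * (if k = j then 1 else 0))| ≤ 4 * ‖z‖ := by
    have hn := norm_nonneg z
    rw [abs_le] at *
    constructor <;> split_ifs <;> linarith
  have d2 := abs_delta_sub_le i j z
  refine (abs_add_le _ _).trans ?_
  rw [abs_mul, abs_mul, abs_mul, abs_mul, abs_of_nonneg p1, abs_of_nonneg p2]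
  calc _ ≤ 2 * (‖z‖ ^ 2 + ε) ^ (γ / 2 - 1) * ‖z‖ * (2 * ‖z‖ ^ 2) +
        (‖z‖ ^ 2 + ε) ^ (γ / 2) * (4 * ‖z‖) := by gcongr
    _ = 4 * ‖z‖ * ((‖z‖ ^ 2 + ε) ^ (γ / 2 - 1) * ‖z‖ ^ 2) +
        (‖z‖ ^ 2 + ε) ^ (γ / 2) * (4 * ‖z‖) := by ring
    _ ≤ 4 * ‖z‖ * (‖z‖ ^ 2 + ε) ^ (γ / 2) + (‖z‖ ^ 2 + ε) ^ (γ / 2) * (4 * ‖z‖) := by gcongr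
    _ ≤ _ := by linarith

lemma abs_pd_bReg_le {γ : ℝ} (h1 : -2 ≤ γ) (h2 : γ ≤ 1) (i k : Fin 3) (z : E3) :
    |pd k (bReg γ 1 i) z| ≤ 6 * jap z ^ γ := by
  rw [pd_bReg γ one_pos]
  have hγ : |γ| ≤ 2 := abs_le.2 ⟨h1, by linarith⟩
  have b2 := reg_sub_one (γ := γ) one_pos z
  have p1 : 0 ≤ (‖z‖ ^ 2 + 1) ^ (γ / 2 - 1) := by positivity
  have p2 : 0 ≤ (‖z‖ ^ 2 + 1) ^ (γ / 2) := by positivity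
  have c1 := abs_coord_le z i
  have c3 := abs_coord_le z k
  have e : jap z ^ γ = (‖z‖ ^ 2 + 1) ^ (γ / 2) := by rw [jap_rpow_eq, add_comm]
  rw [abs_mul, abs_neg, abs_two, e]
  have t1 : |γ * (‖z‖ ^ 2 + 1) ^ (γ / 2 - 1) * z k * z i| ≤ 2 * (‖z‖ ^ 2 + 1) ^ (γ / 2) := by
    rw [abs_mul, abs_mul, abs_mul, abs_of_nonneg p1]
    calc _ ≤ 2 * (‖z‖ ^ 2 + 1) ^ (γ / 2 - 1) * ‖z‖ * ‖z‖ := by gcongr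
      _ = 2 * ((‖z‖ ^ 2 + 1) ^ (γ / 2 - 1) * ‖z‖ ^ 2) := by ring
      _ ≤ _ := by gcongr
  have t2 : |(‖z‖ ^ 2 + 1) ^ (γ / 2) * (if k = i then (1 : ℝ) else 0)| ≤
      (‖z‖ ^ 2 + 1) ^ (γ / 2) := by
    split_ifs
    · simp [abs_of_nonneg p2]
    · simpa using p2
  linarith [abs_add_le (γ * (‖z‖ ^ 2 + 1) ^ (γ / 2 - 1) * z k * z i)
    ((‖z‖ ^ 2 + 1) ^ (γ / 2) * (if k = i then (1 : ℝ) else 0))]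

lemma jap_rpow_le_sing {γ : ℝ} (h2 : γ ≤ 4) (z : E3) :
    jap z ^ γ ≤ (1 + ‖z‖⁻¹) * jap z ^ (4 : ℝ) := by
  have a1 := jap_rpow_mono z h2
  have a2 : 0 ≤ ‖z‖⁻¹ := by positivity
  nlinarith [mul_nonneg a2 (jap_rpow_nonneg z 4)]

lemma ker_pd_bReg {γ : ℝ} (h1 : -2 ≤ γ) (h2 : γ ≤ 1) (i k : Fin 3) :
    Ker (pd k (bReg γ 1 i)) := by
  refine ⟨measurable_pd _ _, 6, by norm_num, fun z => (abs_pd_bReg_le h1 h2 i k z).trans ?_⟩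
  have := jap_rpow_le_sing (γ := γ) (by linarith) z
  gcongr

lemma abs_bKer_le {γ : ℝ} (i : Fin 3) (z : E3) : |bKer γ i z| ≤ 2 * (‖z‖⁻¹ * ‖z‖ ^ (γ + 2)) := by
  rcases eq_or_ne z 0 with rfl | hz
  · simp [bKer]
  have hz' : 0 < ‖z‖ := norm_pos_iff.2 hz
  rw [bKer, abs_mul, abs_mul, abs_neg, abs_two, abs_of_nonneg (Real.rpow_nonneg (norm_nonneg _) _),
    Real.rpow_add hz', Real.rpow_two]
  calc _ ≤ 2 * ‖z‖ ^ γ * ‖z‖ := by gcongr; exact abs_coord_le z i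
    _ = _ := by field_simp

lemma ker_bKer {γ : ℝ} (h1 : -2 ≤ γ) (h2 : γ ≤ 1) (i : Fin 3) : Ker (bKer γ i) := by
  refine ⟨measurable_bKer γ i, 2, by norm_num, fun z => (abs_bKer_le i z).trans ?_⟩
  have a1 := (norm_rpow_le_jap z (s := γ + 2) (by linarith)).trans
    (jap_rpow_mono z (t := 4) (by linarith))
  have a2 : 0 ≤ ‖z‖⁻¹ := by positivity
  have a3 := jap_rpow_nonneg z 4
  nlinarith [mul_le_mul_of_nonneg_left a1 a2]

/-- The singular part of `b` is bounded at infinity. -/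
lemma abs_bKer_sub_bReg_le {γ : ℝ} (h1 : -2 ≤ γ) (h2 : γ ≤ 1) (i : Fin 3) (z : E3) :
    |bKer γ i z - bReg γ 1 i z| ≤ 64 * (1 + ‖z‖⁻¹) := by
  rcases eq_or_ne z 0 with rfl | hz
  · simp [bKer, bReg]
  have hz' : 0 < ‖z‖ := norm_pos_iff.2 hz
  have a2 : 0 ≤ ‖z‖⁻¹ := by positivity
  rcases le_total ‖z‖ 1 with hz1 | hz1
  · have b1 : |bKer γ i z| ≤ 2 * ‖z‖⁻¹ := by
      refine (abs_bKer_le i z).trans ?_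
      have := Real.rpow_le_one (norm_nonneg z) hz1 (show 0 ≤ γ + 2 by linarith)
      nlinarith
    have b2 : |bReg γ 1 i z| ≤ 32 * (1 + ‖z‖⁻¹) := by
      refine (abs_bReg_le h1 h2 one_pos le_rfl i z).trans ?_
      have : jap z ^ (4 : ℝ) ≤ 16 := by
        have h : jap z ≤ 2 := (jap_le z).trans (by linarith)
        calc jap z ^ (4 : ℝ) ≤ 2 ^ (4 : ℝ) := Real.rpow_le_rpow (jap_pos z).le h (by norm_num)
          _ = 16 := by norm_num
      nlinarith
    refine (abs_sub _ _).trans ?_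
    nlinarith
  -- For |z| ≥ 1 the leading terms at infinity cancel. With s = |z|^{-2} the difference is |z|^γ (1
  -- − (1+s)^{γ/2}), and Bernoulli's inequality, applied to the inverse power when γ ≤ 0, bounds the
  -- bracket by s. The difference of the kernels is then at most 2|z|^{γ−1} ≤ 2.
  · have key : |‖z‖ ^ γ - (‖z‖ ^ 2 + 1) ^ (γ / 2)| ≤ ‖z‖ ^ γ * (‖z‖⁻¹) ^ 2 := by
      set s : ℝ := (‖z‖⁻¹) ^ 2 with hs
      have hs0 : 0 < s := by positivity
      have hs1 : s ≤ 1 := pow_le_one₀ a2 (inv_le_one_of_one_le₀ hz1)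
      have e1 : (‖z‖ ^ 2 + 1) ^ (γ / 2) = ‖z‖ ^ γ * (1 + s) ^ (γ / 2) := by
        have : ‖z‖ ^ 2 + 1 = ‖z‖ ^ 2 * (1 + s) := by rw [hs]; field_simp
        rw [this, Real.mul_rpow (by positivity) (by positivity), ← Real.rpow_natCast ‖z‖ 2,
          ← Real.rpow_mul (norm_nonneg _)]
        congr 2
        push_cast; ring
      have p0 : 0 ≤ ‖z‖ ^ γ := Real.rpow_nonneg (norm_nonneg _) _
      have e2 : |1 - (1 + s) ^ (γ / 2)| ≤ s := by
        rcases le_total 0 γ with h | h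
        · have q1 := Real.one_le_rpow (show 1 ≤ 1 + s by linarith) (show 0 ≤ γ / 2 by linarith)
          have q2 := rpow_one_add_le_one_add_mul_self (show -1 ≤ s by linarith)
            (show 0 ≤ γ / 2 by linarith) (by linarith)
          rw [abs_le]; constructor <;> nlinarith
        · have q1 := Real.rpow_le_one_of_one_le_of_nonpos (show 1 ≤ 1 + s by linarith)
            (show γ / 2 ≤ 0 by linarith)
          have q2 := rpow_one_add_le_one_add_mul_self (show -1 ≤ s by linarith)
            (show 0 ≤ -(γ / 2) by linarith) (by linarith)
          have q3 : (1 + s) ^ (γ / 2) * (1 + s) ^ (-(γ / 2)) = 1 := by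
            rw [← Real.rpow_add (by linarith)]; simp
          have q4 : 0 < (1 + s) ^ (γ / 2) := by positivity
          have q5 : (1 + s) ^ (-(γ / 2)) ≤ 1 + s := by nlinarith
          have q6 : 1 ≤ (1 + s) ^ (γ / 2) * (1 + s) := by
            linarith [mul_le_mul_of_nonneg_left q5 q4.le]
          rw [abs_le]; constructor <;> nlinarith
      rw [e1, show ‖z‖ ^ γ - ‖z‖ ^ γ * (1 + s) ^ (γ / 2) = ‖z‖ ^ γ * (1 - (1 + s) ^ (γ / 2)) by
        ring, abs_mul, abs_of_nonneg p0]
      gcongr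
    have e : bKer γ i z - bReg γ 1 i z =
        -2 * (‖z‖ ^ γ - (‖z‖ ^ 2 + 1) ^ (γ / 2)) * z i := by unfold bKer bReg; ring
    have p1 : ‖z‖ ^ γ ≤ ‖z‖ := by
      calc ‖z‖ ^ γ ≤ ‖z‖ ^ (1 : ℝ) := Real.rpow_le_rpow_of_exponent_le hz1 h2
        _ = _ := Real.rpow_one _
    rw [e, abs_mul, abs_mul, abs_neg, abs_two]
    calc _ ≤ 2 * (‖z‖ * (‖z‖⁻¹) ^ 2) * ‖z‖ := by
          gcongr
          · exact key.trans (by gcongr)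
          · exact abs_coord_le z i
      _ = 2 := by field_simp
      _ ≤ _ := by nlinarith

/-! ### Integration by parts in convolutions -/

/-- `h` is of class `C¹`, and `h` and its derivatives are `O(⟨v⟩^{-12})`. -/
def Dec1 (h : E3 → ℝ) : Prop :=
  ContDiff ℝ 1 h ∧ ∃ A : ℝ, ∀ v, |h v| ≤ A * jap v ^ (-12 : ℝ) ∧
    ∀ j, |pd j h v| ≤ A * jap v ^ (-12 : ℝ)

lemma Dec1.continuous_pd {h : E3 → ℝ} (H : Dec1 h) (j : Fin 3) : Continuous (pd j h) :=
  (H.1.continuous_fderiv (by simp)).clm_apply continuous_const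

lemma ker_integrable {K : E3 → ℝ} (hK : Ker K) {h : E3 → ℝ} (hc : Continuous h) {A : ℝ}
    (hA : ∀ v, |h v| ≤ A * jap v ^ (-12 : ℝ)) (v : E3) :
    Integrable (fun z => K z * h (v - z)) volume :=
  conv_integrable hK (h := fun p => h p.2)
    (Gr.zero (hc.comp continuous_snd) ⟨A, fun p => hA p.2⟩) (0, v)

lemma Dec1.integrable {K : E3 → ℝ} (hK : Ker K) {h : E3 → ℝ} (H : Dec1 h) (v : E3) :
    Integrable (fun z => K z * h (v - z)) volume := by
  obtain ⟨A, hA⟩ := H.2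
  exact ker_integrable hK H.1.continuous (fun v => (hA v).1) v

lemma Dec1.integrable_pd {K : E3 → ℝ} (hK : Ker K) {h : E3 → ℝ} (H : Dec1 h) (v : E3)
    (j : Fin 3) : Integrable (fun z => K z * pd j h (v - z)) volume := by
  obtain ⟨A, hA⟩ := H.2
  exact ker_integrable hK (H.continuous_pd j) (fun v => (hA v).2 j) v

lemma integral_ker_pd {K : E3 → ℝ} (hK : Ker K) (hd : Differentiable ℝ K) (j : Fin 3)
    (hK' : Ker (pd j K)) {h : E3 → ℝ} (H : Dec1 h) (v : E3) :
    ∫ z, K z * pd j h (v - z) = ∫ z, pd j K z * h (v - z) := by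
  have hh : Differentiable ℝ h := H.1.differentiable (by simp)
  have e : ∀ z, fderiv ℝ (fun z => h (v - z)) z (e3 j) = - pd j h (v - z) := fun z => by
    have h1 : HasFDerivAt (fun z => v - z) (-ContinuousLinearMap.id ℝ E3) z := by
      simpa using (hasFDerivAt_id (𝕜 := ℝ) z).const_sub v
    have h2 := ((hh (v - z)).hasFDerivAt.comp z h1).fderiv
    change fderiv ℝ (h ∘ fun z => v - z) z _ = _
    rw [h2]; simp [pd]
  have := integral_mul_fderiv_eq_neg_fderiv_mul_of_integrable (μ := volume) (f := K)
    (g := fun z => h (v - z)) (v := e3 j) (H.integrable hK' v)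
    (by simp_rw [e, mul_neg]; exact (H.integrable_pd hK v j).neg) (H.integrable hK v)
    (fun z _ => hd z) (fun z _ => by
      have := hh (v - z)
      have h1 : DifferentiableAt ℝ (fun z => v - z) z := by fun_prop
      exact this.comp z h1)
  simp_rw [e, mul_neg, integral_neg, neg_inj] at this
  exact this

/-- The divergence of `a` is `b`. -/
lemma sum_integral_aKer_pd {γ : ℝ} (h1 : -2 ≤ γ) (h2 : γ ≤ 1) (i : Fin 3) {h : E3 → ℝ}
    (H : Dec1 h) (v : E3) :
    ∑ j, ∫ z, aKer γ i j z * pd j h (v - z) = ∫ z, bKer γ i z * h (v - z) := by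
  obtain ⟨A, hA⟩ := H.2
  -- The kernel a need not be differentiable at the origin. The integration by parts is done for
  -- `aReg` with ε = 1/(n+1), and both sides pass to the limit by dominated convergence, the origin
  -- being a null set.
  let e : ℕ → ℝ := fun n => 1 / ((n : ℝ) + 1)
  have he0 : ∀ n, 0 < e n := fun n => by positivity
  have he1 : ∀ n, e n ≤ 1 := fun n => by
    rw [div_le_one (by positivity)]; linarith [n.cast_nonneg (α := ℝ)]
  have he : Filter.Tendsto e Filter.atTop (nhds 0) := tendsto_one_div_add_atTop_nhds_zero_nat
  have hne : ∀ᵐ z : E3, z ≠ 0 := by simp [ae_iff]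
  have reg : ∀ n, ∑ j, ∫ z, aReg γ (e n) i j z * pd j h (v - z) =
      ∫ z, bReg γ (e n) i z * h (v - z) := fun n => by
    simp_rw [← sum_pd_aReg γ (he0 n) i, Finset.sum_mul]
    rw [integral_finsetSum _ fun j _ =>
      H.integrable (ker_pd_aReg h1 h2 (he0 n) (he1 n) i j j) v]
    exact Finset.sum_congr rfl fun j _ => integral_ker_pd (ker_aReg h1 h2 (he0 n) (he1 n) i j)
      (differentiable_aReg γ (he0 n) i j) j (ker_pd_aReg h1 h2 (he0 n) (he1 n) i j j) H v
  have dom : Ker fun z => (1 + ‖z‖⁻¹) * jap z ^ (4 : ℝ) := by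
    refine ⟨(measurable_const.add measurable_norm.inv).mul (continuous_jap_rpow 4).measurable, 1,
      by norm_num, fun z => ?_⟩
    rw [abs_of_nonneg (by positivity [jap_rpow_nonneg z 4]), one_mul]
  have lim1 : ∀ j, Filter.Tendsto (fun n => ∫ z, aReg γ (e n) i j z * pd j h (v - z))
      Filter.atTop (nhds (∫ z, aKer γ i j z * pd j h (v - z))) := fun j => by
    refine tendsto_integral_of_dominated_convergence
      (fun z => 2 * ‖((1 + ‖z‖⁻¹) * jap z ^ (4 : ℝ)) * pd j h (v - z)‖)
      (fun n => (H.integrable_pd (ker_aReg h1 h2 (he0 n) (he1 n) i j) v j).1)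
      ((H.integrable_pd dom v j).norm.const_mul 2) (fun n => .of_forall fun z => ?_) ?_
    · have := abs_aReg_le h1 h2 (he0 n) (he1 n) i j z
      have p := jap_rpow_nonneg z 4
      have e : ‖(1 + ‖z‖⁻¹) * jap z ^ (4 : ℝ)‖ = (1 + ‖z‖⁻¹) * jap z ^ (4 : ℝ) :=
        Real.norm_of_nonneg (by positivity)
      rw [norm_mul, norm_mul, ← mul_assoc, Real.norm_eq_abs, e]
      gcongr
    · filter_upwards [hne] with z hz
      refine Filter.Tendsto.mul_const _ ?_
      rw [aKer_eq hz]
      exact (tendsto_reg hz γ he).mul_const _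
  have lim2 : Filter.Tendsto (fun n => ∫ z, bReg γ (e n) i z * h (v - z))
      Filter.atTop (nhds (∫ z, bKer γ i z * h (v - z))) := by
    refine tendsto_integral_of_dominated_convergence
      (fun z => 2 * ‖((1 + ‖z‖⁻¹) * jap z ^ (4 : ℝ)) * h (v - z)‖)
      (fun n => (H.integrable (ker_bReg h1 h2 (he0 n) (he1 n) i) v).1)
      ((H.integrable dom v).norm.const_mul 2) (fun n => .of_forall fun z => ?_) ?_
    · have := abs_bReg_le h1 h2 (he0 n) (he1 n) i z
      have p := jap_rpow_nonneg z 4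
      have e : ‖(1 + ‖z‖⁻¹) * jap z ^ (4 : ℝ)‖ = (1 + ‖z‖⁻¹) * jap z ^ (4 : ℝ) :=
        Real.norm_of_nonneg (by positivity)
      rw [norm_mul, norm_mul, ← mul_assoc, Real.norm_eq_abs, e]
      gcongr
    · filter_upwards [hne] with z hz
      refine Filter.Tendsto.mul_const _ ?_
      exact ((tendsto_reg hz γ he).const_mul _).mul_const _
  refine tendsto_nhds_unique ?_ lim2
  simp_rw [← reg]
  exact tendsto_finsetSum _ fun j _ => lim1 j

/-- Integration by parts against the smooth part of `b`. -/
lemma sum_integral_bReg_pd {γ : ℝ} (h1 : -2 ≤ γ) (h2 : γ ≤ 1) {h : E3 → ℝ}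
    (H : Dec1 h) (v : E3) :
    ∑ j, ∫ z, bReg γ 1 j z * pd j h (v - z) = ∫ z, cReg γ z * h (v - z) := by
  simp_rw [← sum_pd_bReg γ, Finset.sum_mul]
  rw [integral_finsetSum _ fun j _ => H.integrable (ker_pd_bReg h1 h2 j j) v]
  exact Finset.sum_congr rfl fun j _ => integral_ker_pd (ker_bReg h1 h2 one_pos le_rfl j)
    (differentiable_bReg γ one_pos j) j (ker_pd_bReg h1 h2 j j) H v

lemma abs_cReg_le {γ : ℝ} (h1 : -2 ≤ γ) (h2 : γ ≤ 1) (z : E3) :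
    |cReg γ z| ≤ 18 * jap z ^ γ := by
  rw [← sum_pd_bReg γ]
  refine (Finset.abs_sum_le_sum_abs _ _).trans ?_
  refine (Finset.sum_le_sum fun j _ => abs_pd_bReg_le h1 h2 j j z).trans (le_of_eq ?_)
  simp; ring

/-! ### The anisotropic bound on the kernel `a` -/

lemma inner_eq_sum (p q : E3) : inner ℝ p q = ∑ i, p i * q i := by
  simp [PiLp.inner_apply, mul_comm]

/-- The bilinear form `a(z) p · q`. -/
def aForm (γ : ℝ) (z p q : E3) : ℝ := ∑ i, ∑ j, aKer γ i j z * p i * q j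

lemma aForm_eq {z : E3} (hz : z ≠ 0) (γ : ℝ) (p q : E3) :
    aForm γ z p q = ‖z‖ ^ γ * (‖z‖ ^ 2 * inner ℝ p q - inner ℝ z p * inner ℝ z q) := by
  simp_rw [aForm, aKer_eq hz, inner_eq_sum, norm_sq_eq_sum]
  simp [Fin.sum_univ_three]
  ring

lemma abs_aForm_le {γ : ℝ} (z p q : E3) : |aForm γ z p q| ≤ 18 * ‖z‖ ^ (γ + 2) * ‖p‖ * ‖q‖ := by
  unfold aForm
  have h : ∀ i j : Fin 3, |aKer γ i j z * p i * q j| ≤ 2 * ‖z‖ ^ (γ + 2) * ‖p‖ * ‖q‖ := by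
    intro i j
    rw [abs_mul, abs_mul]
    have h0 : 0 ≤ ‖z‖ ^ (γ + 2) := Real.rpow_nonneg (norm_nonneg _) _
    gcongr
    · exact abs_aKer_le i j z
    · exact abs_coord_le p i
    · exact abs_coord_le q j
  refine (Finset.abs_sum_le_sum_abs _ _).trans ?_
  refine (Finset.sum_le_sum fun i _ => (Finset.abs_sum_le_sum_abs _ _).trans
    (Finset.sum_le_sum fun j _ => h i j)).trans (le_of_eq ?_)
  simp; ring

/-- The projection on the orthogonal complement of `z`. -/
def perp (z p : E3) : E3 := p - (inner ℝ z p / ‖z‖ ^ 2) • z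

lemma perp_add (z p q : E3) : perp z (p + q) = perp z p + perp z q := by
  simp only [perp, inner_add_right]; module

lemma perp_smul (z : E3) (c : ℝ) (p : E3) : perp z (c • p) = c • perp z p := by
  simp only [perp, inner_smul_right]; module

lemma perp_self {z : E3} (hz : z ≠ 0) : perp z z = 0 := by
  have : ‖z‖ ^ 2 ≠ 0 := pow_ne_zero 2 (norm_ne_zero_iff.2 hz)
  rw [perp, real_inner_self_eq_norm_sq, div_self this, one_smul, sub_self]

lemma inner_perp {z : E3} (hz : z ≠ 0) (p q : E3) :
    ‖z‖ ^ 2 * inner ℝ (perp z p) (perp z q) =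
      ‖z‖ ^ 2 * inner ℝ p q - inner ℝ z p * inner ℝ z q := by
  have : ‖z‖ ≠ 0 := norm_ne_zero_iff.2 hz
  simp only [perp, inner_sub_left, inner_sub_right, inner_smul_left, inner_smul_right,
    real_inner_self_eq_norm_sq, real_inner_comm z p]
  simp
  field_simp
  ring

lemma norm_perp_le {z : E3} (hz : z ≠ 0) (p : E3) : ‖perp z p‖ ≤ ‖p‖ := by
  have h := inner_perp hz p p
  have hz' : 0 < ‖z‖ := norm_pos_iff.2 hz
  rw [real_inner_self_eq_norm_sq, real_inner_self_eq_norm_sq] at h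
  refine abs_le_of_sq_le_sq' ?_ (norm_nonneg _) |>.2
  have : ‖z‖ ^ 2 * ‖perp z p‖ ^ 2 ≤ ‖z‖ ^ 2 * ‖p‖ ^ 2 := by
    rw [h]; nlinarith [mul_self_nonneg (inner ℝ z p)]
  exact le_of_mul_le_mul_left this (by positivity)

/-- The weighted norm `⟨v⟩^{γ/2} (|p · u| + ⟨v⟩ |p - (p · u) u|)`. -/
def wnorm (γ : ℝ) (u v p : E3) : ℝ :=
  jap v ^ (γ / 2) * (|inner ℝ u p| + jap v * ‖p - inner ℝ u p • u‖)

lemma norm_le_wnorm (γ : ℝ) {u : E3} (hu : ‖u‖ = 1) (v p : E3) :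
    jap v ^ (γ / 2) * ‖p‖ ≤ wnorm γ u v p := by
  unfold wnorm
  have := jap_rpow_nonneg v (γ / 2)
  gcongr
  calc ‖p‖ = ‖inner ℝ u p • u + (p - inner ℝ u p • u)‖ := by congr 1; module
    _ ≤ ‖inner ℝ u p • u‖ + ‖p - inner ℝ u p • u‖ := norm_add_le _ _
    _ ≤ |inner ℝ u p| + jap v * ‖p - inner ℝ u p • u‖ := by
      rw [norm_smul, hu, mul_one, Real.norm_eq_abs]
      have := one_le_jap v
      nlinarith [norm_nonneg (p - inner ℝ u p • u)]

/-- The source of the anisotropy: moving along u = v/|v| costs no power of v. Indeed |v| times the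
part of u orthogonal to z is the part of v = z + w orthogonal to z, which is that of w alone. The
transverse directions pay the full |z| ≲ ⟨v⟩⟨w⟩. -/
lemma norm_perp_mul_le {u v w : E3} (hu : ‖u‖ = 1) (hv : v = ‖v‖ • u) (hz : v - w ≠ 0) (p : E3) :
    ‖v - w‖ * ‖perp (v - w) p‖ ≤
      2 * jap w ^ 2 * (|inner ℝ u p| + jap v * ‖p - inner ℝ u p • u‖) := by
  set z := v - w with hzd
  have hw := norm_le_jap w
  have hw1 := one_le_jap w
  have hv1 := one_le_jap v
  have b1 : ‖z‖ * ‖perp z u‖ ≤ 2 * jap w ^ 2 := by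
    have c1 : ‖perp z u‖ ≤ 1 := hu ▸ norm_perp_le hz u
    have c2 : ‖z‖ ≤ ‖v‖ + ‖w‖ := norm_sub_le v w
    rcases le_total ‖v‖ 1 with h | h
    · nlinarith [norm_nonneg (perp z u), norm_nonneg z]
    · have e : ‖v‖ • perp z u = perp z w := by
        rw [← perp_smul, ← hv]
        conv_lhs => rw [show v = z + w by rw [hzd]; abel]
        rw [perp_add, perp_self hz, zero_add]
      have c3 : ‖v‖ * ‖perp z u‖ ≤ ‖w‖ := by
        have := norm_perp_le hz w
        rw [← e, norm_smul, norm_norm] at this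
        exact this
      nlinarith [norm_nonneg (perp z u), norm_nonneg w, mul_le_mul_of_nonneg_right c2 (norm_nonneg (perp z u))]
  have b2 : ‖z‖ ≤ 2 * jap w ^ 2 * jap v := by
    have c2 : ‖z‖ ≤ ‖v‖ + ‖w‖ := norm_sub_le v w
    have := norm_le_jap v
    have c3 : jap v + jap w ≤ 2 * (jap v * jap w) := by nlinarith
    have c4 : jap v * jap w ≤ jap w ^ 2 * jap v := by nlinarith [mul_pos (jap_pos v) (jap_pos w)]
    linarith
  have e : perp z p = inner ℝ u p • perp z u + perp z (p - inner ℝ u p • u) := by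
    rw [← perp_smul, ← perp_add]; congr 1; module
  have b3 : ‖perp z p‖ ≤ |inner ℝ u p| * ‖perp z u‖ + ‖p - inner ℝ u p • u‖ := by
    rw [e]
    refine (norm_add_le _ _).trans ?_
    rw [norm_smul, Real.norm_eq_abs]
    gcongr
    exact norm_perp_le hz _
  calc ‖z‖ * ‖perp z p‖ ≤ ‖z‖ * (|inner ℝ u p| * ‖perp z u‖ + ‖p - inner ℝ u p • u‖) := by gcongr
    _ = |inner ℝ u p| * (‖z‖ * ‖perp z u‖) + ‖z‖ * ‖p - inner ℝ u p • u‖ := by ring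
    _ ≤ |inner ℝ u p| * (2 * jap w ^ 2) + 2 * jap w ^ 2 * jap v * ‖p - inner ℝ u p • u‖ := by
        gcongr
    _ = _ := by ring

lemma jap_rpow_add_le (γ : ℝ) (hγ : |γ| ≤ 2) (v w : E3) :
    jap (v - w) ^ γ ≤ 4 * jap v ^ γ * jap w ^ (2 : ℝ) := by
  have h := jap_peetre γ v (-w)
  rw [jap_neg, ← sub_eq_add_neg] at h
  have h2 : (2 : ℝ) ^ |γ| ≤ 4 := by
    calc (2 : ℝ) ^ |γ| ≤ 2 ^ (2 : ℝ) := Real.rpow_le_rpow_of_exponent_le (by norm_num) hγ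
      _ = 4 := by norm_num
  refine h.trans ?_
  have := jap_rpow_nonneg v γ
  have := jap_rpow_nonneg w |γ|
  have := jap_rpow_mono w hγ
  gcongr

/-- For |z| ≥ 1, a(z) is |z|^{γ+2} times the projection onto z^⊥, |z|^γ is comparable to ⟨z⟩^γ, and
`norm_perp_mul_le` is applied to p and to q. For |z| ≤ 1 the crude isotropic bound suffices, because
v and w are then comparable and γ + 2 ≥ 0. -/
lemma aForm_le_wnorm {γ : ℝ} (h1 : -2 ≤ γ) (h2 : γ ≤ 1) {u v : E3} (hu : ‖u‖ = 1)
    (hv : v = ‖v‖ • u) (w p q : E3) :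
    |aForm γ (v - w) p q| ≤ 512 * jap w ^ (6 : ℝ) * wnorm γ u v p * wnorm γ u v q := by
  have hγ : |γ| ≤ 2 := abs_le.2 ⟨h1, by linarith⟩
  have hp := norm_le_wnorm γ hu v p
  have hq := norm_le_wnorm γ hu v q
  have jp := jap_rpow_pos v (γ / 2)
  have jp2 : jap v ^ (γ / 2) * jap v ^ (γ / 2) = jap v ^ γ := by
    rw [← jap_rpow_add]; congr 1; ring
  have hw1 := one_le_jap w
  rcases le_total ‖v - w‖ 1 with hz | hz
  · have a1 := abs_aForm_le (γ := γ) (v - w) p q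
    have a2 := Real.rpow_le_one (norm_nonneg (v - w)) hz (show 0 ≤ γ + 2 by linarith)
    have a3 : jap (v - w) ≤ 2 := (jap_le _).trans (by linarith)
    -- When |v − w| ≤ 1 one has ⟨v⟩ ≤ 4⟨w⟩, so ⟨v⟩^{-γ} ≤ ⟨v⟩² ≤ 16⟨w⟩².
    have a4 : 1 ≤ 16 * jap w ^ (6 : ℝ) * jap v ^ γ := by
      have hv2 : jap v ≤ 4 * jap w := by
        have := jap_add_le (v - w) w
        rw [sub_add_cancel] at this
        nlinarith
      have e2 : jap v ^ (2 : ℝ) ≤ 16 * jap w ^ (2 : ℝ) := by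
        rw [Real.rpow_two, Real.rpow_two]
        nlinarith [jap_pos v]
      have e3 : jap v ^ (-γ) ≤ jap v ^ (2 : ℝ) := jap_rpow_mono v (by linarith)
      have e4 : jap v ^ γ * jap v ^ (-γ) = 1 := by rw [← jap_rpow_add]; simp
      have e5 : jap w ^ (2 : ℝ) ≤ jap w ^ (6 : ℝ) := jap_rpow_mono w (by norm_num)
      have := jap_rpow_pos v γ
      rw [← e4, mul_comm]
      gcongr
      linarith
    have a5 := norm_nonneg p
    have a6 := norm_nonneg q
    calc _ ≤ 18 * ‖v - w‖ ^ (γ + 2) * ‖p‖ * ‖q‖ := a1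
      _ ≤ 18 * 1 * ‖p‖ * ‖q‖ := by gcongr
      _ = 18 * (‖p‖ * ‖q‖) * 1 := by ring
      _ ≤ 18 * (‖p‖ * ‖q‖) * (16 * jap w ^ (6 : ℝ) * jap v ^ γ) := by gcongr
      _ = 288 * jap w ^ (6 : ℝ) * ((jap v ^ (γ / 2) * ‖p‖) * (jap v ^ (γ / 2) * ‖q‖)) := by
          rw [← jp2]; ring
      _ ≤ 288 * jap w ^ (6 : ℝ) * (wnorm γ u v p * wnorm γ u v q) := by
          have := jap_rpow_nonneg w 6
          have p1 : 0 ≤ wnorm γ u v p := le_trans (by positivity) hp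
          gcongr
      _ ≤ _ := by
          have := jap_rpow_nonneg w 6
          have : 0 ≤ wnorm γ u v p * wnorm γ u v q :=
            mul_nonneg (le_trans (by positivity) hp) (le_trans (by positivity) hq)
          nlinarith [mul_nonneg ‹0 ≤ jap w ^ (6:ℝ)› this]
  · have hz0 : 0 < ‖v - w‖ := by linarith
    have hzne : v - w ≠ 0 := norm_pos_iff.1 hz0
    have b1 := norm_perp_mul_le hu hv hzne p
    have b2 := norm_perp_mul_le hu hv hzne q
    have b3 : ‖v - w‖ ^ γ ≤ 16 * jap v ^ γ * jap w ^ (2 : ℝ) := by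
      have c1 : ‖v - w‖ ^ γ ≤ 4 * jap (v - w) ^ γ := by
        rcases le_total 0 γ with h | h
        · have := norm_rpow_le_jap (v - w) h
          have := jap_rpow_nonneg (v - w) γ
          linarith
        · have c2 : jap (v - w) / 2 ≤ ‖v - w‖ := by linarith [jap_le (v - w)]
          have c3 := Real.rpow_le_rpow_of_nonpos (by linarith [jap_pos (v - w)]) c2 h
          refine c3.trans ?_
          rw [Real.div_rpow (jap_pos _).le (by norm_num), div_eq_mul_inv, ← Real.rpow_neg (by norm_num),
            mul_comm]
          have : (2 : ℝ) ^ (-γ) ≤ 4 := by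
            calc (2 : ℝ) ^ (-γ) ≤ 2 ^ (2 : ℝ) :=
                  Real.rpow_le_rpow_of_exponent_le (by norm_num) (by linarith)
              _ = 4 := by norm_num
          have := jap_rpow_nonneg (v - w) γ
          gcongr
      have c4 := jap_rpow_add_le γ hγ v w
      nlinarith
    rw [aForm_eq hzne, ← inner_perp hzne, abs_mul, abs_mul,
      abs_of_nonneg (Real.rpow_nonneg (norm_nonneg _) _), abs_of_nonneg (sq_nonneg ‖v - w‖)]
    have b4 := abs_real_inner_le_norm (perp (v - w) p) (perp (v - w) q)
    set P := |inner ℝ u p| + jap v * ‖p - inner ℝ u p • u‖ with hP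
    set Q := |inner ℝ u q| + jap v * ‖q - inner ℝ u q • u‖ with hQ
    have hP0 : 0 ≤ P := by have := jap_pos v; positivity
    have hQ0 : 0 ≤ Q := by have := jap_pos v; positivity
    have e6 : jap w ^ (6 : ℝ) = jap w ^ (2 : ℝ) * (jap w ^ 2 * jap w ^ 2) := by
      rw [Real.rpow_two, show (6 : ℝ) = (6 : ℕ) by norm_num, Real.rpow_natCast]; ring
    have := jap_rpow_nonneg v γ
    have := jap_rpow_nonneg w 2
    calc _ ≤ 16 * jap v ^ γ * jap w ^ (2 : ℝ) * (‖v - w‖ ^ 2 *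
            (‖perp (v - w) p‖ * ‖perp (v - w) q‖)) := by gcongr
      _ = 16 * jap v ^ γ * jap w ^ (2 : ℝ) * ((‖v - w‖ * ‖perp (v - w) p‖) *
            (‖v - w‖ * ‖perp (v - w) q‖)) := by ring
      _ ≤ 16 * jap v ^ γ * jap w ^ (2 : ℝ) * ((2 * jap w ^ 2 * P) * (2 * jap w ^ 2 * Q)) := by
          gcongr
      _ = 64 * jap w ^ (6 : ℝ) * wnorm γ u v p * wnorm γ u v q := by
          rw [wnorm, wnorm, ← hP, ← hQ, ← jp2, e6]; ring
      _ ≤ _ := by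
          have := jap_rpow_nonneg w 6
          have p1 : 0 ≤ wnorm γ u v p := le_trans (by positivity) hp
          have p2 : 0 ≤ wnorm γ u v q := le_trans (by positivity) hq
          gcongr
          norm_num

/-! ### The functional controlling the convolutions -/

/-- The kernel of the functional `majorant`. -/
def mker (v w : E3) : ℝ := (1 + ‖v - w‖⁻¹) * jap w ^ (12 : ℝ) * sqrtM w

/-- The majorant `∫ (1 + 1/|v - w|) ⟨w⟩^{12} √M(w) |φ(w)| dw` of the convolutions. -/
def majorant (φ : E3 → ℝ) (v : E3) : ℝ := ∫ w, mker v w * |φ w|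

lemma mker_nonneg (v w : E3) : 0 ≤ mker v w := by
  have := jap_rpow_nonneg w 12
  have := (sqrtM_pos w).le
  unfold mker; positivity

lemma majorant_nonneg (φ : E3 → ℝ) (v : E3) : 0 ≤ majorant φ v :=
  integral_nonneg fun w => mul_nonneg (mker_nonneg v w) (abs_nonneg _)

lemma measurable_mker (v : E3) : Measurable (mker v) := by
  have := (continuous_jap_rpow 12).measurable
  have := continuous_sqrtM.measurable
  unfold mker; fun_prop

/-- Continuous and bounded functions. -/
def Bdd (φ : E3 → ℝ) : Prop := Continuous φ ∧ ∃ A : ℝ, ∀ v, |φ v| ≤ A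

lemma ker_one_add_inv : Ker fun z => 1 + ‖z‖⁻¹ := by
  refine ⟨by fun_prop, 1, by norm_num, fun z => ?_⟩
  have a2 : 0 ≤ ‖z‖⁻¹ := by positivity
  have := one_le_jap_rpow z (show (0 : ℝ) ≤ 4 by norm_num)
  rw [abs_of_nonneg (by positivity)]
  nlinarith

lemma Bdd.integrable_mker {φ : E3 → ℝ} (H : Bdd φ) (v : E3) :
    Integrable fun w => mker v w * |φ w| := by
  obtain ⟨A, hA⟩ := H.2
  obtain ⟨C, hC0, hC⟩ := sqrtM_le (-24)
  have h := (ker_integrable ker_one_add_inv (h := fun w => jap w ^ (12 : ℝ) * sqrtM w * |φ w|)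
    (((continuous_jap_rpow 12).mul continuous_sqrtM).mul H.1.abs) (A := C * A)
    (fun w => ?_) v).comp_sub_left v
  · refine h.congr (.of_forall fun w => ?_)
    simp only [sub_sub_cancel, mker]; ring
  · have p1 := jap_rpow_nonneg w 12
    have e : jap w ^ (12 : ℝ) * jap w ^ (-24 : ℝ) = jap w ^ (-12 : ℝ) := by
      rw [← jap_rpow_add]; norm_num
    have p2 := (sqrtM_pos w).le
    rw [abs_mul, abs_mul, abs_abs, abs_of_nonneg p1, abs_of_nonneg p2]
    calc _ ≤ jap w ^ (12 : ℝ) * (C * jap w ^ (-24 : ℝ)) * A := by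
          have := hC w; have := hA w; have := jap_rpow_nonneg w (-24); gcongr
      _ = C * A * (jap w ^ (12 : ℝ) * jap w ^ (-24 : ℝ)) := by ring
      _ = _ := by rw [e]

lemma abs_integral_le_majorant {φ : E3 → ℝ} (H : Bdd φ) {v : E3} {f : E3 → ℝ} {c : ℝ}
    (hf : ∀ w, |f w| ≤ c * (mker v w * |φ w|)) : |∫ w, f w| ≤ c * majorant φ v := by
  rw [majorant, ← integral_const_mul]
  exact norm_integral_le_of_norm_le ((H.integrable_mker v).const_mul c) (.of_forall fun w => by rw [Real.norm_eq_abs]; exact hf w)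

/-- The Cauchy-Schwarz inequality, squared. -/
lemma lintegral_mul_sq_le {α : Type*} [MeasurableSpace α] {μ : Measure α} {f g : α → ℝ≥0∞}
    (hf : AEMeasurable f μ) (hg : AEMeasurable g μ) :
    (∫⁻ a, f a * g a ∂μ) ^ 2 ≤ (∫⁻ a, f a ^ 2 ∂μ) * ∫⁻ a, g a ^ 2 ∂μ := by
  have h := ENNReal.lintegral_mul_le_Lp_mul_Lq μ Real.HolderConjugate.two_two hf hg
  simp only [Pi.mul_apply, ENNReal.rpow_two] at h
  calc _ ≤ ((∫⁻ a, f a ^ 2 ∂μ) ^ (1 / 2 : ℝ) * (∫⁻ a, g a ^ 2 ∂μ) ^ (1 / 2 : ℝ)) ^ 2 := by gcongr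
    _ = _ := by
      rw [mul_pow, ← ENNReal.rpow_natCast, ← ENNReal.rpow_natCast, ← ENNReal.rpow_mul,
        ← ENNReal.rpow_mul]
      norm_num

/-- Cauchy-Schwarz: the kernel is square integrable in w uniformly in v. The Gaussian leaves room
for a weight ⟨w⟩^{-1} on φ, which later pays for 𝐁⁻¹ and for the degeneracy of 𝐁. -/
lemma majorant_sq_le : ∃ C : ℝ≥0, ∀ φ : E3 → ℝ, Measurable φ → ∀ v,
    ‖majorant φ v‖ₑ ^ 2 ≤ C * ∫⁻ w, ‖jap w ^ (-1 : ℝ) * φ w‖ₑ ^ 2 := by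
  -- The exponent −15 leaves ⟨w⟩^{12−15+1} = ⟨w⟩^{-2}, whose square ⟨w⟩^{-4} is integrable.
  obtain ⟨C, hC0, hC⟩ := sqrtM_le (-15)
  set I1 : ℝ := ∫ z : E3, jap z ^ (-4 : ℝ)
  set I2 : ℝ := ∫ z : E3, (1 + ‖z‖⁻¹) ^ 2 * jap z ^ (-4 : ℝ)
  have i1 := integrable_jap_rpow (s := -4) (by norm_num)
  have i2 := integrable_sing_sq (s := -4) (by norm_num)
  refine ⟨Real.toNNReal (C ^ 2 * (4 * I1 + 4 * I2)), fun φ hφ v => ?_⟩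
  have e0 : ∀ w, mker v w * |φ w| = (mker v w * jap w) * (jap w ^ (-1 : ℝ) * |φ w|) := fun w => by
    rw [Real.rpow_neg_one]; field_simp [(jap_pos w).ne']
  have m1 := measurable_mker v
  have m2 := continuous_jap.measurable
  have m3 := (continuous_jap_rpow (-1)).measurable
  have key : ∫⁻ w, ‖mker v w * jap w‖ₑ ^ 2 ≤
      (Real.toNNReal (C ^ 2 * (4 * I1 + 4 * I2)) : ℝ≥0∞) := by
    have b : ∀ w, (mker v w * jap w) ^ 2 ≤ C ^ 2 * (4 * jap w ^ (-4 : ℝ) +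
        4 * ((1 + ‖v - w‖⁻¹) ^ 2 * jap (v - w) ^ (-4 : ℝ))) := fun w => by
      have c1 : (jap w ^ (12 : ℝ) * sqrtM w * jap w) ≤ C * jap w ^ (-2 : ℝ) := by
        have := jap_rpow_nonneg w 12
        have := jap_pos w
        calc _ ≤ jap w ^ (12 : ℝ) * (C * jap w ^ (-15 : ℝ)) * jap w := by
              have := hC w; gcongr
          _ = C * (jap w ^ (12 : ℝ) * jap w ^ (-15 : ℝ) * jap w ^ (1 : ℝ)) := by
              rw [Real.rpow_one]; ring
          _ = _ := by rw [← jap_rpow_add, ← jap_rpow_add]; norm_num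
      -- Away from the singularity (1 + 1/|v − w|)² ≤ 4. Near it ⟨v − w⟩^{-4} ≥ 1/4, so the decay
      -- can be inserted in the variable v − w; the integral of that term is then independent of v
      -- by translation.
      have c2 : (1 + ‖v - w‖⁻¹) ^ 2 * jap w ^ (-4 : ℝ) ≤ 4 * jap w ^ (-4 : ℝ) +
          4 * ((1 + ‖v - w‖⁻¹) ^ 2 * jap (v - w) ^ (-4 : ℝ)) := by
        have p4 := jap_rpow_nonneg w (-4)
        have p5 := jap_rpow_nonneg (v - w) (-4)
        rcases le_total ‖v - w‖ 1 with hz | hz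
        · have q1 : jap w ^ (-4 : ℝ) ≤ 1 :=
            Real.rpow_le_one_of_one_le_of_nonpos (one_le_jap _) (by norm_num)
          have q2 : 1 ≤ 4 * jap (v - w) ^ (-4 : ℝ) := by
            rw [jap_rpow_eq, show (-4 : ℝ) / 2 = -2 by norm_num, Real.rpow_neg (by positivity),
              Real.rpow_two, ← div_eq_mul_inv, le_div_iff₀ (by positivity)]
            have : ‖v - w‖ ^ 2 ≤ 1 := pow_le_one₀ (norm_nonneg _) hz
            nlinarith [sq_nonneg ‖v - w‖]
          have q3 : 0 ≤ (1 + ‖v - w‖⁻¹) ^ 2 := sq_nonneg _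
          nlinarith
        · have q1 : ‖v - w‖⁻¹ ≤ 1 := inv_le_one_of_one_le₀ hz
          have q2 : 0 ≤ ‖v - w‖⁻¹ := by positivity
          have q4 : (1 + ‖v - w‖⁻¹) ^ 2 ≤ 4 := by nlinarith
          have q5 := mul_nonneg (sq_nonneg (1 + ‖v - w‖⁻¹)) p5
          nlinarith
      have e : (mker v w * jap w) ^ 2 = (1 + ‖v - w‖⁻¹) ^ 2 *
          (jap w ^ (12 : ℝ) * sqrtM w * jap w) ^ 2 := by unfold mker; ring
      have e2 : (jap w ^ (-2 : ℝ)) ^ 2 = jap w ^ (-4 : ℝ) := by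
        rw [sq, ← jap_rpow_add]; norm_num
      have p6 : 0 ≤ jap w ^ (12 : ℝ) * sqrtM w * jap w := by
        have := jap_rpow_nonneg w 12
        have := jap_pos w
        have := sqrtM_pos w
        positivity
      rw [e]
      calc _ ≤ (1 + ‖v - w‖⁻¹) ^ 2 * (C * jap w ^ (-2 : ℝ)) ^ 2 := by gcongr
        _ = C ^ 2 * ((1 + ‖v - w‖⁻¹) ^ 2 * jap w ^ (-4 : ℝ)) := by rw [mul_pow, e2]; ring
        _ ≤ _ := by gcongr
    have i3 := i2.comp_sub_left v
    have hint := ((i1.const_mul 4).add (i3.const_mul 4)).const_mul (C ^ 2)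
    calc _ ≤ ∫⁻ w, ENNReal.ofReal (C ^ 2 * (4 * jap w ^ (-4 : ℝ) +
        4 * ((1 + ‖v - w‖⁻¹) ^ 2 * jap (v - w) ^ (-4 : ℝ)))) := by
          refine lintegral_mono fun w => ?_
          simp only
          rw [← enorm_pow, Real.enorm_of_nonneg (sq_nonneg _)]
          exact ENNReal.ofReal_le_ofReal (b w)
      _ = ENNReal.ofReal (∫ w, C ^ 2 * (4 * jap w ^ (-4 : ℝ) +
        4 * ((1 + ‖v - w‖⁻¹) ^ 2 * jap (v - w) ^ (-4 : ℝ)))) := by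
          refine (ofReal_integral_eq_lintegral_ofReal hint (.of_forall fun w => ?_)).symm
          exact (sq_nonneg _).trans (b w)
      _ ≤ _ := by
          rw [integral_const_mul, integral_add (i1.const_mul 4) (i3.const_mul 4),
            integral_const_mul, integral_const_mul,
            integral_sub_left_eq_self (fun z => (1 + ‖z‖⁻¹) ^ 2 * jap z ^ (-4 : ℝ)) volume v]
          rfl
  calc ‖majorant φ v‖ₑ ^ 2 ≤ (∫⁻ w, ‖mker v w * |φ w|‖ₑ) ^ 2 := by
        gcongr; exact enorm_integral_le_lintegral_enorm _
    _ = (∫⁻ w, ‖mker v w * jap w‖ₑ * ‖jap w ^ (-1 : ℝ) * φ w‖ₑ) ^ 2 := by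
        congr 2; funext w
        rw [e0, enorm_mul]
        congr 1
        rw [enorm_mul, enorm_mul, ← Real.norm_eq_abs, enorm_norm]
    _ ≤ (∫⁻ w, ‖mker v w * jap w‖ₑ ^ 2) * ∫⁻ w, ‖jap w ^ (-1 : ℝ) * φ w‖ₑ ^ 2 :=
        lintegral_mul_sq_le (by fun_prop) (by fun_prop)
    _ ≤ _ := by gcongr

/-! ### The matrix `𝐀` -/

lemma gr_maxwellian (n : ℕ) (s : ℝ) : Gr n s (fun p => maxwellian p.2) := by
  have h := (gr_sqrtM n s).mul (gr_sqrtM n 0)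
  rw [add_zero] at h
  simpa only [← maxwellian_eq] using h

lemma maxwellian_pos (v : E3) : 0 < maxwellian v := by
  rw [maxwellian_eq]; exact mul_pos (sqrtM_pos v) (sqrtM_pos v)

lemma continuous_maxwellian : Continuous maxwellian := by
  rw [show maxwellian = fun v => sqrtM v * sqrtM v from funext maxwellian_eq]
  exact continuous_sqrtM.mul continuous_sqrtM

lemma differentiable_maxwellian : Differentiable ℝ maxwellian := by
  rw [show maxwellian = fun v => sqrtM v * sqrtM v from funext maxwellian_eq]
  exact differentiable_sqrtM.mul differentiable_sqrtM

lemma maxwellian_le (s : ℝ) : ∃ C : ℝ, 0 < C ∧ ∀ v, maxwellian v ≤ C * jap v ^ s := by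
  obtain ⟨C, hC, h⟩ := (gr_maxwellian 0 s).bound
  exact ⟨C, hC, fun v => (le_abs_self _).trans (h (0, v))⟩

lemma integrable_jap_maxwellian (s : ℝ) : Integrable fun w => jap w ^ s * maxwellian w := by
  obtain ⟨C, _, hC⟩ := maxwellian_le (-4 - s)
  refine ((integrable_jap_rpow (s := -4) (by norm_num)).const_mul C).mono'
    (((continuous_jap_rpow s).mul continuous_maxwellian).aestronglyMeasurable)
    (.of_forall fun w => ?_)
  have p := jap_rpow_nonneg w s
  rw [Real.norm_of_nonneg (mul_nonneg p (maxwellian_pos w).le)]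
  calc _ ≤ jap w ^ s * (C * jap w ^ (-4 - s)) := by gcongr; exact hC w
    _ = C * (jap w ^ s * jap w ^ (-4 - s)) := by ring
    _ = _ := by rw [← jap_rpow_add]; ring_nf

lemma pd_maxwellian (i : Fin 3) (v : E3) : pd i maxwellian v = -(v i) * maxwellian v := by
  rw [show maxwellian = fun v => sqrtM v * sqrtM v from funext maxwellian_eq,
    pd_mul i (differentiable_sqrtM v) (differentiable_sqrtM v), pd_sqrtM]
  ring

lemma matA_eq_conv (γ : ℝ) (i j : Fin 3) (v : E3) :
    matA γ i j v = conv (aKer γ i j) (fun p => maxwellian p.2) (0, v) := by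
  rw [matA, conv, ← integral_sub_left_eq_self _ _ v]
  simp

section bounds

variable {γ : ℝ} (h1 : -2 ≤ γ) (h2 : γ ≤ 1)
include h1 h2

lemma hasFDerivAt_matA (i j : Fin 3) (v : E3) : HasFDerivAt (matA γ i j)
    ((conv (aKer γ i j) (fderiv ℝ fun p : E3 × E3 => maxwellian p.2) (0, v)).comp
      (ContinuousLinearMap.inr ℝ E3 E3)) v := by
  have h := conv_hasFDerivAt (ker_aKer h1 h2 i j) (gr_maxwellian 1 (-12)) (0, v)
  have h' := h.comp v (hasFDerivAt_prodMk_right (𝕜 := ℝ) (0 : E3) v)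
  exact h'.congr_of_eventuallyEq (.of_forall fun u => matA_eq_conv γ i j u)

lemma differentiable_matA (i j : Fin 3) : Differentiable ℝ (matA γ i j) :=
  fun v => (hasFDerivAt_matA h1 h2 i j v).differentiableAt

lemma norm_fderiv_matA_le (i j : Fin 3) :
    ∃ L : ℝ, 0 ≤ L ∧ ∀ v, ‖v‖ ≤ 1 → ‖fderiv ℝ (matA γ i j) v‖ ≤ L := by
  obtain ⟨C, hC⟩ := conv_norm_le (ker_aKer h1 h2 i j) ((gr_maxwellian 1 (-12)).fderiv (n := 0))
  have hC0 : 0 ≤ C := by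
    have := (norm_nonneg _).trans (hC 0)
    exact nonneg_of_mul_nonneg_left this (jap_rpow_pos _ _)
  refine ⟨C * 2 ^ (12 : ℝ), by positivity, fun v hv => ?_⟩
  rw [(hasFDerivAt_matA h1 h2 i j v).fderiv]
  refine (ContinuousLinearMap.opNorm_comp_le _ _).trans ?_
  have e := ContinuousLinearMap.norm_inr_le_one ℝ E3 E3
  have := hC (0, v)
  have h3 : jap v ^ (12 : ℝ) ≤ 2 ^ (12 : ℝ) :=
    Real.rpow_le_rpow (jap_pos v).le ((jap_le v).trans (by linarith)) (by norm_num)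
  calc _ ≤ (C * jap v ^ (12 : ℝ)) * 1 :=
        mul_le_mul this e (norm_nonneg _) ((norm_nonneg _).trans this)
    _ ≤ _ := by rw [mul_one]; gcongr

lemma pd_matA (i j k : Fin 3) (v : E3) :
    pd k (matA γ i j) v = ∫ w, aKer γ i j (v - w) * (-(w k) * maxwellian w) := by
  rw [pd, (hasFDerivAt_matA h1 h2 i j v).fderiv]
  rw [← integral_sub_left_eq_self _ _ v]
  simp only [sub_sub_cancel]
  have hi := conv_integrable (ker_aKer h1 h2 i j) ((gr_maxwellian 1 (-12)).fderiv (n := 0)) (0, v)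
  simp only [ContinuousLinearMap.comp_apply, conv]
  rw [ContinuousLinearMap.integral_apply hi]
  refine integral_congr_ae (.of_forall fun z => ?_)
  simp only [smul_apply, smul_eq_mul]
  congr 1
  rw [← pd_maxwellian]
  have h := ((differentiable_maxwellian (v - z)).hasFDerivAt.comp ((0 : E3), v - z)
    (hasFDerivAt_snd (𝕜 := ℝ))).fderiv
  change fderiv ℝ (maxwellian ∘ Prod.snd) _ _ = _
  rw [h]; simp [pd]

lemma integrable_aKer_mul {f : E3 → ℝ} (hf : Continuous f) {A : ℝ}
    (hA : ∀ v, |f v| ≤ A * jap v ^ (-12 : ℝ)) (i j : Fin 3) (v : E3) :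
    Integrable fun w => aKer γ i j (v - w) * f w := by
  refine ((ker_integrable (ker_aKer h1 h2 i j) hf hA v).comp_sub_left v).congr
    (.of_forall fun w => ?_)
  simp

lemma integral_aForm_mul {f : E3 → ℝ} (hf : Continuous f) {A : ℝ}
    (hA : ∀ v, |f v| ≤ A * jap v ^ (-12 : ℝ)) (v p q : E3) :
    ∑ i, ∑ j, (∫ w, aKer γ i j (v - w) * f w) * p i * q j = ∫ w, aForm γ (v - w) p q * f w := by
  have hi := fun i j => integrable_aKer_mul h1 h2 hf hA i j v
  have e : ∀ w, aForm γ (v - w) p q * f w =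
      ∑ i, ∑ j, aKer γ i j (v - w) * f w * (p i * q j) := fun w => by
    simp_rw [aForm, Finset.sum_mul]
    refine Finset.sum_congr rfl fun i _ => Finset.sum_congr rfl fun j _ => by ring
  simp_rw [e]
  rw [integral_finsetSum _ fun i _ => integrable_finsetSum _ fun j _ => (hi i j).mul_const _]
  refine Finset.sum_congr rfl fun i _ => ?_
  rw [integral_finsetSum _ fun j _ => (hi i j).mul_const _]
  refine Finset.sum_congr rfl fun j _ => ?_
  rw [integral_mul_const]; ring

omit h1 h2 in
lemma maxwellian_abs_le : ∃ A : ℝ, ∀ v, |maxwellian v| ≤ A * jap v ^ (-12 : ℝ) := by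
  obtain ⟨C, _, hC⟩ := maxwellian_le (-12)
  exact ⟨C, fun v => by rw [abs_of_pos (maxwellian_pos v)]; exact hC v⟩

omit h1 h2 in
lemma coord_maxwellian_abs_le (k : Fin 3) :
    ∃ A : ℝ, ∀ v : E3, |-(v k) * maxwellian v| ≤ A * jap v ^ (-12 : ℝ) := by
  obtain ⟨C, hC0, hC⟩ := maxwellian_le (-13)
  refine ⟨C, fun v => ?_⟩
  rw [abs_mul, abs_neg, abs_of_pos (maxwellian_pos v)]
  have p := jap_pos v
  calc _ ≤ jap v * (C * jap v ^ (-13 : ℝ)) := by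
        have := (maxwellian_pos v).le
        gcongr
        · exact (abs_coord_le v k).trans (norm_le_jap v)
        · exact hC v
    _ = C * (jap v ^ (1 : ℝ) * jap v ^ (-13 : ℝ)) := by rw [Real.rpow_one]; ring
    _ = _ := by rw [← jap_rpow_add]; norm_num

omit h1 h2 in
/-- The bilinear form of `𝐀(v)`. -/
def AForm (γ : ℝ) (v p q : E3) : ℝ := ∑ i, ∑ j, matA γ i j v * p i * q j

lemma AForm_eq (v p q : E3) : AForm γ v p q = ∫ w, aForm γ (v - w) p q * maxwellian w := by
  obtain ⟨A, hA⟩ := maxwellian_abs_le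
  exact integral_aForm_mul h1 h2 continuous_maxwellian hA v p q

end bounds

/-! ### Symmetries of the matrix 𝐀. -/

lemma aForm_eq' (γ : ℝ) (z p q : E3) :
    aForm γ z p q = ‖z‖ ^ (γ + 2) * (inner ℝ p q - inner ℝ z p * inner ℝ z q / ‖z‖ ^ 2) := by
  simp_rw [aForm, aKer, inner_eq_sum]
  simp [Fin.sum_univ_three]
  ring

/-- `𝐀(v) p · q` vanishes if `q` is orthogonal to `v` and `p`. -/
lemma AForm_eq_zero {γ : ℝ} (h1 : -2 ≤ γ) (h2 : γ ≤ 1) {v p q : E3} (hv : inner ℝ q v = 0)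
    (hp : inner ℝ q p = 0) : AForm γ v p q = 0 := by
  rw [AForm_eq h1 h2]
  -- The reflection across q^⊥ fixes v and p, sends q to −q, and preserves M and Lebesgue measure.
  -- The integral is therefore equal to its opposite.
  let R : E3 ≃ₗᵢ[ℝ] E3 := (ℝ ∙ q)ᗮ.reflection
  have hRq : R q = -q := Submodule.reflection_orthogonalComplement_singleton_eq_neg q
  have hR : ∀ x, inner ℝ q x = 0 → R x = x := fun x hx =>
    Submodule.reflection_mem_subspace_eq_self (Submodule.mem_orthogonal_singleton_iff_inner_right.2 hx)
  have e : ∀ w, aForm γ (v - R w) p q * maxwellian (R w) =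
      -(aForm γ (v - w) p q * maxwellian w) := fun w => by
    have e1 : v - R w = R (v - w) := by rw [map_sub, hR v hv]
    have e2 : inner ℝ (R (v - w)) p = inner ℝ (v - w) p := by
      conv_lhs => rw [← hR p hp]
      exact R.inner_map_map _ _
    have e3 : inner ℝ (R (v - w)) q = -inner ℝ (v - w) q := by
      have : q = -R q := by rw [hRq, neg_neg]
      conv_lhs => rw [this]
      rw [inner_neg_right, R.inner_map_map]
    have e4 : inner ℝ p q = 0 := by rw [real_inner_comm]; exact hp
    have e5 : maxwellian (R w) = maxwellian w := by simp [maxwellian]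
    rw [e1, aForm_eq', aForm_eq', e2, e3, e4, e5, R.norm_map]
    ring
  have h := R.measurePreserving.integral_comp R.toHomeomorph.measurableEmbedding
    (fun w => aForm γ (v - w) p q * maxwellian w)
  have h' : ∫ w, aForm γ (v - R w) p q * maxwellian (R w) =
      ∫ w, aForm γ (v - w) p q * maxwellian w := h
  simp_rw [e, integral_neg] at h'
  linarith

lemma AForm_comm (γ : ℝ) (v p q : E3) : AForm γ v p q = AForm γ v q p := by
  have : ∀ i j, matA γ i j v = matA γ j i v := fun i j => by
    have e : ∀ z, aKer γ i j z = aKer γ j i z := fun z => by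
      simp only [aKer, eq_comm (a := i), mul_comm (z i)]
    simp only [matA, e]
  unfold AForm
  rw [Finset.sum_comm]
  refine Finset.sum_congr rfl fun i _ => Finset.sum_congr rfl fun j _ => ?_
  rw [this j i]; ring

lemma AForm_single (γ : ℝ) (v : E3) (i j : Fin 3) :
    AForm γ v (e3 i) (e3 j) = matA γ i j v := by
  fin_cases i <;> fin_cases j <;> simp [AForm]

/-- At v = 0 the orthogonality required by `AForm_eq_zero` is only that of p and q. Basis vectors
give the off-diagonal entries, and e_i + e_j ⊥ e_i − e_j makes the diagonal entries equal. -/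
lemma matA_zero {γ : ℝ} (h1 : -2 ≤ γ) (h2 : γ ≤ 1) (i j : Fin 3) :
    matA γ i j 0 = if i = j then trA γ 0 / 3 else 0 := by
  have off : ∀ i j : Fin 3, i ≠ j → matA γ i j 0 = 0 := fun i j hij => by
    rw [← AForm_single]
    refine AForm_eq_zero h1 h2 (by simp) ?_
    rw [inner_eq_sum]
    fin_cases i <;> fin_cases j <;> simp_all
  have dia : ∀ i j : Fin 3, matA γ i i 0 = matA γ j j 0 := fun i j => by
    rcases eq_or_ne i j with rfl | hij
    · rfl
    have h : AForm γ 0 (e3 i + e3 j) (e3 i - e3 j) = 0 := by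
      refine AForm_eq_zero h1 h2 (by simp) ?_
      rw [inner_eq_sum]
      fin_cases i <;> fin_cases j <;> simp_all [Fin.sum_univ_three]
    have e : AForm γ 0 (e3 i + e3 j) (e3 i - e3 j) = matA γ i i 0 - matA γ i j 0 +
        matA γ j i 0 - matA γ j j 0 := by
      fin_cases i <;> fin_cases j <;> simp [AForm, Fin.sum_univ_three] <;> ring
    rw [h, off i j hij, off j i hij.symm] at e
    linarith
  split_ifs with h
  · subst h
    rw [trA, Fin.sum_univ_three, dia 0 i, dia 1 i, dia 2 i]; ring
  · exact off i j h

/-- A direction u with v = |v|u exists even at v = 0, where it is arbitrary. Formulas written with u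
are thus valid for every v, whereas v/|v| is 0 at the origin. -/
lemma exists_dir (v : E3) : ∃ u : E3, ‖u‖ = 1 ∧ v = ‖v‖ • u := by
  rcases eq_or_ne v 0 with rfl | hv
  · exact ⟨e3 0, by simp, by simp⟩
  · have : ‖v‖ ≠ 0 := norm_ne_zero_iff.2 hv
    exact ⟨‖v‖⁻¹ • v, by rw [norm_smul, norm_inv, norm_norm, inv_mul_cancel₀ this],
      by rw [smul_smul, mul_inv_cancel₀ this, one_smul]⟩

lemma exists_orth (u : E3) : ∃ n : E3, ‖n‖ = 1 ∧ inner ℝ u n = 0 := by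
  have h : (ℝ ∙ u)ᗮ ≠ ⊥ := by
    intro h
    rw [Submodule.orthogonal_eq_bot_iff] at h
    have h3 : Module.finrank ℝ (ℝ ∙ u) ≤ 1 := by
      simpa using finrank_span_le_card (R := ℝ) ({u} : Set E3)
    rw [h, finrank_top] at h3
    simp at h3
  obtain ⟨n, hn, hn0⟩ := Submodule.exists_mem_ne_zero_of_ne_bot h
  have : ‖n‖ ≠ 0 := norm_ne_zero_iff.2 hn0
  refine ⟨‖n‖⁻¹ • n, by rw [norm_smul, norm_inv, norm_norm, inv_mul_cancel₀ this], ?_⟩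
  rw [inner_smul_right, Submodule.mem_orthogonal_singleton_iff_inner_right.1 hn, mul_zero]

/-! ### Size of the eigenvalues of 𝐀. -/

section ell

variable {γ : ℝ} (h1 : -2 ≤ γ) (h2 : γ ≤ 1)
include h1 h2

/-- At v = 0 the choice of u is irrelevant because 𝐀(0) is scalar. -/
lemma ell1_eq {u v : E3} (hu : ‖u‖ = 1) (hv : v = ‖v‖ • u) : ell1 γ v = AForm γ v u u := by
  have hs : ∑ i, u i ^ 2 = 1 := by rw [← norm_sq_eq_sum, hu]; norm_num
  unfold ell1
  split_ifs with h
  · subst h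
    simp_rw [AForm, matA_zero h1 h2]
    simp [Fin.sum_univ_three] at hs ⊢
    linear_combination (-trA γ 0 / 3) * hs
  · have hn : ‖v‖ ≠ 0 := norm_ne_zero_iff.2 h
    have : ∑ i, ∑ j, matA γ i j v * v i * v j = ‖v‖ ^ 2 * AForm γ v u u := by
      have hc : ∀ i, v i = ‖v‖ * u i := fun i => by
        conv_lhs => rw [hv]
        simp
      unfold AForm
      rw [Finset.mul_sum]
      refine Finset.sum_congr rfl fun i _ => ?_
      rw [Finset.mul_sum]
      refine Finset.sum_congr rfl fun j _ => ?_
      rw [hc i, hc j]; ring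
    rw [this]; field_simp

/-- The region on which the lower bounds on the eigenvalues are tested: n is orthogonal to u and w
is within 1 of 2n. Then |z·n| = |w·n| ≥ 1, so Bessel's inequality gives |z|² − (z·u)² ≥ 1, while |w|
≤ 3 and |z| ≥ 1 give ⟨v⟩/5 ≤ |z| ≤ 4⟨v⟩. The constant 125 = 5³ serves all exponents between −2 and
3. -/
lemma aForm_unit_bounds {u v w n : E3} (hu : ‖u‖ = 1) (hv : v = ‖v‖ • u) (hn : ‖n‖ = 1)
    (hun : inner ℝ u n = 0) (hw : w ∈ Metric.ball ((2 : ℝ) • n) 1) :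
    jap v ^ γ / 125 ≤ aForm γ (v - w) u u ∧ jap v ^ (γ + 2) / 125 ≤ ‖v - w‖ ^ (γ + 2) := by
  set z := v - w with hz
  have hwn : 1 ≤ inner ℝ w n := by
    have e : inner ℝ w n = 2 + inner ℝ (w - (2 : ℝ) • n) n := by
      rw [inner_sub_left, inner_smul_left, real_inner_self_eq_norm_sq, hn]; simp
    have h := abs_real_inner_le_norm (w - (2 : ℝ) • n) n
    rw [hn, mul_one] at h
    have h' : ‖w - (2 : ℝ) • n‖ < 1 := by simpa [dist_eq_norm] using hw
    have := abs_le.1 h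
    linarith
  have hw3 : ‖w‖ ≤ 3 := by
    have h' : ‖w - (2 : ℝ) • n‖ < 1 := by simpa [dist_eq_norm] using hw
    have := norm_add_le (w - (2 : ℝ) • n) ((2 : ℝ) • n)
    rw [sub_add_cancel, norm_smul, hn] at this
    norm_num at this
    linarith
  have hzn : 1 ≤ (inner ℝ z n) ^ 2 := by
    have : inner ℝ z n = - inner ℝ w n := by
      rw [hz, inner_sub_left, hv, inner_smul_left, hun]; simp
    rw [this]; nlinarith
  have bes : (inner ℝ z u) ^ 2 + (inner ℝ z n) ^ 2 ≤ ‖z‖ ^ 2 := by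
    have h := norm_nonneg (z - inner ℝ z u • u - inner ℝ z n • n)
    have e : ‖z - inner ℝ z u • u - inner ℝ z n • n‖ ^ 2 =
        ‖z‖ ^ 2 - (inner ℝ z u) ^ 2 - (inner ℝ z n) ^ 2 := by
      rw [← real_inner_self_eq_norm_sq, ← real_inner_self_eq_norm_sq z]
      have e1 : inner ℝ u u = (1 : ℝ) := by rw [real_inner_self_eq_norm_sq, hu]; norm_num
      have e2 : inner ℝ n n = (1 : ℝ) := by rw [real_inner_self_eq_norm_sq, hn]; norm_num
      have e3 : inner ℝ n u = (0 : ℝ) := by rw [real_inner_comm]; exact hun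
      simp only [inner_sub_left, inner_sub_right, inner_smul_left, inner_smul_right, e1, e2, e3,
        hun, real_inner_comm z u, real_inner_comm z n]
      simp
      ring
    nlinarith [sq_nonneg ‖z - inner ℝ z u • u - inner ℝ z n • n‖]
  have hz1 : 1 ≤ ‖z‖ := by
    have : 1 ≤ ‖z‖ ^ 2 := by nlinarith [sq_nonneg (inner ℝ z u)]
    nlinarith [norm_nonneg z]
  have hzl : jap v / 5 ≤ ‖z‖ := by
    have a1 := jap_le v
    have a2 : ‖v‖ - ‖w‖ ≤ ‖z‖ := norm_sub_norm_le v w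
    rcases le_total ‖v‖ 4 with h | h <;> linarith
  have hzu : ‖z‖ ≤ 4 * jap v := by
    have a1 := norm_le_jap v
    have a2 : ‖z‖ ≤ ‖v‖ + ‖w‖ := norm_sub_le v w
    linarith [one_le_jap v]
  have hz0 : z ≠ 0 := norm_pos_iff.1 (by linarith)
  have pow : ∀ s : ℝ, -2 ≤ s → s ≤ 3 → jap v ^ s / 125 ≤ ‖z‖ ^ s := fun s hs2 hs3 => by
    have p := jap_rpow_nonneg v s
    rcases le_total 0 s with h | h
    · refine le_trans ?_ (Real.rpow_le_rpow (by linarith [jap_pos v]) hzl h)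
      rw [Real.div_rpow (jap_pos v).le (by norm_num)]
      have : (5 : ℝ) ^ s ≤ 125 := by
        calc (5 : ℝ) ^ s ≤ 5 ^ (3 : ℝ) := Real.rpow_le_rpow_of_exponent_le (by norm_num) hs3
          _ = 125 := by norm_num
      gcongr
    · refine le_trans ?_ (Real.rpow_le_rpow_of_nonpos (by linarith) hzu h)
      rw [Real.mul_rpow (by norm_num) (jap_pos v).le, div_eq_inv_mul]
      have : (125 : ℝ)⁻¹ ≤ 4 ^ s := by
        calc (125 : ℝ)⁻¹ ≤ 4 ^ (-2 : ℝ) := by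
              rw [Real.rpow_neg (by norm_num), Real.rpow_two]; norm_num
          _ ≤ _ := Real.rpow_le_rpow_of_exponent_le (by norm_num) hs2
      gcongr
  refine ⟨?_, pow _ (by linarith) (by linarith)⟩
  rw [aForm_eq hz0, real_inner_self_eq_norm_sq, hu]
  have := pow γ h1 (by linarith)
  have p := Real.rpow_nonneg (norm_nonneg z) γ
  nlinarith

omit h1 h2 in
-- The integrand is nonnegative, so the integral is cut down to the ball around 2n, where |w| ≤ 3
-- and the Gaussian is at least its value at |w| = 3.
lemma lower_bound_integral {f : E3 → ℝ} (hf : Integrable fun w => f w * maxwellian w)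
    (hf0 : ∀ w, 0 ≤ f w) {n : E3} (hn : ‖n‖ = 1) {b : ℝ}
    (hb : ∀ w ∈ Metric.ball ((2 : ℝ) • n) 1, b ≤ f w) :
    b * ((2 * Real.pi) ^ (-(3 / 2) : ℝ) * Real.exp (-9 / 2) *
      (volume : Measure E3).real (Metric.ball 0 1)) ≤ ∫ w, f w * maxwellian w := by
  rcases le_total b 0 with hb0 | hb0
  · refine le_trans (mul_nonpos_of_nonpos_of_nonneg hb0 (by positivity)) ?_
    exact integral_nonneg fun w => mul_nonneg (hf0 w) (maxwellian_pos w).le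
  have hM : ∀ w ∈ Metric.ball ((2 : ℝ) • n) 1,
      (2 * Real.pi) ^ (-(3 / 2) : ℝ) * Real.exp (-9 / 2) ≤ maxwellian w := fun w hw => by
    have hw3 : ‖w‖ ≤ 3 := by
      have h' : ‖w - (2 : ℝ) • n‖ < 1 := by simpa [dist_eq_norm] using hw
      have := norm_add_le (w - (2 : ℝ) • n) ((2 : ℝ) • n)
      rw [sub_add_cancel, norm_smul, hn] at this
      norm_num at this
      linarith
    unfold maxwellian
    gcongr
    nlinarith [norm_nonneg w]
  have e : (volume : Measure E3).real (Metric.ball 0 1) =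
      (volume : Measure E3).real (Metric.ball ((2 : ℝ) • n) 1) := by
    simp [Measure.real, Measure.addHaar_ball_center volume ((2 : ℝ) • n) 1]
  calc _ = ∫ w in Metric.ball ((2 : ℝ) • n) 1,
        b * ((2 * Real.pi) ^ (-(3 / 2) : ℝ) * Real.exp (-9 / 2)) := by
        rw [setIntegral_const, e, smul_eq_mul]; ring
    _ ≤ ∫ w in Metric.ball ((2 : ℝ) • n) 1, f w * maxwellian w := by
        refine setIntegral_mono_on (integrableOn_const measure_ball_lt_top.ne) hf.integrableOn
          measurableSet_ball fun w hw => ?_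
        exact mul_le_mul (hb w hw) (hM w hw) (by positivity) (hf0 w)
    _ ≤ _ := setIntegral_le_integral hf
        (.of_forall fun w => mul_nonneg (hf0 w) (maxwellian_pos w).le)

omit h1 h2 in
lemma aForm_self_nonneg (z p : E3) : 0 ≤ aForm γ z p p := by
  rcases eq_or_ne z 0 with rfl | hz
  · rw [aForm_eq']
    simp only [inner_zero_left, zero_mul, zero_div, sub_zero]
    exact mul_nonneg (Real.rpow_nonneg (norm_nonneg _) _) real_inner_self_nonneg
  · rw [aForm_eq hz, ← inner_perp hz]
    have := Real.rpow_nonneg (norm_nonneg z) γ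
    have : 0 ≤ inner ℝ (perp z p) (perp z p) := real_inner_self_nonneg
    positivity

lemma integrable_aForm_mul {f : E3 → ℝ} (hf : Continuous f) {A : ℝ}
    (hA : ∀ v, |f v| ≤ A * jap v ^ (-12 : ℝ)) (v p q : E3) :
    Integrable fun w => aForm γ (v - w) p q * f w := by
  have hi := fun i j => integrable_aKer_mul h1 h2 hf hA i j v
  have e : ∀ w, aForm γ (v - w) p q * f w =
      ∑ i, ∑ j, aKer γ i j (v - w) * f w * (p i * q j) := fun w => by
    simp_rw [aForm, Finset.sum_mul]
    refine Finset.sum_congr rfl fun i _ => Finset.sum_congr rfl fun j _ => by ring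
  simp_rw [e]
  exact integrable_finsetSum _ fun i _ => integrable_finsetSum _ fun j _ => (hi i j).mul_const _

lemma trA_sub_eq (u v : E3) : trA γ v - AForm γ v u u =
    ∫ w, (∑ i, aKer γ i i (v - w) - aForm γ (v - w) u u) * maxwellian w := by
  obtain ⟨A, hA⟩ := maxwellian_abs_le
  have hi := fun i j => integrable_aKer_mul h1 h2 continuous_maxwellian hA i j v
  simp_rw [sub_mul, Finset.sum_mul]
  rw [integral_sub (integrable_finsetSum _ fun i _ => hi i i)
    (integrable_aForm_mul h1 h2 continuous_maxwellian hA v u u),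
    integral_finsetSum _ fun i _ => hi i i, ← AForm_eq h1 h2]
  rfl

omit h1 h2 in
lemma tr_sub_bounds {u : E3} (hu : ‖u‖ = 1) (z : E3) :
    ‖z‖ ^ (γ + 2) ≤ ∑ i, aKer γ i i z - aForm γ z u u ∧
      ∑ i, aKer γ i i z - aForm γ z u u ≤ 3 * ‖z‖ ^ (γ + 2) := by
  have e : ∑ i, aKer γ i i z = ‖z‖ ^ (γ + 2) * (3 - ‖z‖ ^ 2 / ‖z‖ ^ 2) := by
    simp_rw [aKer]
    conv_rhs => rw [show ‖z‖ ^ 2 / ‖z‖ ^ 2 = (∑ i, z i ^ 2) / ‖z‖ ^ 2 by rw [norm_sq_eq_sum]]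
    simp [Fin.sum_univ_three]
    ring
  have p := Real.rpow_nonneg (norm_nonneg z) (γ + 2)
  -- At z = 0 the quotient |z|²/|z|² is 0 and not 1. Only its bounds 0 and 1 are used, whence the
  -- constant 3 where 2 holds for z ≠ 0.
  have q1 : 0 ≤ ‖z‖ ^ 2 / ‖z‖ ^ 2 := by positivity
  have q2 : ‖z‖ ^ 2 / ‖z‖ ^ 2 ≤ 1 := div_self_le_one _
  have q3 : 0 ≤ inner ℝ z u * inner ℝ z u / ‖z‖ ^ 2 := div_nonneg (mul_self_nonneg _) (sq_nonneg _)
  have q4 : inner ℝ z u * inner ℝ z u / ‖z‖ ^ 2 ≤ 1 := by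
    refine div_le_one_of_le₀ ?_ (sq_nonneg _)
    have := abs_real_inner_le_norm z u
    rw [hu, mul_one] at this
    nlinarith [abs_mul_abs_self (inner ℝ z u), abs_nonneg (inner ℝ z u)]
  rw [e, aForm_eq', real_inner_self_eq_norm_sq, hu]
  constructor <;> nlinarith

omit h1 h2 in
lemma wnorm_self {u v : E3} (hu : ‖u‖ = 1) : wnorm γ u v u = jap v ^ (γ / 2) := by
  rw [wnorm, real_inner_self_eq_norm_sq, hu]
  simp

lemma aForm_unit_le {u v : E3} (hu : ‖u‖ = 1) (hv : v = ‖v‖ • u) (w : E3) :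
    |aForm γ (v - w) u u| ≤ 512 * jap w ^ (6 : ℝ) * jap v ^ γ := by
  have h := aForm_le_wnorm h1 h2 hu hv w u u
  rw [wnorm_self hu, mul_assoc, ← jap_rpow_add] at h
  rwa [add_halves] at h

lemma norm_sub_rpow_le (v w : E3) :
    ‖v - w‖ ^ (γ + 2) ≤ 8 * jap w ^ (3 : ℝ) * jap v ^ (γ + 2) := by
  have a1 := norm_rpow_le_jap (v - w) (show 0 ≤ γ + 2 by linarith)
  have a2 := jap_peetre (γ + 2) v (-w)
  rw [jap_neg, ← sub_eq_add_neg, abs_of_nonneg (by linarith)] at a2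
  have a3 : (2 : ℝ) ^ (γ + 2) ≤ 8 := by
    calc (2 : ℝ) ^ (γ + 2) ≤ 2 ^ (3 : ℝ) :=
          Real.rpow_le_rpow_of_exponent_le (by norm_num) (by linarith)
      _ = 8 := by norm_num
  have a4 := jap_rpow_mono w (show γ + 2 ≤ 3 by linarith)
  have p1 := jap_rpow_nonneg v (γ + 2)
  have p2 := jap_rpow_nonneg w (γ + 2)
  calc _ ≤ _ := a1.trans a2
    _ ≤ 8 * jap v ^ (γ + 2) * jap w ^ (3 : ℝ) := by gcongr
    _ = _ := by ring

/-- The eigenvalues satisfy `ℓ₁ ~ ⟨v⟩^γ` and `ℓ₂ ~ ⟨v⟩^{γ+2}`. -/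
lemma ell_bounds : ∃ c C : ℝ, 0 < c ∧ 0 < C ∧ ∀ v,
    c * jap v ^ γ ≤ ell1 γ v ∧ ell1 γ v ≤ C * jap v ^ γ ∧
    c * jap v ^ (γ + 2) ≤ ell2 γ v ∧ ell2 γ v ≤ C * jap v ^ (γ + 2) := by
  set κ : ℝ := (2 * Real.pi) ^ (-(3 / 2) : ℝ) * Real.exp (-9 / 2) *
      (volume : Measure E3).real (Metric.ball 0 1) with hκd
  have hκ : 0 < κ := by
    have : 0 < (volume : Measure E3).real (Metric.ball 0 1) :=
      ENNReal.toReal_pos (Metric.measure_ball_pos _ _ one_pos).ne' measure_ball_lt_top.ne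
    positivity
  set I6 := ∫ w, jap w ^ (6 : ℝ) * maxwellian w
  set I3 := ∫ w, jap w ^ (3 : ℝ) * maxwellian w
  have hI6 : 0 ≤ I6 := integral_nonneg fun w =>
    mul_nonneg (jap_rpow_nonneg w _) (maxwellian_pos w).le
  have hI3 : 0 ≤ I3 := integral_nonneg fun w =>
    mul_nonneg (jap_rpow_nonneg w _) (maxwellian_pos w).le
  have i6 := integrable_jap_maxwellian 6
  have i3 := integrable_jap_maxwellian 3
  obtain ⟨A, hA⟩ := maxwellian_abs_le
  -- κ bounds from below the Gaussian mass of the ball around 2n. The constant 250 is twice 125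
  -- because ℓ₂ is half of tr 𝐀 − ℓ₁; the final 1 only makes the upper constant positive.
  refine ⟨κ / 250, 512 * I6 + 24 * I3 + 1, by positivity, by positivity, fun v => ?_⟩
  obtain ⟨u, hu, hv⟩ := exists_dir v
  obtain ⟨n, hn, hun⟩ := exists_orth u
  have e1 := ell1_eq h1 h2 hu hv
  have e2 : ell2 γ v = (trA γ v - AForm γ v u u) / 2 := by rw [ell2, e1]
  have p1 := jap_rpow_pos v γ
  have p2 := jap_rpow_pos v (γ + 2)
  have int1 := integrable_aForm_mul h1 h2 continuous_maxwellian hA v u u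
  have l1 := lower_bound_integral int1 (fun w => aForm_self_nonneg _ _) hn
    (fun w hw => (aForm_unit_bounds h1 h2 hu hv hn hun hw).1)
  have int2 : Integrable fun w =>
      (∑ i, aKer γ i i (v - w) - aForm γ (v - w) u u) * maxwellian w := by
    simp_rw [sub_mul, Finset.sum_mul]
    exact (integrable_finsetSum _ fun i _ =>
      integrable_aKer_mul h1 h2 continuous_maxwellian hA i i v).sub int1
  have l2 := lower_bound_integral int2
    (fun w => (Real.rpow_nonneg (norm_nonneg _) _).trans (tr_sub_bounds hu (v - w)).1) hn
    (fun w hw => (aForm_unit_bounds h1 h2 hu hv hn hun hw).2.trans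
      (tr_sub_bounds hu (v - w)).1)
  have u1 : ∫ w, aForm γ (v - w) u u * maxwellian w ≤ 512 * I6 * jap v ^ γ := by
    calc _ ≤ ∫ w, (512 * jap v ^ γ) * (jap w ^ (6 : ℝ) * maxwellian w) := by
          refine integral_mono int1 (i6.const_mul _) fun w => ?_
          have := (abs_le.1 (aForm_unit_le h1 h2 hu hv w)).2
          have := mul_le_mul_of_nonneg_right this (maxwellian_pos w).le
          simp only
          linarith
      _ = _ := by rw [integral_const_mul]; ring
  have u2 : ∫ w, (∑ i, aKer γ i i (v - w) - aForm γ (v - w) u u) * maxwellian w ≤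
      24 * I3 * jap v ^ (γ + 2) := by
    calc _ ≤ ∫ w, (24 * jap v ^ (γ + 2)) * (jap w ^ (3 : ℝ) * maxwellian w) := by
          refine integral_mono int2 (i3.const_mul _) fun w => ?_
          have a := (tr_sub_bounds (γ := γ) hu (v - w)).2
          have b := norm_sub_rpow_le h1 h2 v w
          have := mul_le_mul_of_nonneg_right (a.trans (by linarith :
            _ ≤ 3 * (8 * jap w ^ (3 : ℝ) * jap v ^ (γ + 2)))) (maxwellian_pos w).le
          simp only
          linarith
      _ = _ := by rw [integral_const_mul]; ring
  rw [← hκd] at l1 l2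
  rw [← AForm_eq h1 h2, ← e1] at l1 u1
  rw [← trA_sub_eq h1 h2] at l2 u2
  refine ⟨?_, ?_, ?_, ?_⟩
  · have : κ / 250 * jap v ^ γ ≤ jap v ^ γ / 125 * κ := by nlinarith [mul_pos p1 hκ]
    linarith
  · nlinarith [mul_nonneg hI3 p1.le]
  · rw [e2]
    have : κ / 250 * jap v ^ (γ + 2) = jap v ^ (γ + 2) / 125 * κ / 2 := by ring
    linarith
  · rw [e2]
    nlinarith [mul_nonneg hI6 p2.le, mul_nonneg hI3 p2.le]

end ell

/-! ### The matrix `𝐁` -/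

/-- The inverse of the matrix `𝐁`. -/
def matBinv (γ : ℝ) (i j : Fin 3) (v : E3) : ℝ :=
  (Real.sqrt (ell1 γ v))⁻¹ * (v i / ‖v‖ * (v j / ‖v‖)) +
    (Real.sqrt (ell2 γ v))⁻¹ * ((if i = j then 1 else 0) - v i / ‖v‖ * (v j / ‖v‖))

/-- The matrix `(∂_i 𝐁) 𝐁⁻¹`. -/
def matE (γ : ℝ) (i j q : Fin 3) (v : E3) : ℝ := ∑ n, pd i (matB γ j n) v * matBinv γ n q v

/-- The size of `𝐁(v) p`. -/
def bn (γ : ℝ) (v p : E3) : ℝ := ∑ k, |∑ l, matB γ k l v * p l|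

lemma bn_nonneg (γ : ℝ) (v p : E3) : 0 ≤ bn γ v p := Finset.sum_nonneg fun _ _ => abs_nonneg _

lemma unit_coord {u v : E3} (hv : v = ‖v‖ • u) (h0 : v ≠ 0) (i : Fin 3) : v i / ‖v‖ = u i := by
  have hn : ‖v‖ ≠ 0 := norm_ne_zero_iff.2 h0
  have : v i = ‖v‖ * u i := by
    conv_lhs => rw [hv]
    simp
  rw [this]; field_simp

lemma sum_sq_unit {u : E3} (hu : ‖u‖ = 1) : u 0 ^ 2 + u 1 ^ 2 + u 2 ^ 2 = 1 := by
  have h := norm_sq_eq_sum u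
  rw [hu, Fin.sum_univ_three] at h
  linarith

lemma ell_zero (γ : ℝ) : ell1 γ 0 = ell2 γ 0 := by
  simp [ell2, ell1]; ring

lemma matB_eq (γ : ℝ) {u v : E3} (hv : v = ‖v‖ • u) (i j : Fin 3) :
    matB γ i j v = Real.sqrt (ell1 γ v) * (u i * u j) +
      Real.sqrt (ell2 γ v) * ((if i = j then 1 else 0) - u i * u j) := by
  rcases eq_or_ne v 0 with rfl | h0
  · simp only [matB, ell_zero, PiLp.zero_apply, zero_div, mul_zero, sub_zero, zero_add]; ring
  · rw [matB, unit_coord hv h0, unit_coord hv h0]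

lemma matBinv_eq (γ : ℝ) {u v : E3} (hv : v = ‖v‖ • u) (i j : Fin 3) :
    matBinv γ i j v = (Real.sqrt (ell1 γ v))⁻¹ * (u i * u j) +
      (Real.sqrt (ell2 γ v))⁻¹ * ((if i = j then 1 else 0) - u i * u j) := by
  rcases eq_or_ne v 0 with rfl | h0
  · simp only [matBinv, ell_zero, PiLp.zero_apply, zero_div, mul_zero, sub_zero, zero_add]; ring
  · rw [matBinv, unit_coord hv h0, unit_coord hv h0]

/-- u ⊗ u and Id − u ⊗ u are complementary projections, so combinations of them multiply coefficient
by coefficient. -/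
lemma sum_decomp {u : E3} (hu : ‖u‖ = 1) (a b c d : ℝ) (i j : Fin 3) :
    ∑ m, (a * (u i * u m) + b * ((if i = m then 1 else 0) - u i * u m)) *
      (c * (u m * u j) + d * ((if m = j then 1 else 0) - u m * u j)) =
    (a * c) * (u i * u j) + (b * d) * ((if i = j then 1 else 0) - u i * u j) := by
  have hs := sum_sq_unit hu
  have key : ∀ m, (a * (u i * u m) + b * ((if i = m then 1 else 0) - u i * u m)) *
      (c * (u m * u j) + d * ((if m = j then 1 else 0) - u m * u j)) =
      (a - b) * (c - d) * (u i * u j) * u m ^ 2 + (a - b) * d * u i * (u m * if m = j then 1 else 0)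
      + b * (c - d) * u j * ((if i = m then 1 else 0) * u m)
      + b * d * ((if i = m then 1 else 0) * if m = j then 1 else 0) := fun m => by ring
  simp_rw [key, Finset.sum_add_distrib, ← Finset.mul_sum]
  have t1 : ∑ m, u m ^ 2 = 1 := by rw [Fin.sum_univ_three]; exact hs
  rw [t1]
  simp
  split_ifs <;> ring

/-! ### Comparison of 𝐁(v)p with weighted norms of p. -/

section

variable {γ : ℝ} (h1 : -2 ≤ γ) (h2 : γ ≤ 1)
include h1 h2

lemma ell_pos (v : E3) : 0 < ell1 γ v ∧ 0 < ell2 γ v := by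
  obtain ⟨c, C, hc, _, h⟩ := ell_bounds h1 h2
  exact ⟨lt_of_lt_of_le (mul_pos hc (jap_rpow_pos v _)) (h v).1,
    lt_of_lt_of_le (mul_pos hc (jap_rpow_pos v _)) (h v).2.2.1⟩

lemma matB_mul_matBinv (v : E3) (i j : Fin 3) :
    ∑ m, matB γ i m v * matBinv γ m j v = if i = j then 1 else 0 := by
  obtain ⟨u, hu, hv⟩ := exists_dir v
  obtain ⟨p1, p2⟩ := ell_pos h1 h2 v
  have q1 := (Real.sqrt_pos.2 p1).ne'
  have q2 := (Real.sqrt_pos.2 p2).ne'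
  simp_rw [matB_eq γ hv, matBinv_eq γ hv, sum_decomp hu, mul_inv_cancel₀ q1, mul_inv_cancel₀ q2]
  ring

lemma matBinv_mul_matB (v : E3) (i j : Fin 3) :
    ∑ m, matBinv γ i m v * matB γ m j v = if i = j then 1 else 0 := by
  obtain ⟨u, hu, hv⟩ := exists_dir v
  obtain ⟨p1, p2⟩ := ell_pos h1 h2 v
  have q1 := (Real.sqrt_pos.2 p1).ne'
  have q2 := (Real.sqrt_pos.2 p2).ne'
  simp_rw [matB_eq γ hv, matBinv_eq γ hv, sum_decomp hu, inv_mul_cancel₀ q1, inv_mul_cancel₀ q2]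
  ring

/-- `√ℓ₁ ~ ⟨v⟩^{γ/2}` and `√ℓ₂ ~ ⟨v⟩^{γ/2+1}`. -/
lemma sqrt_ell_bounds : ∃ c C : ℝ, 0 < c ∧ 0 < C ∧ ∀ v,
    c * jap v ^ (γ / 2) ≤ √(ell1 γ v) ∧ √(ell1 γ v) ≤ C * jap v ^ (γ / 2) ∧
    c * jap v ^ (γ / 2 + 1) ≤ √(ell2 γ v) ∧ √(ell2 γ v) ≤ C * jap v ^ (γ / 2 + 1) := by
  obtain ⟨c, C, hc, hC, h⟩ := ell_bounds h1 h2
  refine ⟨√c, √C, Real.sqrt_pos.2 hc, Real.sqrt_pos.2 hC, fun v => ?_⟩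
  have e1 : jap v ^ (γ / 2) = √(jap v ^ γ) := by
    rw [Real.sqrt_eq_rpow, ← Real.rpow_mul (jap_pos v).le]; ring_nf
  have e2 : jap v ^ (γ / 2 + 1) = √(jap v ^ (γ + 2)) := by
    rw [Real.sqrt_eq_rpow, ← Real.rpow_mul (jap_pos v).le]; ring_nf
  rw [e1, e2]
  simp_rw [← Real.sqrt_mul hc.le, ← Real.sqrt_mul hC.le]
  obtain ⟨a, b, c', d⟩ := h v
  exact ⟨Real.sqrt_le_sqrt a, Real.sqrt_le_sqrt b, Real.sqrt_le_sqrt c', Real.sqrt_le_sqrt d⟩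

omit h1 h2 in
lemma sum_matB_eq {u v : E3} (hv : v = ‖v‖ • u) (p : E3) (k : Fin 3) :
    ∑ l, matB γ k l v * p l = √(ell1 γ v) * (inner ℝ u p * u k) +
      √(ell2 γ v) * ((p - inner ℝ u p • u) k) := by
  simp_rw [matB_eq γ hv, inner_eq_sum]
  fin_cases k <;> simp [Fin.sum_univ_three] <;> ring

/-- `𝐁(v)p` controls the weighted norm of `p`. -/
lemma wnorm_le_bn : ∃ C : ℝ, 0 < C ∧ ∀ u v p : E3, ‖u‖ = 1 → v = ‖v‖ • u →
    wnorm γ u v p ≤ C * bn γ v p := by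
  obtain ⟨c, _, hc, _, h⟩ := sqrt_ell_bounds h1 h2
  refine ⟨c⁻¹ * 5, by positivity, fun u v p hu hv => ?_⟩
  obtain ⟨a1, _, a2, _⟩ := h v
  set b : E3 := WithLp.toLp 2 fun k => ∑ l, matB γ k l v * p l with hb
  have hbn : ‖b‖ ≤ bn γ v p := by
    have : ‖b‖ ≤ ∑ k, |b k| := by
      rw [EuclideanSpace.norm_eq]
      refine Real.sqrt_le_iff.2 ⟨by positivity, ?_⟩
      simp only [Fin.sum_univ_three, Real.norm_eq_abs]
      nlinarith [abs_nonneg (b 0), abs_nonneg (b 1), abs_nonneg (b 2),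
        mul_nonneg (abs_nonneg (b 0)) (abs_nonneg (b 1)),
        mul_nonneg (abs_nonneg (b 0)) (abs_nonneg (b 2)),
        mul_nonneg (abs_nonneg (b 1)) (abs_nonneg (b 2))]
    exact this
  have hbe : b = (√(ell1 γ v) * inner ℝ u p) • u + √(ell2 γ v) • (p - inner ℝ u p • u) := by
    ext k
    simp only [hb, PiLp.add_apply, PiLp.smul_apply, smul_eq_mul]
    rw [sum_matB_eq hv]; ring
  have huu : inner ℝ u u = (1 : ℝ) := by rw [real_inner_self_eq_norm_sq, hu]; norm_num
  have i1 : inner ℝ u b = √(ell1 γ v) * inner ℝ u p := by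
    rw [hbe, inner_add_right, inner_smul_right, inner_smul_right, inner_sub_right,
      inner_smul_right, huu]
    ring
  have s1 := Real.sqrt_nonneg (ell1 γ v)
  have s2 := Real.sqrt_nonneg (ell2 γ v)
  have c1 : √(ell1 γ v) * |inner ℝ u p| ≤ bn γ v p := by
    have := abs_real_inner_le_norm u b
    rw [hu, one_mul, i1, abs_mul, abs_of_nonneg s1] at this
    exact this.trans hbn
  have c2 : √(ell2 γ v) * ‖p - inner ℝ u p • u‖ ≤ 2 * bn γ v p := by
    have e : √(ell2 γ v) • (p - inner ℝ u p • u) = b - (√(ell1 γ v) * inner ℝ u p) • u := by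
      rw [hbe]; abel
    calc _ = ‖√(ell2 γ v) • (p - inner ℝ u p • u)‖ := by
          rw [norm_smul, Real.norm_of_nonneg s2]
      _ ≤ ‖b‖ + ‖(√(ell1 γ v) * inner ℝ u p) • u‖ := by rw [e]; exact norm_sub_le _ _
      _ = ‖b‖ + √(ell1 γ v) * |inner ℝ u p| := by
          rw [norm_smul, hu, mul_one, Real.norm_eq_abs, abs_mul, abs_of_nonneg s1]
      _ ≤ _ := by linarith
  have e : wnorm γ u v p = jap v ^ (γ / 2) * |inner ℝ u p| +
      jap v ^ (γ / 2 + 1) * ‖p - inner ℝ u p • u‖ := by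
    rw [wnorm, jap_rpow_add, Real.rpow_one]; ring
  rw [e, mul_assoc, ← div_eq_inv_mul, le_div_iff₀ hc]
  have t1 := mul_le_mul_of_nonneg_right a1 (abs_nonneg (inner ℝ u p))
  have t2 := mul_le_mul_of_nonneg_right a2 (norm_nonneg (p - inner ℝ u p • u))
  nlinarith [bn_nonneg γ v p]

/-- `𝐁(v)p` is controlled by the weighted norm of `p`. -/
lemma bn_le_wnorm : ∃ C : ℝ, 0 < C ∧ ∀ u v p : E3, ‖u‖ = 1 → v = ‖v‖ • u →
    bn γ v p ≤ C * wnorm γ u v p := by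
  obtain ⟨_, C, _, hC, h⟩ := sqrt_ell_bounds h1 h2
  refine ⟨C * 3, by positivity, fun u v p hu hv => ?_⟩
  obtain ⟨_, a1, _, a2⟩ := h v
  have s1 := Real.sqrt_nonneg (ell1 γ v)
  have s2 := Real.sqrt_nonneg (ell2 γ v)
  have e : wnorm γ u v p = jap v ^ (γ / 2) * |inner ℝ u p| +
      jap v ^ (γ / 2 + 1) * ‖p - inner ℝ u p • u‖ := by
    rw [wnorm, jap_rpow_add, Real.rpow_one]; ring
  have hk : ∀ k, |∑ l, matB γ k l v * p l| ≤ C * wnorm γ u v p := fun k => by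
    rw [sum_matB_eq hv, e]
    refine (abs_add_le _ _).trans ?_
    rw [abs_mul, abs_mul, abs_mul, abs_of_nonneg s1, abs_of_nonneg s2]
    have b1 := abs_coord_le u k
    rw [hu] at b1
    have b2 := abs_coord_le (p - inner ℝ u p • u) k
    have p1 := jap_rpow_nonneg v (γ / 2)
    have p2 := jap_rpow_nonneg v (γ / 2 + 1)
    calc _ ≤ (C * jap v ^ (γ / 2)) * (|inner ℝ u p| * 1) +
          (C * jap v ^ (γ / 2 + 1)) * ‖p - inner ℝ u p • u‖ := by gcongr
      _ = _ := by ring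
  refine (Finset.sum_le_sum fun k _ => hk k).trans (le_of_eq ?_)
  simp; ring

/-- This is the form in which the anisotropy is used: each vector is paid for by 𝐁(v), so a gradient
is paid for by ∇̃. -/
lemma aForm_le_bn : ∃ C : ℝ, 0 < C ∧ ∀ v w p q : E3,
    |aForm γ (v - w) p q| ≤ C * jap w ^ (6 : ℝ) * bn γ v p * bn γ v q := by
  obtain ⟨C, hC, h⟩ := wnorm_le_bn h1 h2
  refine ⟨512 * C * C, by positivity, fun v w p q => ?_⟩
  obtain ⟨u, hu, hv⟩ := exists_dir v
  refine (aForm_le_wnorm h1 h2 hu hv w p q).trans ?_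
  have p6 := jap_rpow_nonneg w 6
  have q0 : 0 ≤ wnorm γ u v q := le_trans (by positivity [jap_rpow_nonneg v (γ / 2)])
    (norm_le_wnorm γ hu v q)
  have := h u v p hu hv
  have := h u v q hu hv
  have := bn_nonneg γ v p
  calc _ ≤ 512 * jap w ^ (6 : ℝ) * (C * bn γ v p) * (C * bn γ v q) := by gcongr
    _ = _ := by ring

/-- The bounds `⟨v⟩^{γ/2} |p| ≲ |𝐁(v) p| ≲ ⟨v⟩^{γ/2+1} |p|`. -/
lemma bn_bounds : ∃ C : ℝ, 0 < C ∧ ∀ v p : E3, jap v ^ (γ / 2) * ‖p‖ ≤ C * bn γ v p ∧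
    bn γ v p ≤ C * jap v ^ (γ / 2 + 1) * ‖p‖ := by
  obtain ⟨C, hC, h⟩ := wnorm_le_bn h1 h2
  obtain ⟨C', hC', h'⟩ := bn_le_wnorm h1 h2
  refine ⟨C + C' * 3, by positivity, fun v p => ?_⟩
  obtain ⟨u, hu, hv⟩ := exists_dir v
  have a1 := (norm_le_wnorm γ hu v p).trans (h u v p hu hv)
  have a2 := h' u v p hu hv
  have b0 := bn_nonneg γ v p
  refine ⟨by nlinarith, ?_⟩
  have a3 : wnorm γ u v p ≤ 3 * (jap v ^ (γ / 2 + 1) * ‖p‖) := by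
    have e1 : |inner ℝ u p| ≤ ‖p‖ := by
      have := abs_real_inner_le_norm u p
      rwa [hu, one_mul] at this
    have e2 : ‖p - inner ℝ u p • u‖ ≤ 2 * ‖p‖ := by
      refine (norm_sub_le _ _).trans ?_
      rw [norm_smul, hu, mul_one, Real.norm_eq_abs]; linarith
    have := one_le_jap v
    have p0 := jap_rpow_nonneg v (γ / 2)
    rw [wnorm, jap_rpow_add, Real.rpow_one]
    calc _ ≤ jap v ^ (γ / 2) * (jap v * ‖p‖ + jap v * (2 * ‖p‖)) := by
          gcongr
          nlinarith [norm_nonneg p]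
      _ = _ := by ring
  have p0 : 0 ≤ jap v ^ (γ / 2 + 1) * ‖p‖ := by positivity [jap_rpow_nonneg v (γ / 2 + 1)]
  nlinarith

/-- The vector v is an eigenvector for the smaller eigenvalue √ℓ₁ ~ ⟨v⟩^{γ/2}. This saves one power
over the isotropic bound ⟨v⟩^{γ/2+2} and makes the drift v_i/2 in Γ admissible. -/
lemma bn_self_le : ∃ C : ℝ, 0 < C ∧ ∀ v : E3, bn γ v v ≤ C * jap v ^ (γ / 2 + 1) := by
  obtain ⟨C', hC', h'⟩ := bn_le_wnorm h1 h2
  refine ⟨C', hC', fun v => ?_⟩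
  obtain ⟨u, hu, hv⟩ := exists_dir v
  refine (h' u v v hu hv).trans ?_
  have e : inner ℝ u v = ‖v‖ := by
    conv_lhs => rw [hv]
    rw [inner_smul_right, real_inner_self_eq_norm_sq, hu]; ring
  have : wnorm γ u v v = jap v ^ (γ / 2) * ‖v‖ := by
    rw [wnorm, e, ← hv]; simp
  rw [this, jap_rpow_add, Real.rpow_one]
  have := norm_le_jap v
  have := jap_rpow_nonneg v (γ / 2)
  gcongr

/-- `|𝐁(v) p|` is controlled by the quantities in the `H¹_{v,*}` norm. -/
lemma bn_le_proj : ∃ C : ℝ, 0 < C ∧ ∀ v p : E3, bn γ v p ≤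
    C * (‖jap v ^ (γ / 2) • projV v p‖ + ‖jap v ^ (γ / 2 + 1) • (p - projV v p)‖) := by
  obtain ⟨C, hC, h⟩ := bn_bounds h1 h2
  obtain ⟨C', hC', h'⟩ := bn_le_wnorm h1 h2
  refine ⟨C + C', by positivity, fun v p => ?_⟩
  rcases eq_or_ne v 0 with rfl | h0
  · refine (h 0 p).2.trans ?_
    have e : projV 0 p = 0 := by simp [projV]
    have p1 := jap_rpow_nonneg 0 (γ / 2 + 1)
    rw [e, smul_zero, norm_zero, zero_add, sub_zero, norm_smul, Real.norm_of_nonneg p1, mul_assoc]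
    gcongr
    linarith
  · have hn : ‖v‖ ≠ 0 := norm_ne_zero_iff.2 h0
    have hu : ‖‖v‖⁻¹ • v‖ = 1 := by rw [norm_smul, norm_inv, norm_norm, inv_mul_cancel₀ hn]
    have hv : v = ‖v‖ • (‖v‖⁻¹ • v) := by rw [smul_smul, mul_inv_cancel₀ hn, one_smul]
    refine (h' _ v p hu hv).trans ?_
    have e : wnorm γ (‖v‖⁻¹ • v) v p = ‖jap v ^ (γ / 2) • projV v p‖ +
        ‖jap v ^ (γ / 2 + 1) • (p - projV v p)‖ := by
      have p0 := jap_rpow_nonneg v (γ / 2)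
      have p1 := jap_rpow_nonneg v (γ / 2 + 1)
      rw [norm_smul, norm_smul, Real.norm_of_nonneg p0, Real.norm_of_nonneg p1, wnorm, projV,
        norm_smul, hu, real_inner_comm p, jap_rpow_add, Real.rpow_one, Real.norm_eq_abs]
      ring
    rw [e]
    gcongr
    linarith

omit h1 h2 in
lemma abs_unit_mul_le {u : E3} (hu : ‖u‖ = 1) (i j : Fin 3) : |u i * u j| ≤ 1 := by
  rw [abs_mul]
  have a := abs_coord_le u i
  have b := abs_coord_le u j
  rw [hu] at a b
  exact mul_le_one₀ a (abs_nonneg _) b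

omit h1 h2 in
lemma abs_delta_sub_unit_le {u : E3} (hu : ‖u‖ = 1) (i j : Fin 3) :
    |(if i = j then 1 else 0) - u i * u j| ≤ 2 := by
  have := abs_unit_mul_le hu i j
  refine (abs_sub _ _).trans ?_
  have h2 : |(if i = j then (1 : ℝ) else 0)| ≤ 1 := by split_ifs <;> simp
  linarith

lemma abs_matBinv_le : ∃ C : ℝ, 0 < C ∧ ∀ (v : E3) (i j : Fin 3),
    |matBinv γ i j v| ≤ C * jap v ^ (-(γ / 2)) := by
  obtain ⟨c, _, hc, _, h⟩ := sqrt_ell_bounds h1 h2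
  refine ⟨3 * c⁻¹, by positivity, fun v i j => ?_⟩
  obtain ⟨u, hu, hv⟩ := exists_dir v
  obtain ⟨a1, _, a2, _⟩ := h v
  have p0 := jap_rpow_pos v (γ / 2)
  have p1 := jap_rpow_pos v (γ / 2 + 1)
  have e : jap v ^ (-(γ / 2)) = (jap v ^ (γ / 2))⁻¹ := Real.rpow_neg (jap_pos v).le _
  have b1 : (√(ell1 γ v))⁻¹ ≤ c⁻¹ * jap v ^ (-(γ / 2)) := by
    rw [e, ← mul_inv]
    exact inv_anti₀ (by positivity) a1
  have b2 : (√(ell2 γ v))⁻¹ ≤ c⁻¹ * jap v ^ (-(γ / 2)) := by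
    rw [e, ← mul_inv]
    refine inv_anti₀ (by positivity) (le_trans ?_ a2)
    have := jap_rpow_mono v (show γ / 2 ≤ γ / 2 + 1 by linarith)
    gcongr
  rw [matBinv_eq γ hv]
  refine (abs_add_le _ _).trans ?_
  rw [abs_mul _ (u i * u j), abs_mul _ (_ - _), abs_of_nonneg (inv_nonneg.2 (Real.sqrt_nonneg _)),
    abs_of_nonneg (inv_nonneg.2 (Real.sqrt_nonneg _))]
  have c1 := abs_unit_mul_le hu i j
  have c2 := abs_delta_sub_unit_le hu i j
  have p3 := jap_rpow_nonneg v (-(γ / 2))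
  calc _ ≤ (c⁻¹ * jap v ^ (-(γ / 2))) * 1 + (c⁻¹ * jap v ^ (-(γ / 2))) * 2 := by
        gcongr
    _ = _ := by ring

lemma abs_matB_le : ∃ C : ℝ, 0 < C ∧ ∀ (v : E3) (i j : Fin 3),
    |matB γ i j v| ≤ C * jap v ^ (γ / 2 + 1) := by
  obtain ⟨C, hC, h⟩ := bn_bounds h1 h2
  refine ⟨C, hC, fun v i j => ?_⟩
  have a := (h v (e3 j)).2
  rw [PiLp.norm_single, norm_one, mul_one] at a
  refine le_trans ?_ a
  have e : |matB γ i j v| = |∑ l, matB γ i l v * (e3 j) l| := by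
    congr 1
    fin_cases j <;> simp
  rw [e]
  exact Finset.single_le_sum (f := fun k => |∑ l, matB γ k l v * (e3 j) l|)
    (fun _ _ => abs_nonneg _) (Finset.mem_univ i)

/-! ### Differentiability of `𝐁` -/

/-- ℓ₁ is the quadratic form 𝐀u·u. The variation of u is orthogonal to v, and 𝐀v is orthogonal to
v^⊥ by `AForm_eq_zero`, so only the derivative of 𝐀 contributes. -/
lemma pd_ell1 {v : E3} (h0 : v ≠ 0) (k : Fin 3) : DifferentiableAt ℝ (ell1 γ) v ∧
    pd k (ell1 γ) v = ∑ i, ∑ j, pd k (matA γ i j) v * (v i / ‖v‖) * (v j / ‖v‖) := by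
  have hn : ‖v‖ ^ 2 ≠ 0 := pow_ne_zero 2 (norm_ne_zero_iff.2 h0)
  have hev : ell1 γ =ᶠ[nhds v] fun u => (∑ i, ∑ j, matA γ i j u * (u i * u j)) * (‖u‖ ^ 2)⁻¹ := by
    filter_upwards [isOpen_ne.mem_nhds h0] with u hu
    rw [ell1, if_neg hu, div_eq_mul_inv]
    simp_rw [mul_assoc]
  have hA := fun i j => differentiable_matA h1 h2 i j v
  have hN : DifferentiableAt ℝ (fun u : E3 => (‖u‖ ^ 2)⁻¹) v := (differentiable_norm_sq v).inv hn
  have hT : ∀ i j : Fin 3, DifferentiableAt ℝ (fun u : E3 => matA γ i j u * (u i * u j)) v :=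
    fun i j => by have := hA i j; fun_prop
  have hS : DifferentiableAt ℝ (fun u : E3 => ∑ i, ∑ j, matA γ i j u * (u i * u j)) v := by
    fun_prop
  refine ⟨(hS.mul hN).congr_of_eventuallyEq hev, ?_⟩
  rw [pd_congr k hev, pd_mul k hS hN, pd_sum k _ fun i _ => by fun_prop]
  have eN : pd k (fun u : E3 => (‖u‖ ^ 2)⁻¹) v = -((‖v‖ ^ 2) ^ 2)⁻¹ * (2 * v k) := by
    have := pd_comp k (φ := fun t => t⁻¹) (hasDerivAt_inv hn) (differentiable_norm_sq v)
    rw [this, pd_norm_sq]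
  have e1 : ∀ i, pd k (fun u : E3 => ∑ j, matA γ i j u * (u i * u j)) v =
      ∑ j, (pd k (matA γ i j) v * (v i * v j) +
        matA γ i j v * ((if k = i then 1 else 0) * v j + v i * (if k = j then 1 else 0))) :=
    fun i => by
      rw [pd_sum k _ fun j _ => hT i j]
      refine Finset.sum_congr rfl fun j _ => ?_
      rw [pd_mul k (hA i j) (by fun_prop), pd_mul k (by fun_prop) (by fun_prop), pd_coord, pd_coord]
  simp_rw [e1, eN]
  have orth : AForm γ v v (e3 k - (v k / ‖v‖ ^ 2) • v) = 0 := by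
    have ho : inner ℝ (e3 k - (v k / ‖v‖ ^ 2) • v) v = 0 := by
      rw [inner_sub_left, inner_smul_left, real_inner_self_eq_norm_sq]
      simp [EuclideanSpace.inner_single_left]
      field_simp
      simp
    exact AForm_eq_zero h1 h2 ho ho
  have orth' := orth
  rw [AForm_comm] at orth'
  have key : ∑ i, ∑ j, matA γ i j v * ((if k = i then 1 else 0) * v j +
      v i * (if k = j then 1 else 0)) = 2 * (v k / ‖v‖ ^ 2) *
        ∑ i, ∑ j, matA γ i j v * (v i * v j) := by
    have t : AForm γ v v (e3 k - (v k / ‖v‖ ^ 2) • v) +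
      AForm γ v (e3 k - (v k / ‖v‖ ^ 2) • v) v =
      ∑ i, ∑ j, matA γ i j v * ((if k = i then 1 else 0) * v j +
      v i * (if k = j then 1 else 0)) - 2 * (v k / ‖v‖ ^ 2) *
        ∑ i, ∑ j, matA γ i j v * (v i * v j) := by
      unfold AForm
      rw [Finset.mul_sum, ← Finset.sum_sub_distrib, ← Finset.sum_add_distrib]
      refine Finset.sum_congr rfl fun i _ => ?_
      rw [Finset.mul_sum, ← Finset.sum_sub_distrib, ← Finset.sum_add_distrib]
      refine Finset.sum_congr rfl fun j _ => ?_
      simp only [PiLp.sub_apply, PiLp.smul_apply, smul_eq_mul, PiLp.single_apply, eq_comm (a := k)]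
      ring
    rw [orth, orth'] at t
    linarith
  simp_rw [mul_add, Finset.sum_add_distrib] at key ⊢
  rw [key]
  have e2 : ∑ i, ∑ j, pd k (matA γ i j) v * (v i / ‖v‖) * (v j / ‖v‖) =
      (∑ i, ∑ j, pd k (matA γ i j) v * (v i * v j)) * (‖v‖ ^ 2)⁻¹ := by
    simp_rw [Finset.sum_mul]
    refine Finset.sum_congr rfl fun i _ => Finset.sum_congr rfl fun j _ => ?_
    field_simp
  rw [e2]
  have hn' : ‖v‖ ≠ 0 := norm_ne_zero_iff.2 h0
  field_simp
  ring

lemma differentiable_trA : Differentiable ℝ (trA γ) := by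
  have := fun i => differentiable_matA h1 h2 i i
  unfold trA
  fun_prop

/-- By `pd_ell1` the derivative is (∂_k 𝐀)u·u, and ∂_k falls on the Gaussian: the same anisotropic
bound as for ℓ₁ applies, with one more power of ⟨w⟩. -/
lemma abs_pd_ell1_le : ∃ C : ℝ, 0 ≤ C ∧ ∀ (v : E3) (k : Fin 3), v ≠ 0 →
    |pd k (ell1 γ) v| ≤ C * jap v ^ γ := by
  have i7 := integrable_jap_maxwellian 7
  refine ⟨512 * ∫ w, jap w ^ (7 : ℝ) * maxwellian w, mul_nonneg (by norm_num)
    (integral_nonneg fun w => mul_nonneg (jap_rpow_nonneg w _) (maxwellian_pos w).le),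
    fun v k h0 => ?_⟩
  obtain ⟨u, hu, hv⟩ := exists_dir v
  obtain ⟨A, hA⟩ := coord_maxwellian_abs_le k
  have hc : Continuous fun v : E3 => -(v k) * maxwellian v := by
    have := continuous_maxwellian; fun_prop
  rw [(pd_ell1 h1 h2 h0 k).2]
  simp_rw [unit_coord hv h0, pd_matA h1 h2]
  rw [integral_aForm_mul h1 h2 hc hA, ← Real.norm_eq_abs]
  have hb : ∀ w, ‖aForm γ (v - w) u u * (-(w k) * maxwellian w)‖ ≤
      (512 * jap v ^ γ) * (jap w ^ (7 : ℝ) * maxwellian w) := fun w => by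
    have a1 := aForm_unit_le h1 h2 hu hv w
    have a2 := (abs_coord_le w k).trans (norm_le_jap w)
    have a3 := (maxwellian_pos w).le
    have a4 := jap_rpow_nonneg w 6
    have a5 := jap_rpow_nonneg v γ
    have e : jap w ^ (7 : ℝ) = jap w ^ (6 : ℝ) * jap w := by
      rw [show (7 : ℝ) = 6 + 1 by norm_num, jap_rpow_add, Real.rpow_one]
    rw [Real.norm_eq_abs, abs_mul, abs_mul, abs_neg, abs_of_nonneg a3, e]
    calc _ ≤ (512 * jap w ^ (6 : ℝ) * jap v ^ γ) * (jap w * maxwellian w) := by gcongr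
      _ = _ := by ring
  refine (norm_integral_le_of_norm_le (i7.const_mul _) (.of_forall hb)).trans (le_of_eq ?_)
  rw [integral_const_mul]; ring

lemma abs_pd_trA_le : ∃ C : ℝ, 0 ≤ C ∧ ∀ (v : E3) (k : Fin 3),
    |pd k (trA γ) v| ≤ C * jap v ^ (γ + 2) := by
  have i4 := integrable_jap_maxwellian 4
  refine ⟨48 * ∫ w, jap w ^ (4 : ℝ) * maxwellian w, mul_nonneg (by norm_num)
    (integral_nonneg fun w => mul_nonneg (jap_rpow_nonneg w _) (maxwellian_pos w).le),
    fun v k => ?_⟩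
  have e : pd k (trA γ) v = ∑ i, pd k (matA γ i i) v :=
    pd_sum k _ fun i _ => differentiable_matA h1 h2 i i v
  have hb : ∀ i w, ‖aKer γ i i (v - w) * (-(w k) * maxwellian w)‖ ≤
      (16 * jap v ^ (γ + 2)) * (jap w ^ (4 : ℝ) * maxwellian w) := fun i w => by
    have a1 := (abs_aKer_le i i (v - w)).trans
      (mul_le_mul_of_nonneg_left (norm_sub_rpow_le h1 h2 v w) (by norm_num))
    have a2 := (abs_coord_le w k).trans (norm_le_jap w)
    have a3 := (maxwellian_pos w).le
    have a4 := jap_rpow_nonneg w 3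
    have a5 := jap_rpow_nonneg v (γ + 2)
    have e : jap w ^ (4 : ℝ) = jap w ^ (3 : ℝ) * jap w := by
      rw [show (4 : ℝ) = 3 + 1 by norm_num, jap_rpow_add, Real.rpow_one]
    rw [Real.norm_eq_abs, abs_mul, abs_mul, abs_neg, abs_of_nonneg a3, e]
    calc _ ≤ (2 * (8 * jap w ^ (3 : ℝ) * jap v ^ (γ + 2))) * (jap w * maxwellian w) := by
          gcongr
      _ = _ := by ring
  rw [e]
  refine (Finset.abs_sum_le_sum_abs _ _).trans ((Finset.sum_le_sum fun i _ =>
    (?_ : _ ≤ 16 * jap v ^ (γ + 2) * ∫ w, jap w ^ (4 : ℝ) * maxwellian w)).trans (le_of_eq ?_))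
  · rw [pd_matA h1 h2, ← Real.norm_eq_abs, ← integral_const_mul]
    exact norm_integral_le_of_norm_le (i4.const_mul _) (.of_forall (hb i))
  · simp; ring

lemma abs_pd_ell_le : ∃ C : ℝ, 0 < C ∧ ∀ (v : E3) (k : Fin 3), v ≠ 0 →
    |pd k (ell1 γ) v| ≤ C * jap v ^ γ ∧ |pd k (ell2 γ) v| ≤ C * jap v ^ (γ + 2) := by
  obtain ⟨C, hC, h⟩ := abs_pd_ell1_le h1 h2
  obtain ⟨D, hD, h'⟩ := abs_pd_trA_le h1 h2
  refine ⟨C + D + 1, by positivity, fun v k h0 => ?_⟩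
  have g1 := jap_rpow_pos v γ
  have g2 := jap_rpow_pos v (γ + 2)
  have g3 := jap_rpow_mono v (show γ ≤ γ + 2 by linarith)
  have b1 := h v k h0
  have b2 := h' v k
  have t1 : C * jap v ^ γ ≤ C * jap v ^ (γ + 2) := by gcongr
  have e : pd k (ell2 γ) v = (pd k (trA γ) v - pd k (ell1 γ) v) / 2 := by
    have : ell2 γ = fun u => (1 / 2) * (trA γ u - ell1 γ u) := by
      funext u; rw [ell2]; ring
    rw [this, pd_const_mul, pd_sub k (differentiable_trA h1 h2 v) (pd_ell1 h1 h2 h0 k).1]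
    ring
  have := abs_sub (pd k (trA γ) v) (pd k (ell1 γ) v)
  have n1 := mul_nonneg hD g1.le
  have n2 := mul_nonneg hD g2.le
  have n3 := mul_nonneg hC g2.le
  refine ⟨by linarith, ?_⟩
  rw [e, abs_div, abs_two]
  linarith

omit h1 h2 in
/-- The distance of `𝐀(v)` to `𝐀(0)`. -/
def distA (γ : ℝ) (v : E3) : ℝ := ∑ i, ∑ j, |matA γ i j v - matA γ i j 0|

lemma ell_sub_le (v : E3) : |ell1 γ v - ell1 γ 0| ≤ distA γ v ∧
    |ell2 γ v - ell1 γ 0| ≤ distA γ v := by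
  obtain ⟨u, hu, hv⟩ := exists_dir v
  have e1 := ell1_eq h1 h2 hu hv
  have e0 := ell1_eq h1 h2 hu (show (0 : E3) = ‖(0 : E3)‖ • u by simp)
  have t0 : trA γ 0 = 3 * ell1 γ 0 := by
    simp [ell1]; ring
  have d1 : ell1 γ v - ell1 γ 0 = ∑ i, ∑ j, (matA γ i j v - matA γ i j 0) * (u i * u j) := by
    rw [e1, e0, AForm, AForm, ← Finset.sum_sub_distrib]
    refine Finset.sum_congr rfl fun i _ => ?_
    rw [← Finset.sum_sub_distrib]
    exact Finset.sum_congr rfl fun j _ => by ring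
  have d2 : ell2 γ v - ell1 γ 0 = ∑ i, ∑ j, (matA γ i j v - matA γ i j 0) *
      (((if i = j then 1 else 0) - u i * u j) / 2) := by
    have : ell2 γ v - ell1 γ 0 = ((trA γ v - trA γ 0) - (ell1 γ v - ell1 γ 0)) / 2 := by
      rw [ell2, t0]; ring
    rw [this, d1, trA, trA]
    simp [Fin.sum_univ_three]
    ring
  constructor
  · rw [d1]
    refine (Finset.abs_sum_le_sum_abs _ _).trans (Finset.sum_le_sum fun i _ =>
      (Finset.abs_sum_le_sum_abs _ _).trans (Finset.sum_le_sum fun j _ => ?_))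
    rw [abs_mul]
    exact mul_le_of_le_one_right (abs_nonneg _) (abs_unit_mul_le hu i j)
  · rw [d2]
    refine (Finset.abs_sum_le_sum_abs _ _).trans (Finset.sum_le_sum fun i _ =>
      (Finset.abs_sum_le_sum_abs _ _).trans (Finset.sum_le_sum fun j _ => ?_))
    rw [abs_mul]
    refine mul_le_of_le_one_right (abs_nonneg _) ?_
    rw [abs_div, abs_two]
    linarith [abs_delta_sub_unit_le hu i j]

lemma distA_le : ∃ L : ℝ, 0 ≤ L ∧ ∀ v : E3, ‖v‖ ≤ 1 → distA γ v ≤ L * ‖v‖ := by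
  choose L hL0 hL using fun i j => norm_fderiv_matA_le h1 h2 i j
  refine ⟨∑ i, ∑ j, L i j, Finset.sum_nonneg fun i _ => Finset.sum_nonneg fun j _ => hL0 i j,
    fun v hv => ?_⟩
  unfold distA
  rw [Finset.sum_mul]
  refine Finset.sum_le_sum fun i _ => ?_
  rw [Finset.sum_mul]
  refine Finset.sum_le_sum fun j _ => ?_
  have := (convex_closedBall (0 : E3) 1).norm_image_sub_le_of_norm_fderiv_le (𝕜 := ℝ)
    (f := matA γ i j) (x := 0) (y := v)
    (fun x _ => differentiable_matA h1 h2 i j x) (fun x hx => hL i j x (by simpa using hx))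
    (by simp) (by simpa using hv)
  simpa using this

/-- The kernel a and the Gaussian are even, so 𝐀 is even and its differential at the origin
vanishes. -/
lemma distA_isLittleO : (fun v : E3 => distA γ v) =o[nhds (0 : E3)] fun v : E3 => v := by
  unfold distA
  refine Asymptotics.IsLittleO.fun_sum fun i _ => Asymptotics.IsLittleO.fun_sum fun j _ => ?_
  have hz : fderiv ℝ (matA γ i j) 0 = 0 := by
    have hev : ∀ v, matA γ i j (-v) = matA γ i j v := fun v => by
      unfold matA
      rw [← integral_neg_eq_self]
      refine integral_congr_ae (.of_forall fun w => ?_)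
      have e1 : aKer γ i j (-v - -w) = aKer γ i j (v - w) := by
        rw [show -v - -w = -(v - w) by abel, aKer, aKer, norm_neg, PiLp.neg_apply, PiLp.neg_apply,
          neg_mul_neg]
      simp only [e1]
      simp [maxwellian]
    have hd := (differentiable_matA h1 h2 i j 0).hasFDerivAt
    have hd' : HasFDerivAt (matA γ i j) (fderiv ℝ (matA γ i j) 0) (-(0 : E3)) := by simpa using hd
    have h3 := hd'.comp (0 : E3) (hasFDerivAt_id (0 : E3)).neg
    have h4 : HasFDerivAt (matA γ i j) ((fderiv ℝ (matA γ i j) 0).comp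
        (-ContinuousLinearMap.id ℝ E3)) 0 :=
      h3.congr_of_eventuallyEq (.of_forall fun v => (hev v).symm)
    have h5 := hd.unique h4
    ext p
    have h6 := congrArg (fun L : E3 →L[ℝ] ℝ => L p) h5
    simp at h6
    simp
    linarith
  have hd := (differentiable_matA h1 h2 i j 0).hasFDerivAt
  rw [hz, hasFDerivAt_iff_isLittleO_nhds_zero] at hd
  simp only [zero_add, zero_apply, sub_zero] at hd
  exact hd.abs_left

omit h1 h2 in
lemma abs_sqrt_sub_le {a b : ℝ} (ha : 0 ≤ a) (hb : 0 < b) : |√a - √b| ≤ |a - b| / √b := by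
  have hs := Real.sqrt_pos.2 hb
  rw [le_div_iff₀ hs]
  have e : a - b = (√a - √b) * (√a + √b) := by
    have := Real.mul_self_sqrt ha
    have := Real.mul_self_sqrt hb.le
    linarith
  rw [e, abs_mul]
  gcongr
  exact (le_add_of_nonneg_left (Real.sqrt_nonneg a)).trans (le_abs_self _)

/-- The projections in 𝐁 have no limit at the origin, but they are bounded and both eigenvalues tend
to ℓ₁(0). Hence |𝐁(v) − 𝐁(0)| is controlled by the distance of 𝐀(v) to 𝐀(0), which is o(|v|). -/
lemma hasFDerivAt_matB_zero (i j : Fin 3) : HasFDerivAt (matB γ i j) (0 : E3 →L[ℝ] ℝ) 0 := by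
  rw [hasFDerivAt_iff_isLittleO_nhds_zero]
  simp only [zero_add, zero_apply, sub_zero]
  have hα := (ell_pos h1 h2 0).1
  refine Asymptotics.IsBigO.trans_isLittleO ?_ (distA_isLittleO h1 h2)
  refine Asymptotics.IsBigO.of_bound (3 / √(ell1 γ 0)) (.of_forall fun v => ?_)
  obtain ⟨u, hu, hv⟩ := exists_dir v
  have e0 := matB_eq γ (show (0 : E3) = ‖(0 : E3)‖ • u by simp) i j
  rw [← ell_zero] at e0
  rw [matB_eq γ hv, e0]
  have e : √(ell1 γ v) * (u i * u j) + √(ell2 γ v) * ((if i = j then 1 else 0) - u i * u j) -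
      (√(ell1 γ 0) * (u i * u j) + √(ell1 γ 0) * ((if i = j then 1 else 0) - u i * u j)) =
      (√(ell1 γ v) - √(ell1 γ 0)) * (u i * u j) +
        (√(ell2 γ v) - √(ell1 γ 0)) * ((if i = j then 1 else 0) - u i * u j) := by ring
  have dn : 0 ≤ distA γ v := Finset.sum_nonneg fun _ _ => Finset.sum_nonneg fun _ _ => abs_nonneg _
  rw [e, Real.norm_eq_abs, Real.norm_of_nonneg dn]
  refine (abs_add_le _ _).trans ?_
  rw [abs_mul _ (u i * u j), abs_mul _ (_ - _)]
  have a1 := abs_sqrt_sub_le (ell_pos h1 h2 v).1.le hα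
  have a2 := abs_sqrt_sub_le (ell_pos h1 h2 v).2.le hα
  obtain ⟨b1, b2⟩ := ell_sub_le h1 h2 v
  have hs := Real.sqrt_pos.2 hα
  calc _ ≤ (|ell1 γ v - ell1 γ 0| / √(ell1 γ 0)) * 1 +
        (|ell2 γ v - ell1 γ 0| / √(ell1 γ 0)) * 2 := by
        gcongr
        · exact abs_unit_mul_le hu i j
        · exact abs_delta_sub_unit_le hu i j
    _ ≤ (distA γ v / √(ell1 γ 0)) * 1 + (distA γ v / √(ell1 γ 0)) * 2 := by gcongr
    _ = _ := by ring

omit h1 h2 in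
lemma pd_proj {v : E3} (h0 : v ≠ 0) (k i j : Fin 3) :
    DifferentiableAt ℝ (fun u : E3 => u i / ‖u‖ * (u j / ‖u‖)) v ∧
    |pd k (fun u : E3 => u i / ‖u‖ * (u j / ‖u‖)) v| ≤ 4 * ‖v‖⁻¹ := by
  have hp : 0 < ‖v‖ := norm_pos_iff.2 h0
  have hn : ‖v‖ ^ 2 ≠ 0 := by positivity
  have hN : DifferentiableAt ℝ (fun u : E3 => (‖u‖ ^ 2)⁻¹) v := (differentiable_norm_sq v).inv hn
  have e : (fun u : E3 => u i / ‖u‖ * (u j / ‖u‖)) = fun u => (u i * u j) * (‖u‖ ^ 2)⁻¹ := by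
    funext u; rw [div_mul_div_comm, div_eq_mul_inv, ← sq]
  rw [e]
  refine ⟨by fun_prop, ?_⟩
  have eN : pd k (fun u : E3 => (‖u‖ ^ 2)⁻¹) v = -((‖v‖ ^ 2) ^ 2)⁻¹ * (2 * v k) := by
    have := pd_comp k (φ := fun t => t⁻¹) (hasDerivAt_inv hn) (differentiable_norm_sq v)
    rw [this, pd_norm_sq]
  rw [pd_mul k (by fun_prop) hN, pd_mul k (by fun_prop) (by fun_prop), pd_coord, pd_coord, eN]
  have c1 := abs_coord_le v i
  have c2 := abs_coord_le v j
  have c3 := abs_coord_le v k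
  have d1 : |(if k = i then 1 else 0) * v j + v i * (if k = j then 1 else 0)| ≤ 2 * ‖v‖ := by
    rw [abs_le] at *
    constructor <;> split_ifs <;> linarith
  refine (abs_add_le _ _).trans ?_
  simp only [abs_mul, abs_neg, abs_inv, abs_two, abs_pow, abs_norm]
  calc _ ≤ (2 * ‖v‖) * (‖v‖ ^ 2)⁻¹ + ‖v‖ * ‖v‖ * (((‖v‖ ^ 2) ^ 2)⁻¹ * (2 * ‖v‖)) := by
        gcongr
    _ = _ := by field_simp; ring

lemma matB_deriv {v : E3} (h0 : v ≠ 0) (k i j : Fin 3) : DifferentiableAt ℝ (matB γ i j) v ∧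
    pd k (matB γ i j) v = pd k (ell1 γ) v / (2 * √(ell1 γ v)) * (v i / ‖v‖ * (v j / ‖v‖)) +
      pd k (ell2 γ) v / (2 * √(ell2 γ v)) *
        ((if i = j then 1 else 0) - v i / ‖v‖ * (v j / ‖v‖)) +
      (√(ell1 γ v) - √(ell2 γ v)) * pd k (fun u : E3 => u i / ‖u‖ * (u j / ‖u‖)) v := by
  obtain ⟨p1, p2⟩ := ell_pos h1 h2 v
  have d1 := (pd_ell1 h1 h2 h0 k).1
  have d2 : DifferentiableAt ℝ (ell2 γ) v := by
    have d3 := differentiable_trA h1 h2 v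
    change DifferentiableAt ℝ (fun u => (trA γ u - ell1 γ u) / 2) v
    fun_prop
  have dP := (pd_proj h0 k i j).1
  have s1 : DifferentiableAt ℝ (fun u => √(ell1 γ u)) v := d1.sqrt p1.ne'
  have s2 : DifferentiableAt ℝ (fun u => √(ell2 γ u)) v := d2.sqrt p2.ne'
  have q1 : pd k (fun u => √(ell1 γ u)) v = pd k (ell1 γ) v / (2 * √(ell1 γ v)) := by
    rw [pd_comp k (Real.hasDerivAt_sqrt p1.ne') d1]; ring
  have q2 : pd k (fun u => √(ell2 γ u)) v = pd k (ell2 γ) v / (2 * √(ell2 γ v)) := by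
    rw [pd_comp k (Real.hasDerivAt_sqrt p2.ne') d2]; ring
  have dQ : DifferentiableAt ℝ
      (fun u : E3 => (if i = j then (1 : ℝ) else 0) - u i / ‖u‖ * (u j / ‖u‖)) v :=
    (differentiableAt_const _).sub dP
  have e0 : pd k (fun _ : E3 => if i = j then (1 : ℝ) else 0) v = 0 := by simp [pd]
  have m1 := s1.mul dP
  have m2 := s2.mul dQ
  refine ⟨m1.add m2, ?_⟩
  have e := pd_add k m1 m2
  have f1 := pd_mul k s1 dP
  have f2 := pd_mul k s2 dQ
  rw [pd_sub k (differentiableAt_const _) dP, e0, q2] at f2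
  rw [q1] at f1
  refine e.trans ((congrArg₂ (· + ·) f1 f2).trans ?_)
  ring

lemma differentiable_matB (i j : Fin 3) : Differentiable ℝ (matB γ i j) := fun v => by
  rcases eq_or_ne v 0 with rfl | h0
  · exact (hasFDerivAt_matB_zero h1 h2 i j).differentiableAt
  · exact (matB_deriv h1 h2 h0 0 i j).1

lemma continuous_matB (i j : Fin 3) : Continuous (matB γ i j) :=
  (differentiable_matB h1 h2 i j).continuous

lemma pd_matB_eq (k i j : Fin 3) (v : E3) :
    pd k (matB γ i j) v = ∑ q, matE γ k i q v * matB γ q j v := by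
  simp_rw [matE, Finset.sum_mul]
  rw [Finset.sum_comm]
  simp_rw [mul_assoc, ← Finset.mul_sum, matBinv_mul_matB h1 h2]
  simp

/-- The oscillation of the eigenvalues near the origin. -/
lemma sqrt_ell_sub_le : ∃ C : ℝ, 0 < C ∧ ∀ v : E3, v ≠ 0 →
    |√(ell1 γ v) - √(ell2 γ v)| * ‖v‖⁻¹ ≤ C * jap v ^ (γ / 2) := by
  obtain ⟨c, C, hc, hC, h⟩ := sqrt_ell_bounds h1 h2
  obtain ⟨L, hL0, hL⟩ := distA_le h1 h2
  have hα := (ell_pos h1 h2 0).1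
  have hs := Real.sqrt_pos.2 hα
  refine ⟨4 * C + 8 * (L / √(ell1 γ 0)), by positivity, fun v h0 => ?_⟩
  have hp : 0 < ‖v‖ := norm_pos_iff.2 h0
  have g0 := jap_rpow_nonneg v (γ / 2)
  -- Near the origin 𝐀 is Lipschitz, so both eigenvalues are within O(|v|) of ℓ₁(0). Far away, 1/|v|
  -- compensates the extra power of ⟨v⟩ in √ℓ₂.
  rcases le_total ‖v‖ 1 with hv | hv
  · obtain ⟨b1, b2⟩ := ell_sub_le h1 h2 v
    have a1 := abs_sqrt_sub_le (ell_pos h1 h2 v).1.le hα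
    have a2 := abs_sqrt_sub_le (ell_pos h1 h2 v).2.le hα
    have a3 : |√(ell1 γ v) - √(ell2 γ v)| ≤ 2 * (L / √(ell1 γ 0)) * ‖v‖ := by
      have t := abs_sub (√(ell1 γ v) - √(ell1 γ 0)) (√(ell2 γ v) - √(ell1 γ 0))
      rw [sub_sub_sub_cancel_right] at t
      have u1 : |ell1 γ v - ell1 γ 0| / √(ell1 γ 0) ≤ L / √(ell1 γ 0) * ‖v‖ := by
        rw [div_mul_eq_mul_div]
        exact div_le_div_of_nonneg_right (b1.trans (hL v hv)) hs.le
      have u2 : |ell2 γ v - ell1 γ 0| / √(ell1 γ 0) ≤ L / √(ell1 γ 0) * ‖v‖ := by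
        rw [div_mul_eq_mul_div]
        exact div_le_div_of_nonneg_right (b2.trans (hL v hv)) hs.le
      linarith
    have a4 : 1 / 4 ≤ jap v ^ (γ / 2) := by
      have : jap v ^ (-1 : ℝ) ≤ jap v ^ (γ / 2) := jap_rpow_mono v (by linarith)
      refine le_trans ?_ this
      rw [Real.rpow_neg_one, ← one_div]
      exact one_div_le_one_div_of_le (jap_pos v) ((jap_le v).trans (by linarith))
    rw [← div_eq_mul_inv, div_le_iff₀ hp]
    have q : 0 ≤ L / √(ell1 γ 0) * ‖v‖ := by positivity
    nlinarith [mul_nonneg (mul_nonneg hC.le g0) hp.le]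
  · obtain ⟨_, a1, _, a2⟩ := h v
    have s1 := Real.sqrt_nonneg (ell1 γ v)
    have s2 := Real.sqrt_nonneg (ell2 γ v)
    have g1 : jap v ^ (γ / 2 + 1) ≤ 2 * ‖v‖ * jap v ^ (γ / 2) := by
      rw [jap_rpow_add, Real.rpow_one, mul_comm]
      gcongr
      linarith [jap_le v]
    have g2 := jap_rpow_mono v (show γ / 2 ≤ γ / 2 + 1 by linarith)
    have t : |√(ell1 γ v) - √(ell2 γ v)| ≤ √(ell1 γ v) + √(ell2 γ v) := by
      rw [abs_le]; constructor <;> linarith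
    rw [← div_eq_mul_inv, div_le_iff₀ hp]
    have q : 0 ≤ L / √(ell1 γ 0) * jap v ^ (γ / 2) * ‖v‖ := by positivity
    nlinarith

/-- The matrices `(∂_k 𝐁) 𝐁⁻¹` are bounded. -/
lemma abs_matE_le : ∃ C : ℝ, 0 < C ∧ ∀ (v : E3) (k i j : Fin 3), |matE γ k i j v| ≤ C := by
  obtain ⟨c, C, hc, hC, hl⟩ := ell_bounds h1 h2
  obtain ⟨D, hD, hd⟩ := abs_pd_ell_le h1 h2
  obtain ⟨S, hS, hs⟩ := sqrt_ell_sub_le h1 h2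
  obtain ⟨I, hI, hi⟩ := abs_matBinv_le h1 h2
  refine ⟨D / c + D / c * 2 + 3 * (4 * S * I), by positivity, fun v k i j => ?_⟩
  rcases eq_or_ne v 0 with rfl | h0
  · have : ∀ n, pd k (matB γ i n) 0 = 0 := fun n => by
      rw [pd, (hasFDerivAt_matB_zero h1 h2 i n).fderiv]; rfl
    simp only [matE, this, zero_mul, Finset.sum_const_zero, abs_zero]
    positivity
  obtain ⟨u, hu, hv⟩ := exists_dir v
  obtain ⟨p1, p2⟩ := ell_pos h1 h2 v
  have q1 := Real.sqrt_pos.2 p1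
  have q2 := Real.sqrt_pos.2 p2
  obtain ⟨d1, d2⟩ := hd v k h0
  obtain ⟨l1, _, l2, _⟩ := hl v
  have hN : v i / ‖v‖ = u i := unit_coord hv h0 i
  set R : Fin 3 → ℝ := fun n => (√(ell1 γ v) - √(ell2 γ v)) *
    pd k (fun u : E3 => u i / ‖u‖ * (u n / ‖u‖)) v * matBinv γ n j v with hR
  -- Differentiating the eigenvalues gives terms built on the same projections as 𝐁⁻¹, so the
  -- products reduce to the bounded quotients ∂ℓ/(2ℓ). What is left is the derivative of the
  -- projection, of size 1/|v|, multiplied by √ℓ₁ − √ℓ₂ and by 𝐁⁻¹.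
  have e : matE γ k i j v = pd k (ell1 γ) v / (2 * ell1 γ v) * (u i * u j) +
      pd k (ell2 γ) v / (2 * ell2 γ v) * ((if i = j then 1 else 0) - u i * u j) +
      ∑ n, R n := by
    have : matE γ k i j v = ∑ n, (pd k (ell1 γ) v / (2 * √(ell1 γ v)) * (u i * u n) +
      pd k (ell2 γ) v / (2 * √(ell2 γ v)) * ((if i = n then 1 else 0) - u i * u n)) *
        ((√(ell1 γ v))⁻¹ * (u n * u j) +
      (√(ell2 γ v))⁻¹ * ((if n = j then 1 else 0) - u n * u j)) + ∑ n, R n := by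
      rw [← Finset.sum_add_distrib, matE]
      refine Finset.sum_congr rfl fun n _ => ?_
      rw [(matB_deriv h1 h2 h0 k i n).2, ← matBinv_eq γ hv, hN, unit_coord hv h0, hR]
      ring
    rw [this, sum_decomp hu]
    congr 2
    · rw [show pd k (ell1 γ) v / (2 * √(ell1 γ v)) * (√(ell1 γ v))⁻¹ =
        pd k (ell1 γ) v / (2 * ell1 γ v) by
        rw [← div_eq_mul_inv, div_div, mul_assoc, Real.mul_self_sqrt p1.le]]
    · rw [show pd k (ell2 γ) v / (2 * √(ell2 γ v)) * (√(ell2 γ v))⁻¹ =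
        pd k (ell2 γ) v / (2 * ell2 γ v) by
        rw [← div_eq_mul_inv, div_div, mul_assoc, Real.mul_self_sqrt p2.le]]
  have r1 : |pd k (ell1 γ) v / (2 * ell1 γ v)| ≤ D / c := by
    rw [abs_div, abs_of_pos (show 0 < 2 * ell1 γ v by linarith),
      div_le_div_iff₀ (by linarith) hc]
    have := mul_le_mul_of_nonneg_right d1 hc.le
    nlinarith [mul_le_mul_of_nonneg_left l1 hD.le, mul_pos hD p1]
  have r2 : |pd k (ell2 γ) v / (2 * ell2 γ v)| ≤ D / c := by
    rw [abs_div, abs_of_pos (show 0 < 2 * ell2 γ v by linarith),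
      div_le_div_iff₀ (by linarith) hc]
    have := mul_le_mul_of_nonneg_right d2 hc.le
    nlinarith [mul_le_mul_of_nonneg_left l2 hD.le, mul_pos hD p2]
  have r3 : ∀ n, |R n| ≤ 4 * S * I := fun n => by
    have a1 := (pd_proj h0 k i n).2
    have a2 := hi v n j
    have a3 := hs v h0
    have g : jap v ^ (γ / 2) * jap v ^ (-(γ / 2)) = 1 := by rw [← jap_rpow_add]; simp
    simp only [hR]
    rw [abs_mul, abs_mul]
    have g1 := jap_rpow_nonneg v (γ / 2)
    have g2 := jap_rpow_nonneg v (-(γ / 2))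
    calc _ ≤ |√(ell1 γ v) - √(ell2 γ v)| * (4 * ‖v‖⁻¹) * (I * jap v ^ (-(γ / 2))) := by gcongr
      _ = 4 * I * (|√(ell1 γ v) - √(ell2 γ v)| * ‖v‖⁻¹) * jap v ^ (-(γ / 2)) := by ring
      _ ≤ 4 * I * (S * jap v ^ (γ / 2)) * jap v ^ (-(γ / 2)) := by gcongr
      _ = 4 * S * I * (jap v ^ (γ / 2) * jap v ^ (-(γ / 2))) := by ring
      _ = _ := by rw [g, mul_one]
  rw [e]
  refine (abs_add_le _ _).trans (add_le_add ((abs_add_le _ _).trans (add_le_add ?_ ?_)) ?_)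
  · rw [abs_mul]
    have := abs_unit_mul_le hu i j
    calc _ ≤ D / c * 1 := by gcongr
      _ = _ := mul_one _
  · rw [abs_mul]
    have := abs_delta_sub_unit_le hu i j
    gcongr
  · refine (Finset.abs_sum_le_sum_abs _ _).trans ((Finset.sum_le_sum fun n _ => r3 n).trans ?_)
    simp

lemma abs_pd_matB_le : ∃ C : ℝ, 0 < C ∧ ∀ (v : E3) (k i j : Fin 3),
    |pd k (matB γ i j) v| ≤ C * jap v ^ (γ / 2 + 1) := by
  obtain ⟨E, hE, he⟩ := abs_matE_le h1 h2
  obtain ⟨B, hB, hb⟩ := abs_matB_le h1 h2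
  refine ⟨3 * (E * B), by positivity, fun v k i j => ?_⟩
  rw [pd_matB_eq h1 h2]
  refine (Finset.abs_sum_le_sum_abs _ _).trans
    ((Finset.sum_le_sum fun q _ => (?_ : _ ≤ E * (B * jap v ^ (γ / 2 + 1)))).trans (le_of_eq ?_))
  · rw [abs_mul]
    have := he v k i q
    have := hb v q j
    gcongr
  · simp; ring

end

/-! ### The structure of `Γ` -/

/-- The convolution of a kernel with `√M g`. -/
def KK (K : E3 → ℝ) (g : E3 → E3 → ℝ) (x v : E3) : ℝ := ∫ w, K (v - w) * (sqrtM w * g x w)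

/-- The fluxes `J_i` such that `Γ(g₁,g₂) = ∑ (∂_i - v_i/2) J_i`. -/
def JJ (γ : ℝ) (i : Fin 3) (g₁ g₂ : E3 → E3 → ℝ) (x v : E3) : ℝ :=
  ∑ j, (KK (aKer γ i j) g₁ x v * pv j g₂ x v - KK (aKer γ i j) (pv j g₁) x v * g₂ x v)

section

variable {K : E3 → ℝ} {n : ℕ} {s t : ℝ} {f g : E3 → E3 → ℝ}

lemma integral_comp_sub (F : E3 → E3 → ℝ) (v : E3) :
    ∫ w, F (v - w) w = ∫ z, F z (v - z) := by
  rw [← integral_sub_left_eq_self (fun z => F z (v - z)) volume v]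
  simp

lemma unc_KK (K : E3 → ℝ) (g : E3 → E3 → ℝ) :
    unc (KK K g) = conv K (unc fun x v => sqrtM v * g x v) := by
  funext p
  exact integral_comp_sub (fun z w => K z * (sqrtM w * g p.1 w)) p.2

lemma Sm.KK (hK : Ker K) (H : Sm n s g) : Sm n 12 (KK K g) := by
  unfold Sm
  rw [unc_KK]
  exact Gr.conv hK n (H.sqrtM_mul (-12))

lemma KK_integrable (hK : Ker K) (H : Sm n s g) (x v : E3) :
    Integrable fun w => K (v - w) * (sqrtM w * g x w) := by
  have h := (conv_integrable hK ((H.sqrtM_mul (-12)).le (Nat.zero_le _)) (x, v)).comp_sub_left v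
  simpa [unc] using h

lemma Sm.dec1 (H : Sm (n + 1) s g) (x : E3) : Dec1 fun v => sqrtM v * g x v := by
  have H' := H.sqrtM_mul (-12)
  refine ⟨(H'.contDiff_v x).of_le (by simp), ?_⟩
  obtain ⟨A, hA0, hA⟩ := Gr.bound H'
  choose B hB0 hB using fun j => Gr.bound (H'.pv j)
  refine ⟨A + ∑ j, B j, fun v => ⟨(hA (x, v)).trans ?_, fun j => (hB j (x, v)).trans ?_⟩⟩
  · have := jap_rpow_nonneg v (-12)
    have : 0 ≤ ∑ j, B j := Finset.sum_nonneg fun j _ => (hB0 j).le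
    gcongr
    linarith
  · have := jap_rpow_nonneg v (-12)
    have : B j ≤ ∑ j, B j :=
      Finset.single_le_sum (f := B) (fun j _ => (hB0 j).le) (Finset.mem_univ j)
    gcongr
    linarith

lemma dx_sqrtM_mul (k : Fin 3) (g : E3 → E3 → ℝ) :
    dx k (fun x v => sqrtM v * g x v) = fun x v => sqrtM v * dx k g x v := by
  funext x v
  exact pd_const_mul k (sqrtM v) (fun y => g y v) x

lemma pv_sqrtM_mul (k : Fin 3) (H : Sm (n + 1) s g) (x v : E3) :
    pv k (fun x v => sqrtM v * g x v) x v = sqrtM v * (pv k g x v - v k / 2 * g x v) := by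
  change pd k (fun v => sqrtM v * g x v) v = _
  rw [pd_mul k (differentiable_sqrtM v) (H.diff_v x v), pd_sqrtM]
  simp only [pv]; ring

lemma fderiv_KK_apply (hK : Ker K) (H : Sm (n + 1) s g) (p e : E3 × E3) :
    fderiv ℝ (unc (KK K g)) p e =
      conv K (fun q => fderiv ℝ (unc fun x v => sqrtM v * g x v) q e) p := by
  have H' : Gr (n + 1) (-12) (unc fun x v => sqrtM v * g x v) := H.sqrtM_mul (-12)
  have H1 := H'.mono (show 1 ≤ n + 1 by omega) le_rfl
  rw [unc_KK, fderiv_conv hK H1]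
  unfold conv
  have hi := conv_integrable hK (H'.fderiv.mono (Nat.zero_le _) le_rfl) p
  exact (ContinuousLinearMap.apply ℝ ℝ e).integral_comp_comm hi |>.symm

lemma dx_KK (hK : Ker K) (H : Sm (n + 1) s g) (k : Fin 3) : dx k (KK K g) = KK K (dx k g) := by
  suffices h : unc (dx k (KK K g)) = unc (KK K (dx k g)) from
    funext fun x => funext fun v => congrFun h (x, v)
  rw [unc_dx (Gr.differentiable (H.KK hK)), unc_KK K (dx k g), ← dx_sqrtM_mul,
    unc_dx (Gr.differentiable (n := n) (H.sqrtM_mul 0))]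
  exact funext fun p => fderiv_KK_apply hK H p _

lemma KK_sub (hK : Ker K) {m : ℕ} (H : Sm n s f) (H' : Sm m t g) (x v : E3) :
    KK K (fun x v => f x v - g x v) x v = KK K f x v - KK K g x v := by
  unfold KK
  rw [← integral_sub (KK_integrable hK H x v) (KK_integrable hK H' x v)]
  congr 1; funext w; ring

lemma KK_const_mul (K : E3 → ℝ) (c : ℝ) (g : E3 → E3 → ℝ) (x v : E3) :
    KK K (fun x v => c * g x v) x v = c * KK K g x v := by
  unfold KK
  rw [← integral_const_mul]
  congr 1; funext w; ring

/-- The function `w_k g`. -/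
def cmul (k : Fin 3) (g : E3 → E3 → ℝ) (x v : E3) : ℝ := v k * g x v

lemma Sm.cmul (H : Sm n s g) (k : Fin 3) : Sm n (1 + s) (cmul k g) := (Sm.coord n k).mul H

lemma KK_pv_eq (hK : Ker K) (H : Sm (n + 1) s g) (k : Fin 3) (x v : E3) :
    ∫ z, K z * pd k (fun w => sqrtM w * g x w) (v - z) =
      KK K (pv k g) x v - 1 / 2 * KK K (cmul k g) x v := by
  rw [← KK_const_mul, ← KK_sub hK (H.pv k) ((H.cmul k).const_mul (1 / 2)), KK,
    ← integral_comp_sub (fun z w => K z * pd k (fun w => sqrtM w * g x w) w) v]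
  refine integral_congr_ae (.of_forall fun w => ?_)
  have := pv_sqrtM_mul k H x w
  simp only [pv] at this ⊢
  simp only [this, Landau.cmul]
  ring

/-- A convolution is differentiated on its smooth factor √M g; the Gaussian contributes the factor
−w_k/2. -/
lemma pv_KK (hK : Ker K) (H : Sm (n + 1) s g) (k : Fin 3) (x v : E3) :
    pv k (KK K g) x v = KK K (pv k g) x v - 1 / 2 * KK K (cmul k g) x v := by
  have h1 := congrFun (unc_pv (Gr.differentiable (H.KK hK)) k) (x, v)
  have h2 := unc_pv (Gr.differentiable (n := n) (H.sqrtM_mul 0)) k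
  rw [fderiv_KK_apply hK H, ← h2] at h1
  rw [← KK_pv_eq hK H]
  exact h1

end

/-! ### The divergence form of Γ and its derivatives in x. -/

section

variable {γ : ℝ} (h1 : -2 ≤ γ) (h2 : γ ≤ 1)
include h1 h2

/-- The convolution `∑_j a_{ij} * (√M ∂_j g)` as a convolution of `√M g`. -/
lemma sum_KK_pv {n : ℕ} {s : ℝ} {g : E3 → E3 → ℝ} (H : Sm (n + 1) s g) (i : Fin 3) (x v : E3) :
    ∑ j, KK (aKer γ i j) (pv j g) x v =
      KK (bKer γ i) g x v + 1 / 2 * ∑ j, KK (aKer γ i j) (cmul j g) x v := by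
  have h := sum_integral_aKer_pd h1 h2 i (H.dec1 x) v
  simp_rw [KK_pv_eq (ker_aKer h1 h2 _ _) H] at h
  rw [Finset.sum_sub_distrib, ← Finset.mul_sum] at h
  have e : ∫ z, bKer γ i z * (fun v => sqrtM v * g x v) (v - z) = KK (bKer γ i) g x v :=
    (integral_comp_sub (fun z w => bKer γ i z * (sqrtM w * g x w)) v).symm
  rw [e] at h
  linarith

lemma sum_KK_bReg_pv {n : ℕ} {s : ℝ} {g : E3 → E3 → ℝ} (H : Sm (n + 1) s g) (x v : E3) :
    ∑ j, KK (bReg γ 1 j) (pv j g) x v =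
      KK (cReg γ) g x v + 1 / 2 * ∑ j, KK (bReg γ 1 j) (cmul j g) x v := by
  have h := sum_integral_bReg_pd h1 h2 (H.dec1 x) v
  simp_rw [KK_pv_eq (ker_bReg h1 h2 one_pos le_rfl _) H] at h
  rw [Finset.sum_sub_distrib, ← Finset.mul_sum] at h
  have e : ∫ z, cReg γ z * (fun v => sqrtM v * g x v) (v - z) = KK (cReg γ) g x v :=
    (integral_comp_sub (fun z w => cReg γ z * (sqrtM w * g x w)) v).symm
  rw [e] at h
  linarith

lemma Sm.JJ {n : ℕ} {s t : ℝ} {f g : E3 → E3 → ℝ} (H : Sm (n + 1) s f) (H' : Sm (n + 1) t g)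
    (i : Fin 3) : Sm n (12 + t) (JJ γ i f g) := by
  refine Sm.sum _ fun j _ => ?_
  have hK := ker_aKer h1 h2 i j
  exact (((H.le (by omega)).KK hK).mul (H'.pv j)).sub
    (((H.pv j).KK hK).mul (H'.le (by omega)))

omit h1 h2 in
-- This degeneracy of a along z removes the Gaussian factors from the collision operator.
lemma sum_aKer_mul_self (γ : ℝ) (i : Fin 3) (z : E3) : ∑ j, aKer γ i j z * z j = 0 := by
  rcases eq_or_ne z 0 with rfl | hz
  · simp
  · have h := norm_sq_eq_sum z
    simp_rw [aKer_eq hz]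
    have : ∑ j, ‖z‖ ^ γ * (‖z‖ ^ 2 * (if i = j then 1 else 0) - z i * z j) * z j =
        ‖z‖ ^ γ * (‖z‖ ^ 2 * z i - z i * ∑ j, z j ^ 2) := by
      fin_cases i <;> simp [Fin.sum_univ_three] <;> ring
    rw [this, ← h]; ring

/-- The derivatives of √M at u and at w together produce −(u − w)_j/2 times a common factor, and a(u
− w) annihilates u − w. Only derivatives of f and g survive. -/
lemma inner_integral_eq {n : ℕ} {s t : ℝ} {f g : E3 → E3 → ℝ} (H : Sm (n + 1) s f)
    (H' : Sm (n + 1) t g) (i : Fin 3) (x u : E3) :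
    (∫ w, ∑ j, aKer γ i j (u - w) * ((fun w => sqrtM w * f x w) w *
      pd j (fun w => sqrtM w * g x w) u - (fun w => sqrtM w * g x w) u *
        pd j (fun w => sqrtM w * f x w) w)) = sqrtM u * JJ γ i f g x u := by
  have hj : ∀ w, ∑ j, aKer γ i j (u - w) * (sqrtM w * f x w *
      pd j (fun w => sqrtM w * g x w) u - sqrtM u * g x u *
        pd j (fun w => sqrtM w * f x w) w) =
      ∑ j, (sqrtM u * (pv j g x u) * (aKer γ i j (u - w) * (sqrtM w * f x w)) -
        sqrtM u * g x u * (aKer γ i j (u - w) * (sqrtM w * pv j f x w))) := fun w => by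
    have z := sum_aKer_mul_self γ i (u - w)
    have e : ∀ j, aKer γ i j (u - w) * (sqrtM w * f x w *
      pd j (fun w => sqrtM w * g x w) u - sqrtM u * g x u *
        pd j (fun w => sqrtM w * f x w) w) =
      (sqrtM u * (pv j g x u) * (aKer γ i j (u - w) * (sqrtM w * f x w)) -
        sqrtM u * g x u * (aKer γ i j (u - w) * (sqrtM w * pv j f x w))) -
        1 / 2 * sqrtM u * sqrtM w * f x w * g x u * (aKer γ i j (u - w) * (u - w) j) := fun j => by
      have a := pv_sqrtM_mul j H x w
      have b := pv_sqrtM_mul j H' x u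
      simp only [pv] at a b ⊢
      rw [a, b, PiLp.sub_apply]
      ring
    rw [Finset.sum_congr rfl fun j _ => e j, Finset.sum_sub_distrib, ← Finset.mul_sum, z]
    ring
  simp_rw [hj]
  have iA := fun j => (KK_integrable (ker_aKer h1 h2 i j) H x u).const_mul
    (sqrtM u * (pv j g x u))
  have iB := fun j => (KK_integrable (ker_aKer h1 h2 i j) (H.pv j) x u).const_mul
    (sqrtM u * g x u)
  have iC : ∀ j, Integrable fun w =>
      sqrtM u * (pv j g x u) * (aKer γ i j (u - w) * (sqrtM w * f x w)) -
        sqrtM u * g x u * (aKer γ i j (u - w) * (sqrtM w * pv j f x w)) :=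
    fun j => (iA j).sub (iB j)
  rw [integral_finsetSum _ fun j _ => iC j, JJ, Finset.mul_sum]
  refine Finset.sum_congr rfl fun j _ => ?_
  rw [integral_sub (iA j) (iB j), integral_const_mul, integral_const_mul, KK, KK]
  ring

/-- The divergence form of `Γ`. -/
lemma Gam_eq {n : ℕ} {s t : ℝ} {f g : E3 → E3 → ℝ} (H : Sm (n + 2) s f)
    (H' : Sm (n + 2) t g) : Gam γ f g =
      fun x v => ∑ i, (pv i (JJ γ i f g) x v - v i / 2 * JJ γ i f g x v) := by
  funext x v
  rw [Gam, landauQ, Finset.mul_sum]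
  refine Finset.sum_congr rfl fun i _ => ?_
  have e : (fun u => ∫ w, ∑ j, aKer γ i j (u - w) * ((fun w => sqrtM w * f x w) w *
      pd j (fun w => sqrtM w * g x w) u - (fun w => sqrtM w * g x w) u *
        pd j (fun w => sqrtM w * f x w) w)) = fun u => sqrtM u * JJ γ i f g x u :=
    funext fun u => inner_integral_eq h1 h2 (n := n + 1) H H' i x u
  rw [e]
  have hJ : Sm (n + 1) (12 + t) (JJ γ i f g) := H.JJ h1 h2 H' i
  have := pv_sqrtM_mul i hJ x v
  simp only [pv] at this ⊢
  rw [this, ← mul_assoc, inv_mul_cancel₀ (sqrtM_pos v).ne', one_mul]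

lemma Sm.Gam {n : ℕ} {s t : ℝ} {f g : E3 → E3 → ℝ} (H : Sm (n + 2) s f)
    (H' : Sm (n + 2) t g) : Sm n (13 + t) (Gam γ f g) := by
  rw [Gam_eq h1 h2 H H']
  refine Sm.sum _ fun i _ => ?_
  have hJ : Sm (n + 1) (12 + t) (Landau.JJ γ i f g) := H.JJ h1 h2 H' i
  refine ((hJ.pv i).mono le_rfl (by linarith)).sub ?_
  have h := ((Sm.coord n i).const_mul (1 / 2)).mul (hJ.le (show n ≤ n + 1 by omega))
  rw [show (1 : ℝ) + (12 + t) = 13 + t by ring] at h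
  convert h using 4
  ring

lemma dx_JJ {n : ℕ} {s t : ℝ} {f g : E3 → E3 → ℝ} (H : Sm (n + 2) s f)
    (H' : Sm (n + 2) t g) (i k : Fin 3) :
    dx k (JJ γ i f g) = fun x v => JJ γ i (dx k f) g x v + JJ γ i f (dx k g) x v := by
  funext x v
  have hK := fun j => ker_aKer h1 h2 i j
  have d1 := fun j => ((H.KK (hK j)).diff_x (n := n + 1) v) x
  have d2 := fun j => ((H.pv (n := n + 1) j).KK (hK j)).diff_x (n := n) v x
  have d3 := fun j => (H'.pv (n := n + 1) j).diff_x (n := n) v x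
  have d4 := H'.diff_x (n := n + 1) v x
  have a1 := fun j => congrFun (congrFun (dx_KK (hK j) (n := n + 1) H k) x) v
  have a2 := fun j => congrFun (congrFun (dx_KK (hK j) (n := n) (H.pv (n := n + 1) j) k) x) v
  have a3 := fun j => congrFun (congrFun (H'.dx_pv k j) x) v
  simp only [dx] at a1 a2 a3
  change pd k (fun y => ∑ j, (KK (aKer γ i j) f y v * pv j g y v -
    KK (aKer γ i j) (pv j f) y v * g y v)) x = _
  have d5 : ∀ j, DifferentiableAt ℝ (fun y => KK (aKer γ i j) f y v * pv j g y v -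
    KK (aKer γ i j) (pv j f) y v * g y v) x := fun j => ((d1 j).mul (d3 j)).sub ((d2 j).mul d4)
  rw [pd_sum k _ fun j _ => d5 j, JJ, JJ,
    ← Finset.sum_add_distrib]
  refine Finset.sum_congr rfl fun j _ => ?_
  have e := H.dx_pv (n := n) k j
  have d6 : DifferentiableAt ℝ (fun y => KK (aKer γ i j) f y v * pv j g y v) x :=
    (d1 j).mul (d3 j)
  have d7 : DifferentiableAt ℝ (fun y => KK (aKer γ i j) (pv j f) y v * g y v) x :=
    (d2 j).mul d4
  rw [pd_sub k d6 d7, pd_mul k (d1 j) (d3 j), pd_mul k (d2 j) d4,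
    a1, a2, a3, ← e]
  simp only [dx]
  ring

lemma dx_Gam {n : ℕ} {s t : ℝ} {f g : E3 → E3 → ℝ} (H : Sm (n + 3) s f)
    (H' : Sm (n + 3) t g) (k : Fin 3) :
    dx k (Gam γ f g) = fun x v => Gam γ (dx k f) g x v + Gam γ f (dx k g) x v := by
  funext x v
  have hJ := fun i => H.JJ (n := n + 2) h1 h2 H' i
  have L1 : Sm (n + 2) s f := H.le (by omega)
  have L2 : Sm (n + 2) t g := H'.le (by omega)
  have D1 : Sm (n + 2) s (dx k f) := H.dx k
  have D2 : Sm (n + 2) t (dx k g) := H'.dx k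
  rw [Gam_eq h1 h2 L1 L2, Gam_eq h1 h2 D1 L2, Gam_eq h1 h2 L1 D2]
  have p1 := fun i => ((hJ i).pv (n := n + 1) i).diff_x (n := n) v x
  have p2 := fun i => (hJ i).diff_x (n := n + 1) v x
  change pd k (fun y => ∑ i, (pv i (JJ γ i f g) y v - v i / 2 * JJ γ i f g y v)) x = _
  have p3 : ∀ i, DifferentiableAt ℝ
    (fun y => pv i (JJ γ i f g) y v - v i / 2 * JJ γ i f g y v) x :=
    fun i => (p1 i).sub ((p2 i).const_mul _)
  rw [pd_sum k _ fun i _ => p3 i, ← Finset.sum_add_distrib]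
  refine Finset.sum_congr rfl fun i _ => ?_
  have a1 := congrFun (congrFun ((hJ i).dx_pv (n := n) k i) x) v
  rw [dx_JJ h1 h2 (n := n + 1) H H'] at a1
  have a2 := congrFun (congrFun (dx_JJ h1 h2 (n := n + 1) H H' i k) x) v
  have J1 : Sm (n + 1) (12 + t) (JJ γ i (dx k f) g) := D1.JJ h1 h2 L2 i
  have J2 : Sm (n + 1) (12 + t) (JJ γ i f (dx k g)) := L1.JJ h1 h2 D2 i
  have a3 : pv i (fun x v => JJ γ i (dx k f) g x v + JJ γ i f (dx k g) x v) x v = _ :=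
    pd_add i (J1.diff_v x v) (J2.diff_v x v)
  rw [pd_sub k (p1 i) ((p2 i).const_mul _), pd_const_mul]
  simp only [dx] at a1 a2
  rw [a1, a2]
  simp only [pv] at a3 ⊢
  rw [a3]
  ring

end

/-! ### The Leibniz rule for iterated derivatives in `x` -/

/-- The ways of distributing the derivatives of a list on two factors. -/
def splits : List (Fin 3) → List (List (Fin 3) × List (Fin 3))
  | [] => [([], [])]
  | i :: l => (splits l).map (fun q => (i :: q.1, q.2)) ++ (splits l).map (fun q => (q.1, i :: q.2))

lemma length_of_mem_splits : ∀ (l : List (Fin 3)), ∀ q ∈ splits l,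
    q.1.length + q.2.length = l.length
  | [], q, hq => by simp [splits] at hq; simp [hq]
  | i :: l, q, hq => by
    simp only [splits, List.mem_append, List.mem_map] at hq
    rcases hq with ⟨r, hr, rfl⟩ | ⟨r, hr, rfl⟩ <;>
    · have := length_of_mem_splits l r hr
      simp; omega

lemma Sm.dxIter {s : ℝ} {g : E3 → E3 → ℝ} : ∀ (l : List (Fin 3)) {n : ℕ}, Sm (n + l.length) s g →
    Sm n s (dxIter l g)
  | [], _, H => H
  | i :: l, n, H => Sm.dx (Sm.dxIter l (n := n + 1) (H.le (by simp; omega))) i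

lemma Sm.dxIter_of_le {s : ℝ} {g : E3 → E3 → ℝ} {m n : ℕ} (l : List (Fin 3)) (H : Sm m s g)
    (h : n + l.length ≤ m) : Sm n s (Landau.dxIter l g) := Sm.dxIter l (H.le h)

lemma dxIter_append (l l' : List (Fin 3)) (g : E3 → E3 → ℝ) :
    dxIter (l ++ l') g = dxIter l (dxIter l' g) := by
  induction l with
  | nil => rfl
  | cons i l ih => simp [dxIter, ih]

lemma dx_list_sum {α : Type*} (L : List α) (h : α → E3 → E3 → ℝ) (k : Fin 3)
    (H : ∀ a ∈ L, ∀ v, Differentiable ℝ fun x => h a x v) :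
    (dx k (fun x v => (L.map fun a => h a x v).sum) =
      fun x v => (L.map fun a => dx k (h a) x v).sum) ∧
    ∀ v, Differentiable ℝ fun x => (L.map fun a => h a x v).sum := by
  induction L with
  | nil => exact ⟨by funext x v; simp [dx, pd], by simp⟩
  | cons a L ih =>
    obtain ⟨ih1, ih2⟩ := ih fun b hb => H b (List.mem_cons_of_mem _ hb)
    have ha := H a List.mem_cons_self
    simp only [List.map_cons, List.sum_cons]
    refine ⟨?_, fun v => (ha v).add (ih2 v)⟩
    funext x v
    rw [← congrFun (congrFun ih1 x) v]
    exact pd_add k (ha v x) (ih2 v x)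

section

variable {γ : ℝ} (h1 : -2 ≤ γ) (h2 : γ ≤ 1)
include h1 h2

lemma dxIter_Gam {s t : ℝ} {f g : E3 → E3 → ℝ} : ∀ (l : List (Fin 3)) {n : ℕ},
    Sm (n + 2 + l.length) s f → Sm (n + 2 + l.length) t g →
    dxIter l (Gam γ f g) = fun x v =>
      ((splits l).map fun q => Gam γ (dxIter q.1 f) (dxIter q.2 g) x v).sum
  | [], _, _, _ => by simp [dxIter, splits]
  | k :: l, n, H, H' => by
    have L1 : Sm (n + 1 + 2 + l.length) s f := H.le (by simp; omega)
    have L2 : Sm (n + 1 + 2 + l.length) t g := H'.le (by simp; omega)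
    have R1 : ∀ q ∈ splits l, Sm (n + 3) s (dxIter q.1 f) := fun q hq =>
      L1.dxIter_of_le q.1 (by have := length_of_mem_splits l q hq; omega)
    have R2 : ∀ q ∈ splits l, Sm (n + 3) t (dxIter q.2 g) := fun q hq =>
      L2.dxIter_of_le q.2 (by have := length_of_mem_splits l q hq; omega)
    have hd := (dx_list_sum (splits l) (fun q => Gam γ (dxIter q.1 f) (dxIter q.2 g)) k
      fun q hq v => ((R1 q hq).Gam h1 h2 (n := n + 1) (R2 q hq)).diff_x v).1
    rw [dxIter, dxIter_Gam l L1 L2, hd]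
    · funext x v
      rw [splits, List.map_append, List.sum_append, List.map_map, List.map_map,
        ← List.sum_map_add]
      refine congrArg List.sum (List.map_congr_left fun q hq => ?_)
      rw [dx_Gam h1 h2 (R1 q hq) (R2 q hq)]
      rfl

end

/-! ### Pointwise bounds on `Γ` -/

/-- The quantities of first order which control a function. -/
def D1 (γ : ℝ) (f : E3 → ℝ) (v : E3) : ℝ := jap v ^ (γ / 2 + 1) * |f v| + ∑ k, |tgV γ k f v|

/-- The component `kl` of `𝐁 (∇²f) 𝐁`. -/
def bhb (γ : ℝ) (k l : Fin 3) (f : E3 → ℝ) (v : E3) : ℝ :=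
  ∑ i, ∑ j, matB γ k i v * matB γ l j v * pd i (pd j f) v

/-- The quantities of second order which control a function. -/
def D2 (γ : ℝ) (f : E3 → ℝ) (v : E3) : ℝ :=
  jap v ^ (γ + 2) * |f v| + jap v ^ (γ / 2 + 1) * ∑ k, |tgV γ k f v| + ∑ k, ∑ l, |bhb γ k l f v|

lemma D1_nonneg (γ : ℝ) (f : E3 → ℝ) (v : E3) : 0 ≤ D1 γ f v := by
  have := jap_rpow_nonneg v (γ / 2 + 1)
  unfold D1; positivity

lemma D2_nonneg (γ : ℝ) (f : E3 → ℝ) (v : E3) : 0 ≤ D2 γ f v := by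
  have := jap_rpow_nonneg v (γ / 2 + 1)
  have := jap_rpow_nonneg v (γ + 2)
  unfold D2; positivity

lemma bn_grad (γ : ℝ) (f : E3 → ℝ) (v : E3) : bn γ v (grad f v) = ∑ k, |tgV γ k f v| := rfl

lemma D1_le_D2 (γ : ℝ) (f : E3 → ℝ) (v : E3) : jap v ^ (γ / 2 + 1) * D1 γ f v ≤ D2 γ f v := by
  have e : jap v ^ (γ + 2) = jap v ^ (γ / 2 + 1) * jap v ^ (γ / 2 + 1) := by
    rw [← jap_rpow_add]; ring_nf
  have : 0 ≤ ∑ k, ∑ l, |bhb γ k l f v| := by positivity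
  rw [D1, D2, e]
  linarith

/-- The flux associated with the first function `g`, a gradient `q` and a value `a`. -/
def flux (γ : ℝ) (g : E3 → E3 → ℝ) (x v : E3) (q : E3) (a : ℝ) (i : Fin 3) : ℝ :=
  ∑ j, (KK (aKer γ i j) g x v * q j - KK (aKer γ i j) (pv j g) x v * a)

lemma aKer_comm (γ : ℝ) (i j : Fin 3) (z : E3) : aKer γ i j z = aKer γ j i z := by
  simp only [aKer, eq_comm (a := i), mul_comm (z i)]

lemma KK_aKer_comm (γ : ℝ) (i j : Fin 3) (g : E3 → E3 → ℝ) (x v : E3) :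
    KK (aKer γ i j) g x v = KK (aKer γ j i) g x v := by
  simp only [KK, aKer_comm γ i j]

lemma Sm.bdd {n : ℕ} {s : ℝ} {g : E3 → E3 → ℝ} (H : Sm n s g) (hs : s ≤ 0) (x : E3) :
    Bdd (g x) := by
  obtain ⟨A, _, hA⟩ := Gr.bound (Gr.mono H le_rfl hs)
  exact ⟨(H.contDiff_v x).continuous, A, fun v => by simpa [unc] using hA (x, v)⟩

lemma abs_integral_mul_sqrtM_le {φ : E3 → ℝ} (H : Bdd φ) {v : E3} {κ : E3 → ℝ} {c : ℝ}
    (hκ : ∀ w, |κ w| ≤ c * ((1 + ‖v - w‖⁻¹) * jap w ^ (12 : ℝ))) :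
    |∫ w, κ w * (sqrtM w * φ w)| ≤ c * majorant φ v := by
  refine abs_integral_le_majorant H fun w => ?_
  have hm := (sqrtM_pos w).le
  rw [abs_mul, abs_mul, abs_of_nonneg hm, mker]
  calc _ ≤ c * ((1 + ‖v - w‖⁻¹) * jap w ^ (12 : ℝ)) * (sqrtM w * |φ w|) := by
        gcongr
        exact hκ w
    _ = _ := by ring

lemma jap_le_sing (v w : E3) {s : ℝ} (hs : s ≤ 12) :
    jap w ^ s ≤ (1 + ‖v - w‖⁻¹) * jap w ^ (12 : ℝ) := by
  have h := jap_rpow_mono w hs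
  have h' : 0 ≤ ‖v - w‖⁻¹ := by positivity
  have := jap_rpow_nonneg w 12
  nlinarith [mul_nonneg h' this]

/-- Up to powers of ⟨w⟩ and the singularity, 1/|v − w| is worth 1/⟨v⟩. Hence convolution with b is
smaller than convolution with a by one power of ⟨v⟩. -/
lemma inv_norm_sub_le (v w : E3) : ‖v - w‖⁻¹ * jap v ≤ 2 * jap w * (1 + ‖v - w‖⁻¹) := by
  have a1 : jap v ≤ 2 * jap (v - w) * jap w := by
    have := jap_add_le (v - w) w
    rwa [sub_add_cancel] at this
  have a2 : ‖v - w‖⁻¹ * jap (v - w) ≤ 1 + ‖v - w‖⁻¹ := by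
    rcases eq_or_ne ‖v - w‖ 0 with h | h
    · simp [h]
    · calc _ ≤ ‖v - w‖⁻¹ * (1 + ‖v - w‖) := by gcongr; exact jap_le _
        _ = _ := by field_simp; ring
  have h' : 0 ≤ ‖v - w‖⁻¹ := by positivity
  have := (jap_pos w).le
  calc _ ≤ ‖v - w‖⁻¹ * (2 * jap (v - w) * jap w) := by gcongr
    _ = 2 * jap w * (‖v - w‖⁻¹ * jap (v - w)) := by ring
    _ ≤ _ := by gcongr

lemma norm_le_sum_abs (p : E3) : ∑ i, |p i| ≤ 3 * ‖p‖ := by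
  refine (Finset.sum_le_sum fun i _ => abs_coord_le p i).trans (le_of_eq ?_)
  simp

/-! ### Fluxes against a vector, and the strong pointwise bound on Γ. -/

section

variable {γ : ℝ} (h1 : -2 ≤ γ) (h2 : γ ≤ 1)
include h1 h2

lemma abs_bKer_sub_le (i : Fin 3) (v w : E3) : |bKer γ i (v - w)| ≤
    (32 * jap v ^ (γ + 1)) * ((1 + ‖v - w‖⁻¹) * jap w ^ (12 : ℝ)) := by
  have a1 := abs_bKer_le (γ := γ) i (v - w)
  have a2 := norm_sub_rpow_le h1 h2 v w
  have a3 := inv_norm_sub_le v w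
  have h' : 0 ≤ ‖v - w‖⁻¹ := by positivity
  have p1 := jap_rpow_nonneg w 3
  have p2 := jap_rpow_nonneg v (γ + 1)
  have e : jap v ^ (γ + 2) = jap v ^ (γ + 1) * jap v := by
    rw [show γ + 2 = γ + 1 + 1 by ring, jap_rpow_add, Real.rpow_one]
  have e4 : jap w ^ (3 : ℝ) * jap w ≤ jap w ^ (12 : ℝ) := by
    have : jap w ^ (3 : ℝ) * jap w = jap w ^ (4 : ℝ) := by
      rw [show (4 : ℝ) = 3 + 1 by norm_num, jap_rpow_add, Real.rpow_one]
    rw [this]; exact jap_rpow_mono w (by norm_num)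
  calc _ ≤ 2 * (‖v - w‖⁻¹ * (8 * jap w ^ (3 : ℝ) * jap v ^ (γ + 2))) := a1.trans (by gcongr)
    _ = 16 * jap w ^ (3 : ℝ) * jap v ^ (γ + 1) * (‖v - w‖⁻¹ * jap v) := by rw [e]; ring
    _ ≤ 16 * jap w ^ (3 : ℝ) * jap v ^ (γ + 1) * (2 * jap w * (1 + ‖v - w‖⁻¹)) := by gcongr
    _ = (32 * jap v ^ (γ + 1)) * ((1 + ‖v - w‖⁻¹) * (jap w ^ (3 : ℝ) * jap w)) := by ring
    _ ≤ _ := by gcongr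

lemma abs_bReg_sub_le (i : Fin 3) (v w : E3) : |bReg γ 1 i (v - w) * w i| ≤
    (16 * jap v ^ (γ + 2)) * ((1 + ‖v - w‖⁻¹) * jap w ^ (12 : ℝ)) := by
  have e : |bReg γ 1 i (v - w)| = 2 * jap (v - w) ^ γ * |(v - w) i| := by
    have : 0 ≤ (‖v - w‖ ^ 2 + 1) ^ (γ / 2) := by positivity
    rw [bReg, abs_mul, abs_mul, abs_of_nonneg this, jap_rpow_eq, add_comm (1 : ℝ)]
    norm_num
  have a1 := jap_rpow_add_le γ (abs_le.2 ⟨by linarith, by linarith⟩) v w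
  have a2 := ((abs_coord_le (v - w) i).trans (norm_le_jap _)).trans (jap_sub_le v w)
  have a3 := (abs_coord_le w i).trans (norm_le_jap w)
  have p1 := jap_rpow_nonneg v γ
  have p2 := jap_rpow_nonneg w 2
  have p3 := (jap_pos v).le
  have p4 := (jap_pos w).le
  have p5 := jap_rpow_nonneg (v - w) γ
  have e1 : jap v ^ γ * jap v ≤ jap v ^ (γ + 2) := by
    have : jap v ^ γ * jap v = jap v ^ (γ + 1) := by rw [jap_rpow_add, Real.rpow_one]
    rw [this]; exact jap_rpow_mono v (by linarith)
  have e2 : jap w ^ (2 : ℝ) * jap w * jap w = jap w ^ (4 : ℝ) := by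
    rw [show (4 : ℝ) = 2 + 1 + 1 by norm_num, jap_rpow_add, jap_rpow_add, Real.rpow_one]
  rw [abs_mul, e]
  calc _ ≤ 2 * (4 * jap v ^ γ * jap w ^ (2 : ℝ)) * (2 * jap v * jap w) * jap w := by gcongr
    _ = 16 * (jap v ^ γ * jap v) * (jap w ^ (2 : ℝ) * jap w * jap w) := by ring
    _ ≤ 16 * jap v ^ (γ + 2) * ((1 + ‖v - w‖⁻¹) * jap w ^ (12 : ℝ)) := by
        rw [e2]
        have := jap_le_sing v w (show (4 : ℝ) ≤ 12 by norm_num)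
        have := jap_rpow_nonneg w 4
        gcongr

lemma abs_cReg_sub_le (v w : E3) : |cReg γ (v - w)| ≤
    (72 * jap v ^ (γ + 2)) * ((1 + ‖v - w‖⁻¹) * jap w ^ (12 : ℝ)) := by
  have a1 := jap_rpow_add_le γ (abs_le.2 ⟨by linarith, by linarith⟩) v w
  have a2 := jap_le_sing v w (show (2 : ℝ) ≤ 12 by norm_num)
  have a3 := jap_rpow_mono v (show γ ≤ γ + 2 by linarith)
  have p1 := jap_rpow_nonneg v (γ + 2)
  have p2 := jap_rpow_nonneg w 2
  calc _ ≤ 18 * (4 * jap v ^ γ * jap w ^ (2 : ℝ)) := by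
        refine (abs_cReg_le h1 h2 _).trans ?_
        gcongr
    _ = 72 * jap v ^ γ * jap w ^ (2 : ℝ) := by ring
    _ ≤ _ := by gcongr

omit h1 h2 in
lemma Sm.sqrtM_abs_le {n : ℕ} {s : ℝ} {g : E3 → E3 → ℝ} (H : Sm n s g) (x : E3) :
    Continuous (fun w => sqrtM w * g x w) ∧
      ∃ A : ℝ, ∀ w, |sqrtM w * g x w| ≤ A * jap w ^ (-12 : ℝ) := by
  have H' := H.sqrtM_mul (-12)
  obtain ⟨A, _, hA⟩ := Gr.bound H'
  exact ⟨(H'.contDiff_v x).continuous, A, fun w => hA (x, w)⟩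

lemma abs_sum_KK_aKer_le : ∃ C : ℝ, 0 < C ∧ ∀ {n : ℕ} {s : ℝ} {g : E3 → E3 → ℝ}, Sm n s g → s ≤ 0 →
    ∀ x v p q : E3, |∑ i, ∑ j, KK (aKer γ i j) g x v * p i * q j| ≤
      C * majorant (g x) v * bn γ v p * bn γ v q := by
  obtain ⟨C, hC, h⟩ := aForm_le_bn h1 h2
  refine ⟨C, hC, fun {n s g} H hs x v p q => ?_⟩
  obtain ⟨hc, A, hA⟩ := H.sqrtM_abs_le x
  have e := integral_aForm_mul h1 h2 hc hA v p q
  unfold KK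
  rw [e]
  have p1 := bn_nonneg γ v p
  have p2 := bn_nonneg γ v q
  refine (abs_integral_mul_sqrtM_le (H.bdd hs x) (c := C * bn γ v p * bn γ v q)
    fun w => ?_).trans (le_of_eq (by ring))
  have := jap_le_sing v w (show (6 : ℝ) ≤ 12 by norm_num)
  calc _ ≤ C * jap w ^ (6 : ℝ) * bn γ v p * bn γ v q := h v w p q
    _ = C * bn γ v p * bn γ v q * jap w ^ (6 : ℝ) := by ring
    _ ≤ _ := by gcongr

lemma bn_jap_le : ∃ C : ℝ, 0 < C ∧ ∀ v w : E3, bn γ v w ≤ C * jap v ^ (γ / 2 + 1) * jap w := by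
  obtain ⟨C, hC, h⟩ := bn_bounds h1 h2
  refine ⟨C, hC, fun v w => (h v w).2.trans ?_⟩
  have := jap_rpow_nonneg v (γ / 2 + 1)
  have := norm_le_jap w
  gcongr

/-- The integration variable w is the second vector of the bilinear form a(v − w)p·w, and |𝐁(v)w| ≲
⟨v⟩^{γ/2+1}⟨w⟩. -/
lemma abs_sum_KK_cmul_le : ∃ C : ℝ, 0 < C ∧ ∀ {n : ℕ} {s : ℝ} {g : E3 → E3 → ℝ}, Sm n s g → s ≤ 0 →
    ∀ x v p : E3, |∑ i, ∑ j, KK (aKer γ i j) (cmul j g) x v * p i| ≤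
      C * majorant (g x) v * jap v ^ (γ / 2 + 1) * bn γ v p := by
  obtain ⟨C, hC, h⟩ := aForm_le_bn h1 h2
  obtain ⟨D, hD, h'⟩ := bn_jap_le h1 h2
  refine ⟨C * D, by positivity, fun {n s g} H hs x v p => ?_⟩
  have e : ∑ i, ∑ j, KK (aKer γ i j) (cmul j g) x v * p i =
      ∫ w, aForm γ (v - w) p w * (sqrtM w * g x w) := by
    have hi := fun i j => (KK_integrable (ker_aKer h1 h2 i j) (H.cmul j) x v).mul_const (p i)
    unfold KK
    simp_rw [← integral_mul_const]
    simp_rw [← integral_finsetSum _ fun j _ => hi _ j]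
    rw [← integral_finsetSum _ fun i _ => integrable_finsetSum _ fun j _ => hi i j]
    refine integral_congr_ae (.of_forall fun w => ?_)
    simp only [aForm, Finset.sum_mul, cmul]
    exact Finset.sum_congr rfl fun i _ => Finset.sum_congr rfl fun j _ => by ring
  rw [e]
  have p1 := bn_nonneg γ v p
  have p2 := jap_rpow_nonneg v (γ / 2 + 1)
  refine (abs_integral_mul_sqrtM_le (H.bdd hs x)
    (c := C * D * jap v ^ (γ / 2 + 1) * bn γ v p) fun w => ?_).trans (le_of_eq (by ring))
  have := jap_le_sing v w (show (7 : ℝ) ≤ 12 by norm_num)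
  have p6 := jap_rpow_nonneg w 6
  have e7 : jap w ^ (7 : ℝ) = jap w ^ (6 : ℝ) * jap w := by
    rw [show (7 : ℝ) = 6 + 1 by norm_num, jap_rpow_add, Real.rpow_one]
  calc _ ≤ C * jap w ^ (6 : ℝ) * bn γ v p * (D * jap v ^ (γ / 2 + 1) * jap w) := by
        refine (h v w p w).trans ?_
        gcongr
        exact h' v w
    _ = C * D * jap v ^ (γ / 2 + 1) * bn γ v p * jap w ^ (7 : ℝ) := by rw [e7]; ring
    _ ≤ _ := by gcongr

/-- The kernel b has no useful anisotropy, but its size ⟨v⟩^{γ+1} factors as ⟨v⟩^{γ/2+1}⟨v⟩^{γ/2},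
and ⟨v⟩^{γ/2}|p| ≲ |𝐁(v)p| even in the degenerate direction. -/
lemma abs_sum_KK_bKer_le : ∃ C : ℝ, 0 < C ∧ ∀ {n : ℕ} {s : ℝ} {g : E3 → E3 → ℝ}, Sm n s g → s ≤ 0 →
    ∀ x v p : E3, |∑ i, KK (bKer γ i) g x v * p i| ≤
      C * majorant (g x) v * jap v ^ (γ / 2 + 1) * bn γ v p := by
  obtain ⟨C, hC, h⟩ := bn_bounds h1 h2
  refine ⟨96 * C, by positivity, fun {n s g} H hs x v p => ?_⟩
  have hb : ∀ i, |KK (bKer γ i) g x v| ≤ 32 * jap v ^ (γ + 1) * majorant (g x) v := fun i =>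
    abs_integral_mul_sqrtM_le (H.bdd hs x) (abs_bKer_sub_le h1 h2 i v)
  have m0 := majorant_nonneg (g x) v
  have e : jap v ^ (γ + 1) = jap v ^ (γ / 2 + 1) * jap v ^ (γ / 2) := by
    rw [← jap_rpow_add]; ring_nf
  have p0 := jap_rpow_nonneg v (γ / 2 + 1)
  have p1 := jap_rpow_nonneg v (γ + 1)
  calc _ ≤ ∑ i, 32 * jap v ^ (γ + 1) * majorant (g x) v * |p i| := by
        refine (Finset.abs_sum_le_sum_abs _ _).trans (Finset.sum_le_sum fun i _ => ?_)
        rw [abs_mul]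
        gcongr
        exact hb i
    _ = 32 * jap v ^ (γ + 1) * majorant (g x) v * ∑ i, |p i| := by rw [Finset.mul_sum]
    _ ≤ 32 * jap v ^ (γ + 1) * majorant (g x) v * (3 * ‖p‖) := by
        gcongr
        exact norm_le_sum_abs p
    _ = 96 * majorant (g x) v * jap v ^ (γ / 2 + 1) * (jap v ^ (γ / 2) * ‖p‖) := by rw [e]; ring
    _ ≤ 96 * majorant (g x) v * jap v ^ (γ / 2 + 1) * (C * bn γ v p) := by
        exact mul_le_mul_of_nonneg_left (h v p).1 (by positivity)
    _ = _ := by ring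

/-- The bound on the fluxes. -/
lemma abs_sum_flux_le : ∃ C : ℝ, 0 < C ∧ ∀ {n : ℕ} {s : ℝ} {g : E3 → E3 → ℝ}, Sm (n + 1) s g →
    s ≤ 0 → ∀ (x v p q : E3) (a : ℝ), |∑ i, flux γ g x v q a i * p i| ≤
      C * majorant (g x) v * (bn γ v q + jap v ^ (γ / 2 + 1) * |a|) * bn γ v p := by
  obtain ⟨C1, hC1, b1⟩ := abs_sum_KK_aKer_le h1 h2
  obtain ⟨C2, hC2, b2⟩ := abs_sum_KK_cmul_le h1 h2
  obtain ⟨C3, hC3, b3⟩ := abs_sum_KK_bKer_le h1 h2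
  refine ⟨C1 + C2 + C3, by positivity, fun {n s g} H hs x v p q a => ?_⟩
  -- By `sum_KK_pv` the divergence is moved from g to the kernel, so that no derivative of the first
  -- function remains.
  have e : ∑ i, flux γ g x v q a i * p i = ∑ i, ∑ j, KK (aKer γ i j) g x v * p i * q j -
      a * (∑ i, KK (bKer γ i) g x v * p i +
        1 / 2 * ∑ i, ∑ j, KK (aKer γ i j) (cmul j g) x v * p i) := by
    rw [Finset.mul_sum, ← Finset.sum_add_distrib, Finset.mul_sum, ← Finset.sum_sub_distrib]
    refine Finset.sum_congr rfl fun i _ => ?_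
    have h := sum_KK_pv h1 h2 H i x v
    have h' : ∑ j, KK (aKer γ i j) g x v * p i * q j =
        (∑ j, KK (aKer γ i j) g x v * q j) * p i := by
      rw [Finset.sum_mul]
      exact Finset.sum_congr rfl fun j _ => by ring
    rw [flux, Finset.sum_sub_distrib, ← Finset.sum_mul, h, h', ← Finset.sum_mul]
    ring
  rw [e]
  have a1 := b1 H hs x v p q
  have a2 := b2 H hs x v p
  have a3 := b3 H hs x v p
  have m0 := majorant_nonneg (g x) v
  have p0 := jap_rpow_nonneg v (γ / 2 + 1)
  have n1 := bn_nonneg γ v p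
  have n2 := bn_nonneg γ v q
  have t1 : 0 ≤ majorant (g x) v * bn γ v p * bn γ v q := by positivity
  have t2 : 0 ≤ majorant (g x) v * jap v ^ (γ / 2 + 1) * bn γ v p * |a| := by positivity
  refine (abs_sub _ _).trans ?_
  rw [abs_mul]
  have a4 : |∑ i, KK (bKer γ i) g x v * p i +
        1 / 2 * ∑ i, ∑ j, KK (aKer γ i j) (cmul j g) x v * p i| ≤
      (C2 + C3) * majorant (g x) v * jap v ^ (γ / 2 + 1) * bn γ v p := by
    refine (abs_add_le _ _).trans ?_
    rw [abs_mul, show |(1 / 2 : ℝ)| = 1 / 2 by norm_num]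
    have := abs_nonneg (∑ i, ∑ j, KK (aKer γ i j) (cmul j g) x v * p i)
    linarith
  have a5 := mul_le_mul_of_nonneg_left a4 (abs_nonneg a)
  nlinarith [mul_nonneg hC1.le t2, mul_nonneg hC2.le t1, mul_nonneg hC3.le t1]

/-- The derivatives in the divergence form are carried out. Since a is symmetric, the terms pairing
a first derivative of f with a first derivative of g cancel after exchanging i and j. In the term
with two derivatives of f one of them is moved to the kernel, which becomes b. -/
lemma Gam_expand {n : ℕ} {s t : ℝ} {f g : E3 → E3 → ℝ} (H : Sm (n + 2) s f)
    (H' : Sm (n + 2) t g) (x v : E3) : Gam γ f g x v =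
      ∑ i, ∑ j, KK (aKer γ i j) f x v * pv i (pv j g) x v
      - 1 / 2 * ∑ i, ∑ j, KK (aKer γ i j) (cmul j f) x v * pv i g x v
      - (∑ j, KK (bKer γ j) (pv j f) x v) * g x v
      - 1 / 2 * ∑ i, JJ γ i f g x v * v i := by
  have hK := ker_aKer h1 h2
  have d1 := fun i j => (H.KK (hK i j)).diff_v (n := n + 1) x v
  have d2 := fun i j => ((H.pv (n := n + 1) j).KK (hK i j)).diff_v (n := n) x v
  have d3 := fun j => (H'.pv (n := n + 1) j).diff_v (n := n) x v
  have d4 := H'.diff_v (n := n + 1) x v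
  have d5 : ∀ i j, DifferentiableAt ℝ (fun y => KK (aKer γ i j) f x y * pv j g x y) v :=
    fun i j => (d1 i j).mul (d3 j)
  have d6 : ∀ i j, DifferentiableAt ℝ (fun y => KK (aKer γ i j) (pv j f) x y * g x y) v :=
    fun i j => (d2 i j).mul d4
  have d7 : ∀ i j, DifferentiableAt ℝ (fun y => KK (aKer γ i j) f x y * pv j g x y -
    KK (aKer γ i j) (pv j f) x y * g x y) v := fun i j => (d5 i j).sub (d6 i j)
  have eJ : ∀ i, pv i (JJ γ i f g) x v = ∑ j, ((KK (aKer γ i j) (pv i f) x v -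
      1 / 2 * KK (aKer γ i j) (cmul i f) x v) * pv j g x v +
      KK (aKer γ i j) f x v * pv i (pv j g) x v -
      ((KK (aKer γ i j) (pv i (pv j f)) x v - 1 / 2 * KK (aKer γ i j) (cmul i (pv j f)) x v) *
        g x v + KK (aKer γ i j) (pv j f) x v * pv i g x v)) := fun i => by
    change pd i (fun y => ∑ j, (KK (aKer γ i j) f x y * pv j g x y -
      KK (aKer γ i j) (pv j f) x y * g x y)) v = _
    rw [pd_sum i _ fun j _ => d7 i j]
    refine Finset.sum_congr rfl fun j _ => ?_
    have a1 := pv_KK (hK i j) (n := n + 1) H i x v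
    have a2 := pv_KK (hK i j) (n := n) (H.pv (n := n + 1) j) i x v
    rw [pd_sub i (d5 i j) (d6 i j), pd_mul i (d1 i j) (d3 j), pd_mul i (d2 i j) d4]
    rw [← a1, ← a2]
    rfl
  have eB : ∀ j, ∑ i, KK (aKer γ i j) (pv i (pv j f)) x v =
      KK (bKer γ j) (pv j f) x v + 1 / 2 * ∑ i, KK (aKer γ i j) (cmul i (pv j f)) x v := fun j => by
    simp_rw [KK_aKer_comm γ _ j]
    exact sum_KK_pv h1 h2 (n := n) (H.pv (n := n + 1) j) j x v
  have s1 : ∑ i, ∑ j, KK (aKer γ i j) (pv i f) x v * pv j g x v =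
      ∑ i, ∑ j, KK (aKer γ i j) (pv j f) x v * pv i g x v := by
    rw [Finset.sum_comm]
    exact Finset.sum_congr rfl fun i _ => Finset.sum_congr rfl fun j _ => by
      rw [KK_aKer_comm]
  have s2 : ∑ i, ∑ j, KK (aKer γ i j) (cmul i f) x v * pv j g x v =
      ∑ i, ∑ j, KK (aKer γ i j) (cmul j f) x v * pv i g x v := by
    rw [Finset.sum_comm]
    exact Finset.sum_congr rfl fun i _ => Finset.sum_congr rfl fun j _ => by
      rw [KK_aKer_comm]
  have s3 : ∑ i, ∑ j, (KK (aKer γ i j) (pv i (pv j f)) x v -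
      1 / 2 * KK (aKer γ i j) (cmul i (pv j f)) x v) = ∑ j, KK (bKer γ j) (pv j f) x v := by
    rw [Finset.sum_comm]
    refine Finset.sum_congr rfl fun j _ => ?_
    rw [Finset.sum_sub_distrib, eB, ← Finset.mul_sum]
    ring
  rw [Gam_eq h1 h2 H H', ← s3, ← s2]
  simp_rw [eJ]
  have e : ∀ i, ∑ j, ((KK (aKer γ i j) (pv i f) x v -
      1 / 2 * KK (aKer γ i j) (cmul i f) x v) * pv j g x v +
      KK (aKer γ i j) f x v * pv i (pv j g) x v -
      ((KK (aKer γ i j) (pv i (pv j f)) x v - 1 / 2 * KK (aKer γ i j) (cmul i (pv j f)) x v) *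
        g x v + KK (aKer γ i j) (pv j f) x v * pv i g x v)) - v i / 2 * JJ γ i f g x v =
      ∑ j, KK (aKer γ i j) (pv i f) x v * pv j g x v -
      ∑ j, KK (aKer γ i j) (pv j f) x v * pv i g x v +
      (∑ j, KK (aKer γ i j) f x v * pv i (pv j g) x v
      - 1 / 2 * ∑ j, KK (aKer γ i j) (cmul i f) x v * pv j g x v
      - (∑ j, (KK (aKer γ i j) (pv i (pv j f)) x v -
      1 / 2 * KK (aKer γ i j) (cmul i (pv j f)) x v)) * g x v - 1 / 2 * (JJ γ i f g x v * v i)) :=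
    fun i => by
      simp only [Finset.sum_add_distrib, Finset.sum_sub_distrib, sub_mul, Finset.sum_mul,
        Finset.mul_sum, mul_assoc]
      ring
  rw [Finset.sum_congr rfl fun i _ => e i, Finset.sum_add_distrib, Finset.sum_sub_distrib, s1,
    sub_self, zero_add]
  simp only [Finset.sum_sub_distrib, ← Finset.sum_mul, ← Finset.mul_sum]

/-- The Hessian term. -/
lemma abs_sum_KK_hess_le : ∃ C : ℝ, 0 < C ∧ ∀ {n : ℕ} {s : ℝ} {g : E3 → E3 → ℝ}, Sm n s g → s ≤ 0 →
    ∀ (x v : E3) (h : Fin 3 → Fin 3 → ℝ), |∑ i, ∑ j, KK (aKer γ i j) g x v * h i j| ≤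
      C * majorant (g x) v *
        ∑ k, ∑ l, |∑ i, ∑ j, matB γ k i v * matB γ l j v * h i j| := by
  obtain ⟨C, hC, hb⟩ := abs_sum_KK_aKer_le h1 h2
  refine ⟨C, hC, fun {n s g} H hs x v h => ?_⟩
  set m : Fin 3 → Fin 3 → ℝ := fun k l => ∑ i, ∑ j, matB γ k i v * matB γ l j v * h i j with hm
  -- The vectors p_k are the columns of 𝐁⁻¹, so |𝐁p_k| = 1. Expanding the matrix h in the tensors
  -- p_k ⊗ p_l has the entries of 𝐁h𝐁 as coefficients.
  set p : Fin 3 → E3 := fun k => WithLp.toLp 2 fun i => matBinv γ i k v with hp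
  have hbn : ∀ k, bn γ v (p k) = 1 := fun k => by
    have : ∀ i, ∑ l, matB γ i l v * (p k) l = if i = k then 1 else 0 := fun i =>
      matB_mul_matBinv h1 h2 v i k
    simp only [bn, this]
    simp [apply_ite abs]
  have inv : ∀ i j, h i j = ∑ k, ∑ l, (p k) i * (p l) j * m k l := fun i j => by
    have e : ∀ k l, (p k) i * (p l) j * m k l = ∑ a, ∑ b, (matBinv γ i k v * matB γ k a v) *
        (matBinv γ j l v * matB γ l b v) * h a b := fun k l => by
      rw [hm, Finset.mul_sum]
      refine Finset.sum_congr rfl fun a _ => ?_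
      rw [Finset.mul_sum]
      refine Finset.sum_congr rfl fun b _ => ?_
      simp only [hp]
      ring
    simp_rw [e]
    have e2 : ∑ k, ∑ l, ∑ a, ∑ b, (matBinv γ i k v * matB γ k a v) *
        (matBinv γ j l v * matB γ l b v) * h a b = ∑ a, ∑ b,
        (∑ k, matBinv γ i k v * matB γ k a v) * (∑ l, matBinv γ j l v * matB γ l b v) * h a b := by
      simp only [Fin.sum_univ_three]; ring
    rw [e2]
    simp_rw [matBinv_mul_matB h1 h2]
    simp
  have e : ∑ i, ∑ j, KK (aKer γ i j) g x v * h i j =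
      ∑ k, ∑ l, m k l * ∑ i, ∑ j, KK (aKer γ i j) g x v * (p k) i * (p l) j := by
    simp_rw [inv]
    simp only [Fin.sum_univ_three]; ring
  rw [e, Finset.mul_sum]
  refine (Finset.abs_sum_le_sum_abs _ _).trans (Finset.sum_le_sum fun k _ => ?_)
  rw [Finset.mul_sum]
  refine (Finset.abs_sum_le_sum_abs _ _).trans (Finset.sum_le_sum fun l _ => ?_)
  have := hb H hs x v (p k) (p l)
  rw [hbn, hbn, mul_one, mul_one] at this
  rw [abs_mul, mul_comm]
  gcongr

/-- Moving the remaining derivative to b would produce |z|^γ, which is not locally square integrable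
in the worst case γ = −2. Only the regularized part of b is integrated by parts; the rest is bounded
by 1 + 1/|z| without growth, so the derivative left on g comes without any weight in v. -/
lemma abs_sum_KK_bKer_pv_le : ∃ C : ℝ, 0 < C ∧ ∀ {n : ℕ} {s : ℝ} {g : E3 → E3 → ℝ},
    Sm (n + 1) s g → s ≤ 0 → ∀ x v : E3, |∑ j, KK (bKer γ j) (pv j g) x v| ≤
      C * (jap v ^ (γ + 2) * majorant (g x) v + ∑ j, majorant (pv j g x) v) := by
  refine ⟨96, by norm_num, fun {n s g} H hs x v => ?_⟩
  have kR := fun j => ker_bReg h1 h2 one_pos le_rfl j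
  have kB := fun j => ker_bKer h1 h2 j
  have e : ∑ j, KK (bKer γ j) (pv j g) x v =
      ∑ j, (∫ w, (bKer γ j (v - w) - bReg γ 1 j (v - w)) * (sqrtM w * pv j g x w)) +
      ((∫ w, cReg γ (v - w) * (sqrtM w * g x w)) +
        1 / 2 * ∑ j, ∫ w, (bReg γ 1 j (v - w) * w j) * (sqrtM w * g x w)) := by
    have h := sum_KK_bReg_pv h1 h2 H x v
    have h' : ∀ j, ∫ w, (bReg γ 1 j (v - w) * w j) * (sqrtM w * g x w) =
        KK (bReg γ 1 j) (cmul j g) x v := fun j => by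
      unfold KK; congr 1; funext w; simp only [cmul]; ring
    have h'' : ∀ j, ∫ w, (bKer γ j (v - w) - bReg γ 1 j (v - w)) * (sqrtM w * pv j g x w) =
        KK (bKer γ j) (pv j g) x v - KK (bReg γ 1 j) (pv j g) x v := fun j => by
      unfold KK
      rw [← integral_sub (KK_integrable (kB j) (H.pv j) x v) (KK_integrable (kR j) (H.pv j) x v)]
      congr 1; funext w; ring
    simp_rw [h', h'']
    rw [show ∫ w, cReg γ (v - w) * (sqrtM w * g x w) = KK (cReg γ) g x v from rfl, ← h,
      Finset.sum_sub_distrib]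
    ring
  have b1 : ∀ j, |∫ w, (bKer γ j (v - w) - bReg γ 1 j (v - w)) * (sqrtM w * pv j g x w)| ≤
      64 * majorant (pv j g x) v := fun j => by
    refine abs_integral_mul_sqrtM_le ((H.pv j).bdd hs x) fun w => ?_
    refine (abs_bKer_sub_bReg_le h1 h2 j _).trans ?_
    have := one_le_jap_rpow w (show (0 : ℝ) ≤ 12 by norm_num)
    have h' : 0 ≤ ‖v - w‖⁻¹ := by positivity
    gcongr
    nlinarith
  have b2 : |∫ w, cReg γ (v - w) * (sqrtM w * g x w)| ≤
      72 * jap v ^ (γ + 2) * majorant (g x) v :=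
    abs_integral_mul_sqrtM_le (H.bdd hs x) (abs_cReg_sub_le h1 h2 v)
  have b3 : ∀ j, |∫ w, (bReg γ 1 j (v - w) * w j) * (sqrtM w * g x w)| ≤
      16 * jap v ^ (γ + 2) * majorant (g x) v := fun j =>
    abs_integral_mul_sqrtM_le (H.bdd hs x) (abs_bReg_sub_le h1 h2 j v)
  rw [e]
  have c1 := (Finset.abs_sum_le_sum_abs (fun j => ∫ w, (bKer γ j (v - w) - bReg γ 1 j (v - w)) *
    (sqrtM w * pv j g x w)) Finset.univ).trans (Finset.sum_le_sum fun j _ => b1 j)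
  have c2 := (Finset.abs_sum_le_sum_abs (fun j => ∫ w, (bReg γ 1 j (v - w) * w j) *
    (sqrtM w * g x w)) Finset.univ).trans (Finset.sum_le_sum fun j _ => b3 j)
  rw [← Finset.mul_sum] at c1
  simp only [Finset.sum_const, Finset.card_univ, Fintype.card_fin, nsmul_eq_mul] at c2
  have m1 : 0 ≤ ∑ j, majorant (pv j g x) v := Finset.sum_nonneg fun j _ => majorant_nonneg _ _
  refine (abs_add_le _ _).trans ((add_le_add c1 (abs_add_le _ _)).trans ?_)
  rw [abs_mul, show |(1 / 2 : ℝ)| = 1 / 2 by norm_num]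
  push_cast at c2
  linarith

/-- The strong bound on `Γ`. -/
lemma abs_Gam_le : ∃ C : ℝ, 0 < C ∧ ∀ {n : ℕ} {s t : ℝ} {f g : E3 → E3 → ℝ},
    Sm (n + 2) s f → s ≤ 0 → Sm (n + 2) t g → ∀ x v : E3, |Gam γ f g x v| ≤
      C * (majorant (f x) v * D2 γ (g x) v + ∑ j, majorant (pv j f x) v * |g x v|) := by
  obtain ⟨C1, hC1, b1⟩ := abs_sum_KK_hess_le h1 h2
  obtain ⟨C2, hC2, b2⟩ := abs_sum_KK_cmul_le h1 h2
  obtain ⟨C3, hC3, b3⟩ := abs_sum_KK_bKer_pv_le h1 h2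
  obtain ⟨C4, hC4, b4⟩ := abs_sum_flux_le h1 h2
  obtain ⟨C5, hC5, b5⟩ := bn_self_le h1 h2
  refine ⟨C1 + C2 + C3 + C4 * C5, by positivity, fun {n s t f g} H hs H' x v => ?_⟩
  have a1 : |∑ i, ∑ j, KK (aKer γ i j) f x v * pv i (pv j g) x v| ≤
      C1 * majorant (f x) v * ∑ k, ∑ l, |bhb γ k l (g x) v| :=
    b1 H hs x v fun i j => pv i (pv j g) x v
  have a2 := b2 H hs x v (grad (g x) v)
  have a3 := b3 (n := n + 1) H hs x v
  have a4 := b4 (n := n + 1) H hs x v v (grad (g x) v) (g x v)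
  have a5 := b5 v
  rw [Gam_expand h1 h2 H H']
  have m0 := majorant_nonneg (f x) v
  have m1 : 0 ≤ ∑ j, majorant (pv j f x) v := Finset.sum_nonneg fun j _ => majorant_nonneg _ _
  have p0 := jap_rpow_nonneg v (γ / 2 + 1)
  have p1 := jap_rpow_nonneg v (γ + 2)
  have q0 : 0 ≤ ∑ k, ∑ l, |bhb γ k l (g x) v| := by positivity
  have q1 := bn_nonneg γ v (grad (g x) v)
  have e : jap v ^ (γ + 2) = jap v ^ (γ / 2 + 1) * jap v ^ (γ / 2 + 1) := by
    rw [← jap_rpow_add]; ring_nf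
  have hD : D2 γ (g x) v = jap v ^ (γ + 2) * |g x v| +
    jap v ^ (γ / 2 + 1) * bn γ v (grad (g x) v) + ∑ k, ∑ l, |bhb γ k l (g x) v| := rfl
  have t1 : |∑ i, ∑ j, KK (aKer γ i j) f x v * pv i (pv j g) x v| ≤
      C1 * (majorant (f x) v * D2 γ (g x) v) := by
    refine a1.trans ?_
    rw [mul_assoc, hD]
    gcongr
    have : 0 ≤ jap v ^ (γ + 2) * |g x v| := by positivity
    have : 0 ≤ jap v ^ (γ / 2 + 1) * bn γ v (grad (g x) v) := by positivity
    linarith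
  have t2 : |∑ i, ∑ j, KK (aKer γ i j) (cmul j f) x v * pv i g x v| ≤
      C2 * (majorant (f x) v * D2 γ (g x) v) := by
    refine (a2 : _ ≤ C2 * majorant (f x) v * jap v ^ (γ / 2 + 1) *
      bn γ v (grad (g x) v)).trans ?_
    rw [mul_assoc, mul_assoc, hD]
    gcongr
    have : 0 ≤ jap v ^ (γ + 2) * |g x v| := by positivity
    linarith
  have t3 : |∑ j, KK (bKer γ j) (pv j f) x v| * |g x v| ≤
      C3 * (majorant (f x) v * D2 γ (g x) v + (∑ j, majorant (pv j f x) v) * |g x v|) := by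
    calc _ ≤ C3 * (jap v ^ (γ + 2) * majorant (f x) v + ∑ j, majorant (pv j f x) v) * |g x v| := by
          gcongr
      _ = C3 * (majorant (f x) v * (jap v ^ (γ + 2) * |g x v|) +
          (∑ j, majorant (pv j f x) v) * |g x v|) := by ring
      _ ≤ _ := by
          rw [hD]
          gcongr
          have : 0 ≤ jap v ^ (γ / 2 + 1) * bn γ v (grad (g x) v) := by positivity
          linarith
  -- The flux is tested against v itself, where |𝐁v| ≲ ⟨v⟩^{γ/2+1}; the result is absorbed by the
  -- lower-order part of D2.
  have t4 : |∑ i, JJ γ i f g x v * v i| ≤ C4 * C5 * (majorant (f x) v * D2 γ (g x) v) := by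
    refine (a4 : _ ≤ _).trans ?_
    calc _ ≤ C4 * majorant (f x) v * (bn γ v (grad (g x) v) + jap v ^ (γ / 2 + 1) * |g x v|) *
          (C5 * jap v ^ (γ / 2 + 1)) := by gcongr
      _ = C4 * C5 * (majorant (f x) v * (jap v ^ (γ + 2) * |g x v| +
          jap v ^ (γ / 2 + 1) * bn γ v (grad (g x) v))) := by rw [e]; ring
      _ ≤ _ := by
          rw [hD]
          exact mul_le_mul_of_nonneg_left (mul_le_mul_of_nonneg_left
            (le_add_of_nonneg_right q0) m0) (by positivity)
  rw [← Finset.sum_mul]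
  have n1 : 0 ≤ majorant (f x) v * D2 γ (g x) v := mul_nonneg m0 (D2_nonneg γ (g x) v)
  have n2 : 0 ≤ (∑ j, majorant (pv j f x) v) * |g x v| := by positivity
  have r1 := abs_sub (∑ i, ∑ j, KK (aKer γ i j) f x v * pv i (pv j g) x v
      - 1 / 2 * ∑ i, ∑ j, KK (aKer γ i j) (cmul j f) x v * pv i g x v
      - (∑ j, KK (bKer γ j) (pv j f) x v) * g x v) (1 / 2 * ∑ i, JJ γ i f g x v * v i)
  have r2 := abs_sub (∑ i, ∑ j, KK (aKer γ i j) f x v * pv i (pv j g) x v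
      - 1 / 2 * ∑ i, ∑ j, KK (aKer γ i j) (cmul j f) x v * pv i g x v)
      ((∑ j, KK (bKer γ j) (pv j f) x v) * g x v)
  have r3 := abs_sub (∑ i, ∑ j, KK (aKer γ i j) f x v * pv i (pv j g) x v)
    (1 / 2 * ∑ i, ∑ j, KK (aKer γ i j) (cmul j f) x v * pv i g x v)
  rw [abs_mul, show |(1 / 2 : ℝ)| = 1 / 2 by norm_num] at r1 r3
  rw [abs_mul] at r2
  have u1 := mul_nonneg hC2.le n1
  have u2 := mul_nonneg (mul_nonneg hC4.le hC5.le) n1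
  have u3 := mul_nonneg hC1.le n2
  have u4 := mul_nonneg hC2.le n2
  have u5 := mul_nonneg (mul_nonneg hC4.le hC5.le) n2
  linarith

end

/-! ### Weak forms -/

lemma bn_add_le (γ : ℝ) (v p q : E3) : bn γ v (p + q) ≤ bn γ v p + bn γ v q := by
  rw [bn, bn, bn, ← Finset.sum_add_distrib]
  refine Finset.sum_le_sum fun k _ => ?_
  simp only [PiLp.add_apply, mul_add, Finset.sum_add_distrib]
  exact abs_add_le _ _

lemma bn_smul (γ : ℝ) (v : E3) (c : ℝ) (p : E3) : bn γ v (c • p) = |c| * bn γ v p := by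
  rw [bn, bn, Finset.mul_sum]
  refine Finset.sum_congr rfl fun k _ => ?_
  rw [← abs_mul, Finset.mul_sum]
  congr 1
  refine Finset.sum_congr rfl fun l _ => ?_
  simp only [PiLp.smul_apply, smul_eq_mul]; ring

lemma norm_le_of_coord {p : E3} {R : ℝ} (h : ∀ i, |p i| ≤ R) : ‖p‖ ≤ 3 * R := by
  have hR : 0 ≤ R := (abs_nonneg _).trans (h 0)
  rw [EuclideanSpace.norm_eq]
  refine Real.sqrt_le_iff.2 ⟨by positivity, ?_⟩
  have h2 : ∀ i, ‖p i‖ ^ 2 ≤ R ^ 2 := fun i => by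
    rw [Real.norm_eq_abs]
    exact pow_le_pow_left₀ (abs_nonneg _) (h i) 2
  refine (Finset.sum_le_sum fun i _ => h2 i).trans ?_
  simp
  nlinarith [sq_nonneg R]

lemma grad_mul {ρ ψ : E3 → ℝ} {v : E3} (hρ : DifferentiableAt ℝ ρ v) (hψ : DifferentiableAt ℝ ψ v) :
    grad (fun u => ρ u * ψ u) v = ψ v • grad ρ v + ρ v • grad ψ v := by
  ext i
  simp only [grad, PiLp.add_apply, PiLp.smul_apply, smul_eq_mul, pd_mul i hρ hψ]
  ring

lemma tgV_mul (γ : ℝ) (k : Fin 3) {ρ ψ : E3 → ℝ} {v : E3} (hρ : DifferentiableAt ℝ ρ v)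
    (hψ : DifferentiableAt ℝ ψ v) :
    tgV γ k (fun u => ρ u * ψ u) v = ψ v * tgV γ k ρ v + ρ v * tgV γ k ψ v := by
  rw [tgV, tgV, tgV, Finset.mul_sum, Finset.mul_sum, ← Finset.sum_add_distrib]
  exact Finset.sum_congr rfl fun l _ => by rw [pd_mul l hρ hψ]; ring

lemma abs_pd_jap_rpow_le (s : ℝ) (i : Fin 3) (v : E3) :
    |pd i (fun u => jap u ^ s) v| ≤ |s| * jap v ^ s := by
  have a := (abs_coord_le v i).trans (norm_le_jap v)
  have p := jap_rpow_nonneg v (s - 2)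
  have e : jap v ^ (s - 1) = jap v ^ (s - 2) * jap v := by
    rw [show s - 1 = s - 2 + 1 by ring, jap_rpow_add, Real.rpow_one]
  have m := jap_rpow_mono v (show s - 1 ≤ s by linarith)
  rw [pd_jap_rpow, abs_mul, abs_mul, abs_of_nonneg p, mul_assoc]
  gcongr
  calc _ ≤ jap v ^ (s - 2) * jap v := by gcongr
    _ ≤ _ := by rw [← e]; exact m

lemma differentiable_pd_jap_rpow (s : ℝ) (i : Fin 3) :
    Differentiable ℝ (pd i fun u => jap u ^ s) := by
  have e : (pd i fun u => jap u ^ s) = fun v => s * jap v ^ (s - 2) * v i :=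
    funext fun v => pd_jap_rpow i s v
  rw [e]
  exact ((differentiable_jap_rpow _).const_mul s).mul (differentiable_coord i)

lemma abs_pd_pd_jap_rpow_le (s : ℝ) (i j : Fin 3) (v : E3) :
    |pd i (pd j fun u => jap u ^ s) v| ≤ |s| * (|s - 2| + 1) * jap v ^ s := by
  have e : (pd j fun u => jap u ^ s) = fun v => s * (jap v ^ (s - 2) * v j) :=
    funext fun v => by rw [pd_jap_rpow]; ring
  rw [e, pd_const_mul, abs_mul, mul_assoc, pd_mul i (differentiable_jap_rpow _ v)
    (differentiable_coord j v), pd_coord]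
  gcongr
  have a := (abs_coord_le v j).trans (norm_le_jap v)
  have b := abs_pd_jap_rpow_le (s - 2) i v
  have p := jap_rpow_nonneg v (s - 2)
  have m := jap_rpow_mono v (show s - 2 ≤ s by linarith)
  have m' := jap_rpow_mono v (show s - 1 ≤ s by linarith)
  have e : jap v ^ (s - 1) = jap v ^ (s - 2) * jap v := by
    rw [show s - 1 = s - 2 + 1 by ring, jap_rpow_add, Real.rpow_one]
  have d : |(if i = j then (1 : ℝ) else 0)| ≤ 1 := by split_ifs <;> simp
  refine (abs_add_le _ _).trans ?_
  rw [abs_mul, abs_mul, abs_of_nonneg p]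
  have n := abs_nonneg (s - 2)
  calc _ ≤ (|s - 2| * jap v ^ (s - 2)) * jap v + jap v ^ (s - 2) * 1 := by gcongr
    _ = |s - 2| * jap v ^ (s - 1) + jap v ^ (s - 2) := by rw [e]; ring
    _ ≤ |s - 2| * jap v ^ s + jap v ^ s := by gcongr
    _ = _ := by ring

lemma integrable_of_abs_le {F : E3 → ℝ} (hF : Measurable F) {A : ℝ}
    (h : ∀ v, |F v| ≤ A * jap v ^ (-4 : ℝ)) : Integrable F :=
  ((integrable_jap_rpow (by norm_num)).const_mul A).mono' hF.aestronglyMeasurable (.of_forall h)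

/-- Integration by parts. -/
lemma integral_pd_mul {J χ : E3 → ℝ} (hJ : ContDiff ℝ 1 J) (hχ : Differentiable ℝ χ) (i : Fin 3)
    {A B r s : ℝ} (hJ1 : ∀ v, |J v| ≤ A * jap v ^ s) (hJ2 : ∀ v, |pd i J v| ≤ A * jap v ^ s)
    (hχ1 : ∀ v, |χ v| ≤ B * jap v ^ r) (hχ2 : ∀ v, |pd i χ v| ≤ B * jap v ^ r) (h : s + r ≤ -4) :
    Integrable (fun v => pd i J v * χ v) ∧ Integrable (fun v => J v * pd i χ v) ∧
      Integrable (fun v => J v * χ v) ∧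
      ∫ v, pd i J v * χ v = - ∫ v, J v * pd i χ v := by
  have hA : 0 ≤ A := nonneg_of_mul_nonneg_left ((abs_nonneg _).trans (hJ1 0)) (jap_rpow_pos _ _)
  have hB : 0 ≤ B := nonneg_of_mul_nonneg_left ((abs_nonneg _).trans (hχ1 0)) (jap_rpow_pos _ _)
  have key : ∀ {F G : E3 → ℝ}, Measurable F → Measurable G → (∀ v, |F v| ≤ A * jap v ^ s) →
      (∀ v, |G v| ≤ B * jap v ^ r) → Integrable fun v => F v * G v := by
    intro F G mF mG hF hG
    refine integrable_of_abs_le (A := A * B) (mF.mul mG) fun v => ?_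
    rw [abs_mul]
    have p := jap_rpow_nonneg v s
    calc _ ≤ (A * jap v ^ s) * (B * jap v ^ r) :=
          mul_le_mul (hF v) (hG v) (abs_nonneg _) (by positivity)
      _ = A * B * jap v ^ (s + r) := by rw [jap_rpow_add]; ring
      _ ≤ _ := by have := jap_rpow_mono v h; gcongr
  have mJ := hJ.continuous.measurable
  have mχ := hχ.continuous.measurable
  have i1 := key (measurable_pd i J) mχ hJ2 hχ1
  have i2 := key mJ (measurable_pd i χ) hJ1 hχ2
  have i3 := key mJ mχ hJ1 hχ1
  refine ⟨i1, i2, i3, ?_⟩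
  have := integral_mul_fderiv_eq_neg_fderiv_mul_of_integrable (μ := (volume : Measure E3))
    (f := J) (g := χ) (v := e3 i) i1 i2 i3 (fun v _ => hJ.differentiable (by simp) v) (fun v _ => hχ v)
  exact (neg_eq_iff_eq_neg.2 this).symm

section

variable {γ : ℝ} (h1 : -2 ≤ γ) (h2 : γ ≤ 1)
include h1 h2

/-- Multiplication by a coefficient. -/
lemma bn_grad_mul_le : ∃ C : ℝ, 0 < C ∧ ∀ {ρ ψ : E3 → ℝ} {v : E3} {R : ℝ},
    DifferentiableAt ℝ ρ v → DifferentiableAt ℝ ψ v → |ρ v| ≤ R → (∀ i, |pd i ρ v| ≤ R) →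
    bn γ v (grad (fun u => ρ u * ψ u) v) ≤ C * R * D1 γ ψ v := by
  obtain ⟨C, hC, h⟩ := bn_bounds h1 h2
  refine ⟨C * 3 + 1, by positivity, fun {ρ ψ v R} hρ hψ b1 b2 => ?_⟩
  have hR : 0 ≤ R := (abs_nonneg _).trans b1
  have p := jap_rpow_nonneg v (γ / 2 + 1)
  have q := bn_nonneg γ v (grad ψ v)
  have a := (h v (grad ρ v)).2
  have a' : ‖grad ρ v‖ ≤ 3 * R := norm_le_of_coord b2
  rw [grad_mul hρ hψ]
  refine (bn_add_le _ _ _ _).trans ?_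
  rw [bn_smul, bn_smul, D1, ← bn_grad]
  calc _ ≤ |ψ v| * (C * jap v ^ (γ / 2 + 1) * (3 * R)) + R * bn γ v (grad ψ v) := by
        gcongr
        exact a.trans (by gcongr)
    _ ≤ _ := by nlinarith [mul_nonneg (mul_nonneg hC.le hR) q,
        mul_nonneg hR (mul_nonneg p (abs_nonneg (ψ v)))]

lemma D1_mul_le : ∃ C : ℝ, 0 < C ∧ ∀ {ρ ψ : E3 → ℝ} {v : E3} {R : ℝ},
    DifferentiableAt ℝ ρ v → DifferentiableAt ℝ ψ v → |ρ v| ≤ R → (∀ i, |pd i ρ v| ≤ R) →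
    D1 γ (fun u => ρ u * ψ u) v ≤ C * R * D1 γ ψ v := by
  obtain ⟨C, hC, h⟩ := bn_grad_mul_le h1 h2
  refine ⟨C + 1, by positivity, fun {ρ ψ v R} hρ hψ b1 b2 => ?_⟩
  have hR : 0 ≤ R := (abs_nonneg _).trans b1
  have p := jap_rpow_nonneg v (γ / 2 + 1)
  have a := h hρ hψ b1 b2
  have e : D1 γ (fun u => ρ u * ψ u) v = jap v ^ (γ / 2 + 1) * |ρ v * ψ v| +
    bn γ v (grad (fun u => ρ u * ψ u) v) := rfl
  have e' : D1 γ ψ v = jap v ^ (γ / 2 + 1) * |ψ v| + bn γ v (grad ψ v) := rfl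
  have q := bn_nonneg γ v (grad ψ v)
  have t : jap v ^ (γ / 2 + 1) * |ρ v * ψ v| ≤ R * D1 γ ψ v := by
    rw [abs_mul, e']
    calc _ ≤ jap v ^ (γ / 2 + 1) * (R * |ψ v|) := by gcongr
      _ ≤ _ := by nlinarith [mul_nonneg hR q]
  rw [e]
  linarith

/-- The test vector field in the weak form of `Γ`. -/
lemma bn_test_le : ∃ C : ℝ, 0 < C ∧ ∀ {ρ ψ : E3 → ℝ} {v : E3} {R : ℝ},
    DifferentiableAt ℝ ρ v → DifferentiableAt ℝ ψ v → |ρ v| ≤ R → (∀ i, |pd i ρ v| ≤ R) →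
    bn γ v (grad (fun u => ρ u * ψ u) v + (ρ v * ψ v / 2) • v) ≤ C * R * D1 γ ψ v := by
  obtain ⟨C, hC, h⟩ := bn_grad_mul_le h1 h2
  obtain ⟨D, hD, h'⟩ := bn_self_le h1 h2
  refine ⟨C + D, by positivity, fun {ρ ψ v R} hρ hψ b1 b2 => ?_⟩
  have hR : 0 ≤ R := (abs_nonneg _).trans b1
  have p := jap_rpow_nonneg v (γ / 2 + 1)
  have e' : D1 γ ψ v = jap v ^ (γ / 2 + 1) * |ψ v| + bn γ v (grad ψ v) := rfl
  have q := bn_nonneg γ v (grad ψ v)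
  have a := h hρ hψ b1 b2
  have a2 := h' v
  have t : |ρ v * ψ v / 2| * bn γ v v ≤ D * R * D1 γ ψ v := by
    rw [abs_div, abs_mul, abs_two, e']
    calc _ ≤ (R * |ψ v| / 1) * (D * jap v ^ (γ / 2 + 1)) := by
          gcongr
          · exact bn_nonneg γ v v
          · norm_num
      _ ≤ _ := by nlinarith [mul_nonneg (mul_nonneg hD.le hR) q]
  refine (bn_add_le _ _ _ _).trans ?_
  rw [bn_smul]
  linarith

/-- Integration by parts in `Γ`. -/
lemma integral_Gam_mul {n : ℕ} {s t r B : ℝ} {f g : E3 → E3 → ℝ} (H : Sm (n + 2) s f)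
    (H' : Sm (n + 2) t g) {χ : E3 → ℝ} (hχ : Differentiable ℝ χ)
    (hχ1 : ∀ v, |χ v| ≤ B * jap v ^ r) (hχ2 : ∀ i v, |pd i χ v| ≤ B * jap v ^ r)
    (h : 13 + t + r ≤ -4) (x : E3) :
    ∫ v, Gam γ f g x v * χ v =
      - ∫ v, ∑ i, JJ γ i f g x v * (grad χ v + (χ v / 2) • v) i := by
  have hJ : ∀ i, Sm (n + 1) (12 + t) (JJ γ i f g) := fun i => H.JJ h1 h2 H' i
  have hJv : ∀ i, Sm n (1 + (12 + t)) (cmul i (JJ γ i f g)) := fun i =>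
    ((hJ i).le (Nat.le_succ n)).cmul i
  have hB : 0 ≤ B := nonneg_of_mul_nonneg_left ((abs_nonneg _).trans (hχ1 0)) (jap_rpow_pos _ _)
  have hp : ∀ i, Integrable (fun v => pd i (JJ γ i f g x) v * χ v) ∧
      Integrable (fun v => JJ γ i f g x v * pd i χ v) ∧
      Integrable (fun v => JJ γ i f g x v * χ v) ∧
      ∫ v, pd i (JJ γ i f g x) v * χ v = - ∫ v, JJ γ i f g x v * pd i χ v := fun i => by
    obtain ⟨A1, hA1, b1⟩ := Gr.bound (hJ i)
    obtain ⟨A2, hA2, b2⟩ := Gr.bound ((hJ i).pv i)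
    refine integral_pd_mul (A := A1 + A2) (s := 12 + t) (((hJ i).contDiff_v x).of_le (by simp)) hχ i
      (fun v => (b1 (x, v)).trans ?_) (fun v => (b2 (x, v)).trans ?_) hχ1 (hχ2 i) (by linarith)
    · have := jap_rpow_nonneg v (12 + t)
      exact mul_le_mul_of_nonneg_right (by linarith) this
    · have := jap_rpow_nonneg v (12 + t)
      exact mul_le_mul_of_nonneg_right (by linarith) this
  have hq : ∀ i, Integrable fun v => v i / 2 * JJ γ i f g x v * χ v := fun i => by
    obtain ⟨A, hA, b⟩ := Gr.bound (hJv i)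
    have hm : Measurable fun v => v i / 2 * JJ γ i f g x v * χ v :=
      (((measurable_coord i).div_const 2).mul
        (((hJ i).contDiff_v x).continuous.measurable)).mul hχ.continuous.measurable
    refine integrable_of_abs_le (A := A * B) hm fun v => ?_
    have b' : |v i * JJ γ i f g x v| ≤ A * jap v ^ (1 + (12 + t)) := b (x, v)
    have p := jap_rpow_nonneg v (1 + (12 + t))
    have e : v i / 2 * JJ γ i f g x v * χ v = v i * JJ γ i f g x v * χ v / 2 := by ring
    rw [e, abs_div, abs_mul, abs_two]
    calc _ ≤ (A * jap v ^ (1 + (12 + t))) * (B * jap v ^ r) / 1 := by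
          gcongr
          · exact mul_nonneg (by positivity) ((abs_nonneg _).trans (hχ1 v))
          · exact hχ1 v
          · norm_num
      _ = A * B * jap v ^ (1 + (12 + t) + r) := by rw [jap_rpow_add v (1 + (12 + t))]; ring
      _ ≤ _ := by
          have := jap_rpow_mono v (show 1 + (12 + t) + r ≤ -4 by linarith)
          gcongr
  rw [Gam_eq h1 h2 H H']
  have e1 : ∫ v, (∑ i, (pv i (JJ γ i f g) x v - v i / 2 * JJ γ i f g x v)) * χ v =
      ∑ i, ((∫ v, pd i (JJ γ i f g x) v * χ v) - ∫ v, v i / 2 * JJ γ i f g x v * χ v) := by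
    rw [Finset.sum_congr rfl fun i _ => (integral_sub' (hp i).1 (hq i)).symm,
      ← integral_finsetSum _ fun i _ => (hp i).1.sub (hq i)]
    refine integral_congr_ae (.of_forall fun v => ?_)
    simp only [Finset.sum_mul, pv]
    exact Finset.sum_congr rfl fun i _ => by simp only [Pi.sub_apply]; ring
  have e2 : ∫ v, ∑ i, JJ γ i f g x v * (grad χ v + (χ v / 2) • v) i =
      ∑ i, ((∫ v, JJ γ i f g x v * pd i χ v) + ∫ v, v i / 2 * JJ γ i f g x v * χ v) := by
    rw [Finset.sum_congr rfl fun i _ => (integral_add' (hp i).2.1 (hq i)).symm,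
      ← integral_finsetSum _ fun i _ => (hp i).2.1.add (hq i)]
    refine integral_congr_ae (.of_forall fun v => ?_)
    refine Finset.sum_congr rfl fun i _ => ?_
    simp only [Pi.add_apply, grad, PiLp.add_apply, PiLp.smul_apply, smul_eq_mul]; ring
  rw [e1, e2, ← Finset.sum_neg_distrib]
  refine Finset.sum_congr rfl fun i _ => ?_
  rw [(hp i).2.2.2]; ring

/-- The pointwise bound on the weak form of `Γ`. -/
lemma abs_weak_le : ∃ C : ℝ, 0 < C ∧ ∀ {n : ℕ} {s : ℝ} {f g : E3 → E3 → ℝ}, Sm (n + 1) s f →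
    s ≤ 0 → ∀ {ρ ψ : E3 → ℝ} {x v : E3} {R : ℝ},
    DifferentiableAt ℝ ρ v → DifferentiableAt ℝ ψ v → |ρ v| ≤ R → (∀ i, |pd i ρ v| ≤ R) →
    |∑ i, JJ γ i f g x v * (grad (fun u => ρ u * ψ u) v + (ρ v * ψ v / 2) • v) i| ≤
      C * majorant (f x) v * D1 γ (g x) v * R * D1 γ ψ v := by
  obtain ⟨C, hC, h⟩ := abs_sum_flux_le h1 h2
  obtain ⟨D, hD, h'⟩ := bn_test_le h1 h2
  refine ⟨C * D, by positivity, fun {n s f g} H hs {ρ ψ x v R} hρ hψ b1 b2 => ?_⟩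
  have m0 := majorant_nonneg (f x) v
  have d0 := D1_nonneg γ (g x) v
  have e : D1 γ (g x) v = bn γ v (grad (g x) v) + jap v ^ (γ / 2 + 1) * |g x v| := by
    rw [D1, ← bn_grad, add_comm]
  refine (h H hs x v _ (grad (g x) v) (g x v)).trans ?_
  rw [← e]
  calc _ ≤ C * majorant (f x) v * D1 γ (g x) v * (D * R * D1 γ ψ v) :=
        mul_le_mul_of_nonneg_left (h' hρ hψ b1 b2) (by positivity)
    _ = _ := by ring

/-- The components `∑_l 𝐁_{ql} h_l`. -/
lemma flux_eq_sum {n : ℕ} {t : ℝ} {f : E3 → E3 → ℝ}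
    {h : Fin 3 → E3 → E3 → ℝ} (H' : ∀ l, Sm (n + 1) t (h l)) (x v : E3) (i q : Fin 3) :
    ∑ l, matB γ q l v * JJ γ i f (h l) x v =
      flux γ f x v (grad (fun u => ∑ l, matB γ q l u * h l x u) v + (-1 : ℝ) •
        (WithLp.toLp 2 fun k => ∑ r, matE γ k q r v * ∑ l, matB γ r l v * h l x v : E3))
        (∑ l, matB γ q l v * h l x v) i := by
  have hd : ∀ l, DifferentiableAt ℝ (fun u => matB γ q l u * h l x u) v := fun l =>
    (differentiable_matB h1 h2 q l v).mul ((H' l).diff_v x v)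
  -- Since ∂_k(𝐁h) = 𝐁∂_k h + (∂_k𝐁)h and ∂_k𝐁 = E_k𝐁, subtracting E_k(𝐁h) from the gradient of the
  -- combination leaves the combination of the gradients.
  have e : ∀ j, (grad (fun u => ∑ l, matB γ q l u * h l x u) v + (-1 : ℝ) •
        (WithLp.toLp 2 fun k => ∑ r, matE γ k q r v * ∑ l, matB γ r l v * h l x v : E3)) j =
      ∑ l, matB γ q l v * pv j (h l) x v := fun j => by
    simp only [grad, PiLp.add_apply, PiLp.smul_apply, smul_eq_mul]
    rw [pd_sum j _ fun l _ => hd l]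
    simp_rw [fun l => pd_mul j (differentiable_matB h1 h2 q l v) ((H' l).diff_v x v),
      pd_matB_eq h1 h2]
    simp only [pv, Fin.sum_univ_three]
    ring
  simp_rw [flux, e, JJ, Finset.mul_sum]
  rw [Finset.sum_comm]
  refine Finset.sum_congr rfl fun j _ => ?_
  rw [← Finset.sum_sub_distrib]
  exact Finset.sum_congr rfl fun l _ => by ring

/-- The pointwise bound on the weak form of `∑_l 𝐁_{jl} Γ(f, h_l)`. -/
lemma abs_weak_sum_le : ∃ C : ℝ, 0 < C ∧ ∀ {n : ℕ} {s t : ℝ} {f : E3 → E3 → ℝ}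
    {h : Fin 3 → E3 → E3 → ℝ}, Sm (n + 1) s f → s ≤ 0 → (∀ l, Sm (n + 1) t (h l)) →
    ∀ {ρ ψ : E3 → ℝ} {x v : E3} {R : ℝ} (j : Fin 3),
    DifferentiableAt ℝ ρ v → DifferentiableAt ℝ ψ v → |ρ v| ≤ R → (∀ i, |pd i ρ v| ≤ R) →
    |∑ l, ∑ i, JJ γ i f (h l) x v * (grad (fun u => matB γ j l u * (ρ u * ψ u)) v +
      (matB γ j l v * (ρ v * ψ v) / 2) • v) i| ≤
      C * majorant (f x) v * (∑ q, D1 γ (fun u => ∑ l, matB γ q l u * h l x u) v) *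
        R * D1 γ ψ v := by
  obtain ⟨C, hC, hf⟩ := abs_sum_flux_le h1 h2
  obtain ⟨D, hD, hD'⟩ := bn_test_le h1 h2
  obtain ⟨E, hE, hE'⟩ := abs_matE_le h1 h2
  obtain ⟨B, hB, hb⟩ := bn_bounds h1 h2
  refine ⟨C * (1 + 3 * B * E) * (D + 9 * B * E), by positivity,
    fun {n s t f h} H hs H' {ρ ψ x v R} j hρ hψ b1 b2 => ?_⟩
  have hR : 0 ≤ R := (abs_nonneg _).trans b1
  have p0 := jap_rpow_nonneg v (γ / 2 + 1)
  have m0 := majorant_nonneg (f x) v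
  set Hq : Fin 3 → E3 → ℝ := fun q u => ∑ l, matB γ q l u * h l x u with hHq
  set S := ∑ q, D1 γ (Hq q) v with hS
  have S0 : 0 ≤ S := Finset.sum_nonneg fun q _ => D1_nonneg _ _ _
  have hle : ∀ q, D1 γ (Hq q) v ≤ S := fun q =>
    Finset.single_le_sum (f := fun q => D1 γ (Hq q) v) (fun q _ => D1_nonneg _ _ _)
      (Finset.mem_univ q)
  have d1 : ∀ q, D1 γ (Hq q) v = jap v ^ (γ / 2 + 1) * |Hq q v| + bn γ v (grad (Hq q) v) :=
    fun q => rfl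
  have hsum : jap v ^ (γ / 2 + 1) * ∑ r, |Hq r v| ≤ S := by
    rw [Finset.mul_sum]
    refine Finset.sum_le_sum fun q _ => ?_
    rw [d1]
    exact le_add_of_nonneg_right (bn_nonneg _ _ _)
  set ev : Fin 3 → E3 := fun q => WithLp.toLp 2 fun k => ∑ r, matE γ k q r v * Hq r v with hev
  have hevn : ∀ q, ‖ev q‖ ≤ 3 * (E * ∑ r, |Hq r v|) := fun q => by
    refine norm_le_of_coord fun k => ?_
    change |∑ r, matE γ k q r v * Hq r v| ≤ _
    refine (Finset.abs_sum_le_sum_abs _ _).trans ?_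
    rw [Finset.mul_sum]
    refine Finset.sum_le_sum fun r _ => ?_
    rw [abs_mul]
    have := hE' v k q r
    gcongr
  have hK : ∀ (q : Fin 3) (p : E3), |∑ i, (∑ l, matB γ q l v * JJ γ i f (h l) x v) * p i| ≤
      C * (1 + 3 * B * E) * majorant (f x) v * S * bn γ v p := fun q p => by
    simp_rw [flux_eq_sum h1 h2 H' x v]
    refine (hf H hs x v p _ _).trans ?_
    have n1 := bn_nonneg γ v p
    have t1 : bn γ v (grad (Hq q) v + (-1 : ℝ) • ev q) ≤
        bn γ v (grad (Hq q) v) + 3 * B * E * S := by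
      refine (bn_add_le _ _ _ _).trans ?_
      rw [bn_smul, abs_neg, abs_one, one_mul]
      have := (hb v (ev q)).2
      have t2 : B * jap v ^ (γ / 2 + 1) * ‖ev q‖ ≤ 3 * B * E * S := by
        calc _ ≤ B * jap v ^ (γ / 2 + 1) * (3 * (E * ∑ r, |Hq r v|)) := by
              have := hevn q
              gcongr
          _ = 3 * B * E * (jap v ^ (γ / 2 + 1) * ∑ r, |Hq r v|) := by ring
          _ ≤ _ := by gcongr
      linarith
    have t3 : bn γ v (grad (Hq q) v + (-1 : ℝ) • ev q) + jap v ^ (γ / 2 + 1) * |Hq q v| ≤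
        (1 + 3 * B * E) * S := by
      have := hle q
      rw [d1] at this
      linarith
    calc _ ≤ C * majorant (f x) v * ((1 + 3 * B * E) * S) * bn γ v p :=
          mul_le_mul_of_nonneg_right (mul_le_mul_of_nonneg_left t3 (by positivity)) n1
      _ = _ := by ring
  set p : E3 := grad (fun u => ρ u * ψ u) v + (ρ v * ψ v / 2) • v with hp
  set pe : Fin 3 → E3 := fun q => WithLp.toLp 2 fun i => matE γ i j q v with hpe
  -- The coefficient 𝐁_{jl} is taken out of the test function and summed against the fluxes, so that
  -- only the combinations 𝐁h occur and no power of ⟨v⟩ is lost. The commutator is again a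
  -- combination of these fluxes, because ∂𝐁 = E𝐁, tested against the bounded vectors `pe`.
  have e : ∑ l, ∑ i, JJ γ i f (h l) x v * (grad (fun u => matB γ j l u * (ρ u * ψ u)) v +
      (matB γ j l v * (ρ v * ψ v) / 2) • v) i =
      ∑ i, (∑ l, matB γ j l v * JJ γ i f (h l) x v) * p i +
        ρ v * ψ v * ∑ q, ∑ i, (∑ l, matB γ q l v * JJ γ i f (h l) x v) * (pe q) i := by
    have e1 : ∀ l i, (grad (fun u => matB γ j l u * (ρ u * ψ u)) v +
        (matB γ j l v * (ρ v * ψ v) / 2) • v) i =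
        matB γ j l v * p i + ρ v * ψ v * ∑ q, (pe q) i * matB γ q l v := fun l i => by
      rw [grad_mul (ψ := fun u => ρ u * ψ u) (differentiable_matB h1 h2 j l v) (hρ.mul hψ)]
      have : pd i (matB γ j l) v = ∑ q, (pe q) i * matB γ q l v := pd_matB_eq h1 h2 i j l v
      rw [← this]
      simp only [hp, grad, PiLp.add_apply, PiLp.smul_apply, smul_eq_mul]
      ring
    simp_rw [e1]
    simp only [Fin.sum_univ_three]
    ring
  rw [e]
  have k1 := (hK j p).trans (mul_le_mul_of_nonneg_left (hD' hρ hψ b1 b2) (by positivity))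
  have k2 : ∀ q, |∑ i, (∑ l, matB γ q l v * JJ γ i f (h l) x v) * (pe q) i| ≤
      C * (1 + 3 * B * E) * majorant (f x) v * S * (3 * B * E * jap v ^ (γ / 2 + 1)) := fun q => by
    refine (hK q (pe q)).trans (mul_le_mul_of_nonneg_left ?_ (by positivity))
    have n : ‖pe q‖ ≤ 3 * E := norm_le_of_coord fun i => hE' v i j q
    calc _ ≤ B * jap v ^ (γ / 2 + 1) * (3 * E) := (hb v (pe q)).2.trans (by gcongr)
      _ = _ := by ring
  have k3 : |ρ v * ψ v| ≤ R * |ψ v| := by rw [abs_mul]; gcongr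
  have k4 : jap v ^ (γ / 2 + 1) * |ψ v| ≤ D1 γ ψ v :=
    le_add_of_nonneg_right (Finset.sum_nonneg fun _ _ => abs_nonneg _)
  refine (abs_add_le _ _).trans ?_
  rw [abs_mul]
  calc _ ≤ C * (1 + 3 * B * E) * majorant (f x) v * S * (D * R * D1 γ ψ v) +
        R * |ψ v| * ∑ q : Fin 3,
          C * (1 + 3 * B * E) * majorant (f x) v * S * (3 * B * E * jap v ^ (γ / 2 + 1)) := by
        gcongr
        exact (Finset.abs_sum_le_sum_abs _ _).trans (Finset.sum_le_sum fun q _ => k2 q)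
    _ = C * (1 + 3 * B * E) * majorant (f x) v * S * (D * R * D1 γ ψ v) +
        C * (1 + 3 * B * E) * majorant (f x) v * S * (9 * B * E) * R *
          (jap v ^ (γ / 2 + 1) * |ψ v|) := by
        simp; ring
    _ ≤ C * (1 + 3 * B * E) * majorant (f x) v * S * (D * R * D1 γ ψ v) +
        C * (1 + 3 * B * E) * majorant (f x) v * S * (9 * B * E) * R * D1 γ ψ v := by gcongr
    _ = _ := by ring

/-- The pointwise bound on the adjoint of `∇̃_v`. -/
lemma abs_div_matB_le : ∃ C : ℝ, 0 < C ∧ ∀ {ρ ψ : E3 → ℝ} {v : E3} {R : ℝ} (j : Fin 3),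
    DifferentiableAt ℝ ρ v → DifferentiableAt ℝ ψ v → |ρ v| ≤ R → (∀ i, |pd i ρ v| ≤ R) →
    |∑ l, pd l (fun u => matB γ j l u * (ρ u * ψ u)) v| ≤ C * R * D1 γ ψ v := by
  obtain ⟨C, hC, h⟩ := D1_mul_le h1 h2
  obtain ⟨B, hB, hb⟩ := abs_pd_matB_le h1 h2
  refine ⟨C + 3 * B, by positivity, fun {ρ ψ v R} j hρ hψ b1 b2 => ?_⟩
  have hR : 0 ≤ R := (abs_nonneg _).trans b1
  have p0 := jap_rpow_nonneg v (γ / 2 + 1)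
  have e : ∑ l, pd l (fun u => matB γ j l u * (ρ u * ψ u)) v =
      (∑ l, pd l (matB γ j l) v) * (ρ v * ψ v) + tgV γ j (fun u => ρ u * ψ u) v := by
    rw [tgV, Finset.sum_mul, ← Finset.sum_add_distrib]
    exact Finset.sum_congr rfl fun l _ => pd_mul l (differentiable_matB h1 h2 j l v) (hρ.mul hψ)
  have t1 : |tgV γ j (fun u => ρ u * ψ u) v| ≤ C * R * D1 γ ψ v := by
    refine le_trans ?_ (h hρ hψ b1 b2)
    have := Finset.single_le_sum (f := fun k => |tgV γ k (fun u => ρ u * ψ u) v|)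
      (fun _ _ => abs_nonneg _) (Finset.mem_univ j)
    refine this.trans (le_add_of_nonneg_left (by positivity))
  have t2 : |∑ l, pd l (matB γ j l) v| ≤ 3 * B * jap v ^ (γ / 2 + 1) := by
    refine (Finset.abs_sum_le_sum_abs _ _).trans
      ((Finset.sum_le_sum fun l _ => hb v l j l).trans (le_of_eq ?_))
    simp; ring
  have k4 : jap v ^ (γ / 2 + 1) * |ψ v| ≤ D1 γ ψ v :=
    le_add_of_nonneg_right (Finset.sum_nonneg fun _ _ => abs_nonneg _)
  rw [e]
  refine (abs_add_le _ _).trans ?_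
  rw [abs_mul, abs_mul (ρ v)]
  calc _ ≤ 3 * B * jap v ^ (γ / 2 + 1) * (R * |ψ v|) + C * R * D1 γ ψ v := by gcongr
    _ = 3 * B * R * (jap v ^ (γ / 2 + 1) * |ψ v|) + C * R * D1 γ ψ v := by ring
    _ ≤ 3 * B * R * D1 γ ψ v + C * R * D1 γ ψ v := by gcongr
    _ = _ := by ring

/-! ### Weights -/

/-- A power of ⟨v⟩ commutes with D1 up to a constant: write f as ⟨v⟩^{-s} times ⟨v⟩^s f and use that
the gradient of ⟨v⟩^{-s} is O(⟨v⟩^{-s}). -/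
lemma jap_rpow_mul_D1_le (s : ℝ) : ∃ C : ℝ, 0 < C ∧ ∀ {f : E3 → ℝ}, Differentiable ℝ f → ∀ v,
    jap v ^ s * D1 γ f v ≤ C * D1 γ (fun u => jap u ^ s * f u) v := by
  obtain ⟨C, hC, h⟩ := D1_mul_le h1 h2
  refine ⟨C * (|s| + 1), by positivity, fun {f} hf v => ?_⟩
  have e : f = fun u => jap u ^ (-s) * (jap u ^ s * f u) := by
    funext u
    rw [← mul_assoc, ← jap_rpow_add]; simp
  have p := jap_rpow_nonneg v (-s)
  have q := jap_rpow_nonneg v s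
  have b := h (ρ := fun u => jap u ^ (-s)) (ψ := fun u => jap u ^ s * f u) (v := v)
    (R := (|s| + 1) * jap v ^ (-s)) (differentiable_jap_rpow _ v)
    ((differentiable_jap_rpow _ v).mul (hf v))
    (by rw [abs_of_nonneg p]; nlinarith [mul_nonneg (abs_nonneg s) p])
    (fun i => by
      have := abs_pd_jap_rpow_le (-s) i v
      rw [abs_neg] at this
      linarith)
  rw [← e] at b
  have n : jap v ^ s * jap v ^ (-s) = 1 := by rw [← jap_rpow_add]; simp
  calc _ ≤ jap v ^ s * (C * ((|s| + 1) * jap v ^ (-s)) *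
        D1 γ (fun u => jap u ^ s * f u) v) := by gcongr
    _ = C * (|s| + 1) * D1 γ (fun u => jap u ^ s * f u) v * (jap v ^ s * jap v ^ (-s)) := by ring
    _ = _ := by rw [n, mul_one]

lemma abs_tgV_le : ∃ C : ℝ, 0 < C ∧ ∀ {f : E3 → ℝ} {v : E3} {R : ℝ} (k : Fin 3),
    (∀ i, |pd i f v| ≤ R) → |tgV γ k f v| ≤ C * R * jap v ^ (γ / 2 + 1) := by
  obtain ⟨B, hB, hb⟩ := abs_matB_le h1 h2
  refine ⟨3 * B, by positivity, fun {f v R} k h => ?_⟩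
  refine (Finset.abs_sum_le_sum_abs _ _).trans ((Finset.sum_le_sum fun l _ =>
    (?_ : _ ≤ B * jap v ^ (γ / 2 + 1) * R)).trans (le_of_eq ?_))
  · have p := jap_rpow_nonneg v (γ / 2 + 1)
    rw [abs_mul]
    exact mul_le_mul (hb v k l) (h l) (abs_nonneg _) (by positivity)
  · simp; ring

omit h1 h2 in
lemma weight_arith {P X Y Z R T B : ℝ} (hP : 0 ≤ P) (hX : 0 ≤ X) (hY : 0 ≤ Y) (hZ : 0 ≤ Z)
    (hR : 0 ≤ R) (hT : 0 ≤ T) : P * P * (R * X) + P * (3 * T * R * P * X + R * Y) +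
      (R * Z + 6 * T * R * P * Y + 81 * B ^ 2 * R * (P * P) * X) ≤
    (1 + (1 + 3 * T) + (1 + 18 * T + 81 * B ^ 2)) * R * (P * P * X + P * Y + Z) := by
  rw [← sub_nonneg]
  have e : (1 + (1 + 3 * T) + (1 + 18 * T + 81 * B ^ 2)) * R * (P * P * X + P * Y + Z) -
      (P * P * (R * X) + P * (3 * T * R * P * X + R * Y) +
      (R * Z + 6 * T * R * P * Y + 81 * B ^ 2 * R * (P * P) * X)) =
      R * (P * P * X) * (2 + 18 * T) + R * (P * Y) * (2 + 15 * T + 81 * B ^ 2) +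
        R * Z * (2 + 21 * T + 81 * B ^ 2) := by ring
  rw [e]
  positivity

set_option maxHeartbeats 800000 in
lemma D2_mul_le : ∃ C : ℝ, 0 < C ∧ ∀ {ρ ψ : E3 → ℝ} {v : E3} {R : ℝ},
    Differentiable ℝ ρ → Differentiable ℝ ψ → (∀ i, Differentiable ℝ (pd i ρ)) →
    (∀ i, Differentiable ℝ (pd i ψ)) → |ρ v| ≤ R → (∀ i, |pd i ρ v| ≤ R) →
    (∀ i j, |pd i (pd j ρ) v| ≤ R) →
    D2 γ (fun u => ρ u * ψ u) v ≤ C * R * D2 γ ψ v := by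
  obtain ⟨T, hT, ht⟩ := abs_tgV_le h1 h2
  obtain ⟨B, hB, hb⟩ := abs_matB_le h1 h2
  refine ⟨1 + (1 + 3 * T) + (1 + 18 * T + 81 * B ^ 2), by positivity,
    fun {ρ ψ v R} hρ hψ hρ' hψ' b1 b2 b3 => ?_⟩
  have hR : 0 ≤ R := (abs_nonneg _).trans b1
  set P := jap v ^ (γ / 2 + 1) with hP
  have p0 : 0 ≤ P := jap_rpow_nonneg v (γ / 2 + 1)
  have e : jap v ^ (γ + 2) = P * P := by
    rw [hP, ← jap_rpow_add]; ring_nf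
  set X := |ψ v| with hX
  set Y := ∑ k, |tgV γ k ψ v| with hY
  set Z := ∑ k, ∑ l, |bhb γ k l ψ v| with hZ
  have X0 : 0 ≤ X := abs_nonneg _
  have Y0 : 0 ≤ Y := by positivity
  have Z0 : 0 ≤ Z := by positivity
  have eD : D2 γ ψ v = P * P * X + P * Y + Z := by rw [D2, e]
  have tρ : ∀ k, |tgV γ k ρ v| ≤ T * R * P := fun k => ht k b2
  have s1 : ∑ k, |tgV γ k (fun u => ρ u * ψ u) v| ≤ 3 * T * R * P * X + R * Y := by
    have : ∀ k, |tgV γ k (fun u => ρ u * ψ u) v| ≤ T * R * P * X + R * |tgV γ k ψ v| := fun k => by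
      rw [tgV_mul γ k (hρ v) (hψ v)]
      refine (abs_add_le _ _).trans ?_
      rw [abs_mul, abs_mul]
      have := tρ k
      calc _ ≤ X * (T * R * P) + R * |tgV γ k ψ v| := by gcongr
        _ = _ := by ring
    refine (Finset.sum_le_sum fun k _ => this k).trans (le_of_eq ?_)
    simp only [hY, Fin.sum_univ_three]
    ring
  have bρ : ∀ k l, |bhb γ k l ρ v| ≤ 9 * (B ^ 2 * R * (P * P)) := fun k l => by
    refine (Finset.abs_sum_le_sum_abs _ _).trans ((Finset.sum_le_sum fun i _ =>
      (Finset.abs_sum_le_sum_abs _ _).trans (Finset.sum_le_sum fun j _ =>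
      (?_ : _ ≤ B ^ 2 * R * (P * P)))).trans (le_of_eq ?_))
    · rw [abs_mul, abs_mul]
      calc _ ≤ (B * P) * (B * P) * R := mul_le_mul (mul_le_mul (hb v k i) (hb v l j)
            (abs_nonneg _) (by positivity)) (b3 i j) (abs_nonneg _) (by positivity)
        _ = _ := by ring
    · simp; ring
  have eh : ∀ k l, bhb γ k l (fun u => ρ u * ψ u) v = ρ v * bhb γ k l ψ v +
      tgV γ k ρ v * tgV γ l ψ v + tgV γ l ρ v * tgV γ k ψ v + ψ v * bhb γ k l ρ v := fun k l => by
    have e2 : ∀ i j, pd i (pd j fun u => ρ u * ψ u) v = pd i (pd j ρ) v * ψ v +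
        pd j ρ v * pd i ψ v + (pd i ρ v * pd j ψ v + ρ v * pd i (pd j ψ) v) := fun i j => by
      have : (pd j fun u => ρ u * ψ u) = fun u => pd j ρ u * ψ u + ρ u * pd j ψ u :=
        funext fun u => pd_mul j (hρ u) (hψ u)
      have a1 : DifferentiableAt ℝ (fun u => pd j ρ u * ψ u) v := (hρ' j v).mul (hψ v)
      have a2 : DifferentiableAt ℝ (fun u => ρ u * pd j ψ u) v := (hρ v).mul (hψ' j v)
      rw [this, pd_add i a1 a2, pd_mul i (hρ' j v) (hψ v), pd_mul i (hρ v) (hψ' j v)]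
    simp only [bhb, tgV, e2, Fin.sum_univ_three]
    ring
  have s2 : ∑ k, ∑ l, |bhb γ k l (fun u => ρ u * ψ u) v| ≤
      R * Z + 6 * T * R * P * Y + 81 * B ^ 2 * R * (P * P) * X := by
    have : ∀ k l, |bhb γ k l (fun u => ρ u * ψ u) v| ≤ R * |bhb γ k l ψ v| +
        T * R * P * |tgV γ l ψ v| + T * R * P * |tgV γ k ψ v| +
        9 * (B ^ 2 * R * (P * P)) * X := fun k l => by
      rw [eh]
      refine (abs_add_le _ _).trans (add_le_add ((abs_add_le _ _).trans (add_le_add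
        ((abs_add_le _ _).trans (add_le_add ?_ ?_)) ?_)) ?_) <;> rw [abs_mul]
      · gcongr
      · have := tρ k; gcongr
      · have := tρ l; gcongr
      · have := bρ k l
        rw [mul_comm]; gcongr
    refine (Finset.sum_le_sum fun k _ => Finset.sum_le_sum fun l _ => this k l).trans (le_of_eq ?_)
    simp only [hZ, hY, Fin.sum_univ_three]
    ring
  have e0 : D2 γ (fun u => ρ u * ψ u) v = P * P * |ρ v * ψ v| +
      P * ∑ k, |tgV γ k (fun u => ρ u * ψ u) v| +
      ∑ k, ∑ l, |bhb γ k l (fun u => ρ u * ψ u) v| := by rw [D2, e]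
  rw [e0, eD, abs_mul]
  calc _ ≤ P * P * (R * X) + P * (3 * T * R * P * X + R * Y) +
        (R * Z + 6 * T * R * P * Y + 81 * B ^ 2 * R * (P * P) * X) := by gcongr
    _ ≤ _ := weight_arith p0 X0 Y0 Z0 hR hT.le

lemma jap_rpow_mul_D2_le (s : ℝ) : ∃ C : ℝ, 0 < C ∧ ∀ {f : E3 → ℝ}, Differentiable ℝ f →
    (∀ i, Differentiable ℝ (pd i f)) → ∀ v,
    jap v ^ s * D2 γ f v ≤ C * D2 γ (fun u => jap u ^ s * f u) v := by
  obtain ⟨C, hC, h⟩ := D2_mul_le h1 h2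
  set M := |s| * (|-s - 2| + 1) + |s| + 1 with hM
  refine ⟨C * M, by positivity, fun {f} hf hf' v => ?_⟩
  have e : f = fun u => jap u ^ (-s) * (jap u ^ s * f u) := by
    funext u
    rw [← mul_assoc, ← jap_rpow_add]; simp
  have p := jap_rpow_nonneg v (-s)
  have q := jap_rpow_nonneg v s
  have u1 := mul_nonneg (abs_nonneg s) p
  have u2 : 0 ≤ |s| * (|-s - 2| + 1) * jap v ^ (-s) := by positivity
  have b := h (ρ := fun u => jap u ^ (-s)) (ψ := fun u => jap u ^ s * f u) (v := v)
    (R := M * jap v ^ (-s)) (differentiable_jap_rpow _)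
    ((differentiable_jap_rpow _).mul hf) (differentiable_pd_jap_rpow _)
    (fun i => by
      have : (pd i fun u => jap u ^ s * f u) =
          fun u => pd i (fun u => jap u ^ s) u * f u + jap u ^ s * pd i f u :=
        funext fun u => pd_mul i (differentiable_jap_rpow _ u) (hf u)
      rw [this]
      exact ((differentiable_pd_jap_rpow _ i).mul hf).add
        ((differentiable_jap_rpow _).mul (hf' i)))
    (by rw [abs_of_nonneg p, hM]; linarith)
    (fun i => by
      have := abs_pd_jap_rpow_le (-s) i v
      rw [abs_neg] at this
      rw [hM]; linarith)
    (fun i j => by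
      have := abs_pd_pd_jap_rpow_le (-s) i j v
      rw [abs_neg] at this
      rw [hM]; linarith)
  rw [← e] at b
  have n : jap v ^ s * jap v ^ (-s) = 1 := by rw [← jap_rpow_add]; simp
  calc _ ≤ jap v ^ s * (C * (M * jap v ^ (-s)) *
        D2 γ (fun u => jap u ^ s * f u) v) := by gcongr
    _ = C * M * D2 γ (fun u => jap u ^ s * f u) v * (jap v ^ s * jap v ^ (-s)) := by ring
    _ = _ := by rw [n, mul_one]

/-- 𝐁(∇²f)𝐁 and ∇̃∇̃f differ by 𝐁E∇̃f, and E is bounded. The norm of H²_{v,*} contains the latter;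
the former does not differentiate 𝐁 and obeys a plain product rule. -/
lemma abs_bhb_le : ∃ C : ℝ, 0 < C ∧ ∀ {f : E3 → ℝ}, (∀ i, Differentiable ℝ (pd i f)) →
    ∀ v k l, |bhb γ k l f v| ≤ |tgV γ k (tgV γ l f) v| +
      C * (jap v ^ (γ / 2 + 1) * ∑ k, |tgV γ k f v|) := by
  obtain ⟨E, hE, he⟩ := abs_matE_le h1 h2
  obtain ⟨B, hB, hb⟩ := abs_matB_le h1 h2
  refine ⟨3 * B * E, by positivity, fun {f} hf v k l => ?_⟩
  have p0 := jap_rpow_nonneg v (γ / 2 + 1)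
  have e1 : ∀ i, pd i (tgV γ l f) v =
      ∑ j, matB γ l j v * pd i (pd j f) v + ∑ q, matE γ i l q v * tgV γ q f v := fun i => by
    have hd : ∀ j, DifferentiableAt ℝ (fun u => matB γ l j u * pd j f u) v := fun j =>
      (differentiable_matB h1 h2 l j v).mul (hf j v)
    change pd i (fun u => ∑ j, matB γ l j u * pd j f u) v = _
    rw [pd_sum i _ fun j _ => hd j]
    simp_rw [fun j => pd_mul i (differentiable_matB h1 h2 l j v) (hf j v), pd_matB_eq h1 h2,
      tgV]
    simp only [Fin.sum_univ_three]
    ring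
  have e2 : bhb γ k l f v = tgV γ k (tgV γ l f) v -
      ∑ i, matB γ k i v * ∑ q, matE γ i l q v * tgV γ q f v := by
    rw [tgV, bhb, ← Finset.sum_sub_distrib]
    refine Finset.sum_congr rfl fun i _ => ?_
    rw [e1, mul_add, add_sub_cancel_right, Finset.mul_sum]
    simp_rw [mul_assoc]
  have e3 : |∑ i, matB γ k i v * ∑ q, matE γ i l q v * tgV γ q f v| ≤
      3 * B * E * (jap v ^ (γ / 2 + 1) * ∑ k, |tgV γ k f v|) := by
    refine (Finset.abs_sum_le_sum_abs _ _).trans ((Finset.sum_le_sum fun i _ =>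
      (?_ : _ ≤ (B * jap v ^ (γ / 2 + 1)) * (E * ∑ k, |tgV γ k f v|))).trans (le_of_eq ?_))
    · rw [abs_mul]
      refine mul_le_mul (hb v k i) ?_ (abs_nonneg _) (by positivity)
      refine (Finset.abs_sum_le_sum_abs _ _).trans ?_
      rw [Finset.mul_sum]
      refine Finset.sum_le_sum fun q _ => ?_
      rw [abs_mul]
      have := he v i l q
      gcongr
    · rw [Finset.sum_const, Finset.card_univ, Fintype.card_fin, nsmul_eq_mul]
      push_cast; ring
  rw [e2]
  exact (abs_sub _ _).trans (by linarith)

/-- The second-order quantities are controlled by those of the `H²_{v,*}` norm. -/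
lemma D2_le : ∃ C : ℝ, 0 < C ∧ ∀ {f : E3 → ℝ}, (∀ i, Differentiable ℝ (pd i f)) → ∀ v,
    D2 γ f v ≤ C * (jap v ^ (γ + 2) * |f v| + jap v ^ (γ / 2 + 1) * ∑ k, |tgV γ k f v| +
      ∑ k, ∑ l, |tgV γ k (tgV γ l f) v|) := by
  obtain ⟨C, hC, h⟩ := abs_bhb_le h1 h2
  refine ⟨1 + 9 * C, by positivity, fun {f} hf v => ?_⟩
  have q0 : 0 ≤ jap v ^ (γ + 2) * |f v| := mul_nonneg (jap_rpow_nonneg v _) (abs_nonneg _)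
  have y0 : 0 ≤ jap v ^ (γ / 2 + 1) * ∑ k, |tgV γ k f v| :=
    mul_nonneg (jap_rpow_nonneg v _) (Finset.sum_nonneg fun _ _ => abs_nonneg _)
  have z0 : 0 ≤ ∑ k, ∑ l, |tgV γ k (tgV γ l f) v| :=
    Finset.sum_nonneg fun _ _ => Finset.sum_nonneg fun _ _ => abs_nonneg _
  have hs := Finset.sum_le_sum fun k (_ : k ∈ Finset.univ) =>
    Finset.sum_le_sum fun l (_ : l ∈ Finset.univ) => h hf v k l
  simp only [Finset.sum_add_distrib, Finset.sum_const, Finset.card_univ, Fintype.card_fin,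
    nsmul_eq_mul] at hs
  push_cast at hs
  rw [D2]
  generalize jap v ^ (γ / 2 + 1) * ∑ k, |tgV γ k f v| = Y at *
  generalize jap v ^ (γ + 2) * |f v| = X at *
  generalize ∑ k, ∑ l, |tgV γ k (tgV γ l f) v| = Z at *
  generalize ∑ k, ∑ l, |bhb γ k l f v| = W at *
  nlinarith [mul_nonneg hC.le q0, mul_nonneg hC.le z0]

end

/-! ### A Sobolev inequality on the torus -/

lemma cube_eq_fundamentalDomain :
    cube = ZSpan.fundamentalDomain (EuclideanSpace.basisFun (Fin 3) ℝ).toBasis := by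
  ext x
  simp [cube, ZSpan.mem_fundamentalDomain]

lemma measurableSet_cube : MeasurableSet cube := by
  rw [cube_eq_fundamentalDomain]
  exact ZSpan.fundamentalDomain_measurableSet _

lemma volume_cube : volume cube = 1 := by
  have e : cube = (MeasurableEquiv.toLp 2 (Fin 3 → ℝ)).symm ⁻¹'
      (Set.univ.pi fun _ => Set.Ico (0 : ℝ) 1) := by
    ext x
    simp [cube]
  have h := (PiLp.volume_preserving_ofLp (Fin 3)).measure_preimage
    (MeasurableSet.univ_pi fun _ : Fin 3 => measurableSet_Ico (a := (0 : ℝ)) (b := 1)).nullMeasurableSet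
  rw [e]
  refine h.trans ?_
  simp [Real.volume_pi_Ico]

lemma add_mem_span_periodic {α : Type*} {f : E3 → α} (hf : ∀ x i, f (x + e3 i) = f x) (g : E3)
    (hg : g ∈ Submodule.span ℤ (Set.range (EuclideanSpace.basisFun (Fin 3) ℝ).toBasis)) (x : E3) :
    f (g + x) = f x := by
  induction hg using Submodule.span_induction generalizing x with
  | mem y hy =>
    obtain ⟨i, rfl⟩ := hy
    rw [add_comm]
    simpa using hf x i
  | zero => simp
  | add y z _ _ h1 h2 => rw [add_assoc, h1, h2]
  | smul n y _ h =>
    have hn : ∀ m : ℕ, ∀ x, f (m • y + x) = f x := fun m => by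
      induction m with
      | zero => simp
      | succ m ih => intro x; rw [succ_nsmul, add_assoc, ih, h]
    rcases Int.eq_nat_or_neg n with ⟨m, rfl | rfl⟩
    · simpa using hn m x
    · have := hn m (-(m • y) + x)
      rw [neg_smul, natCast_zsmul, ← this]
      simp

open scoped Pointwise in
-- The cube and its translates are fundamental domains of the same lattice.
lemma setLIntegral_cube_add {f : E3 → ℝ≥0∞} (hf : ∀ x i, f (x + e3 i) = f x) (x : E3) :
    ∫⁻ y in cube, f (x + y) = ∫⁻ y in cube, f y := by
  have hc := cube_eq_fundamentalDomain ▸ ZSpan.isAddFundamentalDomain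
    (EuclideanSpace.basisFun (Fin 3) ℝ).toBasis (volume : Measure E3)
  have e : ∫⁻ y in cube, f (x + y) = ∫⁻ y in (x +ᵥ cube), f y := by
    have := (measurePreserving_add_left (volume : Measure E3) x).setLIntegral_comp_emb
      (measurableEmbedding_addLeft x) f cube
    exact this
  rw [e]
  have : VAddInvariantMeasure
      (Submodule.span ℤ (Set.range (EuclideanSpace.basisFun (Fin 3) ℝ).toBasis)) E3 volume :=
    inferInstanceAs (VAddInvariantMeasure (Submodule.span ℤ
      (Set.range (EuclideanSpace.basisFun (Fin 3) ℝ).toBasis)).toAddSubgroup E3 volume)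
  exact ((hc.vadd_of_comm x).setLIntegral_eq hc f fun g y =>
    add_mem_span_periodic hf g g.2 y)

/-- For t ≤ 1 the dilated cube lies in the cube; t^{-3} is the Jacobian of the dilation in dimension
3. -/
lemma setLIntegral_cube_add_smul_le {f : E3 → ℝ≥0∞} (hm : Measurable f)
    (hf : ∀ x i, f (x + e3 i) = f x) (x : E3) {t : ℝ} (ht : 0 < t) (ht1 : t ≤ 1) :
    ∫⁻ y in cube, f (x + t • y) ≤ ENNReal.ofReal (t ^ (-3 : ℝ)) * ∫⁻ y in cube, f y := by
  set h : E3 → ℝ≥0∞ := cube.indicator fun y => f (x + y) with hh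
  have hhm : Measurable h := Measurable.indicator (by fun_prop) measurableSet_cube
  calc _ = ∫⁻ y, cube.indicator (fun y => f (x + t • y)) y :=
        (lintegral_indicator measurableSet_cube _).symm
    _ ≤ ∫⁻ y, h (t • y) := by
        refine lintegral_mono fun y => ?_
        by_cases hy : y ∈ cube
        swap
        · simp [hy]
        rw [Set.indicator_of_mem hy]
        have : t • y ∈ cube := fun i => by
          have := hy i
          simp only [PiLp.smul_apply, smul_eq_mul]
          exact ⟨mul_nonneg ht.le this.1, by nlinarith [this.1, this.2]⟩
        simp only [hh, Set.indicator_of_mem this, le_refl]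
    _ = ∫⁻ z, h z ∂(Measure.map (t • ·) volume) := (lintegral_map hhm (by fun_prop)).symm
    _ = ENNReal.ofReal (t ^ (-3 : ℝ)) * ∫⁻ z, h z := by
        rw [Measure.map_addHaar_smul _ ht.ne', lintegral_smul_measure]
        have : |(t ^ Module.finrank ℝ E3)⁻¹| = t ^ (-3 : ℝ) := by
          rw [finrank_euclideanSpace, Fintype.card_fin, abs_of_pos (by positivity),
            Real.rpow_neg ht.le]
          norm_cast
        rw [this, smul_eq_mul]
    _ = _ := by rw [lintegral_indicator measurableSet_cube, setLIntegral_cube_add hf]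

/-- The sum of the absolute values of the derivatives of order at most two. -/
def jet2 (u : E3 → ℝ) (x : E3) : ℝ := |u x| + ∑ i, |pd i u x| + ∑ i, ∑ j, |pd i (pd j u) x|

lemma hasDerivAt_line {f : E3 → ℝ} (hf : Differentiable ℝ f) (x y : E3) (t : ℝ) :
    HasDerivAt (fun t : ℝ => f (x + t • y)) (∑ i, y i * pd i f (x + t • y)) t := by
  have h1 : HasDerivAt (fun t : ℝ => x + t • y) y t := by
    simpa using ((hasDerivAt_id t).smul_const y).const_add x
  have h2 := (hf (x + t • y)).hasFDerivAt.comp_hasDerivAt t h1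
  refine h2.congr_deriv ?_
  have : y = ∑ i, y i • e3 i := by
    ext j; simp [e3, Finset.sum_apply, Pi.single_apply]
  have e := congrArg (fderiv ℝ f (x + t • y)) this
  rw [e, map_sum]
  simp only [map_smul, smul_eq_mul]
  rfl

lemma contDiff_pd {n : ℕ} {u : E3 → ℝ} (hu : ContDiff ℝ (n + 1 : ℕ) u) (i : Fin 3) :
    ContDiff ℝ n (pd i u) := by
  have h : ContDiff ℝ n (fderiv ℝ u) := hu.fderiv_right (by norm_cast)
  exact h.clm_apply contDiff_const

lemma continuous_jet2 {u : E3 → ℝ} (hu : ContDiff ℝ (2 : ℕ) u) : Continuous (jet2 u) := by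
  have h0 := hu.continuous
  have h1 : ∀ i, ContDiff ℝ (1 : ℕ) (pd i u) := fun i => contDiff_pd (n := 1) hu i
  have h1' : ∀ i, Continuous (pd i u) := fun i => (h1 i).continuous
  have h2 : ∀ i j, Continuous (pd i (pd j u)) := fun i j =>
    (contDiff_pd (n := 0) (by simpa using h1 j) i).continuous
  unfold jet2
  fun_prop

lemma pd_periodic {u : E3 → ℝ} (hp : ∀ x i, u (x + e3 i) = u x) (j : Fin 3) (x : E3) (i : Fin 3) :
    pd j u (x + e3 i) = pd j u x := by
  have : u = fun x => u (x + e3 i) := funext fun x => (hp x i).symm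
  conv_rhs => rw [this]
  simp only [pd, fderiv_comp_add_right]

/-- Taylor's formula based at x + y: t φ₁(t) − u(x + ty) has derivative t φ₂(t), where φ₁ and φ₂ are
the first two derivatives of u along y. The factor t is kept because it makes the average over y
converge. -/
lemma abs_le_jet2_add_integral {u : E3 → ℝ} (hu : ContDiff ℝ (2 : ℕ) u) (x : E3) {y : E3}
    (hy : ∀ i, |y i| ≤ 1) :
    |u x| ≤ jet2 u (x + y) + ∫ t in (0 : ℝ)..1, t * jet2 u (x + t • y) := by
  have h1 : ∀ i, ContDiff ℝ (1 : ℕ) (pd i u) := fun i => contDiff_pd (n := 1) hu i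
  have h1' : ∀ i, Continuous (pd i u) := fun i => (h1 i).continuous
  have hd : Differentiable ℝ u := hu.differentiable (by simp)
  have hd1 : ∀ i, Differentiable ℝ (pd i u) := fun i => (h1 i).differentiable (by simp)
  have h2 : ∀ i j, Continuous (pd i (pd j u)) := fun i j =>
    (contDiff_pd (n := 0) (by simpa using h1 j) i).continuous
  have hc := continuous_jet2 hu
  set φ1 : ℝ → ℝ := fun t => ∑ i, y i * pd i u (x + t • y)
  set φ2 : ℝ → ℝ := fun t => ∑ i, y i * ∑ j, y j * pd j (pd i u) (x + t • y)
  have D0 : ∀ t, HasDerivAt (fun t : ℝ => u (x + t • y)) (φ1 t) t := hasDerivAt_line hd x y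
  have D1 : ∀ t, HasDerivAt φ1 (φ2 t) t := fun t =>
    HasDerivAt.fun_sum fun i _ => (hasDerivAt_line (hd1 i) x y t).const_mul (y i)
  have hφ2 : Continuous φ2 := by
    have : ∀ i j, Continuous fun t : ℝ => pd j (pd i u) (x + t • y) := fun i j =>
      (h2 j i).comp (by fun_prop)
    fun_prop
  have hD : ∀ t, HasDerivAt (fun t => t * φ1 t - u (x + t • y)) (t * φ2 t) t := fun t => by
    refine (((hasDerivAt_id t).mul (D1 t)).sub (D0 t)).congr_deriv ?_
    simp only [id]; ring
  have I := intervalIntegral.integral_eq_sub_of_hasDerivAt (a := 0) (b := 1) (fun t _ => hD t)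
    (Continuous.intervalIntegrable (by fun_prop) _ _)
  have b2 : ∀ t, |φ2 t| ≤ jet2 u (x + t • y) := fun t => by
    have : |φ2 t| ≤ ∑ i, ∑ j, |pd i (pd j u) (x + t • y)| := by
      rw [Finset.sum_comm]
      refine (Finset.abs_sum_le_sum_abs _ _).trans (Finset.sum_le_sum fun i _ => ?_)
      rw [abs_mul]
      refine (mul_le_of_le_one_left (abs_nonneg _) (hy i)).trans ?_
      refine (Finset.abs_sum_le_sum_abs _ _).trans (Finset.sum_le_sum fun j _ => ?_)
      rw [abs_mul]
      exact mul_le_of_le_one_left (abs_nonneg _) (hy j)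
    have : 0 ≤ ∑ i, |pd i u (x + t • y)| := by positivity
    rw [jet2]
    linarith [abs_nonneg (u (x + t • y))]
  have b1 : |u (x + y)| + |φ1 1| ≤ jet2 u (x + y) := by
    have : |φ1 1| ≤ ∑ i, |pd i u (x + y)| := by
      refine (Finset.abs_sum_le_sum_abs _ _).trans (Finset.sum_le_sum fun i _ => ?_)
      rw [abs_mul, one_smul]
      exact mul_le_of_le_one_left (abs_nonneg _) (hy i)
    have : 0 ≤ ∑ i, ∑ j, |pd i (pd j u) (x + y)| := by positivity
    rw [jet2]
    linarith
  have b3 : |∫ t in (0 : ℝ)..1, t * φ2 t| ≤ ∫ t in (0 : ℝ)..1, t * jet2 u (x + t • y) := by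
    refine (intervalIntegral.abs_integral_le_integral_abs zero_le_one).trans ?_
    refine intervalIntegral.integral_mono_on zero_le_one
      (Continuous.intervalIntegrable (by fun_prop) _ _)
      (Continuous.intervalIntegrable (by fun_prop) _ _) fun t ht => ?_
    rw [abs_mul, abs_of_nonneg ht.1]
    exact mul_le_mul_of_nonneg_left (b2 t) ht.1
  have e : u x = u (x + y) - φ1 1 + ∫ t in (0 : ℝ)..1, t * φ2 t := by
    rw [I]; simp; ring
  rw [e]
  have := abs_add_le (u (x + y) - φ1 1) (∫ t in (0 : ℝ)..1, t * φ2 t)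
  have := abs_sub (u (x + y)) (φ1 1)
  linarith

lemma jet2_nonneg (u : E3 → ℝ) (x : E3) : 0 ≤ jet2 u x := by unfold jet2; positivity

lemma lintegral_cube_le_sqrt {f : E3 → ℝ≥0∞} (hf : Measurable f) :
    ∫⁻ y in cube, f y ≤ (∫⁻ y in cube, f y ^ 2) ^ (1 / 2 : ℝ) := by
  have := lintegral_mul_sq_le (μ := volume.restrict cube) (f := f) (g := 1) hf.aemeasurable
    aemeasurable_const
  simp only [Pi.one_apply, mul_one, one_pow, lintegral_const, Measure.restrict_apply_univ,
    volume_cube] at this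
  rw [one_div, ENNReal.le_rpow_inv_iff (by norm_num), ENNReal.rpow_two]
  exact this

lemma lintegral_rpow_neg_half : ∫⁻ t in Set.Ioc (0 : ℝ) 1, ENNReal.ofReal (t ^ (-(1 / 2) : ℝ)) = 2 := by
  rw [← ofReal_integral_eq_lintegral_ofReal]
  · rw [← intervalIntegral.integral_of_le zero_le_one, integral_rpow (Or.inl (by norm_num))]
    norm_num
  · exact (intervalIntegrable_iff_integrableOn_Ioc_of_le zero_le_one).1
      (intervalIntegral.intervalIntegrable_rpow' (by norm_num))
  · exact (ae_restrict_mem measurableSet_Ioc).mono fun t ht => Real.rpow_nonneg ht.1.le _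

/-- Taylor's formula is averaged over y in the cube. By Cauchy-Schwarz and the dilation bound, the
remainder at time t costs t · t^{-3/2} = t^{-1/2}, with integral 2; the boundary term adds 1, and 9
= 3². -/
lemma enorm_sq_le_lintegral_jet2 {u : E3 → ℝ} (hu : ContDiff ℝ (2 : ℕ) u)
    (hp : ∀ x i, u (x + e3 i) = u x) (x : E3) :
    ‖u x‖ₑ ^ 2 ≤ 9 * ∫⁻ y in cube, ‖jet2 u y‖ₑ ^ 2 := by
  have hc := continuous_jet2 hu
  have hj : Measurable (jet2 u) := hc.measurable
  have hm : Measurable (fun y => ‖jet2 u y‖ₑ) := hj.enorm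
  have hp' : ∀ y i, jet2 u (y + e3 i) = jet2 u y := fun y i => by
    simp only [jet2, hp, pd_periodic hp, pd_periodic (pd_periodic hp _)]
  set I := (∫⁻ y in cube, ‖jet2 u y‖ₑ ^ 2) ^ (1 / 2 : ℝ) with hI
  have key : ∀ y ∈ cube, ‖u x‖ₑ ≤ ‖jet2 u (x + y)‖ₑ +
      ∫⁻ t in Set.Ioc (0 : ℝ) 1, ENNReal.ofReal t * ‖jet2 u (x + t • y)‖ₑ := fun y hy => by
    have h := abs_le_jet2_add_integral hu x (y := y) fun i => by
      rw [abs_of_nonneg (hy i).1]; exact (hy i).2.le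
    have hi : 0 ≤ ∫ t in (0 : ℝ)..1, t * jet2 u (x + t • y) :=
      intervalIntegral.integral_nonneg zero_le_one fun t ht => mul_nonneg ht.1 (jet2_nonneg _ _)
    rw [Real.enorm_eq_ofReal_abs]
    refine (ENNReal.ofReal_le_ofReal h).trans ?_
    rw [ENNReal.ofReal_add (jet2_nonneg _ _) hi, Real.enorm_of_nonneg (jet2_nonneg _ _)]
    gcongr
    rw [intervalIntegral.integral_of_le zero_le_one, ofReal_integral_eq_lintegral_ofReal]
    · refine lintegral_mono_ae ((ae_restrict_mem measurableSet_Ioc).mono fun t ht => ?_)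
      rw [ENNReal.ofReal_mul ht.1.le, Real.enorm_of_nonneg (jet2_nonneg _ _)]
    · exact (Continuous.integrableOn_Icc (by fun_prop)).mono_set Set.Ioc_subset_Icc_self
    · exact (ae_restrict_mem measurableSet_Ioc).mono fun t ht =>
        mul_nonneg ht.1.le (jet2_nonneg _ _)
  have h3 : ‖u x‖ₑ ≤ 3 * I := by
    calc ‖u x‖ₑ = ∫⁻ y in cube, ‖u x‖ₑ := by simp [volume_cube]
      _ ≤ ∫⁻ y in cube, (‖jet2 u (x + y)‖ₑ +
          ∫⁻ t in Set.Ioc (0 : ℝ) 1, ENNReal.ofReal t * ‖jet2 u (x + t • y)‖ₑ) :=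
        setLIntegral_mono' measurableSet_cube key
      _ = (∫⁻ y in cube, ‖jet2 u (x + y)‖ₑ) +
          ∫⁻ t in Set.Ioc (0 : ℝ) 1, ENNReal.ofReal t * ∫⁻ y in cube, ‖jet2 u (x + t • y)‖ₑ := by
        have hj' : Measurable fun y => ‖jet2 u (x + y)‖ₑ := (hj.comp (by fun_prop)).enorm
        rw [lintegral_add_left hj', lintegral_lintegral_swap]
        · congr 1
          refine lintegral_congr fun t => ?_
          have hj' : Measurable fun y => ‖jet2 u (x + t • y)‖ₑ := (hj.comp (by fun_prop)).enorm
          rw [lintegral_const_mul _ hj']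
        · fun_prop
      _ ≤ I + ∫⁻ t in Set.Ioc (0 : ℝ) 1, ENNReal.ofReal (t ^ (-(1 / 2) : ℝ)) * I := by
        gcongr ?_ + ?_
        · rw [setLIntegral_cube_add (f := fun y => ‖jet2 u y‖ₑ) fun y i => by rw [hp']]
          exact lintegral_cube_le_sqrt hm
        · refine setLIntegral_mono' measurableSet_Ioc fun t ht => ?_
          have h1 : ∫⁻ y in cube, ‖jet2 u (x + t • y)‖ₑ ≤
              (∫⁻ y in cube, ‖jet2 u (x + t • y)‖ₑ ^ 2) ^ (1 / 2 : ℝ) :=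
            lintegral_cube_le_sqrt (hj.comp (by fun_prop)).enorm
          have h2 := setLIntegral_cube_add_smul_le (f := fun y => ‖jet2 u y‖ₑ ^ 2) (by fun_prop)
            (fun y i => by rw [hp']) x ht.1 ht.2
          have h4 : ENNReal.ofReal t * ENNReal.ofReal (t ^ (-3 : ℝ)) ^ (1 / 2 : ℝ) =
              ENNReal.ofReal (t ^ (-(1 / 2) : ℝ)) := by
            have := ht.1
            rw [ENNReal.ofReal_rpow_of_pos (by positivity), ← ENNReal.ofReal_mul this.le,
              ← Real.rpow_mul this.le]
            nth_rewrite 1 [← Real.rpow_one t]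
            rw [← Real.rpow_add this]
            norm_num
          calc _ ≤ ENNReal.ofReal t * (ENNReal.ofReal (t ^ (-3 : ℝ)) *
                ∫⁻ y in cube, ‖jet2 u y‖ₑ ^ 2) ^ (1 / 2 : ℝ) := by
                gcongr
                exact h1.trans (by gcongr)
            _ = _ := by
                rw [ENNReal.mul_rpow_of_nonneg _ _ (by norm_num), ← mul_assoc, h4]
      _ = 3 * I := by
        rw [lintegral_mul_const _ (by fun_prop), lintegral_rpow_neg_half]
        ring
  calc ‖u x‖ₑ ^ 2 ≤ (3 * I) ^ 2 := by gcongr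
    _ = _ := by
      rw [mul_pow, hI, ← ENNReal.rpow_natCast, ← ENNReal.rpow_natCast, ← ENNReal.rpow_mul]
      norm_num

/-! ### Functions on the torus and sup norms of slices -/

/-- Functions on `𝕋³ × ℝ³` of class `C^n` with rapidly decaying derivatives. -/
structure Tor (n : ℕ) (g : E3 → E3 → ℝ) : Prop where
  sm : Sm n (-40) g
  per : ∀ x v i, g (x + e3 i) v = g x v

section Tor

variable {n : ℕ} {g : E3 → E3 → ℝ}

lemma Tor.le {m : ℕ} (H : Tor n g) (h : m ≤ n) : Tor m g := ⟨H.sm.le h, H.per⟩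

lemma Tor.dx (H : Tor (n + 1) g) (i : Fin 3) : Tor n (dx i g) :=
  ⟨H.sm.dx i, fun x v j => pd_periodic (fun x i => H.per x v i) i x j⟩

lemma Tor.pv (H : Tor (n + 1) g) (i : Fin 3) : Tor n (pv i g) :=
  ⟨H.sm.pv i, fun x v j => by
    have : g (x + e3 j) = g x := funext fun v => H.per x v j
    simp only [Landau.pv, this]⟩

lemma Tor.dxIter : ∀ (l : List (Fin 3)) {n : ℕ}, Tor (n + l.length) g → Tor n (dxIter l g)
  | [], _, H => H
  | i :: l, n, H => Tor.dx (Tor.dxIter l (n := n + 1) (H.le (by simp; omega))) i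

lemma Tor.dxIter_of_le {m : ℕ} (l : List (Fin 3)) (H : Tor m g) (h : n + l.length ≤ m) :
    Tor n (Landau.dxIter l g) := Tor.dxIter l (H.le h)

lemma dxIter_pv (m : Fin 3) : ∀ (l : List (Fin 3)) {n : ℕ} {s : ℝ}, Sm (n + 1 + l.length) s g →
    dxIter l (pv m g) = pv m (dxIter l g)
  | [], _, _, _ => rfl
  | i :: l, n, s, H => by
    have H' : Sm (n + 1 + 1 + l.length) s g := H.le (by simp; omega)
    rw [Landau.dxIter, dxIter_pv m l H', (Sm.dxIter l H').dx_pv]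
    rfl

lemma dxIter_sum_mul {ι : Type*} [Fintype ι] {s : ℝ} (c : ι → E3 → ℝ) {h : ι → E3 → E3 → ℝ} :
    ∀ (l : List (Fin 3)) (_ : ∀ a, Sm l.length s (h a)),
    dxIter l (fun x v => ∑ a, c a v * h a x v) = fun x v => ∑ a, c a v * dxIter l (h a) x v
  | [], _ => rfl
  | i :: l, H => by
    have H' : ∀ a, Sm (1 + l.length) s (h a) := fun a => (H a).le (by simp; omega)
    rw [Landau.dxIter, dxIter_sum_mul c l fun a => (H' a).le (by omega)]
    funext x v
    have hd : ∀ a, Differentiable ℝ fun y => c a v * Landau.dxIter l (h a) y v := fun a =>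
      ((Sm.dxIter l (n := 1) (H' a)).diff_x (n := 0) v).const_mul _
    simp only [Landau.dx]
    rw [pd_sum i _ fun a _ => hd a x]
    simp only [pd_const_mul]
    rfl

end Tor

/-! ### Squares of sums, and the Sobolev inequality at fixed velocity. -/

lemma sum_sq_le {ι : Type*} (s : Finset ι) (f : ι → ℝ≥0∞) :
    (∑ i ∈ s, f i) ^ 2 ≤ s.card * ∑ i ∈ s, f i ^ 2 := by
  have := ENNReal.rpow_sum_le_const_mul_sum_rpow s f (p := 2) (by norm_num)
  norm_num at this
  exact_mod_cast this

lemma enorm_sum_sq_le {ι : Type*} (s : Finset ι) (f : ι → ℝ) :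
    ‖∑ i ∈ s, f i‖ₑ ^ 2 ≤ s.card * ∑ i ∈ s, ‖f i‖ₑ ^ 2 := by
  refine le_trans ?_ (sum_sq_le s _)
  gcongr
  exact enorm_sum_le _ _

lemma enorm_jet2_sq_le (u : E3 → ℝ) (x : E3) : ‖jet2 u x‖ₑ ^ 2 ≤
    27 * (‖u x‖ₑ ^ 2 + ∑ i, ‖pd i u x‖ₑ ^ 2 + ∑ i, ∑ j, ‖pd i (pd j u) x‖ₑ ^ 2) := by
  have e : ‖jet2 u x‖ₑ ≤ ‖u x‖ₑ + ∑ i, ‖pd i u x‖ₑ + ∑ i, ∑ j, ‖pd i (pd j u) x‖ₑ := by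
    refine (enorm_add_le _ _).trans (add_le_add ((enorm_add_le _ _).trans (add_le_add ?_ ?_)) ?_)
    · simp
    · exact (enorm_sum_le _ _).trans (by simp)
    · refine (enorm_sum_le _ _).trans (Finset.sum_le_sum fun i _ => ?_)
      exact (enorm_sum_le _ _).trans (by simp)
  have h1 : (∑ i, ‖pd i u x‖ₑ) ^ 2 ≤ 3 * ∑ i, ‖pd i u x‖ₑ ^ 2 := by
    simpa using sum_sq_le Finset.univ fun i : Fin 3 => ‖pd i u x‖ₑ
  have h2 : (∑ i, ∑ j, ‖pd i (pd j u) x‖ₑ) ^ 2 ≤ 3 * (3 * ∑ i, ∑ j, ‖pd i (pd j u) x‖ₑ ^ 2) := by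
    refine (sum_sq_le _ _).trans ?_
    rw [Finset.card_univ, Fintype.card_fin]
    push_cast
    gcongr
    rw [Finset.mul_sum]
    gcongr with i
    simpa using sum_sq_le Finset.univ fun j : Fin 3 => ‖pd i (pd j u) x‖ₑ
  have h3 : ∀ a b c : ℝ≥0∞, (a + b + c) ^ 2 ≤ 3 * (a ^ 2 + b ^ 2 + c ^ 2) := fun a b c => by
    simpa [Fin.sum_univ_three] using sum_sq_le Finset.univ ![a, b, c]
  refine (pow_le_pow_left' e 2).trans ((h3 _ _ _).trans ?_)
  generalize ∑ i, ∑ j, ‖pd i (pd j u) x‖ₑ ^ 2 = B at *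
  generalize ∑ i, ‖pd i u x‖ₑ ^ 2 = A at *
  calc _ ≤ 3 * (‖u x‖ₑ ^ 2 + 3 * A + 3 * (3 * B)) := by gcongr
    _ ≤ 3 * (9 * ‖u x‖ₑ ^ 2 + 9 * A + 3 * (3 * B)) := by
        gcongr
        · exact le_mul_of_one_le_left' (by norm_num)
        · norm_num
    _ = _ := by ring

lemma lintegral_add_sum_add_sum {α : Type*} [MeasurableSpace α] {μ : Measure α} {f0 : α → ℝ≥0∞}
    {f1 : Fin 3 → α → ℝ≥0∞} {f2 : Fin 3 → Fin 3 → α → ℝ≥0∞} (h0 : Measurable f0)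
    (h1 : ∀ i, Measurable (f1 i)) (h2 : ∀ i j, Measurable (f2 i j)) :
    ∫⁻ a, (f0 a + ∑ i, f1 i a + ∑ i, ∑ j, f2 i j a) ∂μ =
      ∫⁻ a, f0 a ∂μ + ∑ i, ∫⁻ a, f1 i a ∂μ + ∑ i, ∑ j, ∫⁻ a, f2 i j a ∂μ := by
  have h1' : Measurable fun a => ∑ i, f1 i a := Finset.measurable_sum _ fun i _ => h1 i
  have h2' : ∀ i, Measurable fun a => ∑ j, f2 i j a := fun i =>
    Finset.measurable_sum _ fun j _ => h2 i j
  have h3 : Measurable fun a => f0 a + ∑ i, f1 i a := h0.add h1'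
  rw [lintegral_add_left h3, lintegral_add_left h0, lintegral_finsetSum _ fun i _ => h1 i,
    lintegral_finsetSum _ fun i _ => h2' i]
  congr 2
  funext i
  rw [lintegral_finsetSum _ fun j _ => h2 i j]

lemma measurable_sum_mul {ι : Type*} [Fintype ι] {n : ℕ} {s : ℝ} {c : ι → E3 → ℝ}
    (hc : ∀ a, Measurable (c a)) {h : ι → E3 → E3 → ℝ} (H : ∀ a, Sm n s (h a)) :
    Measurable fun p : E3 × E3 => ∑ a, c a p.2 * h a p.1 p.2 :=
  Finset.measurable_sum _ fun a _ => ((hc a).comp measurable_snd).mul (H a).continuous.measurable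

/-- The Sobolev inequality in x is applied for each v and then integrated in v by Tonelli's theorem.
The coefficients depend on v only and need just be measurable. The constant is 9 · 27 · 13, where 13
= 1 + 3 + 9 counts the derivatives of order at most two. -/
lemma lintegral_slice_sum_mul_le {ι : Type*} [Fintype ι] {c : ι → E3 → ℝ}
    (hc : ∀ a, Measurable (c a)) {h : ι → E3 → E3 → ℝ} (H : ∀ a, Tor 2 (h a)) {T : ℝ≥0∞}
    (hT : ∀ l : List (Fin 3), l.length ≤ 2 →
      ∫⁻ y in cube, ∫⁻ v, ‖∑ a, c a v * dxIter l (h a) y v‖ₑ ^ 2 ≤ T) (x : E3) :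
    ∫⁻ v, ‖∑ a, c a v * h a x v‖ₑ ^ 2 ≤ 3159 * T := by
  set U : E3 → E3 → ℝ := fun x v => ∑ a, c a v * h a x v with hU
  have hdU : ∀ l : List (Fin 3), l.length ≤ 2 →
      dxIter l U = fun x v => ∑ a, c a v * dxIter l (h a) x v := fun l hl =>
    dxIter_sum_mul c l fun a => (H a).sm.le hl
  have hmU : ∀ l : List (Fin 3), l.length ≤ 2 → Measurable fun p : E3 × E3 => dxIter l U p.1 p.2 :=
    fun l hl => by
      rw [hdU l hl]
      exact measurable_sum_mul hc (n := 0) fun a => ((H a).dxIter_of_le l (by omega)).sm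
  have hle : ∀ l : List (Fin 3), l.length ≤ 2 →
      ∫⁻ v, ∫⁻ y in cube, ‖dxIter l U y v‖ₑ ^ 2 ≤ T := fun l hl => by
    rw [lintegral_lintegral_swap]
    · rw [hdU l hl]
      exact hT l hl
    · exact (((hmU l hl).comp measurable_swap).enorm.pow_const 2).aemeasurable
  have hs : ∀ v, ‖U x v‖ₑ ^ 2 ≤ 9 * ∫⁻ y in cube, ‖jet2 (fun y => U y v) y‖ₑ ^ 2 := fun v => by
    refine enorm_sq_le_lintegral_jet2 (u := fun y => U y v) ?_ (fun y i => ?_) x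
    · exact ContDiff.sum fun a _ => contDiff_const.mul ((H a).sm.contDiff_x v)
    · simp only [hU, (H _).per]
  have m1 : ∀ l : List (Fin 3), l.length ≤ 2 → ∀ v, Measurable fun y => ‖dxIter l U y v‖ₑ ^ 2 :=
    fun l hl v => ((hmU l hl).comp (measurable_id.prodMk measurable_const)).enorm.pow_const 2
  have m2 : ∀ l : List (Fin 3), l.length ≤ 2 →
      Measurable fun v => ∫⁻ y in cube, ‖dxIter l U y v‖ₑ ^ 2 := fun l hl =>
    Measurable.lintegral_prod_right' (f := fun p : E3 × E3 => ‖dxIter l U p.2 p.1‖ₑ ^ 2)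
      (((hmU l hl).comp measurable_swap).enorm.pow_const 2)
  calc _ ≤ ∫⁻ v, 9 * ∫⁻ y in cube, 27 * (‖dxIter [] U y v‖ₑ ^ 2 +
        ∑ i, ‖dxIter [i] U y v‖ₑ ^ 2 + ∑ i, ∑ j, ‖dxIter [i, j] U y v‖ₑ ^ 2) := by
        refine lintegral_mono fun v => (hs v).trans ?_
        gcongr with y
        exact enorm_jet2_sq_le _ y
    _ = 9 * (27 * ((∫⁻ v, ∫⁻ y in cube, ‖dxIter [] U y v‖ₑ ^ 2) +
        ∑ i, (∫⁻ v, ∫⁻ y in cube, ‖dxIter [i] U y v‖ₑ ^ 2) +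
        ∑ i, ∑ j, ∫⁻ v, ∫⁻ y in cube, ‖dxIter [i, j] U y v‖ₑ ^ 2)) := by
        simp_rw [lintegral_const_mul' 27 _ (by norm_num : (27 : ℝ≥0∞) ≠ ⊤)]
        rw [lintegral_const_mul' _ _ (by norm_num), lintegral_const_mul' _ _ (by norm_num),
          ← lintegral_add_sum_add_sum (m2 [] (by simp)) (fun i => m2 [i] (by simp))
            fun i j => m2 [i, j] (by simp)]
        congr 2
        refine lintegral_congr fun v => ?_
        exact lintegral_add_sum_add_sum (m1 [] (by simp) v) (fun i => m1 [i] (by simp) v)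
          fun i j => m1 [i, j] (by simp) v
    _ ≤ 9 * (27 * (T + ∑ _i : Fin 3, T + ∑ _i : Fin 3, ∑ _j : Fin 3, T)) := by
        gcongr
        · exact hle _ (by simp)
        · exact hle _ (by simp)
        · exact hle _ (by simp)
    _ = 3159 * T := by
        simp only [Finset.sum_const, Finset.card_univ, Fintype.card_fin, nsmul_eq_mul]
        push_cast
        ring

/-- D1 and D2 are sums of absolute values and cannot be differentiated in x; the Sobolev inequality
is applied to the signed terms of the sum. -/
lemma lintegral_slice_le {κ ι : Type*} [Fintype κ] [Fintype ι] {c : κ → ι → E3 → ℝ}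
    (hc : ∀ k a, Measurable (c k a)) {h : κ → ι → E3 → E3 → ℝ} (H : ∀ k a, Tor 2 (h k a))
    {D : E3 → E3 → ℝ} (hD : ∀ x v, |D x v| ≤ ∑ k, |∑ a, c k a v * h k a x v|) {T : ℝ≥0∞}
    (hT : ∀ l : List (Fin 3), l.length ≤ 2 → ∀ k,
      ∫⁻ y in cube, ∫⁻ v, ‖∑ a, c k a v * dxIter l (h k a) y v‖ₑ ^ 2 ≤ T) (x : E3) :
    ∫⁻ v, ‖D x v‖ₑ ^ 2 ≤ (Fintype.card κ * Fintype.card κ * 3159) * T := by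
  have hm : ∀ k, Measurable fun v => ‖∑ a, c k a v * h k a x v‖ₑ ^ 2 := fun k =>
    ((measurable_sum_mul (hc k) fun a => (H k a).sm).comp
      (measurable_const.prodMk measurable_id)).enorm.pow_const 2
  calc _ ≤ ∫⁻ v, Fintype.card κ * ∑ k, ‖∑ a, c k a v * h k a x v‖ₑ ^ 2 := by
        refine lintegral_mono fun v => ?_
        refine le_trans ?_ (sum_sq_le _ _)
        gcongr
        have := ENNReal.ofReal_le_ofReal (hD x v)
        rw [ENNReal.ofReal_sum_of_nonneg fun _ _ => abs_nonneg _] at this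
        simpa only [← Real.enorm_eq_ofReal_abs] using this
    _ = Fintype.card κ * ∑ k, ∫⁻ v, ‖∑ a, c k a v * h k a x v‖ₑ ^ 2 := by
        rw [lintegral_const_mul' _ _ (by simp), lintegral_finsetSum _ fun k _ => hm k]
    _ ≤ Fintype.card κ * ∑ _k : κ, 3159 * T := by
        gcongr with k
        exact lintegral_slice_sum_mul_le (hc k) (H k) (fun l hl => hT l hl k) x
    _ = _ := by
        simp only [Finset.sum_const, Finset.card_univ, nsmul_eq_mul]
        ring

/-! ### Quantities dominated by the norms -/

lemma le_twistedSq (γ : ℝ) (Hsq : (E3 → ℝ) → ℝ≥0∞) (g : E3 → E3 → ℝ) (l : List (Fin 3))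
    (hl : l.length ≤ 3) :
    ∫⁻ x in cube, Hsq (fun v => wt γ l.length v * dxIter l g x v) ≤ twistedSq γ Hsq g := by
  have e : dxIter l g = gradX l.get g := by simp [gradX, List.ofFn_get]
  rw [e]
  refine le_trans ?_ (Finset.single_le_sum (f := fun k => ∑ ι : Fin k → Fin 3,
    ∫⁻ x in cube, Hsq (fun v => wt γ k v * gradX ι g x v)) (by simp)
    (Finset.mem_range.2 (by omega : l.length < 4)))
  exact Finset.single_le_sum (f := fun ι : Fin l.length → Fin 3 =>
    ∫⁻ x in cube, Hsq (fun v => wt γ l.length v * gradX ι g x v)) (by simp)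
    (Finset.mem_univ l.get)

lemma L2sq_le_of_abs_le {F G : E3 → ℝ} {C : ℝ} (h : ∀ v, |F v| ≤ C * |G v|) :
    L2sq F ≤ ENNReal.ofReal (C ^ 2) * L2sq G := by
  unfold L2sq
  rw [← lintegral_const_mul' _ _ ENNReal.ofReal_ne_top]
  refine lintegral_mono fun v => ?_
  rw [Real.enorm_eq_ofReal_abs, Real.enorm_eq_ofReal_abs, ← ENNReal.ofReal_pow (abs_nonneg _),
    ← ENNReal.ofReal_pow (abs_nonneg _), ← ENNReal.ofReal_mul (sq_nonneg _), ← mul_pow]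
  have := h v
  gcongr

lemma L2sq_mono {F G : E3 → ℝ} (h : ∀ v, |F v| ≤ |G v|) : L2sq F ≤ L2sq G := by
  simpa using L2sq_le_of_abs_le (C := 1) fun v => by simpa using h v

lemma L2sq_sum_le {κ : Type*} [Fintype κ] {F : E3 → ℝ} {f : κ → E3 → ℝ} {C : ℝ}
    (hm : ∀ k, Measurable (f k)) (h : ∀ v, |F v| ≤ C * ∑ k, |f k v|) :
    L2sq F ≤ ENNReal.ofReal (C ^ 2) * Fintype.card κ * ∑ k, L2sq (f k) := by
  refine (L2sq_le_of_abs_le (G := fun v => ∑ k, |f k v|) (C := C) fun v => ?_).trans ?_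
  · rw [abs_of_nonneg (Finset.sum_nonneg fun k _ => abs_nonneg (f k v))]; exact h v
  rw [mul_assoc]
  gcongr
  unfold L2sq
  rw [← lintegral_finsetSum _ fun k _ => (hm k).enorm.pow_const 2,
    ← lintegral_const_mul' _ _ (by simp)]
  refine lintegral_mono fun v => ?_
  simpa using enorm_sum_sq_le Finset.univ fun k => |f k v|

lemma measurable_slice {F : E3 → E3 → ℝ} (h : Measurable (unc F)) (x : E3) : Measurable (F x) :=
  h.comp (measurable_const.prodMk measurable_id)

lemma measurable_L2sq {F : E3 → E3 → ℝ} (h : Measurable (unc F)) : Measurable fun x => L2sq (F x) :=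
  Measurable.lintegral_prod_right' (f := fun p : E3 × E3 => ‖F p.1 p.2‖ₑ ^ 2)
    (h.enorm.pow_const 2)

lemma wt_nonneg (γ : ℝ) (k : ℕ) (v : E3) : 0 ≤ wt γ k v := jap_rpow_nonneg _ _

lemma continuous_wt (γ : ℝ) (k : ℕ) : Continuous (wt γ k) := continuous_jap_rpow _

lemma wt_three (γ : ℝ) (v : E3) : wt γ 3 v = 1 := by simp [wt]

/-- One derivative in x fewer is worth exactly the factor ⟨v⟩^{γ/2+1}, which is the size of 𝐁. The
pairing with ∇̃_x relies on this balance. -/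
lemma wt_succ_mul (γ : ℝ) (k : ℕ) (v : E3) : wt γ (k + 1) v * jap v ^ (γ / 2 + 1) = wt γ k v := by
  rw [wt, wt, ← jap_rpow_add]
  push_cast
  ring_nf

lemma wt_anti {γ : ℝ} (h1 : -2 ≤ γ) {j k : ℕ} (h : j ≤ k) (v : E3) : wt γ k v ≤ wt γ j v := by
  refine jap_rpow_mono v ?_
  have : (j : ℝ) ≤ k := by exact_mod_cast h
  nlinarith

/-- A combination of functions of `(x, v)` with coefficients depending on `v`. -/
def combo {ι : Type} [Fintype ι] (b : ι → E3 → ℝ) (h : ι → E3 → E3 → ℝ) (x v : E3) : ℝ :=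
  ∑ a, b a v * h a x v

section combo

variable {ι : Type} [Fintype ι] {b : ι → E3 → ℝ} {h : ι → E3 → E3 → ℝ}

lemma dxIter_combo {s : ℝ} (b : ι → E3 → ℝ) (l : List (Fin 3)) (H : ∀ a, Sm l.length s (h a)) :
    dxIter l (combo b h) = combo b fun a => dxIter l (h a) := dxIter_sum_mul b l H

lemma measurable_combo {n : ℕ} {s : ℝ} (hb : ∀ a, Measurable (b a)) (H : ∀ a, Sm n s (h a)) :
    Measurable (unc (combo b h)) := measurable_sum_mul hb H

lemma pv_combo {n : ℕ} {s : ℝ} (hb : ∀ a, Differentiable ℝ (b a)) (H : ∀ a, Sm (n + 1) s (h a))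
    (m : Fin 3) (x v : E3) :
    pd m (combo b h x) v = combo (fun a => pd m (b a)) h x v + combo b (fun a => pv m (h a)) x v := by
  have := pd_sum m Finset.univ (f := fun a v => b a v * h a x v) (v := v)
    fun a _ => ((hb a v).mul ((H a).diff_v x v))
  refine Eq.trans this ?_
  rw [combo, combo, ← Finset.sum_add_distrib]
  refine Finset.sum_congr rfl fun a _ => ?_
  rw [pd_mul m (hb a v) ((H a).diff_v x v)]
  rfl

lemma differentiable_combo {n : ℕ} {s : ℝ} (hb : ∀ a, Differentiable ℝ (b a))
    (H : ∀ a, Sm (n + 1) s (h a)) (x : E3) : Differentiable ℝ (combo b h x) := fun v =>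
  DifferentiableAt.fun_sum (A := fun a v => b a v * h a x v)
    fun a _ => ((hb a v).mul ((H a).diff_v x v))

end combo

section Slice

variable {γ : ℝ} (h1 : -2 ≤ γ) (h2 : γ ≤ 1)
include h1 h2

lemma measurable_tgV (k : Fin 3) (f : E3 → ℝ) : Measurable (tgV γ k f) :=
  Finset.measurable_sum _ fun l _ =>
    (continuous_matB h1 h2 k l).measurable.mul (measurable_pd l f)

omit h1 h2 in
lemma measurable_jap_rpow (s : ℝ) : Measurable fun v => jap v ^ s :=
  (continuous_jap_rpow s).measurable

omit h1 h2 in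
lemma measurable_grad (f : E3 → ℝ) : Measurable (grad f) :=
  (WithLp.measurable_toLp 2 _).comp (measurable_pi_lambda _ fun i => measurable_pd i f)

omit h1 h2 in
lemma measurable_projV {f : E3 → E3} (hf : Measurable f) : Measurable fun v => projV v (f v) := by
  unfold projV
  fun_prop

lemma L2sq_D1_le : ∃ C : ℝ≥0, ∀ f : E3 → ℝ, Measurable f → L2sq (D1 γ f) ≤ C * H1sq γ f := by
  obtain ⟨C, hC, h⟩ := bn_le_proj h1 h2
  refine ⟨(((1 + C) ^ 2).toNNReal * 3), fun f hf => ?_⟩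
  have hj := measurable_jap_rpow
  have mg := measurable_grad f
  have mp := measurable_projV mg
  have hb := L2sq_sum_le (κ := Fin 3) (F := D1 γ f) (C := 1 + C)
    (f := ![fun v => jap v ^ (γ / 2 + 1) * f v, fun v => ‖jap v ^ (γ / 2) • projV v (grad f v)‖,
      fun v => ‖jap v ^ (γ / 2 + 1) • (grad f v - projV v (grad f v))‖])
    (fun k => by
      fin_cases k
      · exact (hj _).mul hf
      · exact ((hj _).smul mp).norm
      · exact ((hj _).smul (mg.sub mp)).norm)
    (fun v => by
      rw [abs_of_nonneg (D1_nonneg _ _ _), D1, ← bn_grad]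
      have := h v (grad f v)
      simp only [Fin.sum_univ_three, Matrix.cons_val_zero, Matrix.cons_val_one, Matrix.cons_val,
        abs_norm, abs_mul, abs_of_nonneg (jap_rpow_nonneg v (γ / 2 + 1))]
      have a1 : 0 ≤ jap v ^ (γ / 2 + 1) * |f v| :=
        mul_nonneg (jap_rpow_nonneg v _) (abs_nonneg _)
      have a2 := norm_nonneg (jap v ^ (γ / 2) • projV v (grad f v))
      have a3 := norm_nonneg (jap v ^ (γ / 2 + 1) • (grad f v - projV v (grad f v)))
      nlinarith [mul_nonneg hC.le a1])
  refine hb.trans (le_of_eq ?_)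
  simp only [Fin.sum_univ_three, Matrix.cons_val_zero, Matrix.cons_val_one, Matrix.cons_val,
    H1sq, L2sq, enorm_norm, Fintype.card_fin, ENNReal.coe_mul]
  rfl

lemma L2sq_D2_le : ∃ C : ℝ≥0, ∀ f : E3 → ℝ, Measurable f → (∀ i, Differentiable ℝ (pd i f)) →
    L2sq (D2 γ f) ≤ C * H2sq γ f := by
  obtain ⟨C, hC, h⟩ := D2_le h1 h2
  refine ⟨((C ^ 2).toNNReal * 13), fun f hf hd => ?_⟩
  have hj := measurable_jap_rpow
  have hb := L2sq_sum_le (κ := Unit ⊕ Fin 3 ⊕ (Fin 3 × Fin 3)) (F := D2 γ f) (C := C)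
    (f := Sum.elim (fun _ v => jap v ^ (γ + 2) * f v)
      (Sum.elim (fun k v => jap v ^ (γ / 2 + 1) * tgV γ k f v)
        fun p => tgV γ p.1 (tgV γ p.2 f)))
    (fun k => by
      rcases k with _ | _ | _
      · exact (hj _).mul hf
      · exact (hj _).mul (measurable_tgV h1 h2 _ _)
      · exact measurable_tgV h1 h2 _ _)
    (fun v => by
      rw [abs_of_nonneg (D2_nonneg _ _ _)]
      refine (h hd v).trans (le_of_eq ?_)
      simp only [Fintype.sum_sum_type, Fintype.sum_prod_type, Sum.elim_inl, Sum.elim_inr, abs_mul,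
        abs_of_nonneg (jap_rpow_nonneg v (γ / 2 + 1)), abs_of_nonneg (jap_rpow_nonneg v (γ + 2)),
        ← Finset.mul_sum, Finset.univ_unique, Finset.sum_singleton]
      ring)
  refine hb.trans ?_
  have e : ENNReal.ofReal (C ^ 2) * (Fintype.card (Unit ⊕ Fin 3 ⊕ (Fin 3 × Fin 3)) : ℝ≥0∞) =
      (((C ^ 2).toNNReal * 13 : ℝ≥0) : ℝ≥0∞) := by
    simp only [Fintype.card_sum, Fintype.card_prod, Fintype.card_fin, Fintype.card_unit,
      ENNReal.coe_mul]
    norm_num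
    rfl
  rw [e]
  gcongr
  simp only [Fintype.sum_sum_type, Fintype.sum_prod_type, Sum.elim_inl, Sum.elim_inr,
    Finset.univ_unique, Finset.sum_singleton, H2sq]
  rw [← add_assoc]
  gcongr
  exact le_self_add

/-- The first-order quantities are controlled by the norm built on `H¹_{v,*}`. -/
lemma lintegral_wt_D1_le : ∃ C : ℝ≥0, ∀ (u : E3 → E3 → ℝ) (l : List (Fin 3)), l.length ≤ 3 →
    (∀ x, Differentiable ℝ (dxIter l u x)) →
    ∫⁻ x in cube, L2sq (fun v => wt γ l.length v * D1 γ (dxIter l u x) v) ≤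
      C * twistedSq γ (H1sq γ) u := by
  obtain ⟨C, h⟩ := L2sq_D1_le h1 h2
  choose K hK hk using fun k : ℕ => jap_rpow_mul_D1_le h1 h2 ((3 - (k : ℝ)) * (γ / 2 + 1))
  refine ⟨(∑ k ∈ Finset.range 4, (K k ^ 2).toNNReal) * C, fun u l hl hd => ?_⟩
  have hKC : ENNReal.ofReal (K l.length ^ 2) ≤
      ((∑ k ∈ Finset.range 4, (K k ^ 2).toNNReal : ℝ≥0) : ℝ≥0∞) := by
    rw [ENNReal.ofReal]
    exact ENNReal.coe_le_coe.2 (Finset.single_le_sum (f := fun k => (K k ^ (2 : ℕ)).toNNReal)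
      (fun _ _ => zero_le) (Finset.mem_range.2 (by omega : l.length < 4)))
  have e : ∀ x, L2sq (fun v => wt γ l.length v * D1 γ (dxIter l u x) v) ≤
      ((∑ k ∈ Finset.range 4, (K k ^ 2).toNNReal : ℝ≥0) : ℝ≥0∞) * C *
        H1sq γ (fun v => wt γ l.length v * dxIter l u x v) := fun x => by
    have h3 : Differentiable ℝ fun v => wt γ l.length v * dxIter l u x v :=
      (differentiable_jap_rpow _).mul (hd x)
    rw [mul_assoc]
    refine (L2sq_le_of_abs_le fun v => ?_).trans (mul_le_mul' hKC (h _ h3.continuous.measurable))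
    rw [abs_of_nonneg (D1_nonneg _ _ _),
      abs_of_nonneg (mul_nonneg (wt_nonneg _ _ _) (D1_nonneg _ _ _))]
    exact hk l.length (hd x) v
  calc _ ≤ ∫⁻ x in cube, ((∑ k ∈ Finset.range 4, (K k ^ 2).toNNReal : ℝ≥0) : ℝ≥0∞) * C *
        H1sq γ (fun v => wt γ l.length v * dxIter l u x v) := lintegral_mono e
    _ ≤ _ := by
        rw [lintegral_const_mul' _ _ (by rw [← ENNReal.coe_mul]; exact ENNReal.coe_ne_top),
          ENNReal.coe_mul]
        gcongr
        exact le_twistedSq γ (H1sq γ) u l hl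

/-- The second-order quantities are controlled by the norm built on `H²_{v,*}`. -/
lemma lintegral_wt_D2_le : ∃ C : ℝ≥0, ∀ (u : E3 → E3 → ℝ) (l : List (Fin 3)), l.length ≤ 3 →
    (∀ x, ContDiff ℝ 2 (dxIter l u x)) →
    ∫⁻ x in cube, L2sq (fun v => wt γ l.length v * D2 γ (dxIter l u x) v) ≤
      C * twistedSq γ (H2sq γ) u := by
  obtain ⟨C, h⟩ := L2sq_D2_le h1 h2
  choose K hK hk using fun k : ℕ => jap_rpow_mul_D2_le h1 h2 ((3 - (k : ℝ)) * (γ / 2 + 1))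
  refine ⟨(∑ k ∈ Finset.range 4, (K k ^ 2).toNNReal) * C, fun u l hl hd => ?_⟩
  have hKC : ENNReal.ofReal (K l.length ^ 2) ≤
      ((∑ k ∈ Finset.range 4, (K k ^ 2).toNNReal : ℝ≥0) : ℝ≥0∞) := by
    rw [ENNReal.ofReal]
    exact ENNReal.coe_le_coe.2 (Finset.single_le_sum (f := fun k => (K k ^ (2 : ℕ)).toNNReal)
      (fun _ _ => zero_le) (Finset.mem_range.2 (by omega : l.length < 4)))
  have hpd : ∀ {f : E3 → ℝ}, ContDiff ℝ 2 f → ∀ i, Differentiable ℝ (pd i f) := fun hf i =>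
    (contDiff_pd (n := 1) (by exact_mod_cast hf) i).differentiable (by simp)
  have e : ∀ x, L2sq (fun v => wt γ l.length v * D2 γ (dxIter l u x) v) ≤
      ((∑ k ∈ Finset.range 4, (K k ^ 2).toNNReal : ℝ≥0) : ℝ≥0∞) * C *
        H2sq γ (fun v => wt γ l.length v * dxIter l u x v) := fun x => by
    have h3 : ContDiff ℝ 2 fun v => wt γ l.length v * dxIter l u x v :=
      ((contDiff_jap_rpow _).of_le le_top).mul (hd x)
    rw [mul_assoc]
    refine (L2sq_le_of_abs_le fun v => ?_).trans
      (mul_le_mul' hKC (h _ h3.continuous.measurable (hpd h3)))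
    rw [abs_of_nonneg (D2_nonneg _ _ _),
      abs_of_nonneg (mul_nonneg (wt_nonneg _ _ _) (D2_nonneg _ _ _))]
    exact hk l.length ((hd x).differentiable (by simp)) (hpd (hd x)) v
  calc _ ≤ ∫⁻ x in cube, ((∑ k ∈ Finset.range 4, (K k ^ 2).toNNReal : ℝ≥0) : ℝ≥0∞) * C *
        H2sq γ (fun v => wt γ l.length v * dxIter l u x v) := lintegral_mono e
    _ ≤ _ := by
        rw [lintegral_const_mul' _ _ (by rw [← ENNReal.coe_mul]; exact ENNReal.coe_ne_top),
          ENNReal.coe_mul]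
        gcongr
        exact le_twistedSq γ (H2sq γ) u l hl

lemma measurable_D1 {F : E3 → E3 → ℝ} (h0 : Measurable (unc F))
    (hp : ∀ l, Measurable (unc (pv l F))) : Measurable fun p : E3 × E3 => D1 γ (F p.1) p.2 := by
  have hB : ∀ k l, Measurable fun p : E3 × E3 => matB γ k l p.2 := fun k l =>
    (continuous_matB h1 h2 k l).measurable.comp measurable_snd
  have hj : Measurable fun p : E3 × E3 => jap p.2 ^ (γ / 2 + 1) :=
    (measurable_jap_rpow _).comp measurable_snd
  refine (hj.mul h0.abs).add (Finset.measurable_sum _ fun k _ => Measurable.abs ?_)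
  exact Finset.measurable_sum _ fun l _ => (hB k l).mul (hp l)

lemma measurable_D2 {n : ℕ} {s : ℝ} {F : E3 → E3 → ℝ} (H : Sm (n + 2) s F) :
    Measurable fun p : E3 × E3 => D2 γ (F p.1) p.2 := by
  have hB : ∀ k l, Measurable fun p : E3 × E3 => matB γ k l p.2 := fun k l =>
    (continuous_matB h1 h2 k l).measurable.comp measurable_snd
  have hj : ∀ s : ℝ, Measurable fun p : E3 × E3 => jap p.2 ^ s := fun s =>
    (measurable_jap_rpow s).comp measurable_snd
  have H1 : ∀ i, Sm (n + 1) s (pv i F) := fun i => H.pv i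
  refine (((hj _).mul H.continuous.measurable.abs).add ((hj _).mul
    (Finset.measurable_sum _ fun k _ => Measurable.abs ?_))).add
    (Finset.measurable_sum _ fun k _ => Finset.measurable_sum _ fun l _ => Measurable.abs ?_)
  · exact Finset.measurable_sum _ fun l _ => (hB k l).mul (H1 l).continuous.measurable
  · exact Finset.measurable_sum _ fun i _ => Finset.measurable_sum _ fun j _ =>
      ((hB k i).mul (hB l j)).mul ((H1 j).pv i).continuous.measurable

end Slice

/-! ### Uniform bounds on slices -/

section Atoms

variable {ι : Type} [Fintype ι]

/-- The components of `D1`. -/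
def atomD1 (γ : ℝ) (f : E3 → ℝ) (v : E3) : Option (Fin 3) → ℝ
  | none => jap v ^ (γ / 2 + 1) * f v
  | some k => tgV γ k f v

lemma D1_eq_sum (γ : ℝ) (f : E3 → ℝ) (v : E3) : D1 γ f v = ∑ q, |atomD1 γ f v q| := by
  rw [Fintype.sum_option, atomD1, abs_mul, abs_of_nonneg (jap_rpow_nonneg _ _)]
  rfl

/-- The coefficients of `atomD1` on a combination. -/
def coefD1 (γ : ℝ) (w : E3 → ℝ) (b : ι → E3 → ℝ) :
    Option (Fin 3) → Option (Fin 3) × ι → E3 → ℝ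
  | none, (none, a) => fun v => w v * (jap v ^ (γ / 2 + 1) * b a v)
  | none, (some _, _) => 0
  | some k, (none, a) => fun v => w v * tgV γ k (b a) v
  | some k, (some m, a) => fun v => w v * (matB γ k m v * b a v)

/-- The functions which occur in `atomD1` on a combination. -/
def funD1 (h : ι → E3 → E3 → ℝ) : Option (Fin 3) × ι → E3 → E3 → ℝ
  | (none, a) => h a
  | (some m, a) => pv m (h a)

lemma sum_coefD1 (γ : ℝ) (w : E3 → ℝ) {b : ι → E3 → ℝ} {h : ι → E3 → E3 → ℝ} {n : ℕ} {s : ℝ}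
    (hb : ∀ a, Differentiable ℝ (b a)) (H : ∀ a, Sm (n + 1) s (h a)) (q : Option (Fin 3))
    (x v : E3) :
    ∑ p, coefD1 γ w b q p v * funD1 h p x v = w v * atomD1 γ (combo b h x) v q := by
  rw [Fintype.sum_prod_type, Fintype.sum_option]
  rcases q with _ | k
  · simp only [coefD1, funD1, atomD1, combo, Pi.zero_apply, zero_mul, Finset.sum_const_zero,
      add_zero, Finset.mul_sum]
    exact Finset.sum_congr rfl fun a _ => by ring
  · simp only [coefD1, funD1, atomD1, tgV, pv_combo hb H, combo, mul_add, Finset.sum_add_distrib,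
      Finset.mul_sum, Finset.sum_mul]
    congr 1
    · rw [Finset.sum_comm]
      exact Finset.sum_congr rfl fun m _ => Finset.sum_congr rfl fun a _ => by ring
    · exact Finset.sum_congr rfl fun m _ => Finset.sum_congr rfl fun a _ => by ring

/-- The components of `D2`. -/
def atomD2 (γ : ℝ) (f : E3 → ℝ) (v : E3) : Unit ⊕ Fin 3 ⊕ (Fin 3 × Fin 3) → ℝ
  | .inl _ => jap v ^ (γ + 2) * f v
  | .inr (.inl k) => jap v ^ (γ / 2 + 1) * tgV γ k f v
  | .inr (.inr p) => bhb γ p.1 p.2 f v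

lemma D2_eq_sum (γ : ℝ) (f : E3 → ℝ) (v : E3) : D2 γ f v = ∑ q, |atomD2 γ f v q| := by
  simp only [Fintype.sum_sum_type, Fintype.sum_prod_type, atomD2, abs_mul,
    abs_of_nonneg (jap_rpow_nonneg v (γ / 2 + 1)), abs_of_nonneg (jap_rpow_nonneg v (γ + 2)),
    ← Finset.mul_sum, Finset.univ_unique, Finset.sum_singleton, D2, add_assoc]

/-- The coefficients of `atomD2`. -/
def coefD2 (γ : ℝ) (w : E3 → ℝ) : Unit ⊕ Fin 3 ⊕ (Fin 3 × Fin 3) →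
    Unit ⊕ Fin 3 ⊕ (Fin 3 × Fin 3) → E3 → ℝ
  | .inl _, .inl _ => fun v => w v * jap v ^ (γ + 2)
  | .inr (.inl k), .inr (.inl m) => fun v => w v * (jap v ^ (γ / 2 + 1) * matB γ k m v)
  | .inr (.inr p), .inr (.inr i) => fun v => w v * (matB γ p.1 i.1 v * matB γ p.2 i.2 v)
  | _, _ => 0

/-- The functions which occur in `atomD2`. -/
def funD2 (f : E3 → E3 → ℝ) : Unit ⊕ Fin 3 ⊕ (Fin 3 × Fin 3) → E3 → E3 → ℝ
  | .inl _ => f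
  | .inr (.inl m) => pv m f
  | .inr (.inr i) => pv i.1 (pv i.2 f)

lemma sum_coefD2 (γ : ℝ) (w : E3 → ℝ) (f : E3 → E3 → ℝ) (q : Unit ⊕ Fin 3 ⊕ (Fin 3 × Fin 3))
    (x v : E3) : ∑ p, coefD2 γ w q p v * funD2 f p x v = w v * atomD2 γ (f x) v q := by
  rw [Fintype.sum_sum_type, Fintype.sum_sum_type, Fintype.sum_prod_type]
  rcases q with _ | k | p <;>
  simp only [coefD2, funD2, atomD2, bhb, tgV, pv, Pi.zero_apply, zero_mul, Finset.sum_const_zero,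
    add_zero, zero_add, Finset.mul_sum, Finset.univ_unique, Finset.sum_singleton, mul_assoc]
  all_goals rfl

end Atoms

section Slice

variable {γ : ℝ} (h1 : -2 ≤ γ) (h2 : γ ≤ 1) {ι : Type} [Fintype ι]
  {b : ι → E3 → ℝ} {h : ι → E3 → E3 → ℝ} {T : ℝ≥0∞} {l : List (Fin 3)} {k : ℕ}
include h1 h2

omit h2 in
lemma setLIntegral_wt_mono {D : E3 → E3 → ℝ} {j : ℕ} (hjk : j ≤ k) :
    ∫⁻ x in cube, L2sq (fun v => wt γ k v * D x v) ≤
      ∫⁻ x in cube, L2sq (fun v => wt γ j v * D x v) := by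
  refine lintegral_mono fun x => L2sq_mono fun v => ?_
  rw [abs_mul, abs_mul, abs_of_nonneg (wt_nonneg _ _ _), abs_of_nonneg (wt_nonneg _ _ _)]
  exact mul_le_mul_of_nonneg_right (wt_anti h1 hjk v) (abs_nonneg _)

omit h2 in
-- The Sobolev inequality adds up to two derivatives in x. The weight of order k remains admissible
-- for all of them when l.length + 2 ≤ k, since the weights decrease with the order.
lemma L2sq_wt_slice_le (hb : ∀ a, Measurable (b a)) (H : ∀ a, Tor 5 (h a)) (hlk : l.length + 2 ≤ k)
    (hk : k ≤ 3) (x : E3) : L2sq (fun v => wt γ k v * dxIter l (combo b h) x v) ≤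
      3159 * twistedSq γ L2sq (combo b h) := by
  rw [dxIter_combo b l fun a => (H a).sm.le (by omega)]
  simp only [combo, Finset.mul_sum, ← mul_assoc]
  refine lintegral_slice_sum_mul_le (c := fun a v => wt γ k v * b a v)
    (fun a => (continuous_wt γ k).measurable.mul (hb a))
    (fun a => (H a).dxIter_of_le l (by omega)) (fun l' hl' => ?_) x
  have e : ∀ y v, ∑ a, wt γ k v * b a v * dxIter l' (dxIter l (h a)) y v =
      wt γ k v * dxIter (l' ++ l) (combo b h) y v := fun y v => by
    rw [dxIter_combo b (l' ++ l) fun a => (H a).sm.le (by simp; omega), combo, Finset.mul_sum]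
    simp only [dxIter_append, mul_assoc]
  simp only [e]
  refine (setLIntegral_wt_mono h1 (j := (l' ++ l).length) (by simp; omega)).trans ?_
  exact le_twistedSq γ L2sq _ _ (by simp; omega)

/-- Each component of D1 is a combination, with coefficients depending on v only, of the functions h
and ∂_v h. Derivatives in x pass through it, and it is again dominated by D1 of the differentiated
function. -/
lemma L2sq_wt_D1_slice_le (hb : ∀ a, Differentiable ℝ (b a)) (H : ∀ a, Tor 6 (h a))
    (hT : ∀ l' : List (Fin 3), l'.length ≤ 3 →
      ∫⁻ y in cube, L2sq (fun v => wt γ l'.length v * D1 γ (dxIter l' (combo b h) y) v) ≤ T)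
    (hlk : l.length + 2 ≤ k) (hk : k ≤ 3) (x : E3) :
    L2sq (fun v => wt γ k v * D1 γ (dxIter l (combo b h) x) v) ≤ (4 * 4 * 3159) * T := by
  rw [dxIter_combo b l fun a => (H a).sm.le (by omega)]
  have Hl : ∀ l' : List (Fin 3), l'.length ≤ 3 → ∀ a, Sm 3 (-40) (dxIter l' (h a)) :=
    fun l' hl' a => ((H a).dxIter_of_le l' (by omega)).sm
  have hm := fun i => (continuous_matB h1 h2 i · |>.measurable)
  have hj := measurable_jap_rpow (γ / 2 + 1)
  have hw := (continuous_wt γ k).measurable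
  have key := lintegral_slice_le (κ := Option (Fin 3)) (ι := Option (Fin 3) × ι)
    (c := coefD1 γ (wt γ k) b) (h := fun _ => funD1 fun a => dxIter l (h a))
    (D := fun x v => wt γ k v * D1 γ (combo b (fun a => dxIter l (h a)) x) v) (T := T) ?_ ?_ ?_ ?_ x
  · have e : Fintype.card (Option (Fin 3)) = 4 := by simp
    rw [e] at key
    exact_mod_cast key
  · have hb' := fun a => (hb a).continuous.measurable
    have ht := fun k a => measurable_tgV h1 h2 k (b a)
    rintro (_ | q) ⟨_ | m, a⟩
    · exact hw.mul (hj.mul (hb' a))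
    · exact measurable_zero
    · exact hw.mul (ht q a)
    · exact hw.mul ((hm q m).mul (hb' a))
  · rintro - ⟨_ | m, a⟩
    · exact (H a).dxIter_of_le l (by omega)
    · exact Tor.pv ((H a).dxIter_of_le l (by omega)) m
  · intro x v
    rw [abs_of_nonneg (mul_nonneg (wt_nonneg _ _ _) (D1_nonneg _ _ _)), D1_eq_sum, Finset.mul_sum]
    simp only [sum_coefD1 γ (wt γ k) hb (n := 2) (Hl l (by omega)), abs_mul,
      abs_of_nonneg (wt_nonneg γ k v), le_refl]
  · intro l' hl' q
    have hlen : (l' ++ l).length ≤ 3 := by simp; omega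
    have e : ∀ y v, ∑ p, coefD1 γ (wt γ k) b q p v *
        dxIter l' (funD1 (fun a => dxIter l (h a)) p) y v =
        wt γ k v * atomD1 γ (dxIter (l' ++ l) (combo b h) y) v q := fun y v => by
      rw [dxIter_combo b (l' ++ l) fun a => (H a).sm.le (by omega),
        ← sum_coefD1 γ (wt γ k) hb (n := 2) (Hl (l' ++ l) hlen)]
      refine Finset.sum_congr rfl fun p _ => ?_
      rcases p with ⟨_ | m, a⟩
      · simp only [funD1, dxIter_append]
      · simp only [funD1, dxIter_append]
        rw [dxIter_pv (n := 2) m l' ((((H a).dxIter_of_le (n := 5) l (by omega)).sm).le (by omega))]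
    simp only [e]
    refine le_trans ?_ (hT _ hlen)
    refine le_trans ?_ (setLIntegral_wt_mono h1 (j := (l' ++ l).length) (k := k) (by simp; omega))
    refine lintegral_mono fun y => L2sq_mono fun v => ?_
    rw [abs_mul, abs_mul]
    refine mul_le_mul_of_nonneg_left ?_ (abs_nonneg _)
    rw [abs_of_nonneg (D1_nonneg _ _ _), D1_eq_sum]
    exact Finset.single_le_sum (f := fun q => |atomD1 γ (dxIter (l' ++ l) (combo b h) y) v q|)
      (fun _ _ => abs_nonneg _) (Finset.mem_univ q)

lemma L2sq_wt_D2_slice_le {g : E3 → E3 → ℝ} (H : Tor 6 g)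
    (hT : ∀ l' : List (Fin 3), l'.length ≤ 3 →
      ∫⁻ y in cube, L2sq (fun v => wt γ l'.length v * D2 γ (dxIter l' g y) v) ≤ T)
    (hlk : l.length + 2 ≤ k) (hk : k ≤ 3) (x : E3) :
    L2sq (fun v => wt γ k v * D2 γ (dxIter l g x) v) ≤ (13 * 13 * 3159) * T := by
  have Hl : ∀ l' : List (Fin 3), l'.length ≤ 3 → Sm 3 (-40) (dxIter l' g) :=
    fun l' hl' => (H.dxIter_of_le l' (by omega)).sm
  have hm := fun i => (continuous_matB h1 h2 i · |>.measurable)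
  have hj := measurable_jap_rpow
  have hw := (continuous_wt γ k).measurable
  have key := lintegral_slice_le (c := coefD2 γ (wt γ k)) (h := fun _ => funD2 (dxIter l g))
    (D := fun x v => wt γ k v * D2 γ (dxIter l g x) v) (T := T) ?_ ?_ ?_ ?_ x
  · have e : Fintype.card (Unit ⊕ Fin 3 ⊕ (Fin 3 × Fin 3)) = 13 := by simp
    rw [e] at key
    exact_mod_cast key
  · rintro (_ | q | q) (_ | m | m)
    · exact hw.mul (hj _)
    · exact measurable_zero
    · exact measurable_zero
    · exact measurable_zero
    · exact hw.mul ((hj _).mul (hm q m))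
    · exact measurable_zero
    · exact measurable_zero
    · exact measurable_zero
    · exact hw.mul ((hm _ _).mul (hm _ _))
  · rintro - (_ | m | m)
    · exact H.dxIter_of_le l (by omega)
    · exact Tor.pv (H.dxIter_of_le l (by omega)) m
    · exact Tor.pv (Tor.pv (H.dxIter_of_le l (by omega)) _) _
  · intro x v
    rw [abs_of_nonneg (mul_nonneg (wt_nonneg _ _ _) (D2_nonneg _ _ _)), D2_eq_sum, Finset.mul_sum]
    simp only [sum_coefD2 γ (wt γ k), abs_mul, abs_of_nonneg (wt_nonneg γ k v), le_refl]
  · intro l' hl' q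
    have hlen : (l' ++ l).length ≤ 3 := by simp; omega
    have e : ∀ y v, ∑ p, coefD2 γ (wt γ k) q p v * dxIter l' (funD2 (dxIter l g) p) y v =
        wt γ k v * atomD2 γ (dxIter (l' ++ l) g y) v q := fun y v => by
      rw [← sum_coefD2 γ (wt γ k), dxIter_append]
      have H' : Sm 5 (-40) (dxIter l g) := (H.dxIter_of_le l (by omega)).sm
      refine Finset.sum_congr rfl fun p _ => ?_
      rcases p with _ | m | m
      · rfl
      · simp only [funD2]
        rw [dxIter_pv (n := 2) m l' (H'.le (by omega))]
      · simp only [funD2]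
        rw [dxIter_pv (n := 1) m.1 l' ((H'.pv (n := 4) m.2).le (by omega)),
          dxIter_pv (n := 2) m.2 l' (H'.le (by omega))]
    simp only [e]
    refine le_trans ?_ (hT _ hlen)
    refine le_trans ?_ (setLIntegral_wt_mono h1 (j := (l' ++ l).length) (k := k) (by simp; omega))
    refine lintegral_mono fun y => L2sq_mono fun v => ?_
    rw [abs_mul, abs_mul]
    refine mul_le_mul_of_nonneg_left ?_ (abs_nonneg _)
    rw [abs_of_nonneg (D2_nonneg _ _ _), D2_eq_sum]
    exact Finset.single_le_sum (f := fun q => |atomD2 γ (dxIter (l' ++ l) g y) v q|)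
      (fun _ _ => abs_nonneg _) (Finset.mem_univ q)

end Slice

/-! ### Trilinear bounds on slices -/

/-- φ is taken in the sup norm, and the other two factors by Cauchy-Schwarz. -/
lemma enorm_integral_sq_le {F b d φ : E3 → ℝ} {C : ℝ} (hb : Measurable b) (hd : Measurable d)
    {A : ℝ≥0∞} (hA : ∀ v, ‖φ v‖ₑ ^ 2 ≤ A) (hF : ∀ v, |F v| ≤ C * |φ v| * |b v| * |d v|) :
    ‖∫ v, F v‖ₑ ^ 2 ≤ ENNReal.ofReal (C ^ 2) * A * L2sq b * L2sq d := by
  have hA' : ∀ v, ‖φ v‖ₑ ≤ A ^ (1 / 2 : ℝ) := fun v => by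
    rw [one_div, ENNReal.le_rpow_inv_iff (by norm_num), ENNReal.rpow_two]
    exact hA v
  have e : ‖∫ v, F v‖ₑ ≤ (ENNReal.ofReal |C| * A ^ (1 / 2 : ℝ)) * ∫⁻ v, ‖b v‖ₑ * ‖d v‖ₑ := by
    have hbd : Measurable fun v => ‖b v‖ₑ * ‖d v‖ₑ := hb.enorm.mul hd.enorm
    rw [← lintegral_const_mul _ hbd]
    refine (enorm_integral_le_lintegral_enorm _).trans (lintegral_mono fun v => ?_)
    calc ‖F v‖ₑ ≤ ENNReal.ofReal (|C| * |φ v| * |b v| * |d v|) := by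
          rw [Real.enorm_eq_ofReal_abs]
          refine ENNReal.ofReal_le_ofReal ((hF v).trans ?_)
          gcongr
          exact le_abs_self C
      _ = ENNReal.ofReal |C| * ‖φ v‖ₑ * (‖b v‖ₑ * ‖d v‖ₑ) := by
          rw [ENNReal.ofReal_mul (by positivity), ENNReal.ofReal_mul (by positivity),
            ENNReal.ofReal_mul (by positivity)]
          simp only [← Real.enorm_eq_ofReal_abs, mul_assoc]
      _ ≤ _ := by
          have := hA' v
          gcongr
  calc _ ≤ ((ENNReal.ofReal |C| * A ^ (1 / 2 : ℝ)) * ∫⁻ v, ‖b v‖ₑ * ‖d v‖ₑ) ^ 2 := by gcongr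
    _ = ENNReal.ofReal (C ^ 2) * A * (∫⁻ v, ‖b v‖ₑ * ‖d v‖ₑ) ^ 2 := by
        rw [mul_pow, mul_pow, ← ENNReal.ofReal_pow (abs_nonneg _), sq_abs,
          ← ENNReal.rpow_natCast (A ^ (1 / 2 : ℝ)), ← ENNReal.rpow_mul]
        norm_num
    _ ≤ ENNReal.ofReal (C ^ 2) * A * (L2sq b * L2sq d) := by
        gcongr
        exact lintegral_mul_sq_le hb.enorm.aemeasurable hd.enorm.aemeasurable
    _ = _ := by ring

lemma jap_rpow_le_one (v : E3) {s : ℝ} (hs : s ≤ 0) : jap v ^ s ≤ 1 := by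
  simpa using jap_rpow_mono v hs

/-- Differentiable functions which are bounded together with their derivatives. -/
def Tst (χ : E3 → ℝ) : Prop :=
  Differentiable ℝ χ ∧ ∃ B : ℝ, (∀ v, |χ v| ≤ B) ∧ ∀ i v, |pd i χ v| ≤ B

lemma tst_mul {ρ ψ : E3 → ℝ} (hρ : Differentiable ℝ ρ) (hψ : Differentiable ℝ ψ) {R K : ℝ}
    (b1 : ∀ v, |ρ v| ≤ R * jap v ^ (12 : ℝ)) (b2 : ∀ i v, |pd i ρ v| ≤ R * jap v ^ (12 : ℝ))
    (c1 : ∀ v, |ψ v| ≤ K * jap v ^ (-27 : ℝ)) (c2 : ∀ i v, |pd i ψ v| ≤ K * jap v ^ (-27 : ℝ)) :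
    Tst fun v => ρ v * ψ v := by
  have key : ∀ {a c : ℝ} {v : E3}, |a| ≤ R * jap v ^ (12 : ℝ) → |c| ≤ K * jap v ^ (-27 : ℝ) →
      |a * c| ≤ |R * K| := fun {a c v} ha hc => by
    rw [abs_mul]
    calc _ ≤ (R * jap v ^ (12 : ℝ)) * (K * jap v ^ (-27 : ℝ)) :=
          mul_le_mul ha hc (abs_nonneg _) ((abs_nonneg _).trans ha)
      _ = R * K * jap v ^ (12 + -27 : ℝ) := by rw [jap_rpow_add]; ring
      _ ≤ |R * K| * 1 := by
          refine mul_le_mul (le_abs_self _) (jap_rpow_le_one v (by norm_num)) (jap_rpow_nonneg _ _)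
            (abs_nonneg _)
      _ = _ := mul_one _
  refine ⟨hρ.mul hψ, |R * K| + |R * K|, fun v => ?_, fun i v => ?_⟩
  · have := key (b1 v) (c1 v)
    linarith [abs_nonneg (R * K)]
  · rw [pd_mul i (hρ v) (hψ v)]
    have t1 := key (b2 i v) (c1 v)
    have t2 := key (b1 v) (c2 i v)
    exact (abs_add_le _ _).trans (add_le_add t1 t2)

section Slice

variable {γ : ℝ} (h1 : -2 ≤ γ) (h2 : γ ≤ 1)
include h1 h2

omit h1 h2 in
lemma enorm_majorant_sq_le_of_le {A : ℝ} {φ b : E3 → ℝ} {v : E3} {C : ℝ≥0}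
    (hC : ∀ φ : E3 → ℝ, Measurable φ → ∀ v,
      ‖majorant φ v‖ₑ ^ 2 ≤ C * ∫⁻ w, ‖jap w ^ (-1 : ℝ) * φ w‖ₑ ^ 2)
    (hφ : Measurable φ) (h : ∀ w, jap w ^ (-1 : ℝ) * |φ w| ≤ A * |b w|) :
    ‖majorant φ v‖ₑ ^ 2 ≤ C * ENNReal.ofReal (A ^ 2) * L2sq b := by
  refine (hC φ hφ v).trans ?_
  rw [mul_assoc]
  gcongr
  refine L2sq_le_of_abs_le fun w => ?_
  rw [abs_mul, abs_of_nonneg (jap_rpow_nonneg _ _)]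
  exact h w

omit h1 h2 in
lemma enorm_majorant_sq_le : ∃ C : ℝ≥0, ∀ φ : E3 → ℝ, Measurable φ → ∀ v,
    ‖majorant φ v‖ₑ ^ 2 ≤ C * L2sq φ := by
  obtain ⟨C, hC⟩ := majorant_sq_le
  refine ⟨C, fun φ hφ v => ?_⟩
  have := enorm_majorant_sq_le_of_le (A := 1) (b := φ) (v := v) hC hφ fun w => by
    gcongr
    exact jap_rpow_le_one w (by norm_num)
  simpa using this

/-- The spare weight of `majorant_sq_le` is used: ⟨w⟩^{-1} ≤ ⟨w⟩^{γ/2} because γ ≥ −2, and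
⟨w⟩^{γ/2}|∇f| is controlled by |𝐁∇f|. -/
lemma enorm_majorant_pd_sq_le : ∃ C : ℝ≥0, ∀ (f : E3 → ℝ) (j : Fin 3) (v : E3),
    ‖majorant (pd j f) v‖ₑ ^ 2 ≤ C * L2sq (D1 γ f) := by
  obtain ⟨C, hC⟩ := majorant_sq_le
  obtain ⟨K, hK, hk⟩ := bn_bounds h1 h2
  refine ⟨C * (K ^ 2).toNNReal, fun f j v => ?_⟩
  refine enorm_majorant_sq_le_of_le (A := K) hC (measurable_pd j f) fun w => ?_
  have a1 := (hk w (grad f w)).1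
  have a2 : |pd j f w| ≤ ‖grad f w‖ := abs_coord_le (grad f w) j
  have a3 : bn γ w (grad f w) ≤ D1 γ f w := by
    rw [D1, bn_grad]
    have := mul_nonneg (jap_rpow_nonneg w (γ / 2 + 1)) (abs_nonneg (f w))
    linarith
  rw [abs_of_nonneg (D1_nonneg _ _ _)]
  calc _ ≤ jap w ^ (γ / 2) * ‖grad f w‖ := by
        have := jap_rpow_nonneg w (γ / 2)
        gcongr
        · exact one_le_jap w
        · linarith
    _ ≤ _ := a1.trans (by gcongr)

/-- A single component p_m is recovered from 𝐁p by 𝐁⁻¹ = O(⟨w⟩^{-γ/2}), which the spare weight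
⟨w⟩^{-1} compensates for γ ≥ −2. For p = ∇_x f this replaces ∂_m f by ∇̃_x f. -/
lemma enorm_majorant_comp_sq_le : ∃ C : ℝ≥0, ∀ (p : Fin 3 → E3 → ℝ), (∀ l, Measurable (p l)) →
    ∀ (m : Fin 3) (v : E3), ‖majorant (p m) v‖ₑ ^ 2 ≤
      C * ∑ j, L2sq (fun v => ∑ l, matB γ j l v * p l v) := by
  obtain ⟨C, hC⟩ := majorant_sq_le
  obtain ⟨K, hK, hk⟩ := abs_matBinv_le h1 h2
  refine ⟨C * (K ^ 2).toNNReal * 3, fun p hp m v => ?_⟩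
  have hm : ∀ j, Measurable fun v => ∑ l, matB γ j l v * p l v := fun j =>
    Finset.measurable_sum _ fun l _ => (continuous_matB h1 h2 j l).measurable.mul (hp l)
  refine (hC _ (hp m) v).trans ?_
  rw [ENNReal.coe_mul, ENNReal.coe_mul, mul_assoc, mul_assoc, ← mul_assoc ((K ^ 2).toNNReal : ℝ≥0∞)]
  gcongr
  refine (L2sq_sum_le (C := K) hm fun w => ?_).trans (by simp; rfl)
  have e : p m w = ∑ j, matBinv γ m j w * ∑ l, matB γ j l w * p l w := by
    simp_rw [Finset.mul_sum]
    rw [Finset.sum_comm]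
    simp_rw [← mul_assoc, ← Finset.sum_mul, matBinv_mul_matB h1 h2]
    simp
  rw [abs_mul, abs_of_nonneg (jap_rpow_nonneg _ _), e, Finset.mul_sum]
  refine (mul_le_mul_of_nonneg_left (Finset.abs_sum_le_sum_abs _ _) (jap_rpow_nonneg _ _)).trans ?_
  rw [Finset.mul_sum]
  refine Finset.sum_le_sum fun j _ => ?_
  rw [abs_mul, ← mul_assoc]
  gcongr
  calc _ ≤ jap w ^ (-1 : ℝ) * (K * jap w ^ (-(γ / 2))) := by
        have := jap_rpow_nonneg w (-1)
        have := hk w m j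
        gcongr
    _ = K * jap w ^ (-1 + -(γ / 2)) := by rw [jap_rpow_add]; ring
    _ ≤ K * 1 := by
        gcongr
        exact jap_rpow_le_one w (by linarith)
    _ = K := mul_one K

/-- The strong bound on `Γ` in `L²_v`. -/
lemma L2sq_Gam_le : ∃ C : ℝ≥0, ∀ {f g : E3 → E3 → ℝ}, Sm 3 (-40) f → Sm 3 (-40) g →
    ∀ {w : E3 → ℝ}, Measurable w → ∀ x, L2sq (fun v => w v * Gam γ f g x v) ≤
      C * (L2sq (f x) * L2sq (fun v => w v * D2 γ (g x) v) +
        L2sq (D1 γ (f x)) * L2sq (fun v => w v * g x v)) := by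
  obtain ⟨K, hK, hk⟩ := abs_Gam_le h1 h2
  obtain ⟨C1, hC1⟩ := enorm_majorant_sq_le
  obtain ⟨C2, hC2⟩ := enorm_majorant_pd_sq_le h1 h2
  refine ⟨(K ^ 2).toNNReal * 4 * (C1 + 3 * C2), fun {f g} Hf Hg {w} hw x => ?_⟩
  have mD := measurable_slice (F := fun x v => D2 γ (g x) v) (measurable_D2 h1 h2 (n := 1) Hg) x
  have mg := measurable_slice Hg.continuous.measurable x
  have mf := measurable_slice Hf.continuous.measurable x
  have key : ∀ v, ‖w v * Gam γ f g x v‖ₑ ^ 2 ≤ ((K ^ 2).toNNReal * 4 : ℝ≥0) *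
      ((C1 * L2sq (f x)) * ‖w v * D2 γ (g x) v‖ₑ ^ 2 +
        (3 * C2 * L2sq (D1 γ (f x))) * ‖w v * g x v‖ₑ ^ 2) := fun v => by
    set F : Option (Fin 3) → ℝ := fun q => q.elim (majorant (f x) v * (w v * D2 γ (g x) v))
      fun j => majorant (pv j f x) v * (w v * g x v) with hF
    have a1 : |w v * Gam γ f g x v| ≤ K * ∑ q, |F q| := by
      have := hk (n := 1) Hf (by norm_num) Hg x v
      simp only [hF, Fintype.sum_option, Option.elim, abs_mul, abs_of_nonneg (D2_nonneg γ (g x) v),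
        abs_of_nonneg (majorant_nonneg _ _)]
      calc _ ≤ |w v| * (K * (majorant (f x) v * D2 γ (g x) v +
            ∑ j, majorant (pv j f x) v * |g x v|)) := by gcongr
        _ = _ := by
          rw [mul_add, mul_add, mul_add, Finset.mul_sum, Finset.mul_sum, Finset.mul_sum]
          congr 1
          · ring
          · exact Finset.sum_congr rfl fun j _ => by ring
    have a2 : ‖w v * Gam γ f g x v‖ₑ ≤ ENNReal.ofReal K * ∑ q, ‖F q‖ₑ := by
      have := ENNReal.ofReal_le_ofReal a1
      rw [ENNReal.ofReal_mul hK.le, ENNReal.ofReal_sum_of_nonneg fun _ _ => abs_nonneg _] at this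
      simpa only [← Real.enorm_eq_ofReal_abs] using this
    calc _ ≤ (ENNReal.ofReal K * ∑ q, ‖F q‖ₑ) ^ 2 := by gcongr
      _ ≤ ENNReal.ofReal (K ^ 2) * (4 * ∑ q, ‖F q‖ₑ ^ 2) := by
          rw [mul_pow, ENNReal.ofReal_pow hK.le]
          gcongr
          simpa using sum_sq_le Finset.univ fun q => ‖F q‖ₑ
      _ = ((K ^ 2).toNNReal * 4 : ℝ≥0) * (‖majorant (f x) v‖ₑ ^ 2 * ‖w v * D2 γ (g x) v‖ₑ ^ 2 +
          ∑ j, ‖majorant (pv j f x) v‖ₑ ^ 2 * ‖w v * g x v‖ₑ ^ 2) := by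
          simp only [hF, Fintype.sum_option, Option.elim, enorm_mul (majorant _ _), mul_pow]
          rw [ENNReal.coe_mul, mul_assoc]
          rfl
      _ ≤ ((K ^ 2).toNNReal * 4 : ℝ≥0) * ((C1 * L2sq (f x)) * ‖w v * D2 γ (g x) v‖ₑ ^ 2 +
          ∑ _j : Fin 3, (C2 * L2sq (D1 γ (f x))) * ‖w v * g x v‖ₑ ^ 2) := by
          gcongr with j
          · exact hC1 _ mf v
          · exact hC2 (f x) j v
      _ = _ := by
          simp only [Finset.sum_const, Finset.card_univ, Fintype.card_fin, nsmul_eq_mul]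
          push_cast
          ring
  calc _ ≤ ∫⁻ v, ((K ^ 2).toNNReal * 4 : ℝ≥0) *
      ((C1 * L2sq (f x)) * ‖w v * D2 γ (g x) v‖ₑ ^ 2 +
        (3 * C2 * L2sq (D1 γ (f x))) * ‖w v * g x v‖ₑ ^ 2) := lintegral_mono key
    _ = ((K ^ 2).toNNReal * 4 : ℝ≥0) * (C1 * (L2sq (f x) * L2sq (fun v => w v * D2 γ (g x) v)) +
        3 * C2 * (L2sq (D1 γ (f x)) * L2sq (fun v => w v * g x v))) := by
        have e1 : Measurable fun v => ‖w v * D2 γ (g x) v‖ₑ ^ 2 := (hw.mul mD).enorm.pow_const 2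
        have e2 : Measurable fun v => ‖w v * g x v‖ₑ ^ 2 := (hw.mul mg).enorm.pow_const 2
        rw [lintegral_const_mul' _ _ ENNReal.coe_ne_top, lintegral_add_left (e1.const_mul _),
          lintegral_const_mul _ e1, lintegral_const_mul _ e2]
        simp only [L2sq, mul_assoc]
    _ ≤ ((K ^ 2).toNNReal * 4 : ℝ≥0) *
        ((C1 + 3 * C2) * (L2sq (f x) * L2sq (fun v => w v * D2 γ (g x) v)) +
        (C1 + 3 * C2) * (L2sq (D1 γ (f x)) * L2sq (fun v => w v * g x v))) := by
        gcongr
        · exact le_self_add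
        · exact le_add_self
    _ = _ := by push_cast; ring

end Slice

/-! ### Weak bounds on slices, with test functions weighted by 𝐁. -/

section Slice

variable {γ : ℝ} (h1 : -2 ≤ γ) (h2 : γ ≤ 1)
include h1 h2

omit h1 h2 in
lemma differentiable_wt_sq (γ : ℝ) (k : ℕ) : Differentiable ℝ fun v => wt γ k v * wt γ k v :=
  (differentiable_jap_rpow _).mul (differentiable_jap_rpow _)

lemma abs_pd_wt_sq_le {k : ℕ} (hk : k ≤ 3) (i : Fin 3) (v : E3) :
    |pd i (fun v => wt γ k v * wt γ k v) v| ≤ 9 * (wt γ k v * wt γ k v) := by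
  have h3 : (0 : ℝ) ≤ 3 - (k : ℝ) := by
    have : (k : ℝ) ≤ 3 := by exact_mod_cast hk
    linarith
  have h4 : (0 : ℝ) ≤ k := by positivity
  have hs : |(3 - (k : ℝ)) * (γ / 2 + 1)| ≤ 9 / 2 := by
    rw [abs_of_nonneg (mul_nonneg h3 (by linarith))]
    nlinarith
  have d : Differentiable ℝ (wt γ k) := differentiable_jap_rpow _
  have a := abs_pd_jap_rpow_le ((3 - (k : ℝ)) * (γ / 2 + 1)) i v
  have w0 := wt_nonneg γ k v
  have b : |pd i (wt γ k) v| ≤ 9 / 2 * wt γ k v := a.trans (by unfold wt at *; gcongr)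
  rw [pd_mul i (d v) (d v)]
  refine (abs_add_le _ _).trans ?_
  rw [abs_mul, abs_mul, abs_of_nonneg w0]
  nlinarith

lemma wt_sq_le {k : ℕ} (v : E3) : wt γ k v * wt γ k v ≤ jap v ^ (9 : ℝ) := by
  have h4 : (0 : ℝ) ≤ k := by positivity
  rw [wt, ← jap_rpow_add]
  refine jap_rpow_mono v ?_
  nlinarith

/-- The bounds on the weight `𝐁_{jm} ρ`. -/
lemma matB_wt_sq_bounds : ∃ C : ℝ, 0 < C ∧ ∀ {k : ℕ}, k ≤ 3 → ∀ (j m : Fin 3) (v : E3),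
    |matB γ j m v * (wt γ k v * wt γ k v)| ≤ C * (jap v ^ (γ / 2 + 1) * wt γ k v) * wt γ k v ∧
    ∀ i, |pd i (fun u => matB γ j m u * (wt γ k u * wt γ k u)) v| ≤
      C * (jap v ^ (γ / 2 + 1) * wt γ k v) * wt γ k v := by
  obtain ⟨B, hB, hb⟩ := abs_matB_le h1 h2
  obtain ⟨E, hE, he⟩ := abs_pd_matB_le h1 h2
  refine ⟨E + 9 * B, by positivity, fun {k} hk j m v => ?_⟩
  have w0 := mul_nonneg (wt_nonneg γ k v) (wt_nonneg γ k v)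
  have p0 := mul_nonneg (jap_rpow_nonneg v (γ / 2 + 1)) w0
  have b0 := hb v j m
  have a1 : |matB γ j m v * (wt γ k v * wt γ k v)| ≤
      B * (jap v ^ (γ / 2 + 1) * (wt γ k v * wt γ k v)) := by
    rw [abs_mul, abs_of_nonneg w0, ← mul_assoc B]
    gcongr
  have e : ∀ c, c * (jap v ^ (γ / 2 + 1) * wt γ k v) * wt γ k v =
      c * (jap v ^ (γ / 2 + 1) * (wt γ k v * wt γ k v)) := fun c => by ring
  simp only [e]
  refine ⟨a1.trans ?_, fun i => ?_⟩
  · gcongr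
    linarith
  · rw [pd_mul i (differentiable_matB h1 h2 j m v) (differentiable_wt_sq γ k v)]
    refine (abs_add_le _ _).trans ?_
    rw [abs_mul, abs_mul (matB γ j m v), abs_of_nonneg w0]
    have e1 : |pd i (matB γ j m) v| * (wt γ k v * wt γ k v) ≤
        E * jap v ^ (γ / 2 + 1) * (wt γ k v * wt γ k v) := by
      have := he v i j m
      gcongr
    have e2 : |matB γ j m v| * |pd i (fun v => wt γ k v * wt γ k v) v| ≤
        B * jap v ^ (γ / 2 + 1) * (9 * (wt γ k v * wt γ k v)) := by
      have := abs_pd_wt_sq_le h1 h2 hk i v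
      exact mul_le_mul b0 this (abs_nonneg _) ((abs_nonneg _).trans b0)
    linarith

/-- 𝐁 and the squared weight, with their derivatives, grow at most like ⟨v⟩^{3+9}, while G decays
like ⟨v⟩^{-40}. -/
lemma tst_matB_wt_sq_mul {k : ℕ} (hk : k ≤ 3) (j m : Fin 3) {G : E3 → E3 → ℝ}
    (HG : Sm 1 (-40) G) (x : E3) :
    Tst fun v => matB γ j m v * (wt γ k v * wt γ k v) * G x v := by
  obtain ⟨C, hC, hc⟩ := matB_wt_sq_bounds h1 h2
  obtain ⟨A1, hA1, b1⟩ := Gr.bound HG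
  have hb2 := fun i => Gr.bound (HG.pv (n := 0) i)
  choose A2 hA2 b2 using hb2
  have key : ∀ v, C * (jap v ^ (γ / 2 + 1) * wt γ k v) * wt γ k v ≤ C * jap v ^ (12 : ℝ) := fun v => by
    have e : jap v ^ (12 : ℝ) = jap v ^ (3 : ℝ) * jap v ^ (9 : ℝ) := by
      rw [← jap_rpow_add]; norm_num
    rw [mul_assoc, mul_assoc, e]
    have := jap_rpow_nonneg v (3 : ℝ)
    have := mul_nonneg (wt_nonneg γ k v) (wt_nonneg γ k v)
    have := wt_sq_le h1 h2 (k := k) v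
    have := jap_rpow_mono v (show γ / 2 + 1 ≤ 3 by linarith)
    gcongr
  have hd : ∀ v, jap v ^ (-40 : ℝ) ≤ jap v ^ (-27 : ℝ) := fun v => jap_rpow_mono v (by norm_num)
  have hs : ∀ i, A2 i ≤ A1 + ∑ i, A2 i := fun i => by
    have := Finset.single_le_sum (f := A2) (fun i _ => (hA2 i).le) (Finset.mem_univ i)
    linarith
  refine tst_mul (ρ := fun v => matB γ j m v * (wt γ k v * wt γ k v)) (R := C) (K := A1 + ∑ i, A2 i)
    ((differentiable_matB h1 h2 j m).mul (differentiable_wt_sq γ k)) (HG.diff_v (n := 0) x)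
    (fun v => ((hc hk j m v).1).trans (key v)) (fun i v => ((hc hk j m v).2 i).trans (key v))
    (fun v => ?_) fun i v => ?_
  · refine (b1 (x, v)).trans ?_
    have := Finset.sum_nonneg fun i (_ : i ∈ Finset.univ) => (hA2 i).le
    have := hd v
    have := jap_rpow_nonneg v (-40)
    gcongr
    linarith
  · refine (b2 i (x, v)).trans ?_
    have := hd v
    have := jap_rpow_nonneg v (-40)
    have := hs i
    have := hA2 i
    have : 0 ≤ A1 + ∑ i, A2 i := by linarith
    gcongr

lemma integral_Gam_mul_tst {f g : E3 → E3 → ℝ} (H : Sm 3 (-40) f) (H' : Sm 3 (-40) g)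
    {χ : E3 → ℝ} (hχ : Tst χ) (x : E3) : ∫ v, Gam γ f g x v * χ v =
      - ∫ v, ∑ i, JJ γ i f g x v * (grad χ v + (χ v / 2) • v) i := by
  obtain ⟨hd, B, b1, b2⟩ := hχ
  exact integral_Gam_mul h1 h2 (n := 1) (r := 0) (B := B) H H' hd (by simpa using b1)
    (by simpa using b2) (by norm_num) x

/-- The weak bound on a slice when the vector field `∇̃_x` acts on the first function. -/
lemma enorm_slice_weak_le : ∃ C : ℝ≥0, ∀ {f g G : E3 → E3 → ℝ}, Sm 3 (-40) f → Sm 3 (-40) g →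
    Sm 3 (-40) G → ∀ {k : ℕ}, k ≤ 3 → ∀ (j m : Fin 3) (x : E3) {A : ℝ≥0∞},
    (∀ v, ‖majorant (f x) v‖ₑ ^ 2 ≤ A) →
    ‖∫ v, Gam γ f g x v * (matB γ j m v * (wt γ k v * wt γ k v) * G x v)‖ₑ ^ 2 ≤
      C * A * L2sq (fun v => (jap v ^ (γ / 2 + 1) * wt γ k v) * D1 γ (g x) v) *
        L2sq (fun v => wt γ k v * D1 γ (G x) v) := by
  obtain ⟨K, hK, hk⟩ := abs_weak_le h1 h2
  obtain ⟨R, hR, hr⟩ := matB_wt_sq_bounds h1 h2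
  refine ⟨((K * R) ^ 2).toNNReal, fun {f g G} Hf Hg HG {k} hk3 j m x {A} hA => ?_⟩
  have hw := (continuous_wt γ k).measurable
  have mD : ∀ {u : E3 → E3 → ℝ}, Sm 3 (-40) u → Measurable (D1 γ (u x)) := fun {u} Hu =>
    measurable_slice (F := fun x v => D1 γ (u x) v) (measurable_D1 h1 h2 Hu.continuous.measurable
      fun l => (Hu.pv (n := 2) l).continuous.measurable) x
  rw [integral_Gam_mul_tst h1 h2 Hf Hg (tst_matB_wt_sq_mul h1 h2 hk3 j m (HG.le (by norm_num)) x) x,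
    enorm_neg]
  refine enorm_integral_sq_le (C := K * R)
    (b := fun v => (jap v ^ (γ / 2 + 1) * wt γ k v) * D1 γ (g x) v)
    (d := fun v => wt γ k v * D1 γ (G x) v) (((measurable_jap_rpow _).mul hw).mul (mD Hg))
    (hw.mul (mD HG)) hA fun v => ?_
  have w0 := wt_nonneg γ k v
  have p0 := jap_rpow_nonneg v (γ / 2 + 1)
  rw [abs_of_nonneg (majorant_nonneg _ _), abs_of_nonneg (mul_nonneg (mul_nonneg p0 w0)
    (D1_nonneg _ _ _)), abs_of_nonneg (mul_nonneg w0 (D1_nonneg _ _ _))]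
  refine (hk (n := 2) (g := g) Hf (by norm_num) (x := x) (v := v)
    (ρ := fun v => matB γ j m v * (wt γ k v * wt γ k v)) (ψ := G x)
    ((differentiable_matB h1 h2 j m).mul (differentiable_wt_sq γ k) v) (HG.diff_v (n := 2) x v)
    (hr hk3 j m v).1 (hr hk3 j m v).2).trans (le_of_eq (by ring))

/-- The weak bound on a slice when the vector field `∇̃_x` acts on the second function. -/
lemma enorm_slice_weak_sum_le : ∃ C : ℝ≥0, ∀ {f G : E3 → E3 → ℝ} {h : Fin 3 → E3 → E3 → ℝ},
    Sm 3 (-40) f → (∀ l, Sm 3 (-40) (h l)) →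
    Sm 3 (-40) G → ∀ {k : ℕ}, k ≤ 3 → ∀ (j : Fin 3) (x : E3) {A : ℝ≥0∞},
    (∀ v, ‖majorant (f x) v‖ₑ ^ 2 ≤ A) →
    ‖∑ m, ∫ v, Gam γ f (h m) x v * (matB γ j m v * (wt γ k v * wt γ k v) * G x v)‖ₑ ^ 2 ≤
      C * A * (∑ q, L2sq (fun v => wt γ k v * D1 γ (combo (matB γ q) h x) v)) *
        L2sq (fun v => wt γ k v * D1 γ (G x) v) := by
  obtain ⟨K, hK, hk⟩ := abs_weak_sum_le h1 h2
  refine ⟨((9 * K) ^ 2).toNNReal * 3, fun {f G h} Hf Hh HG {k} hk3 j x {A} hA => ?_⟩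
  have hw := (continuous_wt γ k).measurable
  have mB := fun q l => (continuous_matB h1 h2 q l).measurable
  have dB := fun q l => differentiable_matB h1 h2 q l
  have mG : Measurable (D1 γ (G x)) :=
    measurable_slice (F := fun x v => D1 γ (G x) v) (measurable_D1 h1 h2 HG.continuous.measurable
      fun l => (HG.pv (n := 2) l).continuous.measurable) x
  have mH : ∀ q, Measurable (D1 γ (combo (matB γ q) h x)) := fun q => by
    refine measurable_slice (F := fun x v => D1 γ (combo (matB γ q) h x) v)
      (measurable_D1 h1 h2 (measurable_combo (mB q) Hh) fun l => ?_) x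
    have e : unc (pv l (combo (matB γ q) h)) = fun p => unc (combo (fun a => pd l (matB γ q a)) h) p +
        unc (combo (matB γ q) fun a => pv l (h a)) p :=
      funext fun p => pv_combo (n := 2) (dB q) Hh l p.1 p.2
    rw [e]
    exact (measurable_combo (fun a => measurable_pd l _) Hh).add
      (measurable_combo (mB q) fun a => (Hh a).pv (n := 2) l)
  have T := fun m => tst_matB_wt_sq_mul h1 h2 hk3 j m (HG.le (m := 1) (by norm_num)) x
  have key : ∀ v, |∑ m, ∑ i, JJ γ i f (h m) x v *
      (grad (fun v => matB γ j m v * (wt γ k v * wt γ k v) * G x v) v +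
        (matB γ j m v * (wt γ k v * wt γ k v) * G x v / 2) • v) i| ≤
      (9 * K) * |majorant (f x) v| * |∑ q, wt γ k v * D1 γ (combo (matB γ q) h x) v| *
        |wt γ k v * D1 γ (G x) v| := fun v => by
    have w0 := wt_nonneg γ k v
    have S0 : 0 ≤ ∑ q, wt γ k v * D1 γ (combo (matB γ q) h x) v :=
      Finset.sum_nonneg fun q _ => mul_nonneg w0 (D1_nonneg _ _ _)
    rw [abs_of_nonneg (majorant_nonneg _ _), abs_of_nonneg S0,
      abs_of_nonneg (mul_nonneg w0 (D1_nonneg _ _ _)), ← Finset.mul_sum]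
    have b := hk (n := 2) Hf (by norm_num) Hh (x := x) (v := v) (R := 9 * (wt γ k v * wt γ k v))
      (ρ := fun v => wt γ k v * wt γ k v) (ψ := G x) j (differentiable_wt_sq γ k v)
      (HG.diff_v (n := 2) x v)
      (by rw [abs_of_nonneg (mul_nonneg w0 w0)]; nlinarith [mul_nonneg w0 w0])
      (fun i => abs_pd_wt_sq_le h1 h2 hk3 i v)
    simp only [mul_assoc] at b ⊢
    refine b.trans (le_of_eq ?_)
    have ec : ∀ q, combo (matB γ q) h x = fun u => ∑ l, matB γ q l u * h l x u := fun q => rfl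
    simp only [ec]
    ring
  have hint : ∀ m, Integrable fun v => ∑ i, JJ γ i f (h m) x v *
      (grad (fun v => matB γ j m v * (wt γ k v * wt γ k v) * G x v) v +
        (matB γ j m v * (wt γ k v * wt γ k v) * G x v / 2) • v) i := fun m => by
    obtain ⟨hd, B, b1, b2⟩ := T m
    set χ := fun v => matB γ j m v * (wt γ k v * wt γ k v) * G x v
    refine integrable_finsetSum _ fun i _ => ?_
    have HJ : Sm 2 (12 + -40) (JJ γ i f (h m)) := Sm.JJ h1 h2 Hf (Hh m) i
    obtain ⟨A0, hA0, a0⟩ := Gr.bound HJ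
    have hm : Measurable fun v => (grad χ v + (χ v / 2) • v) i := by
      have e : (fun v => (grad χ v + (χ v / 2) • v) i) = fun v => pd i χ v + χ v / 2 * v i := rfl
      rw [e]
      exact (measurable_pd i χ).add ((hd.continuous.measurable.div_const 2).mul (measurable_coord i))
    refine integrable_of_abs_le (A := A0 * (2 * B))
      ((measurable_slice HJ.continuous.measurable x).mul hm) fun v => ?_
    have c : |(grad χ v + (χ v / 2) • v) i| ≤ 2 * B * jap v ^ (1 : ℝ) := by
      have e : (grad χ v + (χ v / 2) • v) i = pd i χ v + χ v / 2 * v i := rfl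
      have j1 := one_le_jap v
      have B0 := (abs_nonneg _).trans (b1 v)
      rw [e, Real.rpow_one]
      refine (abs_add_le _ _).trans ?_
      have t : |χ v / 2 * v i| ≤ B / 1 * jap v := by
        rw [abs_mul, abs_div, abs_two]
        have := (abs_coord_le v i).trans (norm_le_jap v)
        have := b1 v
        gcongr
        norm_num
      nlinarith [b2 i v]
    have a0' : |JJ γ i f (h m) x v| ≤ A0 * jap v ^ (12 + -40 : ℝ) := a0 (x, v)
    rw [abs_mul]
    calc _ ≤ (A0 * jap v ^ (12 + -40 : ℝ)) * (2 * B * jap v ^ (1 : ℝ)) :=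
          mul_le_mul a0' c (abs_nonneg _) ((abs_nonneg _).trans a0')
      _ = A0 * (2 * B) * jap v ^ (12 + -40 + 1 : ℝ) := by rw [jap_rpow_add v (12 + -40)]; ring
      _ ≤ _ := by
          have B0 := (abs_nonneg _).trans (b1 v)
          have := jap_rpow_mono v (show (12 + -40 + 1 : ℝ) ≤ -4 by norm_num)
          gcongr
  -- The sum over m is brought under the integral before any estimate, so that the fluxes combine
  -- into those of 𝐁h.
  simp_rw [fun m => integral_Gam_mul_tst h1 h2 Hf (Hh m) (T m) x]
  rw [Finset.sum_neg_distrib, enorm_neg, ← integral_finsetSum _ fun m _ => hint m]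
  refine (enorm_integral_sq_le (C := 9 * K)
    (b := fun v => ∑ q, wt γ k v * D1 γ (combo (matB γ q) h x) v)
    (d := fun v => wt γ k v * D1 γ (G x) v) (Finset.measurable_sum _ fun q _ => hw.mul (mH q))
    (hw.mul mG) hA key).trans ?_
  have S := L2sq_sum_le (C := 1) (F := fun v => ∑ q, wt γ k v * D1 γ (combo (matB γ q) h x) v)
    (f := fun q v => wt γ k v * D1 γ (combo (matB γ q) h x) v) (fun q => hw.mul (mH q))
    fun v => by
      rw [one_mul]
      exact Finset.abs_sum_le_sum_abs _ _
  rw [ENNReal.coe_mul]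
  calc _ ≤ ENNReal.ofReal ((9 * K) ^ 2) * A * (ENNReal.ofReal (1 ^ 2) * (Fintype.card (Fin 3)) *
      ∑ q, L2sq (fun v => wt γ k v * D1 γ (combo (matB γ q) h x) v)) *
        L2sq (fun v => wt γ k v * D1 γ (G x) v) := by gcongr
    _ = _ := by
        simp only [one_pow, ENNReal.ofReal_one, one_mul, Fintype.card_fin]
        rw [ENNReal.ofReal]
        push_cast
        ring

/-- The bound on a slice for the pairing with `∇̃_v`. -/
lemma enorm_slice_div_le : ∃ C : ℝ≥0, ∀ {F G : E3 → E3 → ℝ}, Sm 2 (-27) F → Sm 3 (-40) G →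
    ∀ {k : ℕ}, k ≤ 3 → ∀ (j : Fin 3) (x : E3),
    ‖∑ m, ∫ v, pv m F x v * (matB γ j m v * (wt γ k v * wt γ k v) * G x v)‖ₑ ^ 2 ≤
      C * L2sq (fun v => wt γ k v * F x v) * L2sq (fun v => wt γ k v * D1 γ (G x) v) := by
  obtain ⟨K, hK, hk⟩ := abs_div_matB_le h1 h2
  refine ⟨((9 * K) ^ 2).toNNReal, fun {F G} HF HG {k} hk3 j x => ?_⟩
  have hw := (continuous_wt γ k).measurable
  have mF := measurable_slice HF.continuous.measurable x
  have mG : Measurable (D1 γ (G x)) :=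
    measurable_slice (F := fun x v => D1 γ (G x) v) (measurable_D1 h1 h2 HG.continuous.measurable
      fun l => (HG.pv (n := 2) l).continuous.measurable) x
  have T := fun m => tst_matB_wt_sq_mul h1 h2 hk3 j m (HG.le (m := 1) (by norm_num)) x
  obtain ⟨A1, hA1, b1⟩ := Gr.bound HF
  have hp : ∀ m, Integrable (fun v => F x v *
        pd m (fun v => matB γ j m v * (wt γ k v * wt γ k v) * G x v) v) ∧
      ∫ v, pv m F x v * (matB γ j m v * (wt γ k v * wt γ k v) * G x v) =
        - ∫ v, F x v * pd m (fun v => matB γ j m v * (wt γ k v * wt γ k v) * G x v) v := fun m => by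
    obtain ⟨hd, B, c1, c2⟩ := T m
    obtain ⟨A2, hA2, b2⟩ := Gr.bound (HF.pv (n := 1) m)
    have := integral_pd_mul (A := A1 + A2) (B := B) (s := -27) (r := 0)
      ((HF.contDiff_v x).of_le (by norm_num)) hd m
      (fun v => (b1 (x, v)).trans ?_) (fun v => (b2 (x, v)).trans ?_) (by simpa using c1)
      (by simpa using c2 m) (by norm_num)
    · exact ⟨this.2.1, this.2.2.2⟩
    · exact mul_le_mul_of_nonneg_right (by linarith) (jap_rpow_nonneg _ _)
    · exact mul_le_mul_of_nonneg_right (by linarith) (jap_rpow_nonneg _ _)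
  simp_rw [fun m => (hp m).2]
  rw [Finset.sum_neg_distrib, enorm_neg, ← integral_finsetSum _ fun m _ => (hp m).1]
  have := enorm_integral_sq_le (C := 9 * K) (φ := fun _ => 1) (A := 1)
    (F := fun v => ∑ m, F x v * pd m (fun v => matB γ j m v * (wt γ k v * wt γ k v) * G x v) v)
    (b := fun v => wt γ k v * F x v) (d := fun v => wt γ k v * D1 γ (G x) v)
    (hw.mul mF) (hw.mul mG) (by simp) fun v => by
      have w0 := wt_nonneg γ k v
      have b := hk (v := v) (R := 9 * (wt γ k v * wt γ k v))
        (ρ := fun v => wt γ k v * wt γ k v) (ψ := G x) j (differentiable_wt_sq γ k v)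
        (HG.diff_v (n := 2) x v)
        (by rw [abs_of_nonneg (mul_nonneg w0 w0)]; nlinarith [mul_nonneg w0 w0])
        (fun i => abs_pd_wt_sq_le h1 h2 hk3 i v)
      simp only [mul_assoc] at b ⊢
      rw [← Finset.mul_sum, abs_mul, abs_mul (wt γ k v), abs_mul (wt γ k v), abs_of_nonneg w0,
        abs_of_nonneg (D1_nonneg γ (G x) v), abs_one, one_mul]
      refine (mul_le_mul_of_nonneg_left b (abs_nonneg _)).trans (le_of_eq (by ring))
  simpa [ENNReal.ofReal] using this

end Slice

/-! ### Integration in `x` -/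

/-- `A` is integrable over the torus with integral at most `a` and, if `s` holds, bounded
by `a`. -/
structure Ctl (A : E3 → ℝ≥0∞) (a : ℝ≥0∞) (s : Prop) : Prop where
  meas : Measurable A
  int : ∫⁻ x in cube, A x ≤ a
  sup : s → ∀ x, A x ≤ a

section Ctl

variable {A B D : E3 → ℝ≥0∞} {a b d : ℝ≥0∞} {s t : Prop}

lemma Ctl.mono (h : Ctl A a s) (hB : Measurable B) (hle : ∀ x, B x ≤ A x) (hab : a ≤ b)
    (hst : t → s) : Ctl B b t :=
  ⟨hB, (lintegral_mono hle).trans (h.int.trans hab),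
    fun ht x => (hle x).trans ((h.sup (hst ht) x).trans hab)⟩

lemma Ctl.sum {ι : Type*} [Fintype ι] {A : ι → E3 → ℝ≥0∞} {a : ι → ℝ≥0∞}
    (h : ∀ i, Ctl (A i) (a i) s) : Ctl (fun x => ∑ i, A i x) (∑ i, a i) s :=
  ⟨Finset.measurable_sum _ fun i _ => (h i).meas, by
    rw [lintegral_finsetSum _ fun i _ => (h i).meas]
    exact Finset.sum_le_sum fun i _ => (h i).int,
    fun hs x => Finset.sum_le_sum fun i _ => (h i).sup hs x⟩

/-- One factor is taken in sup norm and the other is integrated; it suffices that one of the two sup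
bounds be available. -/
lemma Ctl.lintegral_mul_le (hA : Ctl A a s) (hB : Ctl B b t) (hst : s ∨ t) :
    ∫⁻ x in cube, A x * B x ≤ a * b := by
  rcases hst with hs | ht
  · calc _ ≤ ∫⁻ x in cube, a * B x := lintegral_mono fun x => mul_le_mul_left (hA.sup hs x) _
      _ = a * ∫⁻ x in cube, B x := lintegral_const_mul _ hB.meas
      _ ≤ _ := mul_le_mul_right hB.int _
  · calc _ ≤ ∫⁻ x in cube, A x * b := lintegral_mono fun x => mul_le_mul_right (hB.sup ht x) _
      _ = (∫⁻ x in cube, A x) * b := lintegral_mul_const _ hA.meas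
      _ ≤ _ := mul_le_mul_left hA.int _

lemma lintegral_sq_le_of_sq_le {I : E3 → ℝ≥0∞} (hA : Measurable A) (hD : Measurable D)
    (h : ∀ x, I x ^ 2 ≤ A x * D x) :
    (∫⁻ x in cube, I x) ^ 2 ≤ (∫⁻ x in cube, A x) * ∫⁻ x in cube, D x := by
  have e : ∀ y : ℝ≥0∞, (y ^ (1 / 2 : ℝ)) ^ 2 = y := fun y => by
    rw [← ENNReal.rpow_natCast, ← ENNReal.rpow_mul]
    norm_num
  have hI : ∀ x, I x ≤ A x ^ (1 / 2 : ℝ) * D x ^ (1 / 2 : ℝ) := fun x => by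
    rw [← ENNReal.mul_rpow_of_nonneg _ _ (by norm_num), one_div,
      ENNReal.le_rpow_inv_iff (by norm_num), ENNReal.rpow_two]
    exact h x
  calc _ ≤ (∫⁻ x in cube, A x ^ (1 / 2 : ℝ) * D x ^ (1 / 2 : ℝ)) ^ 2 := by
        gcongr with x
        exact hI x
    _ ≤ _ := lintegral_mul_sq_le (by fun_prop) (by fun_prop)
    _ = _ := by simp only [e]

/-- Cauchy-Schwarz in x separates D, which comes from the test function and carries its full number
of derivatives; no sup bound is asked of it, whence the `False`. -/
lemma Ctl.lintegral_sq_le {I : E3 → ℝ≥0∞} {C : ℝ≥0} (hA : Ctl A a s) (hB : Ctl B b t)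
    (hst : s ∨ t) (hD : Ctl D d False) (h : ∀ x, I x ^ 2 ≤ C * A x * B x * D x) :
    (∫⁻ x in cube, I x) ^ 2 ≤ C * a * b * d := by
  have hm : Measurable fun x => C * (A x * B x) := (hA.meas.mul hB.meas).const_mul _
  refine (lintegral_sq_le_of_sq_le hm hD.meas fun x => (h x).trans (le_of_eq (by ring))).trans ?_
  rw [lintegral_const_mul' _ _ ENNReal.coe_ne_top]
  calc _ ≤ C * (a * b) * d :=
        mul_le_mul' (mul_le_mul_right (hA.lintegral_mul_le hB hst) _) hD.int
    _ = _ := by ring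

end Ctl

lemma le_of_sq_le_mul {I a b d : ℝ≥0∞} {C : ℝ≥0} (h : I ^ 2 ≤ C * a * b * d) :
    I ≤ (C ^ (1 / 2 : ℝ) : ℝ≥0) * (a ^ (1 / 2 : ℝ) * b ^ (1 / 2 : ℝ)) * d ^ (1 / 2 : ℝ) := by
  have h2 : (0 : ℝ) ≤ 1 / 2 := by norm_num
  rw [ENNReal.coe_rpow_of_nonneg _ h2, ← ENNReal.mul_rpow_of_nonneg _ _ h2,
    ← ENNReal.mul_rpow_of_nonneg _ _ h2, ← ENNReal.mul_rpow_of_nonneg _ _ h2, one_div,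
    ENNReal.le_rpow_inv_iff (by norm_num), ENNReal.rpow_two, ← mul_assoc]
  exact h

lemma combo_unit (g : E3 → E3 → ℝ) : combo (fun (_ : Unit) _ => 1) (fun _ => g) = g := by
  funext x v
  simp [combo]

lemma tildeX_eq_combo (γ : ℝ) (g : E3 → E3 → ℝ) (j : Fin 3) :
    tildeX γ g j = combo (matB γ j) fun l => dx l g := rfl

lemma tildeV_eq_combo (γ : ℝ) (g : E3 → E3 → ℝ) (j : Fin 3) :
    tildeV γ g j = combo (matB γ j) fun l => pv l g := rfl

section Dom

variable {γ : ℝ} (h1 : -2 ≤ γ) (h2 : γ ≤ 1)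
include h1 h2

lemma measurable_D1_combo {ι : Type} [Fintype ι] {b : ι → E3 → ℝ} {h : ι → E3 → E3 → ℝ}
    {n : ℕ} {s : ℝ} (hb : ∀ a, Differentiable ℝ (b a)) (H : ∀ a, Sm (n + 1) s (h a)) :
    Measurable fun p : E3 × E3 => D1 γ (combo b h p.1) p.2 := by
  have mb := fun a => (hb a).continuous.measurable
  refine measurable_D1 h1 h2 (measurable_combo mb H) fun l => ?_
  have e : unc (pv l (combo b h)) = fun p => unc (combo (fun a => pd l (b a)) h) p +
      unc (combo b fun a => pv l (h a)) p := funext fun p => pv_combo hb H l p.1 p.2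
  rw [e]
  exact (measurable_combo (fun a => measurable_pd l _) H).add
    (measurable_combo mb fun a => (H a).pv l)

omit h1 h2 in
lemma measurable_L2sq_wt {k : ℕ} {F : E3 → E3 → ℝ} (h : Measurable (unc F)) :
    Measurable fun x => L2sq fun v => wt γ k v * F x v :=
  measurable_L2sq (F := fun x v => wt γ k v * F x v)
    (((continuous_wt γ k).measurable.comp measurable_snd).mul h)

omit h2 in
lemma ctl_wt {ι : Type} [Fintype ι] {b : ι → E3 → ℝ} {h : ι → E3 → E3 → ℝ} {l : List (Fin 3)}
    {k : ℕ} (hb : ∀ a, Measurable (b a)) (H : ∀ a, Tor 5 (h a)) (hlk : l.length ≤ k) (hk : k ≤ 3) :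
    Ctl (fun x => L2sq fun v => wt γ k v * dxIter l (combo b h) x v)
      (3159 * twistedSq γ L2sq (combo b h)) (l.length + 2 ≤ k) := by
  refine ⟨measurable_L2sq_wt ?_, ?_, fun hs x => L2sq_wt_slice_le h1 hb H hs hk x⟩
  · rw [dxIter_combo b l fun a => (H a).sm.le (by omega)]
    exact measurable_combo hb fun a => ((H a).dxIter_of_le (n := 0) l (by omega)).sm
  · refine (setLIntegral_wt_mono h1 hlk).trans ((le_twistedSq γ L2sq _ l (by omega)).trans ?_)
    exact le_mul_of_one_le_left' (by norm_num)

lemma ctl_wt_D1 : ∃ C : ℝ≥0, ∀ {ι : Type} [Fintype ι] {b : ι → E3 → ℝ} {h : ι → E3 → E3 → ℝ}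
    {l : List (Fin 3)} {k : ℕ}, (∀ a, Differentiable ℝ (b a)) → (∀ a, Tor 6 (h a)) →
    l.length ≤ k → k ≤ 3 →
    Ctl (fun x => L2sq fun v => wt γ k v * D1 γ (dxIter l (combo b h) x) v)
      (C * twistedSq γ (H1sq γ) (combo b h)) (l.length + 2 ≤ k) := by
  obtain ⟨C, hC⟩ := lintegral_wt_D1_le h1 h2
  refine ⟨50544 * C, fun {ι _ b h l k} hb H hlk hk => ?_⟩
  have hD : ∀ l' : List (Fin 3), l'.length ≤ 3 → ∀ x, Differentiable ℝ (dxIter l' (combo b h) x) :=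
    fun l' hl' x => by
      rw [dxIter_combo b l' fun a => (H a).sm.le (by omega)]
      exact differentiable_combo (n := 0) hb (fun a => ((H a).dxIter_of_le l' (by omega)).sm) x
  have e : ((50544 * C : ℝ≥0) : ℝ≥0∞) * twistedSq γ (H1sq γ) (combo b h) =
      (4 * 4 * 3159) * (C * twistedSq γ (H1sq γ) (combo b h)) := by
    push_cast; ring
  rw [e]
  refine ⟨measurable_L2sq_wt (F := fun x v => D1 γ (dxIter l (combo b h) x) v) ?_, ?_,
    fun hs x => L2sq_wt_D1_slice_le h1 h2 hb H
      (fun l' hl' => hC _ l' hl' (hD l' hl')) hs hk x⟩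
  · rw [dxIter_combo b l fun a => (H a).sm.le (by omega)]
    exact measurable_D1_combo h1 h2 (n := 0) hb fun a => ((H a).dxIter_of_le l (by omega)).sm
  · refine (setLIntegral_wt_mono h1 hlk).trans ((hC _ l (by omega) (hD l (by omega))).trans ?_)
    exact le_mul_of_one_le_left' (by norm_num)

lemma ctl_wt_D2 : ∃ C : ℝ≥0, ∀ {g : E3 → E3 → ℝ} {l : List (Fin 3)} {k : ℕ}, Tor 6 g →
    l.length ≤ k → k ≤ 3 →
    Ctl (fun x => L2sq fun v => wt γ k v * D2 γ (dxIter l g x) v)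
      (C * twistedSq γ (H2sq γ) g) (l.length + 2 ≤ k) := by
  obtain ⟨C, hC⟩ := lintegral_wt_D2_le h1 h2
  refine ⟨533871 * C, fun {g l k} H hlk hk => ?_⟩
  have hD : ∀ l' : List (Fin 3), l'.length ≤ 3 → ∀ x, ContDiff ℝ 2 (dxIter l' g x) :=
    fun l' hl' x => (H.dxIter_of_le (n := 2) l' (by omega)).sm.contDiff_v x
  have e : ((533871 * C : ℝ≥0) : ℝ≥0∞) * twistedSq γ (H2sq γ) g =
      (13 * 13 * 3159) * (C * twistedSq γ (H2sq γ) g) := by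
    push_cast; ring
  rw [e]
  refine ⟨measurable_L2sq_wt (F := fun x v => D2 γ (dxIter l g x) v) ?_, ?_,
    fun hs x => L2sq_wt_D2_slice_le h1 h2 H
      (fun l' hl' => hC _ l' hl' (hD l' hl')) hs hk x⟩
  · exact measurable_D2 h1 h2 (n := 0) (H.dxIter_of_le l (by omega)).sm
  · refine (setLIntegral_wt_mono h1 hlk).trans ((hC _ l (by omega) (hD l (by omega))).trans ?_)
    exact le_mul_of_one_le_left' (by norm_num)

omit h2 in
lemma ctl_wt_self {g : E3 → E3 → ℝ} {l : List (Fin 3)} {k : ℕ} (H : Tor 5 g) (hlk : l.length ≤ k)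
    (hk : k ≤ 3) : Ctl (fun x => L2sq fun v => wt γ k v * dxIter l g x v)
      (3159 * twistedSq γ L2sq g) (l.length + 2 ≤ k) := by
  have := ctl_wt h1 (b := fun (_ : Unit) _ => 1) (h := fun _ => g) (fun _ => measurable_const)
    (fun _ => H) hlk hk
  rwa [combo_unit] at this

lemma ctl_wt_D1_self : ∃ C : ℝ≥0, ∀ {g : E3 → E3 → ℝ} {l : List (Fin 3)} {k : ℕ}, Tor 6 g →
    l.length ≤ k → k ≤ 3 →
    Ctl (fun x => L2sq fun v => wt γ k v * D1 γ (dxIter l g x) v)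
      (C * twistedSq γ (H1sq γ) g) (l.length + 2 ≤ k) := by
  obtain ⟨C, hC⟩ := ctl_wt_D1 h1 h2
  refine ⟨C, fun {g l k} H hlk hk => ?_⟩
  have := hC (b := fun (_ : Unit) _ => 1) (h := fun _ => g) (fun _ => differentiable_const _)
    (fun _ => H) hlk hk
  rwa [combo_unit] at this

end Dom

/-! ### The three estimates, term by term -/

lemma lintegral_wt_sum_le {κ : Type*} [Fintype κ] {F : κ → E3 → E3 → ℝ} (γ : ℝ) (k : ℕ)
    (hF : ∀ i, Measurable (unc (F i))) :
    ∫⁻ x in cube, L2sq (fun v => wt γ k v * ∑ i, F i x v) ≤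
      Fintype.card κ * ∑ i, ∫⁻ x in cube, L2sq fun v => wt γ k v * F i x v := by
  have hw := (continuous_wt γ k).measurable
  have hmeas : ∀ i, Measurable fun x => L2sq fun v => wt γ k v * F i x v := fun i =>
    measurable_L2sq_wt (hF i)
  rw [← lintegral_finsetSum _ fun i _ => hmeas i, ← lintegral_const_mul' _ _ (by simp)]
  refine lintegral_mono fun x => (L2sq_sum_le (C := 1) (f := fun i v => wt γ k v * F i x v)
    (fun i => hw.mul (measurable_slice (hF i) x)) fun v => ?_).trans (by simp)
  rw [one_mul, Finset.mul_sum]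
  exact Finset.abs_sum_le_sum_abs _ _

lemma length_splits : ∀ l : List (Fin 3), (splits l).length = 2 ^ l.length
  | [] => rfl
  | i :: l => by
    simp only [splits, List.length_append, List.length_map, length_splits l, List.length_cons]
    ring

lemma length_splits_le {l : List (Fin 3)} (hl : l.length ≤ 3) : (splits l).length ≤ 8 := by
  rw [length_splits]
  exact (Nat.pow_le_pow_right (by norm_num) hl).trans (by norm_num)

lemma length_splits_getElem {l : List (Fin 3)} (i : Fin (splits l).length) :
    (splits l)[i].1.length + (splits l)[i].2.length = l.length :=
  length_of_mem_splits l _ (List.getElem_mem _)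

section Terms

variable {γ : ℝ} (h1 : -2 ≤ γ) (h2 : γ ≤ 1)
include h1 h2

lemma dxIter_Gam_eq_sum {f g : E3 → E3 → ℝ} (l : List (Fin 3)) {n : ℕ} (H : Tor (n + 2 + l.length) f)
    (H' : Tor (n + 2 + l.length) g) :
    dxIter l (Gam γ f g) = fun x v => ∑ i : Fin (splits l).length,
      Gam γ (dxIter (splits l)[i].1 f) (dxIter (splits l)[i].2 g) x v := by
  rw [dxIter_Gam h1 h2 l H.sm H'.sm]
  funext x v
  exact (Fin.sum_univ_fun_getElem (splits l)
    fun q => Gam γ (dxIter q.1 f) (dxIter q.2 g) x v).symm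

lemma sm_dxIter_Gam {f g : E3 → E3 → ℝ} {n : ℕ} (l : List (Fin 3)) (hn : n + 2 + l.length ≤ 20)
    (H : Tor 20 f) (H' : Tor 20 g) : Sm n (-27) (dxIter l (Gam γ f g)) := by
  have : Sm (n + l.length) (13 + -40) (Gam γ f g) :=
    Sm.Gam h1 h2 (H.sm.le (by omega)) (H'.sm.le (by omega))
  have := Sm.dxIter l this
  norm_num at this
  exact this

omit h1 h2 in
lemma sm_dxIter {f : E3 → E3 → ℝ} {n : ℕ} (l : List (Fin 3)) (hn : n + l.length ≤ 20)
    (H : Tor 20 f) : Sm n (-40) (dxIter l f) := (H.dxIter_of_le l hn).sm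

/-- The bound on `Γ` in the norm of `𝒳`. -/
lemma lintegral_wt_Gam_le : ∃ C : ℝ≥0, ∀ {f g : E3 → E3 → ℝ}, Tor 20 f → Tor 20 g →
    ∀ {l : List (Fin 3)}, l.length ≤ 3 →
    ∫⁻ x in cube, L2sq (fun v => wt γ l.length v * dxIter l (Gam γ f g) x v) ≤
      C * (twistedSq γ L2sq f * twistedSq γ (H2sq γ) g +
        twistedSq γ (H1sq γ) f * twistedSq γ L2sq g) := by
  obtain ⟨C0, h0⟩ := L2sq_Gam_le h1 h2
  obtain ⟨C1, hC1⟩ := ctl_wt_D1_self h1 h2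
  obtain ⟨C2, hC2⟩ := ctl_wt_D2 h1 h2
  set M : ℝ≥0 := C0 * (3159 * C2 + 3159 * C1) with hM
  -- Here 64 = 8 · 8: at most 8 ways of splitting the derivatives, and a factor 8 for the square of
  -- a sum of at most 8 terms.
  refine ⟨64 * M, fun {f g} Hf Hg {l} hl => ?_⟩
  set X := twistedSq γ L2sq f
  set Y := twistedSq γ (H2sq γ) g
  set Z := twistedSq γ (H1sq γ) f
  set W := twistedSq γ L2sq g
  have hw := (continuous_wt γ l.length).measurable
  have hq : ∀ i : Fin (splits l).length, ∫⁻ x in cube, L2sq (fun v => wt γ l.length v *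
      Gam γ (dxIter (splits l)[i].1 f) (dxIter (splits l)[i].2 g) x v) ≤ M * (X * Y + Z * W) :=
    fun i => by
    have hlen := length_splits_getElem i
    set q := (splits l)[i]
    -- f is measured with k = 3, where the weight is 1. The whole weight of order l.length goes to
    -- g.
    have A1 := ctl_wt_self h1 (l := q.1) (k := 3) (Hf.le (by norm_num)) (by omega) le_rfl
    have A2 := hC1 (l := q.1) (k := 3) (Hf.le (by norm_num)) (by omega) le_rfl
    have B1 := hC2 (l := q.2) (k := l.length) (Hg.le (by norm_num)) (by omega) hl
    have B2 := ctl_wt_self h1 (l := q.2) (k := l.length) (Hg.le (by norm_num)) (by omega) hl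
    simp only [wt_three, one_mul] at A1 A2
    -- Either at most one derivative falls on f, and q.1.length + 2 ≤ 3 gives a sup bound for f, or
    -- at least two do, and q.2.length + 2 ≤ l.length gives one for g.
    have e1 := A1.lintegral_mul_le B1 (by omega)
    have e2 := A2.lintegral_mul_le B2 (by omega)
    have m1 : Measurable fun x => L2sq (dxIter q.1 f x) *
        L2sq (fun v => wt γ l.length v * D2 γ (dxIter q.2 g x) v) := A1.meas.mul B1.meas
    calc _ ≤ ∫⁻ x in cube, C0 * (L2sq (dxIter q.1 f x) *
          L2sq (fun v => wt γ l.length v * D2 γ (dxIter q.2 g x) v) +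
          L2sq (D1 γ (dxIter q.1 f x)) * L2sq (fun v => wt γ l.length v * dxIter q.2 g x v)) :=
          lintegral_mono fun x => h0 (sm_dxIter q.1 (by omega) Hf)
            (sm_dxIter q.2 (by omega) Hg) hw x
      _ ≤ C0 * ((3159 * X) * (C2 * Y) + (C1 * Z) * (3159 * W)) := by
          rw [lintegral_const_mul' _ _ ENNReal.coe_ne_top, lintegral_add_left m1]
          exact mul_le_mul_right (add_le_add e1 e2) _
      _ = C0 * ((3159 * C2) * (X * Y) + (3159 * C1) * (Z * W)) := by ring
      _ ≤ C0 * ((3159 * C2 + 3159 * C1) * (X * Y) + (3159 * C2 + 3159 * C1) * (Z * W)) := by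
          gcongr
          · exact le_self_add
          · exact le_add_self
      _ = _ := by rw [hM]; push_cast; ring
  have hm : ∀ i : Fin (splits l).length, Sm 3 (-27)
      (Gam γ (dxIter (splits l)[i].1 f) (dxIter (splits l)[i].2 g)) := fun i => by
    have hlen := length_splits_getElem i
    have := Sm.Gam h1 h2 (n := 3) (sm_dxIter (n := 5) (splits l)[i].1 (by omega) Hf)
      (sm_dxIter (n := 5) (splits l)[i].2 (by omega) Hg)
    norm_num at this
    exact this
  rw [dxIter_Gam_eq_sum h1 h2 (n := 15) l (Hf.le (by omega)) (Hg.le (by omega))]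
  have hn : ((splits l).length : ℝ≥0∞) ≤ 8 := by exact_mod_cast length_splits_le hl
  calc _ ≤ (splits l).length * ∑ i : Fin (splits l).length, ∫⁻ x in cube, L2sq fun v =>
        wt γ l.length v * Gam γ (dxIter (splits l)[i].1 f) (dxIter (splits l)[i].2 g) x v := by
        have := lintegral_wt_sum_le γ l.length fun i => (hm i).continuous.measurable
        rwa [Fintype.card_fin] at this
    _ ≤ 8 * ∑ _i : Fin (splits l).length, M * (X * Y + Z * W) := by
        gcongr with i
        exact hq i
    _ ≤ 8 * (8 * (M * (X * Y + Z * W))) := by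
        simp only [Finset.sum_const, Finset.card_univ, Fintype.card_fin, nsmul_eq_mul]
        gcongr
    _ = _ := by push_cast; ring

/-- The bound on the pairing with `∇̃_v`. -/
lemma lintegral_div_sq_le : ∃ C : ℝ≥0, ∀ {f g G : E3 → E3 → ℝ}, Tor 20 f → Tor 20 g → Tor 20 G →
    ∀ {l : List (Fin 3)}, l.length ≤ 3 → ∀ j : Fin 3,
    (∫⁻ x in cube, ‖∑ m, ∫ v, pv m (dxIter l (Gam γ f g)) x v *
      (matB γ j m v * (wt γ l.length v * wt γ l.length v) * dxIter l G x v)‖ₑ) ^ 2 ≤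
      C * (twistedSq γ L2sq f * twistedSq γ (H2sq γ) g +
        twistedSq γ (H1sq γ) f * twistedSq γ L2sq g) * twistedSq γ (H1sq γ) G := by
  obtain ⟨C0, h0⟩ := lintegral_wt_Gam_le h1 h2
  obtain ⟨C1, hC1⟩ := ctl_wt_D1_self h1 h2
  obtain ⟨C2, hC2⟩ := enorm_slice_div_le h1 h2
  refine ⟨C2 * C0 * C1, fun {f g G} Hf Hg HG {l} hl j => ?_⟩
  have D := hC1 (l := l) (k := l.length) (HG.le (by norm_num)) le_rfl hl
  have m1 : Measurable fun x => C2 * L2sq fun v => wt γ l.length v * dxIter l (Gam γ f g) x v :=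
    (measurable_L2sq_wt
      (sm_dxIter_Gam h1 h2 (n := 2) l (by omega) Hf Hg).continuous.measurable).const_mul _
  refine (lintegral_sq_le_of_sq_le m1 D.meas fun x => hC2
    (sm_dxIter_Gam h1 h2 (n := 2) l (by omega) Hf Hg) (sm_dxIter l (by omega) HG)
    hl j x).trans ?_
  rw [lintegral_const_mul' _ _ ENNReal.coe_ne_top]
  refine (mul_le_mul' (mul_le_mul_right (h0 Hf Hg hl) _) D.int).trans (le_of_eq ?_)
  push_cast
  ring

/-- The bound on the pairing with `∇̃_x` when the field acts on the second function. -/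
lemma lintegral_weak_sum_sq_le : ∃ C : ℝ≥0, ∀ {f g G : E3 → E3 → ℝ}, Tor 20 f → Tor 20 g →
    Tor 20 G → ∀ {l p q : List (Fin 3)}, l.length ≤ 3 → p.length + q.length = l.length →
    ∀ j : Fin 3, (∫⁻ x in cube, ‖∑ m, ∫ v, Gam γ (dxIter p f) (dxIter q (dx m g)) x v *
      (matB γ j m v * (wt γ l.length v * wt γ l.length v) * dxIter l G x v)‖ₑ) ^ 2 ≤
      C * twistedSq γ L2sq f * (∑ r, twistedSq γ (H1sq γ) (tildeX γ g r)) *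
        twistedSq γ (H1sq γ) G := by
  obtain ⟨C0, h0⟩ := enorm_slice_weak_sum_le h1 h2
  obtain ⟨C1, hC1⟩ := ctl_wt_D1_self h1 h2
  obtain ⟨C2, hC2⟩ := ctl_wt_D1 h1 h2
  obtain ⟨C3, hC3⟩ := enorm_majorant_sq_le
  refine ⟨C0 * C3 * (3159 * C2 * C1), fun {f g G} Hf Hg HG {l p q} hl hpq j => ?_⟩
  have D := hC1 (l := l) (k := l.length) (HG.le (by norm_num)) le_rfl hl
  have A := ctl_wt_self h1 (l := p) (k := 3) (Hf.le (by norm_num)) (by omega) le_rfl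
  simp only [wt_three, one_mul] at A
  have hdx : ∀ m, Tor 19 (dx m g) := fun m => Hg.dx m
  have B := Ctl.sum fun r : Fin 3 => hC2 (b := matB γ r) (h := fun m => dx m g) (l := q)
    (k := l.length) (differentiable_matB h1 h2 r) (fun m => (hdx m).le (by norm_num)) (by omega) hl
  refine (A.lintegral_sq_le (C := C0 * C3) B (by omega) (D.mono D.meas (fun _ => le_rfl) le_rfl
    False.elim) fun x => ?_).trans (le_of_eq ?_)
  · refine (h0 (sm_dxIter p (by omega) Hf)
      (fun m => ((hdx m).dxIter_of_le q (by omega)).sm) (sm_dxIter l (by omega) HG) hl j x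
      (A := C3 * L2sq (dxIter p f x)) fun v => hC3 _ (measurable_slice
        (sm_dxIter (n := 0) p (by omega) Hf).continuous.measurable x) v).trans (le_of_eq ?_)
    simp only [dxIter_combo _ q fun m => ((hdx m).sm.le (by omega : q.length ≤ 19))]
    push_cast
    ring
  · rw [← Finset.mul_sum]
    simp only [← tildeX_eq_combo]
    push_cast
    ring

/-- The bound on the pairing with `∇̃_x` when the derivative acts on the first function, which
receives an even number of other derivatives. -/
lemma lintegral_weak_even_sq_le : ∃ C : ℝ≥0, ∀ {f g G : E3 → E3 → ℝ}, Tor 20 f → Tor 20 g →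
    Tor 20 G → ∀ {l p q : List (Fin 3)}, l.length ≤ 3 → p.length + q.length = l.length →
    (p.length = 0 ∨ p.length = 2) → ∀ j m : Fin 3,
    (∫⁻ x in cube, ‖∫ v, Gam γ (dxIter p (dx m f)) (dxIter q g) x v *
      (matB γ j m v * (wt γ l.length v * wt γ l.length v) * dxIter l G x v)‖ₑ) ^ 2 ≤
      C * twistedSq γ L2sq f * twistedSq γ (H2sq γ) g * twistedSq γ (H1sq γ) G := by
  obtain ⟨C0, h0⟩ := enorm_slice_weak_le h1 h2
  obtain ⟨C1, hC1⟩ := ctl_wt_D1_self h1 h2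
  obtain ⟨C2, hC2⟩ := ctl_wt_D2 h1 h2
  obtain ⟨C3, hC3⟩ := enorm_majorant_sq_le
  refine ⟨C0 * C3 * (3159 * C2 * C1), fun {f g G} Hf Hg HG {l p q} hl hpq hp j m => ?_⟩
  have D := hC1 (l := l) (k := l.length) (HG.le (by norm_num)) le_rfl hl
  -- ∂_m is counted together with p. The total order on f is then 1, in which case f is bounded in
  -- x, or 3, in which case g has l.length − 2 derivatives and is the bounded factor.
  have A := ctl_wt_self h1 (l := p ++ [m]) (k := 3) (Hf.le (by norm_num)) (by simp; omega) le_rfl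
  simp only [wt_three, one_mul, dxIter_append, List.length_append, List.length_singleton] at A
  have B := hC2 (l := q) (k := l.length) (Hg.le (by norm_num)) (by omega) hl
  have hdx : Tor 19 (dx m f) := Hf.dx m
  refine (A.lintegral_sq_le (C := C0 * C3) B (by omega) (D.mono D.meas (fun _ => le_rfl) le_rfl
    False.elim) fun x => ?_).trans (le_of_eq ?_)
  · refine (h0 (hdx.dxIter_of_le p (by omega)).sm (sm_dxIter q (by omega) Hg)
      (sm_dxIter l (by omega) HG) hl j m x
      (A := C3 * L2sq (dxIter p (dxIter [m] f) x)) fun v => hC3 _ (measurable_slice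
        (hdx.dxIter_of_le (n := 0) p (by omega)).sm.continuous.measurable x) v).trans ?_
    rw [ENNReal.coe_mul, mul_assoc (C0 : ℝ≥0∞) C3]
    gcongr
    -- The factor ⟨v⟩^{γ/2+1} brought by 𝐁 turns D1 of g into D2.
    refine L2sq_mono fun v => ?_
    have w0 := wt_nonneg γ l.length v
    have j0 := jap_rpow_nonneg v (γ / 2 + 1)
    rw [abs_of_nonneg (mul_nonneg (mul_nonneg j0 w0) (D1_nonneg _ _ _)),
      abs_of_nonneg (mul_nonneg w0 (D2_nonneg _ _ _)), mul_comm (jap v ^ (γ / 2 + 1)), mul_assoc]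
    exact mul_le_mul_of_nonneg_left (D1_le_D2 γ _ v) w0
  · push_cast
    ring

/-- The bound on the pairing with `∇̃_x` when the derivative acts on the first function, which
receives an odd number of other derivatives. -/
lemma lintegral_weak_odd_sq_le : ∃ C : ℝ≥0, ∀ {f g G : E3 → E3 → ℝ}, Tor 20 f → Tor 20 g →
    Tor 20 G → ∀ {l p q : List (Fin 3)}, l.length ≤ 3 → p.length + q.length = l.length →
    (p.length = 1 ∨ p.length = 3) → ∀ j m : Fin 3,
    (∫⁻ x in cube, ‖∫ v, Gam γ (dxIter p (dx m f)) (dxIter q g) x v *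
      (matB γ j m v * (wt γ l.length v * wt γ l.length v) * dxIter l G x v)‖ₑ) ^ 2 ≤
      C * (∑ r, twistedSq γ L2sq (tildeX γ f r)) * twistedSq γ (H1sq γ) g *
        twistedSq γ (H1sq γ) G := by
  obtain ⟨C0, h0⟩ := enorm_slice_weak_le h1 h2
  obtain ⟨C1, hC1⟩ := ctl_wt_D1_self h1 h2
  obtain ⟨C3, hC3⟩ := enorm_majorant_comp_sq_le h1 h2
  refine ⟨C0 * C3 * (3159 * C1 * C1), fun {f g G} Hf Hg HG {l p q} hl hpq hp j m => ?_⟩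
  -- Some derivative falls on f, so g has at most k = l.length − 1 of them and may be measured with
  -- the weight of order k. The factor ⟨v⟩^{γ/2+1} brought by 𝐁 is absorbed by the weight, and D1 of
  -- g suffices.
  obtain ⟨k, hk⟩ : ∃ k, l.length = k + 1 := ⟨l.length - 1, by omega⟩
  have D := hC1 (l := l) (k := l.length) (HG.le (by norm_num)) le_rfl hl
  have hdx : ∀ m, Tor 19 (dx m f) := fun m => Hf.dx m
  -- ∇̃_x f stands for ∂_m f, so the order counted on f is that of p alone: if it is 1 this factor
  -- is bounded in x; if it is 3 then q is empty, k = 2, and g is bounded in x.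
  have A := Ctl.sum fun r : Fin 3 => ctl_wt h1 (b := matB γ r) (h := fun m => dx m f) (l := p)
    (k := 3) (fun a => (continuous_matB h1 h2 r a).measurable) (fun m => (hdx m).le (by norm_num))
    (by omega) le_rfl
  simp only [wt_three, one_mul] at A
  have B := hC1 (l := q) (k := k) (Hg.le (by norm_num)) (by omega) (by omega)
  refine (A.lintegral_sq_le (C := C0 * C3) B (by omega) (D.mono D.meas (fun _ => le_rfl) le_rfl
    False.elim) fun x => ?_).trans (le_of_eq ?_)
  · refine (h0 ((hdx m).dxIter_of_le p (by omega)).sm (sm_dxIter q (by omega) Hg)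
      (sm_dxIter l (by omega) HG) hl j m x (A := C3 * ∑ r, L2sq
        (fun v => ∑ a, matB γ r a v * dxIter p (dx a f) x v)) fun v =>
        hC3 (fun a => dxIter p (dx a f) x) (fun a => measurable_slice
        ((hdx a).dxIter_of_le (n := 0) p (by omega)).sm.continuous.measurable x) m v).trans ?_
    simp only [dxIter_combo _ p fun m => ((hdx m).sm.le (by omega : p.length ≤ 19))]
    rw [ENNReal.coe_mul, mul_assoc (C0 : ℝ≥0∞) C3, hk]
    simp only [mul_comm (jap _ ^ (γ / 2 + 1)), wt_succ_mul]
    exact le_rfl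
  · rw [← Finset.mul_sum]
    simp only [← tildeX_eq_combo]
    push_cast
    ring

end Terms

/-! ### The pairings -/

instance : IsFiniteMeasure ((volume : Measure E3).restrict cube) :=
  ⟨by rw [Measure.restrict_apply_univ, volume_cube]; exact ENNReal.one_lt_top⟩

lemma dxIter_add {s : ℝ} {f g : E3 → E3 → ℝ} (l : List (Fin 3)) (Hf : Sm l.length s f)
    (Hg : Sm l.length s g) :
    dxIter l (fun x v => f x v + g x v) = fun x v => dxIter l f x v + dxIter l g x v := by
  have := dxIter_sum_mul (fun (_ : Fin 2) _ => 1) (h := ![f, g]) (s := s) l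
    (fun a => by fin_cases a <;> assumption)
  simpa [Fin.sum_univ_two] using this

lemma integrable_mul_tst {n : ℕ} {F : E3 → E3 → ℝ} (HF : Sm n (-27) F) {χ : E3 → ℝ} (hχ : Tst χ)
    (x : E3) : Integrable fun v => F x v * χ v := by
  obtain ⟨A, hA, a⟩ := Gr.bound HF
  obtain ⟨hd, B, b, -⟩ := hχ
  refine integrable_of_abs_le (A := A * B)
    ((measurable_slice HF.continuous.measurable x).mul hd.continuous.measurable) fun v => ?_
  have a' : |F x v| ≤ A * jap v ^ (-27 : ℝ) := a (x, v)
  have B0 := (abs_nonneg _).trans (b v)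
  rw [abs_mul]
  calc _ ≤ A * jap v ^ (-27 : ℝ) * B :=
        mul_le_mul a' (b v) (abs_nonneg _) ((abs_nonneg _).trans a')
    _ = A * B * jap v ^ (-27 : ℝ) := by ring
    _ ≤ _ := by
        have := jap_rpow_mono v (show (-27 : ℝ) ≤ -4 by norm_num)
        gcongr

lemma measurable_integral_right {F : E3 → E3 → ℝ} (hF : Measurable (unc F)) :
    Measurable fun x => ∫ v, F x v :=
  (StronglyMeasurable.integral_prod_right' (f := unc F) hF.stronglyMeasurable).measurable

section Pairing

variable {γ : ℝ} (h1 : -2 ≤ γ) (h2 : γ ≤ 1)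
include h1 h2

lemma abs_combo_matB_le {n : ℕ} {h : Fin 3 → E3 → E3 → ℝ} (H : ∀ m, Sm n (-27) (h m)) (j : Fin 3) :
    ∃ K : ℝ, ∀ x v, |combo (matB γ j) h x v| ≤ K * jap v ^ (-24 : ℝ) := by
  obtain ⟨B, hB, hb⟩ := abs_matB_le h1 h2
  choose A hA ha using fun m => Gr.bound (H m)
  refine ⟨∑ m, B * A m, fun x v => ?_⟩
  rw [Finset.sum_mul]
  refine (Finset.abs_sum_le_sum_abs _ _).trans (Finset.sum_le_sum fun m _ => ?_)
  have a' : |h m x v| ≤ A m * jap v ^ (-27 : ℝ) := ha m (x, v)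
  rw [abs_mul]
  calc _ ≤ (B * jap v ^ (γ / 2 + 1)) * (A m * jap v ^ (-27 : ℝ)) :=
        mul_le_mul (hb v j m) a' (abs_nonneg _) ((abs_nonneg _).trans (hb v j m))
    _ = B * A m * jap v ^ (γ / 2 + 1 + -27) := by rw [jap_rpow_add v (γ / 2 + 1)]; ring
    _ ≤ _ := by
        have := jap_rpow_mono v (show γ / 2 + 1 + -27 ≤ -24 by linarith)
        have := hA m
        gcongr

lemma integrable_pair {F G : E3 → E3 → ℝ} (hF : Measurable (unc F)) (hG : Measurable (unc G))
    {K L : ℝ} (bF : ∀ x v, |F x v| ≤ K * jap v ^ (-24 : ℝ))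
    (bG : ∀ x v, |G x v| ≤ L * jap v ^ (-40 : ℝ)) (k : ℕ) :
    Integrable (fun p : E3 × E3 => (wt γ k p.2 * F p.1 p.2) * (wt γ k p.2 * G p.1 p.2)) muXV := by
  have hw : Measurable fun p : E3 × E3 => wt γ k p.2 :=
    (continuous_wt γ k).measurable.comp measurable_snd
  have hi : Integrable (fun p : E3 × E3 => K * L * jap p.2 ^ (-4 : ℝ)) muXV :=
    ((integrable_jap_rpow (by norm_num)).const_mul (K * L)).comp_snd _
  refine hi.mono' ((hw.mul hF).mul (hw.mul hG)).aestronglyMeasurable (.of_forall fun p => ?_)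
  obtain ⟨x, v⟩ := p
  have w0 := wt_nonneg γ k v
  have hK := bF x v
  have hL := bG x v
  have K0 : 0 ≤ K := nonneg_of_mul_nonneg_left ((abs_nonneg _).trans hK) (jap_rpow_pos _ _)
  have L0 : 0 ≤ L := nonneg_of_mul_nonneg_left ((abs_nonneg _).trans hL) (jap_rpow_pos _ _)
  rw [Real.norm_eq_abs, abs_mul, abs_mul, abs_mul, abs_of_nonneg w0]
  calc _ = (wt γ k v * wt γ k v) * (|F x v| * |G x v|) := by ring
    _ ≤ jap v ^ (9 : ℝ) * ((K * jap v ^ (-24 : ℝ)) * (L * jap v ^ (-40 : ℝ))) := by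
        exact mul_le_mul (wt_sq_le h1 h2 v) (mul_le_mul hK hL (abs_nonneg _)
          ((abs_nonneg _).trans hK)) (by positivity) (jap_rpow_nonneg v 9)
    _ = K * L * jap v ^ (9 + (-24 + -40) : ℝ) := by rw [jap_rpow_add v 9, jap_rpow_add v (-24)]; ring
    _ ≤ _ := by
        have := jap_rpow_mono v (show (9 + (-24 + -40) : ℝ) ≤ -4 by norm_num)
        gcongr

/-- Reduction of the pairing to integrals over slices. -/
lemma pairing_le {F h G : Fin 3 → E3 → E3 → ℝ} (hF : ∀ j, F j = combo (matB γ j) h)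
    (Hh : ∀ m, Sm 3 (-27) (h m)) (HG : ∀ j, Tor 20 (G j)) {T : ℝ≥0∞}
    (hT : ∀ j (l : List (Fin 3)), l.length ≤ 3 →
      ∫⁻ x in cube, ‖∑ m, ∫ v, dxIter l (h m) x v *
        (matB γ j m v * (wt γ l.length v * wt γ l.length v) * dxIter l (G j) x v)‖ₑ ≤ T) :
    InnerXConverges γ F G ∧ ENNReal.ofReal |innerX γ F G| ≤ 120 * T := by
  have key : ∀ j (l : List (Fin 3)), l.length ≤ 3 →
      Integrable (fun p : E3 × E3 => (wt γ l.length p.2 * dxIter l (F j) p.1 p.2) *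
        (wt γ l.length p.2 * dxIter l (G j) p.1 p.2)) muXV ∧
      ‖∫ p, (wt γ l.length p.2 * dxIter l (F j) p.1 p.2) *
        (wt γ l.length p.2 * dxIter l (G j) p.1 p.2) ∂muXV‖ₑ ≤ T := fun j l hl => by
    have Hl : ∀ m, Sm 0 (-27) (dxIter l (h m)) := fun m => (Hh m).dxIter_of_le l (by omega)
    have HGl : Sm 3 (-40) (dxIter l (G j)) := sm_dxIter l (by omega) (HG j)
    have mB := fun a => (continuous_matB h1 h2 j a).measurable
    have e : dxIter l (F j) = combo (matB γ j) fun m => dxIter l (h m) := by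
      rw [hF j, dxIter_combo _ l fun m => (Hh m).le (by omega)]
    obtain ⟨K, hK⟩ := abs_combo_matB_le h1 h2 Hl j
    obtain ⟨L, -, hL⟩ := Gr.bound HGl
    rw [e]
    have I := integrable_pair h1 h2 (measurable_combo mB Hl) HGl.continuous.measurable hK
      (fun x v => hL (x, v)) l.length
    refine ⟨I, ?_⟩
    rw [muXV, integral_prod _ I]
    refine (enorm_integral_le_lintegral_enorm _).trans (le_trans (le_of_eq ?_) (hT j l hl))
    refine lintegral_congr fun x => ?_
    rw [← integral_finsetSum _ fun m _ => integrable_mul_tst (Hl m)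
      (tst_matB_wt_sq_mul h1 h2 hl j m (HGl.le (by norm_num)) x) x]
    congr 2
    funext v
    simp only [combo, Finset.mul_sum, Finset.sum_mul]
    exact Finset.sum_congr rfl fun m _ => by ring
  have hp : ∀ j {k : ℕ} (ι : Fin k → Fin 3), pairIntegrand γ ι (F j) (G j) =
      fun p : E3 × E3 => (wt γ (List.ofFn ι).length p.2 * dxIter (List.ofFn ι) (F j) p.1 p.2) *
        (wt γ (List.ofFn ι).length p.2 * dxIter (List.ofFn ι) (G j) p.1 p.2) := fun j k ι => by
    simp only [List.length_ofFn]
    rfl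
  have hk : ∀ {k : ℕ}, k ∈ Finset.range 4 → ∀ ι : Fin k → Fin 3, (List.ofFn ι).length ≤ 3 :=
    fun {k} hk ι => by
      have := Finset.mem_range.1 hk
      rw [List.length_ofFn]
      omega
  refine ⟨fun j k hk' ι => ?_, ?_⟩
  · rw [hp]
    exact (key j _ (hk hk' ι)).1
  · rw [← Real.enorm_eq_ofReal_abs, innerX]
    calc _ ≤ ∑ j, ∑ k ∈ Finset.range 4, ∑ ι : Fin k → Fin 3,
          ‖∫ p, pairIntegrand γ ι (F j) (G j) p ∂muXV‖ₑ :=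
          (enorm_sum_le _ _).trans (Finset.sum_le_sum fun j _ => (enorm_sum_le _ _).trans
            (Finset.sum_le_sum fun k _ => enorm_sum_le _ _))
      _ ≤ ∑ _j : Fin 3, ∑ k ∈ Finset.range 4, ∑ _ι : Fin k → Fin 3, T := by
          refine Finset.sum_le_sum fun j _ => Finset.sum_le_sum fun k hk' =>
            Finset.sum_le_sum fun ι _ => ?_
          rw [hp]
          exact (key j _ (hk hk' ι)).2
      -- 120 = 3 · (1 + 3 + 9 + 27): three components, and all the derivatives in x of order at most
      -- 3.
      _ = 120 * T := by
          simp only [Finset.sum_const, Finset.card_univ, Fintype.card_fun, Fintype.card_fin,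
            nsmul_eq_mul, Finset.sum_range_succ, Finset.sum_range_zero]
          push_cast
          ring

end Pairing

/-! ### The three estimates of the proposition. -/

section Final

variable {γ : ℝ} (h1 : -2 ≤ γ) (h2 : γ ≤ 1)

lemma SmoothEnough.tor {g : E3 → E3 → ℝ} (H : SmoothEnough 40 g) : Tor 20 g := by
  have h : Sm 40 (-40) g := by simpa using H.sm
  exact ⟨h.le (by norm_num), H.periodic⟩

lemma lintegral_enorm_sum_le {κ : Type*} [Fintype κ] {A : κ → E3 → ℝ} (hA : ∀ i, Measurable (A i)) :
    ∫⁻ x in cube, ‖∑ i, A i x‖ₑ ≤ ∑ i, ∫⁻ x in cube, ‖A i x‖ₑ := by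
  rw [← lintegral_finsetSum _ fun i _ => (hA i).enorm]
  exact lintegral_mono fun x => enorm_sum_le _ _

lemma twistedSq_le_sum {H : (E3 → ℝ) → ℝ≥0∞} (G : Fin 3 → E3 → E3 → ℝ) (j : Fin 3) :
    twistedSq γ H (G j) ≤ ∑ r, twistedSq γ H (G r) :=
  Finset.single_le_sum (f := fun r => twistedSq γ H (G r)) (fun _ _ => zero_le) (Finset.mem_univ j)

lemma rpow_half_add_le {I a b c d : ℝ≥0∞} {C : ℝ≥0} (h : I ≤ C * (a * b + c * d)) :
    I ^ (1 / 2 : ℝ) ≤ (C ^ (1 / 2 : ℝ) : ℝ≥0) *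
      (a ^ (1 / 2 : ℝ) * b ^ (1 / 2 : ℝ) + c ^ (1 / 2 : ℝ) * d ^ (1 / 2 : ℝ)) := by
  have h0 : (0 : ℝ) ≤ 1 / 2 := by norm_num
  refine (ENNReal.rpow_le_rpow h h0).trans ?_
  rw [ENNReal.mul_rpow_of_nonneg _ _ h0, ENNReal.coe_rpow_of_nonneg _ h0]
  refine mul_le_mul_right ((ENNReal.rpow_add_le_add_rpow _ _ h0 (by norm_num)).trans_eq ?_) _
  rw [ENNReal.mul_rpow_of_nonneg _ _ h0, ENNReal.mul_rpow_of_nonneg _ _ h0]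

include h1 h2

lemma dxIter_dx_Gam {f g : E3 → E3 → ℝ} (Hf : Tor 20 f) (Hg : Tor 20 g) {l : List (Fin 3)}
    (hl : l.length ≤ 3) (m : Fin 3) :
    dxIter l (dx m (Gam γ f g)) = fun x v => ∑ i : Fin (splits l).length,
      (Gam γ (dxIter (splits l)[i].1 (dx m f)) (dxIter (splits l)[i].2 g) x v +
        Gam γ (dxIter (splits l)[i].1 f) (dxIter (splits l)[i].2 (dx m g)) x v) := by
  have Hf' : Tor 19 (dx m f) := Hf.dx m
  have Hg' : Tor 19 (dx m g) := Hg.dx m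
  have s1 : Sm 17 (-27) (Gam γ (dx m f) g) := by
    have := Sm.Gam h1 h2 (n := 17) Hf'.sm (Hg.sm.le (by norm_num))
    norm_num at this
    exact this
  have s2 : Sm 17 (-27) (Gam γ f (dx m g)) := by
    have := Sm.Gam h1 h2 (n := 17) (Hf.sm.le (by norm_num)) Hg'.sm
    norm_num at this
    exact this
  rw [dx_Gam h1 h2 (n := 17) Hf.sm Hg.sm, dxIter_add l (s1.le (by omega)) (s2.le (by omega)),
    dxIter_Gam_eq_sum h1 h2 (n := 10) l (Hf'.le (by omega)) (Hg.le (by omega)),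
    dxIter_Gam_eq_sum h1 h2 (n := 10) l (Hf.le (by omega)) (Hg'.le (by omega))]
  funext x v
  exact Finset.sum_add_distrib.symm

/-- The derivative ∂_m of ∇̃_x falls on f or on g. On g, the sum over m is kept together, since only
∑_m 𝐁_{jm}∂_m g reproduces ∇̃_x g without loss. On f, the terms are bounded separately for each m,
and the loss due to 𝐁 is repaired on g. -/
lemma innerX_tildeX_Gam_le : ∃ C : ℝ≥0, ∀ {f g : E3 → E3 → ℝ} {G : Fin 3 → E3 → E3 → ℝ},
    Tor 20 f → Tor 20 g → (∀ j, Tor 20 (G j)) →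
    InnerXConverges γ (tildeX γ (Gam γ f g)) G ∧
    ENNReal.ofReal |innerX γ (tildeX γ (Gam γ f g)) G| ≤
      C * (normX γ f * vnormY1 γ (tildeX γ g) + vnormX γ (tildeX γ f) * normY1 γ g +
        normX γ f * normY2 γ g) * vnormY1 γ G := by
  obtain ⟨C1, k1⟩ := lintegral_weak_sum_sq_le h1 h2
  obtain ⟨C2, k2⟩ := lintegral_weak_even_sq_le h1 h2
  obtain ⟨C3, k3⟩ := lintegral_weak_odd_sq_le h1 h2
  set K : ℝ≥0 := C1 ^ (1 / 2 : ℝ) + C2 ^ (1 / 2 : ℝ) + C3 ^ (1 / 2 : ℝ) with hK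
  -- There are at most 8 splittings. Each contributes three integrals with ∂_m on f, one for each m,
  -- and a single one, summed over m, with ∂_m on g.
  refine ⟨120 * (8 * (4 * K)), fun {f g G} Hf Hg HG => ?_⟩
  set E := normX γ f * vnormY1 γ (tildeX γ g) + vnormX γ (tildeX γ f) * normY1 γ g +
    normX γ f * normY2 γ g
  set D := vnormY1 γ G
  have HΓ : ∀ m, Sm 3 (-27) (dx m (Gam γ f g)) := fun m => by
    have := (Sm.Gam h1 h2 (n := 4) (Hf.sm.le (by norm_num)) (Hg.sm.le (by norm_num))).dx m
    norm_num at this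
    exact this
  have hGj : ∀ j, twistedSq γ (H1sq γ) (G j) ^ (1 / 2 : ℝ) ≤ D := fun j =>
    ENNReal.rpow_le_rpow (twistedSq_le_sum G j) (by norm_num)
  have hK1 : ((C1 ^ (1 / 2 : ℝ) : ℝ≥0) : ℝ≥0∞) ≤ K := by
    rw [hK, add_assoc]; exact_mod_cast le_self_add
  have hK2 : ((C2 ^ (1 / 2 : ℝ) : ℝ≥0) : ℝ≥0∞) ≤ K := by
    rw [hK, add_right_comm]; exact_mod_cast le_add_self
  have hK3 : ((C3 ^ (1 / 2 : ℝ) : ℝ≥0) : ℝ≥0∞) ≤ K := by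
    rw [hK]; exact_mod_cast le_add_self
  have main := pairing_le h1 h2 (F := tildeX γ (Gam γ f g)) (fun j => tildeX_eq_combo γ _ j) HΓ HG
    (T := 8 * (4 * (K * E * D))) fun j l hl => ?_
  · refine ⟨main.1, main.2.trans (le_of_eq ?_)⟩
    push_cast
    ring
  have HGl : Sm 3 (-40) (dxIter l (G j)) := sm_dxIter l (by omega) (HG j)
  set w : Fin 3 → E3 → E3 → ℝ := fun m x v =>
    matB γ j m v * (wt γ l.length v * wt γ l.length v) * dxIter l (G j) x v
  have tw : ∀ m x, Tst (w m x) := fun m x =>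
    tst_matB_wt_sq_mul h1 h2 hl j m (HGl.le (by norm_num)) x
  have mw : ∀ m, Measurable (unc (w m)) := fun m =>
    (((continuous_matB h1 h2 j m).mul ((continuous_wt γ l.length).mul
      (continuous_wt γ l.length))).measurable.comp measurable_snd).mul HGl.continuous.measurable
  let P : Fin 3 → Fin (splits l).length → E3 → E3 → ℝ := fun m i =>
    Gam γ (dxIter (splits l)[i].1 (dx m f)) (dxIter (splits l)[i].2 g)
  let Q : Fin 3 → Fin (splits l).length → E3 → E3 → ℝ := fun m i =>
    Gam γ (dxIter (splits l)[i].1 f) (dxIter (splits l)[i].2 (dx m g))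
  have hlen := fun i : Fin (splits l).length => length_splits_getElem i
  have sP : ∀ m i, Sm 0 (-27) (P m i) := fun m i => by
    have := hlen i
    have := Sm.Gam h1 h2 (n := 0) ((Tor.dx (n := 19) Hf m).dxIter_of_le (splits l)[i].1 (by omega)).sm
      (sm_dxIter (n := 2) (splits l)[i].2 (by omega) Hg)
    norm_num at this
    exact this
  have sQ : ∀ m i, Sm 0 (-27) (Q m i) := fun m i => by
    have := hlen i
    have := Sm.Gam h1 h2 (n := 0) (sm_dxIter (n := 2) (splits l)[i].1 (by omega) Hf)
      ((Tor.dx (n := 19) Hg m).dxIter_of_le (splits l)[i].2 (by omega)).sm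
    norm_num at this
    exact this
  have mP : ∀ m i, Measurable fun x => ∫ v, P m i x v * w m x v := fun m i =>
    measurable_integral_right (F := fun x v => P m i x v * w m x v)
      ((sP m i).continuous.measurable.mul (mw m))
  have mQ : ∀ m i, Measurable fun x => ∫ v, Q m i x v * w m x v := fun m i =>
    measurable_integral_right (F := fun x v => Q m i x v * w m x v)
      ((sQ m i).continuous.measurable.mul (mw m))
  have mQ' : ∀ i, Measurable fun x => ∑ m, ∫ v, Q m i x v * w m x v := fun i =>
    Finset.measurable_sum _ fun m _ => mQ m i
  have e : ∀ x, ∑ m, ∫ v, dxIter l (dx m (Gam γ f g)) x v * w m x v =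
      ∑ i, (∑ m, (∫ v, P m i x v * w m x v) + ∑ m, ∫ v, Q m i x v * w m x v) := fun x => by
    simp only [← Finset.sum_add_distrib]
    rw [Finset.sum_comm]
    refine Finset.sum_congr rfl fun m _ => ?_
    have iP := fun i => integrable_mul_tst (sP m i) (tw m x) x
    have iQ := fun i => integrable_mul_tst (sQ m i) (tw m x) x
    have iPQ : ∀ i, Integrable fun v => P m i x v * w m x v + Q m i x v * w m x v := fun i =>
      (iP i).add (iQ i)
    simp only [← integral_add (iP _) (iQ _)]
    rw [← integral_finsetSum _ fun i _ => iPQ i, dxIter_dx_Gam h1 h2 Hf Hg hl]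
    refine integral_congr_ae (.of_forall fun v => ?_)
    simp only [Finset.sum_mul, add_mul]
    rfl
  have hP : ∀ m i, ∫⁻ x in cube, ‖∫ v, P m i x v * w m x v‖ₑ ≤ K * E * D := fun m i => by
    -- The parity is imposed by the sup bounds. If f receives one further derivative, the bound with
    -- D2 of g puts two derivatives on f and l.length − 1 on g, and neither factor is bounded in x.
    -- If it receives two, the bound with the raised weight fails in the same way.
    obtain hp | hp : ((splits l)[i].1.length = 0 ∨ (splits l)[i].1.length = 2) ∨
        ((splits l)[i].1.length = 1 ∨ (splits l)[i].1.length = 3) := by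
      have := hlen i
      omega
    · refine (le_of_sq_le_mul (k2 Hf Hg (HG j) hl (hlen i) hp j m)).trans ?_
      exact mul_le_mul' (mul_le_mul' hK2 le_add_self) (hGj j)
    · refine (le_of_sq_le_mul (k3 Hf Hg (HG j) hl (hlen i) hp j m)).trans ?_
      exact mul_le_mul' (mul_le_mul' hK3 (le_add_self.trans le_self_add)) (hGj j)
  have hQ : ∀ i, ∫⁻ x in cube, ‖∑ m, ∫ v, Q m i x v * w m x v‖ₑ ≤ K * E * D := fun i => by
    refine (le_of_sq_le_mul (k1 Hf Hg (HG j) hl (hlen i) j)).trans ?_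
    exact mul_le_mul' (mul_le_mul' hK1 (le_self_add.trans le_self_add)) (hGj j)
  have hn : ((splits l).length : ℝ≥0∞) ≤ 8 := by exact_mod_cast length_splits_le hl
  calc _ = ∫⁻ x in cube, ‖∑ i, (∑ m, (∫ v, P m i x v * w m x v) +
        ∑ m, ∫ v, Q m i x v * w m x v)‖ₑ := lintegral_congr fun x => congrArg _ (e x)
    _ ≤ ∑ i, ∫⁻ x in cube, ‖∑ m, (∫ v, P m i x v * w m x v) +
        ∑ m, ∫ v, Q m i x v * w m x v‖ₑ := lintegral_enorm_sum_le fun i =>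
          (Finset.measurable_sum _ fun m _ => mP m i).add (mQ' i)
    _ ≤ ∑ _i : Fin (splits l).length, 4 * (K * E * D) := by
        refine Finset.sum_le_sum fun i _ => ?_
        calc _ ≤ ∫⁻ x in cube, (‖∑ m, ∫ v, P m i x v * w m x v‖ₑ +
              ‖∑ m, ∫ v, Q m i x v * w m x v‖ₑ) := lintegral_mono fun x => enorm_add_le _ _
          _ ≤ ∑ _m : Fin 3, (K * E * D) + K * E * D := by
              rw [lintegral_add_right _ (mQ' i).enorm]
              exact add_le_add ((lintegral_enorm_sum_le fun m => mP m i).trans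
                (Finset.sum_le_sum fun m _ => hP m i)) (hQ i)
          _ = _ := by
              simp only [Finset.sum_const, Finset.card_univ, Fintype.card_fin, nsmul_eq_mul]
              push_cast
              ring
    _ ≤ _ := by
        simp only [Finset.sum_const, Finset.card_univ, Fintype.card_fin, nsmul_eq_mul]
        gcongr

/-- After an integration by parts in v, the derivative falls on 𝐁, on the weight and on G, all of
which D1 of G controls. What is left of Γ is its norm in 𝒳, so no new trilinear estimate is needed.
-/
lemma innerX_tildeV_Gam_le : ∃ C : ℝ≥0, ∀ {f g : E3 → E3 → ℝ} {G : Fin 3 → E3 → E3 → ℝ},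
    Tor 20 f → Tor 20 g → (∀ j, Tor 20 (G j)) →
    InnerXConverges γ (tildeV γ (Gam γ f g)) G ∧
    ENNReal.ofReal |innerX γ (tildeV γ (Gam γ f g)) G| ≤
      C * (normX γ f * normY2 γ g + normY1 γ f * normX γ g) * vnormY1 γ G := by
  obtain ⟨C0, h0⟩ := lintegral_div_sq_le h1 h2
  refine ⟨120 * C0 ^ (1 / 2 : ℝ), fun {f g G} Hf Hg HG => ?_⟩
  set E := normX γ f * normY2 γ g + normY1 γ f * normX γ g
  have HΓ : Sm 10 (-27) (Gam γ f g) := sm_dxIter_Gam h1 h2 [] (by simp) Hf Hg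
  have main := pairing_le h1 h2 (F := tildeV γ (Gam γ f g)) (fun j => tildeV_eq_combo γ _ j)
    (fun m => (HΓ.le (by norm_num : 3 + 1 ≤ 10)).pv m) HG
    (T := (C0 ^ (1 / 2 : ℝ) : ℝ≥0) * E * vnormY1 γ G) fun j l hl => ?_
  · refine ⟨main.1, main.2.trans (le_of_eq ?_)⟩
    push_cast
    ring
  simp only [dxIter_pv _ l (HΓ.le (by omega : 0 + 1 + l.length ≤ 10))]
  have h := h0 Hf Hg (HG j) hl j
  rw [← mul_one (C0 * _ : ℝ≥0∞)] at h
  refine (le_of_sq_le_mul h).trans ?_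
  rw [ENNReal.one_rpow, mul_one]
  refine mul_le_mul' (mul_le_mul_right ?_ _)
    (ENNReal.rpow_le_rpow (twistedSq_le_sum G j) one_half_pos.le)
  have := rpow_half_add_le (C := 1) (a := twistedSq γ L2sq f) (b := twistedSq γ (H2sq γ) g)
    (c := twistedSq γ (H1sq γ) f) (d := twistedSq γ L2sq g) (by rw [ENNReal.coe_one, one_mul])
  rwa [NNReal.one_rpow, ENNReal.coe_one, one_mul] at this

lemma normX_Gam_le : ∃ C : ℝ≥0, ∀ {f g : E3 → E3 → ℝ}, Tor 20 f → Tor 20 g →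
    normX γ (Gam γ f g) ≤ C * (normX γ f * normY2 γ g + normY1 γ f * normX γ g) := by
  obtain ⟨C0, h0⟩ := lintegral_wt_Gam_le h1 h2
  -- 40 = 1 + 3 + 9 + 27 is the number of derivatives in x of order at most 3.
  refine ⟨(40 * C0) ^ (1 / 2 : ℝ), fun {f g} Hf Hg => rpow_half_add_le ?_⟩
  calc _ ≤ ∑ k ∈ Finset.range 4, ∑ _ι : Fin k → Fin 3, (C0 * (twistedSq γ L2sq f *
        twistedSq γ (H2sq γ) g + twistedSq γ (H1sq γ) f * twistedSq γ L2sq g) : ℝ≥0∞) := by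
        refine Finset.sum_le_sum fun k hk => Finset.sum_le_sum fun ι _ => ?_
        have h := h0 Hf Hg (l := List.ofFn ι) (by
          have := Finset.mem_range.1 hk
          rw [List.length_ofFn]
          omega)
        simp only [List.length_ofFn] at h
        exact h
    _ = _ := by
        simp only [Finset.sum_const, Finset.card_univ, Fintype.card_fun, Fintype.card_fin,
          nsmul_eq_mul, Finset.sum_range_succ, Finset.sum_range_zero]
        push_cast
        ring

end Final
end
end Landau

theorem mainTheorem9 :
    ∃ N : ℕ, ∀ γ : ℝ, -2 ≤ γ → γ ≤ 1 → ∃ C : ℝ≥0, ∀ g₁ g₂ : Landau.E3 → Landau.E3 → ℝ,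
      Landau.SmoothEnough N g₁ → Landau.SmoothEnough N g₂ →
      (∀ G₃ : Fin 3 → Landau.E3 → Landau.E3 → ℝ, (∀ j, Landau.SmoothEnough N (G₃ j)) →
        Landau.InnerXConverges γ (Landau.tildeX γ (Landau.Gam γ g₁ g₂)) G₃ ∧
        ENNReal.ofReal |Landau.innerX γ (Landau.tildeX γ (Landau.Gam γ g₁ g₂)) G₃| ≤
          C * (Landau.normX γ g₁ * Landau.vnormY1 γ (Landau.tildeX γ g₂) +
            Landau.vnormX γ (Landau.tildeX γ g₁) * Landau.normY1 γ g₂ +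
            Landau.normX γ g₁ * Landau.normY2 γ g₂) * Landau.vnormY1 γ G₃) ∧
      (∀ G₃ : Fin 3 → Landau.E3 → Landau.E3 → ℝ, (∀ j, Landau.SmoothEnough N (G₃ j)) →
        Landau.InnerXConverges γ (Landau.tildeV γ (Landau.Gam γ g₁ g₂)) G₃ ∧
        ENNReal.ofReal |Landau.innerX γ (Landau.tildeV γ (Landau.Gam γ g₁ g₂)) G₃| ≤
          C * (Landau.normX γ g₁ * Landau.normY2 γ g₂ +
            Landau.normY1 γ g₁ * Landau.normX γ g₂) * Landau.vnormY1 γ G₃) ∧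
      Landau.normX γ (Landau.Gam γ g₁ g₂) ≤
        C * (Landau.normX γ g₁ * Landau.normY2 γ g₂ +
          Landau.normY1 γ g₁ * Landau.normX γ g₂) := by
  -- Γ loses at most ⟨v⟩^{13} on the decay ⟨v⟩^{-40} of its second argument, which leaves ⟨v⟩^{-27},
  -- while 𝐁 and the squared weights cost at most ⟨v⟩^{12} against the decay of the test field. Of
  -- the 40 derivatives only 20 are retained.
  refine ⟨40, fun γ h1 h2 => ?_⟩
  obtain ⟨C1, k1⟩ := Landau.innerX_tildeX_Gam_le h1 h2
  obtain ⟨C2, k2⟩ := Landau.innerX_tildeV_Gam_le h1 h2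
  obtain ⟨C3, k3⟩ := Landau.normX_Gam_le h1 h2
  have e1 : (C1 : ℝ≥0∞) ≤ (C1 + C2 + C3 : ℝ≥0) := by
    rw [add_assoc]; exact_mod_cast le_self_add
  have e2 : (C2 : ℝ≥0∞) ≤ (C1 + C2 + C3 : ℝ≥0) := by
    rw [add_right_comm]; exact_mod_cast le_add_self
  have e3 : (C3 : ℝ≥0∞) ≤ (C1 + C2 + C3 : ℝ≥0) := by exact_mod_cast le_add_self
  refine ⟨C1 + C2 + C3, fun f g Hf Hg => ⟨fun G HG => ?_, fun G HG => ?_, ?_⟩⟩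
  · obtain ⟨a, b⟩ := k1 Hf.tor Hg.tor fun j => (HG j).tor
    exact ⟨a, b.trans (mul_le_mul_left (mul_le_mul_left e1 _) _)⟩
  · obtain ⟨a, b⟩ := k2 Hf.tor Hg.tor fun j => (HG j).tor
    exact ⟨a, b.trans (mul_le_mul_left (mul_le_mul_left e2 _) _)⟩
  · exact (k3 Hf.tor Hg.tor).trans (mul_le_mul_left e3 _)
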